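/- **Setting.** Let $B$ be an oriented smooth $2$-manifold with boundary (Hausdorff, second countable or, more generally, $\sigma$-compact), let $\partial B$ be its boundary, a smooth $1$-manifold, and fix a collar, i.e. a diffeomorphism from $\partial B\times[0,1)$ onto an open subset of $B$ that maps $\partial B\times\{0\}$ onto the boundary; write $r$ for the coordinate on $[0,1)$ and regard $W\times[0,1)$, for $W\subseteq\partial B$, as a subset of $B$. Orient $\partial B$ so that $(\partial_r,v)$ is a positively oriented basis of the tangent spaces of $B$ on the collar whenever $v$ is positively oriented in $\partial B$. (In the application $B=B_\pm$ is the $2$-dimensional base manifold over which the $3$-dimensional spacetime $M$ is a principal $\mathbb R$-bundle.) For a manifold $X$ let $\mathbf{Open}(X)$ be the category of non-empty open subsets of $X$ and inclusions. **Bulk theory.** For $V\in\mathbf{Open}(B)$ let $$\Omega^\bullet_{\partial,c}(V)[1]=\Big(\Omega^0_{\partial,c}(V)\xrightarrow{-d}\Omega^1_c(V)\xrightarrow{-d}\Omega^2_c(V)\Big)$$ in degrees $-1,0,1$, where $\Omega^k_c(V)$ are the compactly supported smooth real $k$-forms on $V$ (up to the boundary) and $\Omega^0_{\partial,c}(V)\subseteq\Omega^0_c(V)$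 are those functions that vanish on $\partial V=V\cap\partial B$. Put $\sigma(\alpha\otimes\beta)=(-1)^{|\alpha|}\int_V\alpha\wedge\beta$, with $|\alpha|$ the degree in this complex. **Boundary theory.** For $W\in\mathbf{Open}(\partial B)$ let $\Omega^0_c(W)$ be the compactly supported smooth real functions on $W$, viewed as a complex in degree $0$, with $\upsilon(\varphi,\psi)=-\int_W\varphi\,d\psi$. **CCR.** A Poisson cochain complex $(V,\tau)$ is a real cochain complex with a graded antisymmetric cochain map $\tau:V\otimes V\to\mathbb R$; morphisms are cochain maps preserving the pairings. $\mathfrak{CCR}(V,\tau)$ is the differential graded $*$-algebra over $\mathbb C$ given by the quotient of the complexified tensor algebra of $V$ by the relations $v\otimes w-(-1)^{|v||w|}w\otimes v=i\,\tau(v,w)\,1$ for homogeneous $v,w$, with the differential extending that of $V$ as a graded derivation and the involution with $v^*=v$ for $v\in V$ and $(ab)^*=(-1)^{|a||b|}b^*a^*$; it is a functor in $(V,\tau)$. A morphism of differential graded $*$-algebras is a weak equivalence if it is a quasi-isomorphism of the underlying complexes. A functor $\mathfrak F$ from $\mathbf{Open}(X)$ to differential graded $*$-algebras satisfies Einstein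 causality if, whenever $V_1,V_2\subseteq V$ with $V_1\cap V_2=\emptyset$, the images in $\mathfrak F(V)$ of homogeneous $a\in\mathfrak F(V_1)$ and $b\in\mathfrak F(V_2)$ satisfy $ab=(-1)^{|a||b|}ba$. **The map $\kappa$.** Let $\omega\in\Omega^1_c([0,1))$ with $\int_0^1\omega=1$. For $W\in\mathbf{Open}(\partial B)$ and $\varphi\in\Omega^0_c(W)$ put (suppressing pullbacks along the projections of $W\times[0,1)$) $$\kappa(\varphi)=\omega\wedge\varphi-\Big(\int_r^1\omega\Big)\,d\varphi .$$ **Statement.** For all $V\in\mathbf{Open}(B)$ and $W\in\mathbf{Open}(\partial B)$, $(\Omega^\bullet_{\partial,c}(V)[1],\sigma)$ and $(\Omega^0_c(W),\upsilon)$ are Poisson cochain complexes; with extension by zero they are functors of $V$ and $W$. The functors $\mathfrak B=\mathfrak{CCR}(\Omega^\bullet_{\partial,c}[1],\sigma)$ on $\mathbf{Open}(B)$, its restriction $\mathfrak B|_{\partial B}:W\mapsto\mathfrak B(W\times[0,1))$ on $\mathbf{Open}(\partial B)$, and the chiral free boson $\mathfrak C=\mathfrak{CCR}(\Omega^0_c,\upsilon)$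 on $\mathbf{Open}(\partial B)$ satisfy Einstein causality. For every $W\in\mathbf{Open}(\partial B)$, $\kappa$ takes values in closed forms in $\Omega^1_c(W\times[0,1))$ and is a cochain map $\Omega^0_c(W)\to\Omega^\bullet_{\partial,c}(W\times[0,1))[1]$ that is a quasi-isomorphism and satisfies $\sigma(\kappa(\varphi)\otimes\kappa(\psi))=\upsilon(\varphi,\psi)$ for all $\varphi,\psi\in\Omega^0_c(W)$. It is natural in $W$, and the induced natural transformation $$\mathfrak{CCR}(\kappa):\mathfrak C\Longrightarrow\mathfrak B|_{\partial B}$$ is a natural weak equivalence, i.e. $\mathfrak{CCR}(\kappa)_W:\mathfrak C(W)\to\mathfrak B(W\times[0,1))$ is a weak equivalence for every $W\in\mathbf{Open}(\partial B)$. -/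

import Mathlib

open scoped TensorProduct DirectSum ContDiff Manifold Topology
open Set

universe u v

/-! Cochain complexes -/

/-- A cochain complex over `k`, presented as one module with an internal grading by `ℤ`
and a differential of degree one. -/
structure CochainCpx (k : Type) [CommRing k] : Type (u + 1) where
  carrier : Type u
  [addCommGroup : AddCommGroup carrier]
  [module : Module k carrier]
  /-- the homogeneous elements of a given degree -/
  gr : ℤ → Submodule k carrier
  [decomposition : DirectSum.Decomposition gr]
  /-- the differential -/
  d : carrier →ₗ[k] carrier
  d_mem : ∀ (i : ℤ) (v : carrier), v ∈ gr i → d v ∈ gr (i + 1)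
  d_d : ∀ v : carrier, d (d v) = 0

namespace CochainCpx

attribute [instance] addCommGroup module decomposition

variable {k : Type} [CommRing k]

/-- Cochain maps. -/
@[ext]
structure Hom (V : CochainCpx.{u} k) (W : CochainCpx.{v} k) where
  toLin : V.carrier →ₗ[k] W.carrier
  map_gr : ∀ (i : ℤ) (v : V.carrier), v ∈ V.gr i → toLin v ∈ W.gr i
  map_d : ∀ v : V.carrier, toLin (V.d v) = W.d (toLin v)

/-- Cocycles of degree `i`. -/
def cocycles (V : CochainCpx.{u} k) (i : ℤ) : Submodule k V.carrier :=
  V.gr i ⊓ LinearMap.ker V.d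

/-- Coboundaries of degree `i`, as a submodule of the cocycles. -/
def coboundaries (V : CochainCpx.{u} k) (i : ℤ) : Submodule k (V.cocycles i) :=
  ((V.gr (i - 1)).map V.d).comap (V.cocycles i).subtype

/-- The cohomology in degree `i`. -/
abbrev Cohomology (V : CochainCpx.{u} k) (i : ℤ) : Type u :=
  V.cocycles i ⧸ V.coboundaries i

/-- The action of a cochain map on cocycles. -/
def Hom.cocyclesMap {V : CochainCpx.{u} k} {W : CochainCpx.{v} k} (f : Hom V W) (i : ℤ) :
    V.cocycles i →ₗ[k] W.cocycles i :=
  f.toLin.restrict fun v hv => by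
    refine ⟨f.map_gr i v hv.1, ?_⟩
    have h : V.d v = 0 := hv.2
    change W.d (f.toLin v) = 0
    rw [← f.map_d, h, map_zero]

/-- The map induced in cohomology by a cochain map. -/
def Hom.cohomologyMap {V : CochainCpx.{u} k} {W : CochainCpx.{v} k} (f : Hom V W) (i : ℤ) :
    V.Cohomology i →ₗ[k] W.Cohomology i :=
  Submodule.mapQ _ _ (f.cocyclesMap i) (by
    rintro ⟨v, hv⟩ ⟨w, hw, hwv⟩
    exact ⟨f.toLin w, f.map_gr _ _ hw, by
      rw [← f.map_d, hwv]; rfl⟩)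

/-- A cochain map is a quasi-isomorphism if it induces isomorphisms in cohomology. -/
def Hom.IsQuasiIso {V : CochainCpx.{u} k} {W : CochainCpx.{v} k} (f : Hom V W) : Prop :=
  ∀ i : ℤ, Function.Bijective (f.cohomologyMap i)

/-- Multiply the component of degree `i` by the sign `s i`. -/
def scale {V : Type u} [AddCommGroup V] [Module k V] (gr : ℤ → Submodule k V)
    [DirectSum.Decomposition gr] (s : ℤ → ℤˣ) : V →ₗ[k] V :=
  DirectSum.toModule k ℤ V (fun i => ((s i : ℤˣ) : ℤ) • (gr i).subtype) ∘ₗ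
    (DirectSum.decomposeLinearEquiv gr).toLinearMap

theorem scale_of_mem {V : Type u} [AddCommGroup V] [Module k V] (gr : ℤ → Submodule k V)
    [DirectSum.Decomposition gr] (s : ℤ → ℤˣ) {i : ℤ} {v : V} (hv : v ∈ gr i) :
    scale gr s v = ((s i : ℤˣ) : ℤ) • v := by
  simp only [scale, LinearMap.comp_apply, LinearEquiv.coe_coe,
    DirectSum.decomposeLinearEquiv_apply, DirectSum.decompose_of_mem gr hv]
  erw [DirectSum.toModule_lof]
  simp

theorem hom_induction {V : Type u} [AddCommGroup V] [Module k V] (gr : ℤ → Submodule k V)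
    [DirectSum.Decomposition gr] {p : V → Prop} (h0 : p 0)
    (hh : ∀ (i : ℤ) (v : V), v ∈ gr i → p v)
    (ha : ∀ v w, p v → p w → p (v + w)) (v : V) : p v :=
  DirectSum.Decomposition.inductionOn gr h0 (fun {i} m => hh i m m.2) ha v

end CochainCpx

/-! Poisson cochain complexes -/

/-- A pairing `τ` on a real cochain complex is an unshifted linear Poisson
structure if it is bilinear, of degree zero, compatible with the differentials
(that is, a cochain map `V ⊗ V → ℝ`) and graded antisymmetric. -/
structure IsPoisson (V : CochainCpx.{u} ℝ) (τ : V.carrier → V.carrier → ℝ) : Prop where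
  add_left : ∀ v v' w, τ (v + v') w = τ v w + τ v' w
  smul_left : ∀ (c : ℝ) v w, τ (c • v) w = c * τ v w
  add_right : ∀ v w w', τ v (w + w') = τ v w + τ v w'
  smul_right : ∀ (c : ℝ) v w, τ v (c • w) = c * τ v w
  degree_zero : ∀ (i j : ℤ) v w, v ∈ V.gr i → w ∈ V.gr j → i + j ≠ 0 → τ v w = 0
  cochain : ∀ (i : ℤ) v w, v ∈ V.gr i → τ (V.d v) w + (i.negOnePow : ℤ) * τ v (V.d w) = 0
  antisymm : ∀ (i j : ℤ) v w, v ∈ V.gr i → w ∈ V.gr j →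
    τ v w = -(((i * j).negOnePow : ℤ) * τ w v)

/-- Poisson cochain complexes over `ℝ`. -/
structure PoCh : Type (u + 1) where
  cpx : CochainCpx.{u} ℝ
  τ : cpx.carrier → cpx.carrier → ℝ
  isPoisson : IsPoisson cpx τ

namespace PoCh

/-- Morphisms of Poisson cochain complexes: cochain maps that preserve the pairings. -/
@[ext]
structure Hom (P Q : PoCh.{u}) where
  toHom : CochainCpx.Hom P.cpx Q.cpx
  map_τ : ∀ v w, Q.τ (toHom.toLin v) (toHom.toLin w) = P.τ v w

instance : CategoryTheory.Category PoCh.{u} where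
  Hom := Hom
  id P := ⟨⟨LinearMap.id, fun _ _ h => h, fun _ => rfl⟩, fun _ _ => rfl⟩
  comp f g := ⟨⟨g.toHom.toLin ∘ₗ f.toHom.toLin,
    fun i v h => g.toHom.map_gr i _ (f.toHom.map_gr i v h),
    fun v => by simp [f.toHom.map_d, g.toHom.map_d]⟩,
    fun v w => by simp [f.map_τ, g.map_τ]⟩

end PoCh

/-! Differential graded star-algebras -/

/-- Associative unital differential graded `*`-algebras over `ℂ`, with the Koszul sign rule
for the product and the involution. -/
structure DGStarAlg : Type (u + 1) where
  carrier : Type u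
  [ring : Ring carrier]
  [algebra : Algebra ℂ carrier]
  gr : ℤ → Submodule ℂ carrier
  [graded : GradedAlgebra gr]
  d : carrier →ₗ[ℂ] carrier
  d_mem : ∀ (i : ℤ) (a : carrier), a ∈ gr i → d a ∈ gr (i + 1)
  d_d : ∀ a : carrier, d (d a) = 0
  leibniz : ∀ (i : ℤ) (a b : carrier), a ∈ gr i →
    d (a * b) = d a * b + (i.negOnePow : ℤ) • (a * d b)
  star : carrier →ₛₗ[starRingEnd ℂ] carrier
  star_mem : ∀ (i : ℤ) (a : carrier), a ∈ gr i → star a ∈ gr i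
  star_star : ∀ a : carrier, star (star a) = a
  star_mul : ∀ (i j : ℤ) (a b : carrier), a ∈ gr i → b ∈ gr j →
    star (a * b) = ((i * j).negOnePow : ℤ) • (star b * star a)
  star_d : ∀ a : carrier, star (d a) = d (star a)

namespace DGStarAlg

attribute [instance] ring algebra graded

/-- The underlying cochain complex. -/
def cpx (A : DGStarAlg.{u}) : CochainCpx.{u} ℂ where
  carrier := A.carrier
  gr := A.gr
  d := A.d
  d_mem := A.d_mem
  d_d := A.d_d

/-- Morphisms of differential graded `*`-algebras. -/
@[ext]
structure Hom (A B : DGStarAlg.{u}) where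
  toAlgHom : A.carrier →ₐ[ℂ] B.carrier
  map_gr : ∀ (i : ℤ) (a : A.carrier), a ∈ A.gr i → toAlgHom a ∈ B.gr i
  map_d : ∀ a : A.carrier, toAlgHom (A.d a) = B.d (toAlgHom a)
  map_star : ∀ a : A.carrier, toAlgHom (A.star a) = B.star (toAlgHom a)

instance : CategoryTheory.Category DGStarAlg.{u} where
  Hom := Hom
  id A := ⟨AlgHom.id ℂ A.carrier, fun _ _ h => h, fun _ => rfl, fun _ => rfl⟩
  comp f g := ⟨g.toAlgHom.comp f.toAlgHom,
    fun i a h => g.map_gr i _ (f.map_gr i a h),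
    fun a => by simp [f.map_d, g.map_d],
    fun a => by simp [f.map_star, g.map_star]⟩

/-- The cochain map underlying a morphism. -/
def Hom.toCochain {A B : DGStarAlg.{u}} (f : Hom A B) : CochainCpx.Hom A.cpx B.cpx where
  toLin := f.toAlgHom.toLinearMap
  map_gr := f.map_gr
  map_d := f.map_d

/-- Weak equivalences of differential graded `*`-algebras: the underlying cochain map is a
quasi-isomorphism. -/
def IsWeakEquiv {A B : DGStarAlg.{u}} (f : A ⟶ B) : Prop :=
  (Hom.toCochain f).IsQuasiIso

end DGStarAlg

/-! The canonical commutation relations functor -/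

namespace PoCh

variable (P : PoCh.{u})

/-- The complexified tensor algebra of the module underlying `P`. -/
abbrev TensorAlg : Type u := TensorProduct ℝ ℂ (TensorAlgebra ℝ P.cpx.carrier)

/-- The generator of the complexified tensor algebra given by an element of `P`. -/
noncomputable def tensorGen (v : P.cpx.carrier) : P.TensorAlg :=
  (1 : ℂ) ⊗ₜ[ℝ] TensorAlgebra.ι ℝ v

/-- The canonical commutation relations
`v ⊗ w = (-1)^(|v||w|) w ⊗ v + i τ(v,w) 1` for homogeneous generators. -/
inductive CCRRel : P.TensorAlg → P.TensorAlg → Prop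
  | comm (i j : ℤ) (v w : P.cpx.carrier) (hv : v ∈ P.cpx.gr i) (hw : w ∈ P.cpx.gr j) :
      CCRRel
        (P.tensorGen v * P.tensorGen w)
        ((((i * j).negOnePow : ℤ) : ℂ) • (P.tensorGen w * P.tensorGen v)
          + algebraMap ℂ P.TensorAlg (Complex.I * (P.τ v w : ℂ)))

/-- The algebra underlying the CCR-algebra: the complexified tensor algebra modulo the two-sided
ideal generated by the canonical commutation relations. (Since `τ` is a cochain map and graded
antisymmetric, this ideal is stable under the differential and the involution below.) -/
def CCRAlg : Type u := RingQuot P.CCRRel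

noncomputable section

instance : Ring P.CCRAlg := inferInstanceAs (Ring (RingQuot P.CCRRel))

instance : Algebra ℂ P.CCRAlg := inferInstanceAs (Algebra ℂ (RingQuot P.CCRRel))

/-- The quotient map. -/
def mkCCR : P.TensorAlg →ₐ[ℂ] P.CCRAlg := RingQuot.mkAlgHom ℂ P.CCRRel

/-- The generators of the CCR-algebra. -/
def gen : P.cpx.carrier →ₛₗ[Complex.ofRealHom] P.CCRAlg where
  toFun v := P.mkCCR (P.tensorGen v)
  map_add' v w := by simp [tensorGen, TensorProduct.tmul_add]
  map_smul' r v := by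
    rw [← map_smul]
    congr 1
    simp [tensorGen, TensorProduct.smul_tmul']

theorem gen_comm {i j : ℤ} {v w : P.cpx.carrier} (hv : v ∈ P.cpx.gr i) (hw : w ∈ P.cpx.gr j) :
    P.gen v * P.gen w = (((i * j).negOnePow : ℤ) : ℂ) • (P.gen w * P.gen v)
      + algebraMap ℂ P.CCRAlg (Complex.I * (P.τ v w : ℂ)) := by
  have h := RingQuot.mkAlgHom_rel ℂ (CCRRel.comm i j v w hv hw)
  change P.mkCCR _ = P.mkCCR _ at h
  rw [map_add, AlgHom.commutes, map_smul, map_mul, map_mul] at h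
  exact h

variable {P}

theorem isScalarTower_complexToReal (T : Type v) [Semiring T] [Algebra ℂ T] :
    IsScalarTower ℝ ℂ T :=
  IsScalarTower.of_algebraMap_eq' rfl

/-- The extension of a map on generators to the complexified tensor algebra. -/
def tensorLift {T : Type v} [Semiring T] [Algebra ℂ T]
    (f : P.cpx.carrier →ₛₗ[Complex.ofRealHom] T) : P.TensorAlg →ₐ[ℂ] T :=
  haveI := isScalarTower_complexToReal T
  Algebra.TensorProduct.lift (Algebra.ofId ℂ T)
    (TensorAlgebra.lift ℝ
      { toFun := f
        map_add' := f.map_add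
        map_smul' := fun r v => by
          rw [f.map_smulₛₗ]; rfl })
    (fun z x => Algebra.commutes z _)

theorem tensorLift_gen {T : Type v} [Semiring T] [Algebra ℂ T]
    (f : P.cpx.carrier →ₛₗ[Complex.ofRealHom] T) (v : P.cpx.carrier) :
    tensorLift f (P.tensorGen v) = f v := by
  have := isScalarTower_complexToReal T
  rw [tensorLift, tensorGen]
  erw [Algebra.TensorProduct.lift_tmul]
  rw [map_one, one_mul, TensorAlgebra.lift_ι_apply]
  rfl

/-- The universal property of the CCR-algebra. -/
def ccrLift {T : Type v} [Semiring T] [Algebra ℂ T] (f : P.cpx.carrier →ₛₗ[Complex.ofRealHom] T)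
    (hf : ∀ (i j : ℤ) (v w : P.cpx.carrier), v ∈ P.cpx.gr i → w ∈ P.cpx.gr j →
      f v * f w = (((i * j).negOnePow : ℤ) : ℂ) • (f w * f v)
        + algebraMap ℂ T (Complex.I * (P.τ v w : ℂ))) :
    P.CCRAlg →ₐ[ℂ] T :=
  RingQuot.liftAlgHom ℂ ⟨tensorLift f, by
      rintro _ _ ⟨i, j, v, w, hv, hw⟩
      rw [map_add, map_smul, map_mul, map_mul, AlgHom.commutes, tensorLift_gen, tensorLift_gen]
      exact hf i j v w hv hw⟩

theorem ccrLift_gen {T : Type v} [Semiring T] [Algebra ℂ T]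
    (f : P.cpx.carrier →ₛₗ[Complex.ofRealHom] T)
    (hf : ∀ (i j : ℤ) (v w : P.cpx.carrier), v ∈ P.cpx.gr i → w ∈ P.cpx.gr j →
      f v * f w = (((i * j).negOnePow : ℤ) : ℂ) • (f w * f v)
        + algebraMap ℂ T (Complex.I * (P.τ v w : ℂ))) (v : P.cpx.carrier) :
    ccrLift f hf (P.gen v) = f v := by
  change RingQuot.liftAlgHom ℂ _ (RingQuot.mkAlgHom ℂ P.CCRRel (P.tensorGen v)) = f v
  rw [RingQuot.liftAlgHom_mkAlgHom_apply]
  exact tensorLift_gen f v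

theorem ccr_hom_ext {T : Type v} [Semiring T] [Algebra ℂ T] {f g : P.CCRAlg →ₐ[ℂ] T}
    (h : ∀ v, f (P.gen v) = g (P.gen v)) : f = g := by
  refine RingQuot.ringQuot_ext' ℂ f g ?_
  have := isScalarTower_complexToReal T
  apply Algebra.TensorProduct.ext
  · ext
  · apply TensorAlgebra.hom_ext
    ext v
    exact h v

variable (P)

/-- A product of homogeneous generators. -/
def listProd (l : List (Σ i, P.cpx.gr i)) : P.CCRAlg :=
  (l.map fun p => P.gen (p.2 : P.cpx.carrier)).prod

/-- The total degree of a product of homogeneous generators. -/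
def listDeg (l : List (Σ i, P.cpx.gr i)) : ℤ := (l.map Sigma.fst).sum

/-- The elements of degree `i` of the CCR-algebra: the span of the products of homogeneous
generators of total degree `i`. -/
def ccrGr (i : ℤ) : Submodule ℂ P.CCRAlg :=
  Submodule.span ℂ {a | ∃ l : List (Σ i, P.cpx.gr i), P.listDeg l = i ∧ P.listProd l = a}

variable {P}

theorem gen_mem {i : ℤ} {v : P.cpx.carrier} (hv : v ∈ P.cpx.gr i) : P.gen v ∈ P.ccrGr i :=
  Submodule.subset_span ⟨[⟨i, v, hv⟩], by simp [listDeg], by simp [listProd]⟩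

instance ccrGradedMonoid : SetLike.GradedMonoid P.ccrGr where
  one_mem := Submodule.subset_span ⟨[], by simp [listDeg], by simp [listProd]⟩
  mul_mem := by
    intro i j a b ha hb
    have h : P.ccrGr i * P.ccrGr j ≤ P.ccrGr (i + j) := by
      rw [ccrGr, ccrGr, Submodule.span_mul_span, Submodule.span_le]
      rintro _ ⟨_, ⟨l, hl, rfl⟩, _, ⟨m, hm, rfl⟩, rfl⟩
      exact Submodule.subset_span ⟨l ++ m, by simp [listDeg, ← hl, ← hm],
        by simp [listProd]⟩
    exact h (Submodule.mul_mem_mul ha hb)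

/-- Induction for homogeneous elements of the CCR-algebra. -/
theorem ccrGr_induction {p : ℤ → P.CCRAlg → Prop}
    (zero : ∀ i, p i 0) (add : ∀ i a b, p i a → p i b → p i (a + b))
    (smul : ∀ i (c : ℂ) a, p i a → p i (c • a)) (one : p 0 1)
    (mul : ∀ (i j : ℤ) v b, v ∈ P.cpx.gr i → b ∈ P.ccrGr j → p j b →
      p (i + j) (P.gen v * b))
    {i : ℤ} {a : P.CCRAlg} (ha : a ∈ P.ccrGr i) : p i a := by
  induction ha using Submodule.span_induction with
  | zero => exact zero i
  | add a b _ _ iha ihb => exact add i a b iha ihb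
  | smul c a _ iha => exact smul i c a iha
  | mem a ha =>
    obtain ⟨l, rfl, rfl⟩ := ha
    induction l with
    | nil => simpa [listDeg, listProd] using one
    | cons x l ih =>
      have := mul x.1 (P.listDeg l) x.2 (P.listProd l) x.2.2
        (Submodule.subset_span ⟨l, rfl, rfl⟩) ih
      simpa [listDeg, listProd] using this

theorem of_eq {i j : ℤ} (h : i = j) {a b : P.CCRAlg} (ha : a ∈ P.ccrGr i) (hb : b ∈ P.ccrGr j)
    (hab : a = b) :
    DirectSum.of (fun i => P.ccrGr i) i ⟨a, ha⟩ = DirectSum.of (fun i => P.ccrGr i) j ⟨b, hb⟩ := by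
  subst h; subst hab; rfl

theorem smul_of_add_of {i : ℤ} (z : ℂ) (a b : P.ccrGr i) :
    z • DirectSum.of (fun i => P.ccrGr i) i a + DirectSum.of (fun i => P.ccrGr i) i b
      = DirectSum.of (fun i => P.ccrGr i) i (z • a + b) := by
  rw [map_add]
  exact congrArg (· + _) (map_smul (DirectSum.lof ℂ ℤ (fun i => P.ccrGr i) i) z a).symm

/-- The generators as elements of the direct sum of the homogeneous components. -/
def genDS : P.cpx.carrier →ₛₗ[Complex.ofRealHom] (⨁ i, P.ccrGr i) where
  toFun v := DirectSum.toAddMonoid (fun i =>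
    (DirectSum.of (fun i => P.ccrGr i) i).comp
      { toFun := fun w : P.cpx.gr i => (⟨P.gen w, gen_mem w.2⟩ : P.ccrGr i)
        map_zero' := by ext; simp
        map_add' := fun a b => by ext; simp }) (DirectSum.decompose P.cpx.gr v)
  map_add' v w := by simp
  map_smul' r v := by
    refine CochainCpx.hom_induction P.cpx.gr
      (p := fun v => DirectSum.toAddMonoid _ (DirectSum.decompose P.cpx.gr (r • v)) =
        Complex.ofRealHom r • DirectSum.toAddMonoid _ (DirectSum.decompose P.cpx.gr v))
      (by simp) (fun i v hv => ?_) (fun v w h h' => ?_) v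
    · rw [DirectSum.decompose_of_mem P.cpx.gr hv,
        DirectSum.decompose_of_mem P.cpx.gr ((P.cpx.gr i).smul_mem r hv)]
      simp only [DirectSum.toAddMonoid_of, AddMonoidHom.comp_apply]
      rw [← DirectSum.lof_eq_of ℂ]
      erw [← map_smul (DirectSum.lof ℂ ℤ (fun i => P.ccrGr i) i)]
      congr 1
      exact Subtype.ext (P.gen.map_smulₛₗ r v)
    · rw [smul_add, DirectSum.decompose_add, map_add, h, h', DirectSum.decompose_add, map_add,
        smul_add]

theorem genDS_of_mem {i : ℤ} {v : P.cpx.carrier} (hv : v ∈ P.cpx.gr i) :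
    genDS v = DirectSum.of (fun i => P.ccrGr i) i ⟨P.gen v, gen_mem hv⟩ := by
  change DirectSum.toAddMonoid _ (DirectSum.decompose P.cpx.gr v) = _
  rw [DirectSum.decompose_of_mem P.cpx.gr hv]
  simp

theorem lof_comm {i j : ℤ} {v w : P.cpx.carrier} (hv : v ∈ P.cpx.gr i)
    (hw : w ∈ P.cpx.gr j) :
    (genDS v : ⨁ i, P.ccrGr i) * genDS w
      = (((i * j).negOnePow : ℤ) : ℂ) • (genDS w * genDS v)
        + algebraMap ℂ (⨁ i, P.ccrGr i) (Complex.I * (P.τ v w : ℂ)) := by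
  have hvw : P.gen v * P.gen w ∈ P.ccrGr (i + j) :=
    SetLike.mul_mem_graded (gen_mem hv) (gen_mem hw)
  have hwv : P.gen w * P.gen v ∈ P.ccrGr (j + i) :=
    SetLike.mul_mem_graded (gen_mem hw) (gen_mem hv)
  have hwv' : P.gen w * P.gen v ∈ P.ccrGr (i + j) := by rwa [add_comm]
  have hτ : algebraMap ℂ P.CCRAlg (Complex.I * (P.τ v w : ℂ)) ∈ P.ccrGr 0 := by
    rw [Algebra.algebraMap_eq_smul_one]
    exact Submodule.smul_mem _ _ SetLike.GradedOne.one_mem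
  have hτ' : algebraMap ℂ P.CCRAlg (Complex.I * (P.τ v w : ℂ)) ∈ P.ccrGr (i + j) := by
    by_cases h : i + j = 0
    · rwa [h]
    · rw [P.isPoisson.degree_zero i j v w hv hw h]
      simp
  have e : DirectSum.of (fun i => P.ccrGr i) 0 ⟨_, hτ⟩
      = DirectSum.of (fun i => P.ccrGr i) (i + j) ⟨_, hτ'⟩ := by
    by_cases h : i + j = 0
    · exact of_eq h.symm _ _ rfl
    · have h0 := P.isPoisson.degree_zero i j v w hv hw h
      have z1 : (⟨_, hτ⟩ : P.ccrGr 0) = 0 := Subtype.ext (by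
        change algebraMap ℂ P.CCRAlg (Complex.I * (P.τ v w : ℂ)) = 0
        simp [h0])
      have z2 : (⟨_, hτ'⟩ : P.ccrGr (i + j)) = 0 := Subtype.ext (by
        change algebraMap ℂ P.CCRAlg (Complex.I * (P.τ v w : ℂ)) = 0
        simp [h0])
      rw [z1, z2, map_zero, map_zero]
  rw [genDS_of_mem hv, genDS_of_mem hw, DirectSum.of_mul_of, DirectSum.of_mul_of,
    DirectSum.algebraMap_apply]
  change DirectSum.of (fun i => P.ccrGr i) (i + j) ⟨_, hvw⟩ =
    _ • DirectSum.of (fun i => P.ccrGr i) (j + i) ⟨_, hwv⟩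
      + DirectSum.of (fun i => P.ccrGr i) 0 ⟨_, hτ⟩
  rw [e, of_eq (add_comm j i) hwv hwv' rfl, smul_of_add_of]
  exact congrArg _ (Subtype.ext (P.gen_comm hv hw))

/-- The decomposition of elements of the CCR-algebra into homogeneous components. -/
def ccrDecompose : P.CCRAlg →ₐ[ℂ] ⨁ i, P.ccrGr i :=
  ccrLift genDS (fun _ _ _ _ hv hw => lof_comm hv hw)

theorem ccrDecompose_gen (v : P.cpx.carrier) : ccrDecompose (P.gen v) = genDS v :=
  ccrLift_gen genDS _ v

instance ccrGraded : GradedAlgebra P.ccrGr :=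
  GradedAlgebra.ofAlgHom _ ccrDecompose
    (by
      apply ccr_hom_ext
      intro v
      rw [AlgHom.comp_apply, ccrDecompose_gen, AlgHom.id_apply]
      refine CochainCpx.hom_induction P.cpx.gr
        (p := fun v => DirectSum.coeAlgHom P.ccrGr (genDS v) = P.gen v)
        (by simp) (fun i v hv => ?_) (fun v w h h' => ?_) v
      · rw [genDS_of_mem hv, DirectSum.coeAlgHom_of]
      · rw [map_add, map_add, map_add, h, h'])
    (by
      rintro i ⟨a, ha⟩
      have key : ∀ (h : a ∈ P.ccrGr i),
          ccrDecompose a = DirectSum.of (fun i => P.ccrGr i) i ⟨a, h⟩ := by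
        refine (ccrGr_induction (p := fun i a => a ∈ P.ccrGr i ∧ ∀ (h : a ∈ P.ccrGr i),
          ccrDecompose a = DirectSum.of (fun i => P.ccrGr i) i ⟨a, h⟩)
          ?_ ?_ ?_ ?_ ?_ ha).2
        · intro i
          refine ⟨zero_mem _, fun h => ?_⟩
          rw [map_zero]
          exact (map_zero (DirectSum.of (fun i => P.ccrGr i) i)).symm
        · rintro i a b ⟨ha, ha'⟩ ⟨hb, hb'⟩
          refine ⟨add_mem ha hb, fun h => ?_⟩
          rw [map_add, ha' ha, hb' hb, ← map_add]
          rfl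
        · rintro i c a ⟨ha, ha'⟩
          refine ⟨Submodule.smul_mem _ c ha, fun h => ?_⟩
          rw [map_smul, ha' ha]
          exact (map_smul (DirectSum.lof ℂ ℤ (fun i => P.ccrGr i) i) c _).symm
        · refine ⟨SetLike.GradedOne.one_mem, fun h => ?_⟩
          rw [map_one]
          rfl
        · rintro i j v b hv hb ⟨-, hb'⟩
          refine ⟨SetLike.mul_mem_graded (gen_mem hv) hb, fun h => ?_⟩
          rw [map_mul, ccrDecompose_gen, genDS_of_mem hv, hb' hb, DirectSum.of_mul_of]
          rfl
      exact key ha)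

/-- The sign `(-1)^i` as a complex number. -/
abbrev sgn (i : ℤ) : ℂ := ((i.negOnePow : ℤ) : ℂ)

theorem sgn_add (i j : ℤ) : sgn (i + j) = sgn i * sgn j := by
  simp [sgn, Int.negOnePow_add]

theorem sgn_mul_self (i : ℤ) : sgn i * sgn i = 1 := by
  rw [← sgn_add, sgn, Int.negOnePow_even _ ⟨i, rfl⟩]; simp

theorem zsmul_sgn {A : Type u} [AddCommGroup A] [Module ℂ A] (i : ℤ) (a : A) :
    (i.negOnePow : ℤ) • a = sgn i • a := (Int.cast_smul_eq_zsmul ℂ _ a).symm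

theorem gen_scale (s : ℤ → ℤˣ) {i : ℤ} {v : P.cpx.carrier} (hv : v ∈ P.cpx.gr i) :
    P.gen (CochainCpx.scale P.cpx.gr s v) = (((s i : ℤˣ) : ℤ) : ℂ) • P.gen v := by
  rw [CochainCpx.scale_of_mem _ _ hv, map_zsmul, Int.cast_smul_eq_zsmul]

theorem sgn_smul_τ {i j : ℤ} {v w : P.cpx.carrier} (hv : v ∈ P.cpx.gr i)
    (hw : w ∈ P.cpx.gr j) : sgn i * sgn j * (P.τ v w : ℂ) = P.τ v w := by
  by_cases h : i + j = 0
  · rw [← sgn_add, h]; simp [sgn]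
  · rw [P.isPoisson.degree_zero i j v w hv hw h]; simp

theorem ccr_ext_of_homogeneous {T : Type v} [AddCommGroup T] (f g : P.CCRAlg →+ T)
    (h : ∀ (i : ℤ) a, a ∈ P.ccrGr i → f a = g a) (a : P.CCRAlg) : f a = g a :=
  CochainCpx.hom_induction P.ccrGr (p := fun a => f a = g a) (by simp) h
    (fun a b ha hb => by rw [map_add, map_add, ha, hb]) a

/-- The values on generators of the algebra map `a ↦ !![(-1)^|a| a, d a; 0, a]`. -/
def genMat : P.cpx.carrier →ₛₗ[Complex.ofRealHom] Matrix (Fin 2) (Fin 2) P.CCRAlg where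
  toFun v := !![P.gen (CochainCpx.scale P.cpx.gr Int.negOnePow v), P.gen (P.cpx.d v); 0, P.gen v]
  map_add' v w := by
    ext a b; fin_cases a <;> fin_cases b <;> simp
  map_smul' r v := by
    ext a b; fin_cases a <;> fin_cases b <;> simp

theorem genMat_of_mem {i : ℤ} {v : P.cpx.carrier} (hv : v ∈ P.cpx.gr i) :
    genMat v = !![sgn i • P.gen v, P.gen (P.cpx.d v); 0, P.gen v] := by
  change !![_, _; _, _] = _
  rw [gen_scale _ hv]

/-- The algebra map `a ↦ !![(-1)^|a| a, d a; 0, a]`. -/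
def ccrMat : P.CCRAlg →ₐ[ℂ] Matrix (Fin 2) (Fin 2) P.CCRAlg :=
  ccrLift genMat (by
    intro i j v w hv hw
    have hdv := P.cpx.d_mem i v hv
    have hdw := P.cpx.d_mem j w hw
    have h1 := P.gen_comm hv hw
    have h2 := P.gen_comm hv hdw
    have h3 := P.gen_comm hdv hw
    have h4 : (P.τ (P.cpx.d v) w : ℂ) + sgn i * (P.τ v (P.cpx.d w) : ℂ) = 0 := by
      have h := congrArg Complex.ofReal (P.isPoisson.cochain i v w hv)
      rw [Complex.ofReal_add, Complex.ofReal_mul, Complex.ofReal_intCast,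
        Complex.ofReal_zero] at h
      exact h
    have h5 := sgn_smul_τ hv hw
    have s1 : ((((i * (j + 1)).negOnePow : ℤ)) : ℂ) = sgn (i * j) * sgn i := by
      rw [← sgn_add]; congr 4; ring
    have s2 : (((((i + 1) * j).negOnePow : ℤ)) : ℂ) = sgn (i * j) * sgn j := by
      rw [← sgn_add]; congr 4; ring
    rw [s1] at h2
    rw [s2] at h3
    have hi := sgn_mul_self i
    rw [genMat_of_mem hv, genMat_of_mem hw]
    rw [Algebra.algebraMap_eq_smul_one] at h1 h2 h3 ⊢
    ext a b
    fin_cases a <;> fin_cases b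
    · simp only [Fin.zero_eta, Matrix.mul_apply, Fin.sum_univ_two, Matrix.add_apply,
        Matrix.smul_apply, Matrix.one_apply_eq]
      simp only [Matrix.of_apply, Matrix.cons_val_zero, Matrix.cons_val_one, Matrix.cons_val',
        Matrix.cons_val_fin_one, mul_zero, add_zero, smul_mul_assoc, mul_smul_comm, h1]
      have : Complex.I * (P.τ v w : ℂ) = sgn j * (sgn i * (Complex.I * (P.τ v w : ℂ))) := by
        linear_combination (-Complex.I) * h5
      conv_rhs => rw [this]
      module
    · simp only [Fin.zero_eta, Fin.mk_one, Matrix.mul_apply, Fin.sum_univ_two, Matrix.add_apply,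
        Matrix.smul_apply, Matrix.one_apply_ne (zero_ne_one (α := Fin 2))]
      simp only [Matrix.of_apply, Matrix.cons_val_zero, Matrix.cons_val_one, Matrix.cons_val',
        Matrix.cons_val_fin_one, add_zero, smul_mul_assoc, h2, h3,
        smul_zero]
      have : (P.τ (P.cpx.d v) w : ℂ) = - (sgn i * (P.τ v (P.cpx.d w) : ℂ)) := by
        linear_combination h4
      rw [this, smul_add, smul_smul, ← mul_assoc, mul_comm (sgn i) (sgn (i * j)), mul_assoc, hi]
      module
    · simp [Matrix.mul_apply, Fin.sum_univ_two]
    · simp only [Fin.mk_one, Matrix.mul_apply, Fin.sum_univ_two, Matrix.add_apply,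
        Matrix.smul_apply, Matrix.one_apply_eq]
      simp only [Matrix.of_apply, Matrix.cons_val_zero, Matrix.cons_val_one, Matrix.cons_val',
        Matrix.cons_val_fin_one, zero_mul, zero_add, h1])

theorem ccrMat_gen (v : P.cpx.carrier) : ccrMat (P.gen v) = genMat v := ccrLift_gen _ _ v

/-- The differential of the CCR-algebra: the graded derivation that extends the differential
of `P`. -/
def ccrD : P.CCRAlg →ₗ[ℂ] P.CCRAlg where
  toFun a := ccrMat a 0 1
  map_add' a b := by simp
  map_smul' c a := by simp

theorem ccrMat_of_mem {i : ℤ} {a : P.CCRAlg} (ha : a ∈ P.ccrGr i) :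
    ccrMat a = !![sgn i • a, ccrD a; 0, a] := by
  refine ccrGr_induction (p := fun i a => ccrMat a = !![sgn i • a, ccrD a; 0, a])
    (fun i => ?_) (fun i a b ha hb => ?_) (fun i c a ha => ?_) ?_
    (fun i j v b hv _ hb => ?_) ha
  · rw [map_zero, map_zero]; ext a b; fin_cases a <;> fin_cases b <;> simp
  · rw [map_add, map_add, ha, hb]; ext a b; fin_cases a <;> fin_cases b <;> simp
  · rw [map_smul, map_smul, ha]; ext a b
    fin_cases a <;> fin_cases b <;> simp [smul_comm c]
  · have : ccrD (1 : P.CCRAlg) = 0 := by change ccrMat (1 : P.CCRAlg) 0 1 = 0; simp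
    rw [this, map_one]; ext a b; fin_cases a <;> fin_cases b <;> simp [sgn]
  · have h : ccrMat (P.gen v * b) 0 1 = ccrD (P.gen v * b) := rfl
    rw [map_mul, ccrMat_gen, genMat_of_mem hv, hb] at h ⊢
    rw [sgn_add]
    ext x y
    fin_cases x <;> fin_cases y
    · simp [Matrix.mul_apply, Fin.sum_univ_two, smul_smul, mul_comm]
    · exact h
    · simp [Matrix.mul_apply, Fin.sum_univ_two]
    · simp [Matrix.mul_apply, Fin.sum_univ_two]

theorem ccrD_gen (v : P.cpx.carrier) : ccrD (P.gen v) = P.gen (P.cpx.d v) := by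
  change ccrMat (P.gen v) 0 1 = _
  rw [ccrMat_gen]; rfl

theorem ccrMat_one_one (a : P.CCRAlg) : ccrMat a 1 1 = a :=
  CochainCpx.hom_induction P.ccrGr (p := fun a => ccrMat a 1 1 = a) (by simp)
    (fun i a ha => by rw [ccrMat_of_mem ha]; rfl)
    (fun a b ha hb => by rw [map_add, Matrix.add_apply, ha, hb]) a

theorem ccrD_mul {i : ℤ} {a : P.CCRAlg} (ha : a ∈ P.ccrGr i) (b : P.CCRAlg) :
    ccrD (a * b) = ccrD a * b + sgn i • (a * ccrD b) := by
  have h : ccrD (a * b) = (ccrMat a * ccrMat b) 0 1 := by rw [← map_mul]; rfl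
  have h' : ccrMat b 0 1 = ccrD b := rfl
  rw [h, Matrix.mul_apply, Fin.sum_univ_two, ccrMat_one_one, h', ccrMat_of_mem ha]
  simp [add_comm]

theorem ccrD_one : ccrD (1 : P.CCRAlg) = 0 := by change ccrMat (1 : P.CCRAlg) 0 1 = 0; simp

theorem ccrD_mem {i : ℤ} {a : P.CCRAlg} (ha : a ∈ P.ccrGr i) : ccrD a ∈ P.ccrGr (i + 1) := by
  refine ccrGr_induction (p := fun i a => ccrD a ∈ P.ccrGr (i + 1))
    (fun i => ?_) (fun i a b ha hb => ?_) (fun i c a ha => ?_) ?_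
    (fun i j v b hv hb ih => ?_) ha
  · rw [map_zero]; exact zero_mem _
  · rw [map_add]; exact add_mem ha hb
  · rw [map_smul]; exact Submodule.smul_mem _ _ ha
  · rw [ccrD_one]; exact zero_mem _
  · rw [ccrD_mul (gen_mem hv), ccrD_gen]
    refine add_mem ?_ (Submodule.smul_mem _ _ ?_)
    · rw [show i + j + 1 = (i + 1) + j by ring]
      exact SetLike.mul_mem_graded (gen_mem (P.cpx.d_mem i v hv)) hb
    · rw [add_assoc]
      exact SetLike.mul_mem_graded (gen_mem hv) ih

theorem ccrD_ccrD (a : P.CCRAlg) : ccrD (ccrD a) = 0 := by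
  refine ccr_ext_of_homogeneous ((ccrD ∘ₗ ccrD).toAddMonoidHom) 0 (fun i a ha => ?_) a
  change ccrD (ccrD a) = 0
  refine ccrGr_induction (p := fun i a => ccrD (ccrD a) = 0)
    (fun i => ?_) (fun i a b ha hb => ?_) (fun i c a ha => ?_) ?_
    (fun i j v b hv hb ih => ?_) ha
  · simp
  · simp [ha, hb]
  · simp [ha]
  · simp [ccrD_one]
  · rw [ccrD_mul (gen_mem hv), ccrD_gen, map_add, map_smul,
      ccrD_mul (gen_mem (P.cpx.d_mem i v hv)), ccrD_mul (gen_mem hv), ccrD_gen, ccrD_gen,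
      P.cpx.d_d, ih, sgn_add]
    simp

/-- The sign `(-1)^(i(i-1)/2)`. -/
def koszul (i : ℤ) : ℤˣ := (i * (i - 1) / 2).negOnePow

/-- The same sign as a complex number. -/
abbrev kos (i : ℤ) : ℂ := ((koszul i : ℤ) : ℂ)

theorem kos_add (i j : ℤ) : kos (i + j) = kos i * kos j * sgn (i * j) := by
  have h : (i + j) * (i + j - 1) / 2 = i * (i - 1) / 2 + j * (j - 1) / 2 + i * j := by
    have h1 : 2 ∣ i * (i - 1) := (Int.even_mul_pred_self i).two_dvd
    have h2 : 2 ∣ j * (j - 1) := (Int.even_mul_pred_self j).two_dvd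
    obtain ⟨a, ha⟩ := h1
    obtain ⟨b, hb⟩ := h2
    have : (i + j) * (i + j - 1) = 2 * (a + b + i * j) := by linear_combination ha + hb
    rw [this, ha, hb]
    simp
  simp [kos, koszul, h, Int.negOnePow_add]

theorem kos_mul_self (i : ℤ) : kos i * kos i = 1 := sgn_mul_self _

theorem kos_zero : kos 0 = 1 := by simp [kos, koszul]

theorem conj_sgn (i : ℤ) : starRingEnd ℂ (sgn i) = sgn i := by simp [sgn]

theorem conj_kos (i : ℤ) : starRingEnd ℂ (kos i) = kos i := by simp [kos]

/-- The opposite algebra with the complex conjugate scalar multiplication. -/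
def ConjOp (A : Type u) : Type u := Aᵐᵒᵖ

instance {A : Type u} [Ring A] : Ring (ConjOp A) := inferInstanceAs (Ring Aᵐᵒᵖ)

instance {A : Type u} [Ring A] [Algebra ℂ A] : Algebra ℂ (ConjOp A) :=
  RingHom.toAlgebra' ((algebraMap ℂ Aᵐᵒᵖ).comp (starRingEnd ℂ))
    (fun z (a : Aᵐᵒᵖ) => Algebra.commutes (R := ℂ) (A := Aᵐᵒᵖ) (starRingEnd ℂ z) a)

/-- The additive identification of an algebra with its conjugate opposite. -/
def toConj {A : Type u} [Ring A] : A ≃+ ConjOp A := MulOpposite.opAddEquiv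

theorem toConj_mul {A : Type u} [Ring A] (a b : A) : toConj (a * b) = toConj b * toConj a := rfl

theorem toConj_smul {A : Type u} [Ring A] [Algebra ℂ A] (c : ℂ) (a : A) :
    toConj (c • a) = starRingEnd ℂ c • toConj a := by
  have h : starRingEnd ℂ c • toConj a
      = MulOpposite.op (algebraMap ℂ A (starRingEnd ℂ (starRingEnd ℂ c))) * MulOpposite.op a := rfl
  rw [h, Complex.conj_conj, ← MulOpposite.op_mul, ← Algebra.commutes, ← Algebra.smul_def]
  rfl

theorem toConj_one {A : Type u} [Ring A] : toConj (1 : A) = 1 := rfl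

/-- The values on generators of the reversal map. -/
def genRev : P.cpx.carrier →ₛₗ[Complex.ofRealHom] ConjOp P.CCRAlg where
  toFun v := toConj (P.gen (CochainCpx.scale P.cpx.gr koszul v))
  map_add' v w := by simp
  map_smul' r v := by
    rw [map_smul, map_smulₛₗ, toConj_smul]; simp

theorem genRev_of_mem {i : ℤ} {v : P.cpx.carrier} (hv : v ∈ P.cpx.gr i) :
    genRev v = kos i • toConj (P.gen v) := by
  change toConj (P.gen _) = _
  rw [gen_scale _ hv, toConj_smul, conj_kos]

/-- The antilinear antimultiplicative map with value `(-1)^(i(i-1)/2) v` on generators of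
degree `i`. -/
def ccrRev : P.CCRAlg →ₐ[ℂ] ConjOp P.CCRAlg :=
  ccrLift genRev (by
    intro i j v w hv hw
    rw [genRev_of_mem hv, genRev_of_mem hw]
    simp only [smul_mul_assoc, mul_smul_comm, ← toConj_mul]
    have h1 := P.gen_comm hv hw
    rw [Algebra.algebraMap_eq_smul_one] at h1 ⊢
    rw [h1, map_add, toConj_smul, toConj_smul, toConj_one, conj_sgn,
      map_mul (starRingEnd ℂ), Complex.conj_I, Complex.conj_ofReal]
    have hk : kos i * kos j * sgn (i * j) * (P.τ v w : ℂ) = P.τ v w := by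
      rw [← kos_add]
      by_cases h : i + j = 0
      · rw [h, kos_zero, one_mul]
      · rw [P.isPoisson.degree_zero i j v w hv hw h]; simp
    have hs := sgn_mul_self (i * j)
    have h2 : Complex.I * (P.τ v w : ℂ)
        = Complex.I * (kos i * kos j * sgn (i * j) * (P.τ v w : ℂ)) := by rw [hk]
    rw [h2]
    simp only [smul_add, smul_smul]
    rw [show sgn (i * j) * (kos i * (kos j * sgn (i * j)))
      = kos i * kos j * (sgn (i * j) * sgn (i * j)) by ring, hs]
    module)

/-- The reversal map as an additive map of the CCR-algebra. -/
def rev (a : P.CCRAlg) : P.CCRAlg := toConj.symm (ccrRev a)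

theorem rev_add (a b : P.CCRAlg) : rev (a + b) = rev a + rev b := by simp [rev]

theorem rev_zero : rev (0 : P.CCRAlg) = 0 := by simp [rev]

theorem rev_one : rev (1 : P.CCRAlg) = 1 := by
  rw [rev, map_one, AddEquiv.symm_apply_eq]; rfl

theorem rev_smul (c : ℂ) (a : P.CCRAlg) : rev (c • a) = starRingEnd ℂ c • rev a := by
  rw [rev, rev, AddEquiv.symm_apply_eq, toConj_smul, map_smul, Complex.conj_conj,
    AddEquiv.apply_symm_apply]

theorem rev_mul (a b : P.CCRAlg) : rev (a * b) = rev b * rev a := by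
  rw [rev, rev, rev, AddEquiv.symm_apply_eq, toConj_mul, map_mul, AddEquiv.apply_symm_apply,
    AddEquiv.apply_symm_apply]

theorem rev_gen {i : ℤ} {v : P.cpx.carrier} (hv : v ∈ P.cpx.gr i) :
    rev (P.gen v) = kos i • P.gen v := by
  rw [rev, ccrRev, ccrLift_gen, genRev_of_mem hv, AddEquiv.symm_apply_eq, toConj_smul, conj_kos]

theorem rev_mem {i : ℤ} {a : P.CCRAlg} (ha : a ∈ P.ccrGr i) : rev a ∈ P.ccrGr i := by
  refine ccrGr_induction (p := fun i a => rev a ∈ P.ccrGr i)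
    (fun i => ?_) (fun i a b ha hb => ?_) (fun i c a ha => ?_) ?_
    (fun i j v b hv hb ih => ?_) ha
  · rw [rev_zero]; exact zero_mem _
  · rw [rev_add]; exact add_mem ha hb
  · rw [rev_smul]; exact Submodule.smul_mem _ _ ha
  · rw [rev_one]; exact SetLike.GradedOne.one_mem
  · rw [rev_mul, rev_gen hv, add_comm]
    exact SetLike.mul_mem_graded ih (Submodule.smul_mem _ _ (gen_mem hv))

/-- The involution of the CCR-algebra: antilinear, with `(a b)^* = (-1)^(|a||b|) b^* a^*`, and
with `v^* = v` for the generators. -/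
def ccrStar : P.CCRAlg →ₛₗ[starRingEnd ℂ] P.CCRAlg where
  toFun a := CochainCpx.scale P.ccrGr koszul (rev a)
  map_add' a b := by rw [rev_add, map_add]
  map_smul' c a := by rw [rev_smul, map_smul]

theorem ccrStar_of_mem {i : ℤ} {a : P.CCRAlg} (ha : a ∈ P.ccrGr i) :
    ccrStar a = kos i • rev a := by
  change CochainCpx.scale P.ccrGr koszul (rev a) = _
  rw [CochainCpx.scale_of_mem _ _ (rev_mem ha), ← Int.cast_smul_eq_zsmul ℂ]

theorem ccrStar_mem {i : ℤ} {a : P.CCRAlg} (ha : a ∈ P.ccrGr i) : ccrStar a ∈ P.ccrGr i := by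
  rw [ccrStar_of_mem ha]; exact Submodule.smul_mem _ _ (rev_mem ha)

theorem ccrStar_one : ccrStar (1 : P.CCRAlg) = 1 := by
  rw [ccrStar_of_mem (i := 0) SetLike.GradedOne.one_mem, rev_one, kos_zero, one_smul]

theorem ccrStar_gen (v : P.cpx.carrier) : ccrStar (P.gen v) = P.gen v :=
  CochainCpx.hom_induction P.cpx.gr (p := fun v => ccrStar (P.gen v) = P.gen v) (by simp)
    (fun i v hv => by
      rw [ccrStar_of_mem (gen_mem hv), rev_gen hv, smul_smul, kos_mul_self, one_smul])
    (fun v w h h' => by rw [map_add, map_add, h, h']) v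

theorem ccrStar_mul {i j : ℤ} {a b : P.CCRAlg} (ha : a ∈ P.ccrGr i) (hb : b ∈ P.ccrGr j) :
    ccrStar (a * b) = sgn (i * j) • (ccrStar b * ccrStar a) := by
  rw [ccrStar_of_mem (SetLike.mul_mem_graded ha hb), ccrStar_of_mem ha, ccrStar_of_mem hb,
    rev_mul, kos_add, smul_mul_assoc, mul_smul_comm]
  module

theorem ccrStar_ccrStar (a : P.CCRAlg) : ccrStar (ccrStar a) = a := by
  refine ccr_ext_of_homogeneous ((ccrStar.comp ccrStar :
    P.CCRAlg →ₗ[ℂ] P.CCRAlg).toAddMonoidHom) (AddMonoidHom.id _) (fun i a ha => ?_) a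
  change ccrStar (ccrStar a) = a
  refine ccrGr_induction (p := fun i a => ccrStar (ccrStar a) = a)
    (fun i => ?_) (fun i a b ha hb => ?_) (fun i c a ha => ?_) ?_
    (fun i j v b hv hb ih => ?_) ha
  · simp
  · rw [map_add, map_add, ha, hb]
  · rw [map_smulₛₗ, map_smulₛₗ, ha, Complex.conj_conj]
  · rw [ccrStar_one, ccrStar_one]
  · rw [ccrStar_mul (gen_mem hv) hb, map_smulₛₗ, conj_sgn,
      ccrStar_mul (ccrStar_mem hb) (ccrStar_mem (gen_mem hv)), ih, ccrStar_gen, ccrStar_gen,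
      smul_smul, mul_comm j i, sgn_mul_self, one_smul]

theorem ccrStar_ccrD (a : P.CCRAlg) : ccrStar (ccrD a) = ccrD (ccrStar a) := by
  refine ccr_ext_of_homogeneous
    ((ccrStar.comp (ccrD : P.CCRAlg →ₗ[ℂ] P.CCRAlg)).toAddMonoidHom)
    (((ccrD : P.CCRAlg →ₗ[ℂ] P.CCRAlg).comp ccrStar).toAddMonoidHom) (fun i a ha => ?_) a
  change ccrStar (ccrD a) = ccrD (ccrStar a)
  refine ccrGr_induction (p := fun i a => ccrStar (ccrD a) = ccrD (ccrStar a))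
    (fun i => ?_) (fun i a b ha hb => ?_) (fun i c a ha => ?_) ?_
    (fun i j v b hv hb ih => ?_) ha
  · simp
  · rw [map_add, map_add, map_add, map_add, ha, hb]
  · rw [map_smul, map_smulₛₗ, map_smulₛₗ, map_smul, ha]
  · rw [ccrD_one, ccrStar_one, ccrD_one, map_zero]
  · have hdv := P.cpx.d_mem i v hv
    rw [ccrD_mul (gen_mem hv), ccrD_gen, map_add, map_smulₛₗ, conj_sgn,
      ccrStar_mul (gen_mem hdv) hb, ccrStar_mul (gen_mem hv) (ccrD_mem hb), ccrStar_gen,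
      ccrStar_gen, ih, ccrStar_mul (gen_mem hv) hb, map_smul, ccrD_mul (ccrStar_mem hb),
      ccrStar_gen, ccrD_gen]
    have s1 : sgn ((i + 1) * j) = sgn (i * j) * sgn j := by
      rw [← sgn_add]; congr 1; ring
    have s2 : sgn i * sgn (i * (j + 1)) = sgn (i * j) := by
      rw [show i * (j + 1) = i * j + i by ring, sgn_add, mul_left_comm, sgn_mul_self, mul_one]
    rw [s1, smul_smul, s2]
    module

variable (P)

/-- The CCR-algebra of a Poisson cochain complex, as a differential graded `*`-algebra. -/
def ccr : DGStarAlg.{u} where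
  carrier := P.CCRAlg
  gr := P.ccrGr
  d := ccrD
  d_mem _ _ ha := ccrD_mem ha
  d_d := ccrD_ccrD
  leibniz i a b ha := by rw [ccrD_mul ha, zsmul_sgn]
  star := ccrStar
  star_mem _ _ ha := ccrStar_mem ha
  star_star := ccrStar_ccrStar
  star_mul i j a b ha hb := by rw [ccrStar_mul ha hb, zsmul_sgn]
  star_d := ccrStar_ccrD

variable {P}

/-- The algebra map induced by a morphism of Poisson cochain complexes. -/
def ccrMap {P Q : PoCh.{u}} (f : PoCh.Hom P Q) : P.CCRAlg →ₐ[ℂ] Q.CCRAlg :=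
  ccrLift
    { toFun := fun v => Q.gen (f.toHom.toLin v)
      map_add' := fun v w => by rw [map_add, map_add]
      map_smul' := fun r v => by rw [map_smul, map_smulₛₗ] }
    (fun i j v w hv hw => by
      have h := Q.gen_comm (f.toHom.map_gr i v hv) (f.toHom.map_gr j w hw)
      rw [f.map_τ] at h
      exact h)

theorem ccrMap_gen {P Q : PoCh.{u}} (f : PoCh.Hom P Q) (v : P.cpx.carrier) :
    ccrMap f (P.gen v) = Q.gen (f.toHom.toLin v) := ccrLift_gen _ _ v

theorem ccrMap_mem {P Q : PoCh.{u}} (f : PoCh.Hom P Q) {i : ℤ} {a : P.CCRAlg}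
    (ha : a ∈ P.ccrGr i) : ccrMap f a ∈ Q.ccrGr i := by
  refine ccrGr_induction (p := fun i a => ccrMap f a ∈ Q.ccrGr i)
    (fun i => ?_) (fun i a b ha hb => ?_) (fun i c a ha => ?_) ?_
    (fun i j v b hv hb ih => ?_) ha
  · rw [map_zero]; exact zero_mem _
  · rw [map_add]; exact add_mem ha hb
  · rw [map_smul]; exact Submodule.smul_mem _ _ ha
  · rw [map_one]; exact SetLike.GradedOne.one_mem
  · rw [map_mul, ccrMap_gen]
    exact SetLike.mul_mem_graded (gen_mem (f.toHom.map_gr i v hv)) ih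

theorem ccrMap_ccrD {P Q : PoCh.{u}} (f : PoCh.Hom P Q) (a : P.CCRAlg) :
    ccrMap f (ccrD a) = ccrD (ccrMap f a) := by
  refine ccr_ext_of_homogeneous ((ccrMap f).toLinearMap.comp ccrD).toAddMonoidHom
    (ccrD.comp (ccrMap f).toLinearMap).toAddMonoidHom (fun i a ha => ?_) a
  change ccrMap f (ccrD a) = ccrD (ccrMap f a)
  refine ccrGr_induction (p := fun i a => ccrMap f (ccrD a) = ccrD (ccrMap f a))
    (fun i => ?_) (fun i a b ha hb => ?_) (fun i c a ha => ?_) ?_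
    (fun i j v b hv hb ih => ?_) ha
  · simp
  · rw [map_add, map_add, map_add, map_add, ha, hb]
  · rw [map_smul, map_smul, map_smul, map_smul, ha]
  · rw [ccrD_one, map_one, ccrD_one, map_zero]
  · rw [ccrD_mul (gen_mem hv), map_mul, ccrMap_gen,
      ccrD_mul (gen_mem (f.toHom.map_gr i v hv)), ccrD_gen, ccrD_gen, map_add, map_smul, map_mul,
      map_mul, ccrMap_gen, ccrMap_gen, ih, f.toHom.map_d]

theorem ccrMap_ccrStar {P Q : PoCh.{u}} (f : PoCh.Hom P Q) (a : P.CCRAlg) :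
    ccrMap f (ccrStar a) = ccrStar (ccrMap f a) := by
  refine ccr_ext_of_homogeneous
    ((ccrMap f).toLinearMap.comp (ccrStar : P.CCRAlg →ₛₗ[starRingEnd ℂ] P.CCRAlg)).toAddMonoidHom
    ((ccrStar : Q.CCRAlg →ₛₗ[starRingEnd ℂ] Q.CCRAlg).comp
      (ccrMap f).toLinearMap).toAddMonoidHom (fun i a ha => ?_) a
  change ccrMap f (ccrStar a) = ccrStar (ccrMap f a)
  refine ccrGr_induction (p := fun i a => ccrMap f (ccrStar a) = ccrStar (ccrMap f a))
    (fun i => ?_) (fun i a b ha hb => ?_) (fun i c a ha => ?_) ?_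
    (fun i j v b hv hb ih => ?_) ha
  · simp
  · rw [map_add, map_add, map_add, map_add, ha, hb]
  · rw [map_smulₛₗ, map_smul, map_smul, map_smulₛₗ, ha]
  · rw [ccrStar_one, map_one, ccrStar_one]
  · rw [ccrStar_mul (gen_mem hv) hb, map_smul, map_mul, map_mul, ccrMap_gen, ih,
      ccrStar_mul (gen_mem (f.toHom.map_gr i v hv)) (ccrMap_mem f hb), ccrStar_gen, ccrStar_gen,
      ccrMap_gen]

/-- The canonical commutation relations functor. -/
def CCR : CategoryTheory.Functor PoCh.{u} DGStarAlg.{u} where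
  obj P := P.ccr
  map f :=
    { toAlgHom := ccrMap f
      map_gr := fun _ _ ha => ccrMap_mem f ha
      map_d := ccrMap_ccrD f
      map_star := ccrMap_ccrStar f }
  map_id P := DGStarAlg.Hom.ext (ccr_hom_ext fun v => ccrMap_gen _ v)
  map_comp f g := DGStarAlg.Hom.ext (ccr_hom_ext fun v => by
    refine (ccrMap_gen _ v).trans ?_
    change _ = ccrMap g (ccrMap f _)
    rw [ccrMap_gen, ccrMap_gen]
    rfl)

end

end PoCh

set_option linter.unusedSectionVars false

/-! Differential forms on manifolds with boundary -/

noncomputable section Forms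

open Filter

variable {E : Type v} [NormedAddCommGroup E] [NormedSpace ℝ E] {H : Type v} [TopologicalSpace H]
  (I : ModelWithCorners ℝ E H) {M : Type u} [TopologicalSpace M] [ChartedSpace H M]

/-- A `k`-form on `M` in the coordinates given by the extended chart at `x₀`: the pullback
along the inverse of this chart. A `k`-form assigns to each point `x` an alternating `k`-linear
form on the tangent space `TangentSpace I x`, which is by definition the model space `E`
(identified through the derivative of the preferred chart at `x`). -/
def chartRep {k : ℕ} (α : M → E [⋀^Fin k]→L[ℝ] ℝ) (x₀ : M) (y : E) : E [⋀^Fin k]→L[ℝ] ℝ :=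
  (α ((extChartAt I x₀).symm y)).compContinuousLinearMap
    (mfderivWithin 𝓘(ℝ, E) I (extChartAt I x₀).symm (range I) y)

/-- A form is smooth if its coefficients in the charts are smooth (up to the boundary). -/
def IsSmoothForm {k : ℕ} (α : M → E [⋀^Fin k]→L[ℝ] ℝ) : Prop :=
  ∀ x₀ : M, ContDiffOn ℝ ∞ (chartRep I α x₀) (extChartAt I x₀).target

/-- The exterior derivative of a form, computed at `x` in the preferred chart at `x`. -/
def extD {k : ℕ} (α : M → E [⋀^Fin k]→L[ℝ] ℝ) (x : M) : E [⋀^Fin (k + 1)]→L[ℝ] ℝ :=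
  extDerivWithin (chartRep I α x) (range I) (extChartAt I x x)

variable {I}

theorem chartRep_add {k : ℕ} (α β : M → E [⋀^Fin k]→L[ℝ] ℝ) (x₀ : M) :
    chartRep I (α + β) x₀ = chartRep I α x₀ + chartRep I β x₀ := rfl

theorem chartRep_smul {k : ℕ} (c : ℝ) (α : M → E [⋀^Fin k]→L[ℝ] ℝ) (x₀ : M) :
    chartRep I (c • α) x₀ = c • chartRep I α x₀ := rfl

theorem chartRep_zero {k : ℕ} (x₀ : M) :
    chartRep I (0 : M → E [⋀^Fin k]→L[ℝ] ℝ) x₀ = 0 := rfl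

theorem chartRep_of_eq_zero {k : ℕ} {α : M → E [⋀^Fin k]→L[ℝ] ℝ} {x₀ : M} {y : E}
    (h : α ((extChartAt I x₀).symm y) = 0) : chartRep I α x₀ y = 0 := by
  rw [chartRep, h]; rfl

theorem IsSmoothForm.contDiffWithinAt {k : ℕ} {α : M → E [⋀^Fin k]→L[ℝ] ℝ}
    (h : IsSmoothForm I α) {x₀ : M} {y : E} (hy : y ∈ (extChartAt I x₀).target) :
    ContDiffWithinAt ℝ ∞ (chartRep I α x₀) (range I) y :=
  (h x₀ y hy).mono_of_mem_nhdsWithin (extChartAt_target_mem_nhdsWithin_of_mem hy)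

theorem minSmoothness_two_le : minSmoothness ℝ 2 ≤ (∞ : WithTop ℕ∞) := by
  simp only [minSmoothness_of_isRCLikeNormedField]
  exact WithTop.coe_le_coe.2 (le_top : (2 : ℕ∞) ≤ ⊤)

theorem extD_add {k : ℕ} {α β : M → E [⋀^Fin k]→L[ℝ] ℝ} (hα : IsSmoothForm I α)
    (hβ : IsSmoothForm I β) : extD I (α + β) = extD I α + extD I β := by
  funext x
  have hx := mem_extChartAt_target (I := I) x
  exact extDerivWithin_add
    (I.uniqueDiffOn.uniqueDiffWithinAt (extChartAt_target_subset_range x hx))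
    ((hα.contDiffWithinAt hx).differentiableWithinAt (by simp))
    ((hβ.contDiffWithinAt hx).differentiableWithinAt (by simp))

theorem extD_smul {k : ℕ} (c : ℝ) (α : M → E [⋀^Fin k]→L[ℝ] ℝ) :
    extD I (c • α) = c • extD I α := by
  funext x
  have hx := mem_extChartAt_target (I := I) x
  exact extDerivWithin_smul (𝕜 := ℝ) c (chartRep I α x)
    (I.uniqueDiffOn.uniqueDiffWithinAt (extChartAt_target_subset_range x hx))

theorem extD_eq_zero {k : ℕ} {α : M → E [⋀^Fin k]→L[ℝ] ℝ} {K : Set M} (hK : IsClosed K)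
    (h : ∀ x ∉ K, α x = 0) {x : M} (hx : x ∉ K) : extD I α x = 0 := by
  have hev : chartRep I α x =ᶠ[𝓝[range I] (extChartAt I x x)] fun _ => 0 := by
    have hopen : ∀ᶠ w in 𝓝[range I] (extChartAt I x x), (extChartAt I x).symm w ∈ Kᶜ := by
      have hc := (continuousAt_extChartAt_symm (I := I) x).continuousWithinAt (s := range I)
      refine hc.eventually (hK.isOpen_compl.mem_nhds ?_)
      rw [extChartAt_to_inv]
      exact hx
    filter_upwards [hopen] with w hw
    exact chartRep_of_eq_zero (h _ hw)
  have hr := extChartAt_target_subset_range x (mem_extChartAt_target (I := I) x)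
  change extDerivWithin (chartRep I α x) (range I) (extChartAt I x x) = 0
  rw [hev.extDerivWithin_eq_of_mem hr]
  rw [extDerivWithin, fderivWithin_fun_const]
  exact map_zero (ContinuousAlternatingMap.alternatizeUncurryFinCLM ℝ E ℝ)

variable (I)

variable (M E) in
/-- Submodules of the space of all `k`-forms. (This is just
`Submodule ℝ (M → E [⋀^Fin k]→L[ℝ] ℝ)`; spelling out the additive structure on `k`-forms helps
instance resolution.) -/
abbrev FormSubspace (k : ℕ) : Type _ :=
  @Submodule ℝ (M → E [⋀^Fin k]→L[ℝ] ℝ) _ AddCommGroup.toAddCommMonoid inferInstance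

/-- The smooth `k`-forms with compact support contained in the subset `V`. For open `V` this is
the space of compactly supported `k`-forms on `V`, extended by zero. -/
def compactForms (k : ℕ) (V : Set M) : FormSubspace E M k where
  carrier := {α | IsSmoothForm I α ∧ ∃ K : Set M, IsCompact K ∧ K ⊆ V ∧ ∀ x ∉ K, α x = 0}
  zero_mem' := ⟨fun x₀ => by rw [chartRep_zero]; exact contDiffOn_const, ∅, isCompact_empty, empty_subset _, fun _ _ => rfl⟩
  add_mem' := by
    rintro α β ⟨hα, K, hK, hKV, hαK⟩ ⟨hβ, L, hL, hLV, hβL⟩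
    refine ⟨fun x₀ => (hα x₀).add (hβ x₀), K ∪ L, hK.union hL, union_subset hKV hLV, ?_⟩
    intro x hx
    rw [mem_union, not_or] at hx
    rw [Pi.add_apply, hαK x hx.1, hβL x hx.2, add_zero]
  smul_mem' := by
    rintro c α ⟨hα, K, hK, hKV, hαK⟩
    refine ⟨fun x₀ => (hα x₀).const_smul c, K, hK, hKV, ?_⟩
    intro x hx
    rw [Pi.smul_apply, hαK x hx, smul_zero]

/-- The compactly supported smooth functions on `V`, as `0`-forms, whose pullback to the
boundary of `M` vanishes. -/
def compactFormsBdry (V : Set M) : FormSubspace E M 0 :=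
  compactForms I 0 V ⊓
    { carrier := {α | ∀ x ∈ I.boundary M, α x = 0}
      zero_mem' := fun _ _ => rfl
      add_mem' := fun {α β} hα hβ x hx => by rw [Pi.add_apply, hα x hx, hβ x hx, add_zero]
      smul_mem' := fun c α hα x hx => by rw [Pi.smul_apply, hα x hx, smul_zero] }

variable {I}

variable [IsManifold I ∞ M]

/-- The coordinate expression of the exterior derivative in an arbitrary chart. -/
theorem chartRep_extD {k : ℕ} {α : M → E [⋀^Fin k]→L[ℝ] ℝ} (h : IsSmoothForm I α) {x₀ : M}
    {y : E} (hy : y ∈ (extChartAt I x₀).target) :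
    chartRep I (extD I α) x₀ y = extDerivWithin (chartRep I α x₀) (range I) y := by
  have : IsManifold I 1 M := IsManifold.of_le (m := 1) (n := ∞) (by simp)
  set x := (extChartAt I x₀).symm y with hx
  set T : E → E := extChartAt I x ∘ (extChartAt I x₀).symm with hT
  have hyr : y ∈ range I := extChartAt_target_subset_range x₀ hy
  have hTy : T y = extChartAt I x x := rfl
  have hsrc : y ∈ ((extChartAt I x₀).symm ≫ extChartAt I x).source := by
    simp only [PartialEquiv.trans_source, PartialEquiv.symm_source, mem_inter_iff, mem_preimage]
    exact ⟨hy, mem_extChartAt_source x⟩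
  have hTs : ContDiffWithinAt ℝ ∞ T (range I) y := by
    have := contDiffWithinAt_ext_coord_change (I := I) (n := ∞) x x₀ (y := y) hsrc
    exact this
  -- the change of coordinates near the point
  have key : ∀ z ∈ ((extChartAt I x₀).symm ≫ extChartAt I x).source,
      chartRep I α x₀ z =
        (chartRep I α x (T z)).compContinuousLinearMap (fderivWithin ℝ T (range I) z) := by
    intro z hz
    simp only [PartialEquiv.trans_source, PartialEquiv.symm_source, mem_inter_iff,
      mem_preimage] at hz
    obtain ⟨hz1, hz2⟩ := hz
    have hzr : z ∈ range I := extChartAt_target_subset_range x₀ hz1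
    have hzT : T z ∈ (extChartAt I x).target := (extChartAt I x).map_source hz2
    have hinv : (extChartAt I x).symm (T z) = (extChartAt I x₀).symm z :=
      (extChartAt I x).left_inv hz2
    have hTd : DifferentiableWithinAt ℝ T (range I) z := by
      have := contDiffWithinAt_ext_coord_change (I := I) (n := ∞) x x₀ (y := z) (by
        simp only [PartialEquiv.trans_source, PartialEquiv.symm_source, mem_inter_iff,
          mem_preimage]
        exact ⟨hz1, hz2⟩)
      exact this.differentiableWithinAt (by simp)
    have hcomp : mfderivWithin 𝓘(ℝ, E) I (extChartAt I x₀).symm (range I) z =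
        (mfderivWithin 𝓘(ℝ, E) I (extChartAt I x).symm (range I) (T z)).comp
          (mfderivWithin 𝓘(ℝ, E) 𝓘(ℝ, E) T (range I) z) := by
      rw [← mfderivWithin_comp z (mdifferentiableWithinAt_extChartAt_symm hzT)
        hTd.mdifferentiableWithinAt (fun w _ => by exact mem_range_self _)
        (I.uniqueMDiffOn z hzr)]
      symm
      apply Filter.EventuallyEq.mfderivWithin_eq
      · have hopen : ∀ᶠ w in 𝓝[range I] z, (extChartAt I x₀).symm w ∈ (extChartAt I x).source :=
          ((continuousOn_extChartAt_symm x₀ z hz1).mono_of_mem_nhdsWithin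
            (extChartAt_target_mem_nhdsWithin_of_mem hz1)).eventually
            ((isOpen_extChartAt_source x).mem_nhds hz2)
        filter_upwards [hopen] with w hw
        exact (extChartAt I x).left_inv hw
      · exact hinv
    rw [chartRep, chartRep, hinv, hcomp, mfderivWithin_eq_fderivWithin]
    rfl
  have hev : chartRep I α x₀ =ᶠ[𝓝[range I] y] fun z =>
      (chartRep I α x (T z)).compContinuousLinearMap (fderivWithin ℝ T (range I) z) := by
    have hmem : ((extChartAt I x₀).symm ≫ extChartAt I x).source ∈ 𝓝[range I] y := by
      have hopen : ∀ᶠ w in 𝓝[range I] y, (extChartAt I x₀).symm w ∈ (extChartAt I x).source :=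
        ((continuousOn_extChartAt_symm x₀ y hy).mono_of_mem_nhdsWithin
          (extChartAt_target_mem_nhdsWithin_of_mem hy)).eventually
          ((isOpen_extChartAt_source x).mem_nhds (mem_extChartAt_source x))
      filter_upwards [hopen, extChartAt_target_mem_nhdsWithin_of_mem hy] with w hw hw'
      simp only [PartialEquiv.trans_source, PartialEquiv.symm_source, mem_inter_iff, mem_preimage]
      exact ⟨hw', hw⟩
    filter_upwards [hmem] with z hz using key z hz
  rw [hev.extDerivWithin_eq_of_mem hyr]
  have hωd : DifferentiableWithinAt ℝ (chartRep I α x) (range I) (T y) := by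
    rw [hTy]
    exact (h.contDiffWithinAt (mem_extChartAt_target x)).differentiableWithinAt (by simp)
  rw [extDerivWithin_pullback (r := ∞) hωd hTs minSmoothness_two_le I.uniqueDiffOn
    (I.range_subset_closure_interior hyr) hyr (fun w _ => by exact mem_range_self _)]
  have hderiv : fderivWithin ℝ T (range I) y
      = mfderivWithin 𝓘(ℝ, E) I (extChartAt I x₀).symm (range I) y := by
    rw [← mfderivWithin_eq_fderivWithin]
    have h1 : mfderivWithin 𝓘(ℝ, E) 𝓘(ℝ, E) T (range I) y
        = (mfderiv I 𝓘(ℝ, E) (extChartAt I x) x).comp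
          (mfderivWithin 𝓘(ℝ, E) I (extChartAt I x₀).symm (range I) y) :=
      mfderiv_comp_mfderivWithin y
        (mdifferentiableAt_extChartAt (mem_chart_source H x))
        (mdifferentiableWithinAt_extChartAt_symm hy) (I.uniqueMDiffOn y hyr)
    rw [h1, mfderiv_extChartAt_self]
    rfl
  rw [hderiv, hTy]
  rfl

theorem IsSmoothForm.extD {k : ℕ} {α : M → E [⋀^Fin k]→L[ℝ] ℝ} (h : IsSmoothForm I α) :
    IsSmoothForm I (extD I α) := by
  intro x₀ y hy
  have h1 : ContDiffWithinAt ℝ ∞ (extDerivWithin (chartRep I α x₀) (range I)) (range I) y := by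
    have := (h.contDiffWithinAt hy).fderivWithin_right (m := ∞) I.uniqueDiffOn (by simp)
      (extChartAt_target_subset_range x₀ hy)
    exact (ContinuousAlternatingMap.alternatizeUncurryFinCLM ℝ E ℝ).contDiff.contDiffAt
      |>.comp_contDiffWithinAt y this
  exact (h1.mono (extChartAt_target_subset_range x₀)).congr
    (fun z hz => chartRep_extD h hz) (chartRep_extD h hy)

theorem extD_extD {k : ℕ} {α : M → E [⋀^Fin k]→L[ℝ] ℝ} (h : IsSmoothForm I α) :
    extD I (extD I α) = 0 := by
  funext x
  have hx := mem_extChartAt_target (I := I) x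
  have hr := extChartAt_target_subset_range x hx
  have hev : chartRep I (extD I α) x =ᶠ[𝓝[range I] (extChartAt I x x)]
      extDerivWithin (chartRep I α x) (range I) := by
    filter_upwards [extChartAt_target_mem_nhdsWithin_of_mem hx] with z hz
      using chartRep_extD h hz
  change extDerivWithin (chartRep I (extD I α) x) (range I) (extChartAt I x x) = 0
  rw [hev.extDerivWithin_eq_of_mem hr]
  exact extDerivWithin_extDerivWithin_apply (h.contDiffWithinAt hx) minSmoothness_two_le I.uniqueDiffOn
    (I.range_subset_closure_interior hr) hr

variable (I)

/-- The de Rham differential on compactly supported forms. -/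
def compactD [T2Space M] (k : ℕ) (V : Set M) :
    compactForms I k V →ₗ[ℝ] compactForms I (k + 1) V where
  toFun α := ⟨extD I α.1, α.2.1.extD, by
    obtain ⟨K, hK, hKV, h⟩ := α.2.2
    exact ⟨K, hK, hKV, fun x hx => extD_eq_zero hK.isClosed h hx⟩⟩
  map_add' α β := Subtype.ext (extD_add α.2.1 β.2.1)
  map_smul' c α := Subtype.ext (extD_smul c α.1)

end Forms

/-! Integration of top degree forms -/

noncomputable section Integration

variable {n : ℕ} {H : Type} [TopologicalSpace H]
  (I : ModelWithCorners ℝ (EuclideanSpace ℝ (Fin n)) H) (M : Type u) [TopologicalSpace M]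
  [ChartedSpace H M]

/-- The atlas of `M` is oriented: all transition maps have positive Jacobian determinant.
An oriented manifold is a manifold that is presented by such an atlas. -/
def IsOrientedAtlas : Prop :=
  ∀ c ∈ atlas H M, ∀ c' ∈ atlas H M, ∀ y ∈ ((c.extend I).symm ≫ c'.extend I).source,
    0 < (fderivWithin ℝ (c'.extend I ∘ (c.extend I).symm) (range I) y).det

variable {M}

/-- The integral over the chart domain at `x₀` of a top degree form. -/
def chartIntegral (x₀ : M)
    (α : M → EuclideanSpace ℝ (Fin n) [⋀^Fin n]→L[ℝ] ℝ) : ℝ :=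
  ∫ y in (extChartAt I x₀).target, chartRep I α x₀ y (fun i => EuclideanSpace.single i 1)

/-- The integral of a compactly supported smooth form of top degree over an oriented manifold,
by means of a partition of unity subordinate to the charts. -/
def integral [T2Space M] [SigmaCompactSpace M] [IsManifold I ∞ M]
    (α : M → EuclideanSpace ℝ (Fin n) [⋀^Fin n]→L[ℝ] ℝ) : ℝ :=
  let ρ := Classical.choose (SmoothPartitionOfUnity.exists_isSubordinate_chartAt_source I M)
  ∑ᶠ p : M, chartIntegral I p (fun x => ρ p x • α x)

end Integration

/-! Complexes concentrated in degrees `-1, 0, 1`, or in degree `0` -/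

noncomputable section SmallComplexes

variable {A B C : Type u} [AddCommGroup A] [Module ℝ A] [AddCommGroup B] [Module ℝ B]
  [AddCommGroup C] [Module ℝ C]

variable (A B C) in
/-- The grading of `A × B × C` with `A`, `B`, `C` in degrees `-1`, `0`, `1`. -/
def threeGr (i : ℤ) : Submodule ℝ (A × B × C) where
  carrier := {p | (i ≠ -1 → p.1 = 0) ∧ (i ≠ 0 → p.2.1 = 0) ∧ (i ≠ 1 → p.2.2 = 0)}
  zero_mem' := ⟨fun _ => rfl, fun _ => rfl, fun _ => rfl⟩
  add_mem' := by
    rintro p q ⟨h1, h2, h3⟩ ⟨k1, k2, k3⟩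
    refine ⟨fun h => ?_, fun h => ?_, fun h => ?_⟩
    · simp [h1 h, k1 h]
    · simp [h2 h, k2 h]
    · simp [h3 h, k3 h]
  smul_mem' := by
    rintro c p ⟨h1, h2, h3⟩
    refine ⟨fun h => ?_, fun h => ?_, fun h => ?_⟩
    · simp [h1 h]
    · simp [h2 h]
    · simp [h3 h]

/-- The inclusion of a summand. -/
def threeIncl₁ : A →ₗ[ℝ] threeGr A B C (-1) :=
  (LinearMap.inl ℝ A (B × C)).codRestrict _ fun _ =>
    ⟨fun h => absurd rfl h, fun _ => rfl, fun _ => rfl⟩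

/-- The inclusion of a summand. -/
def threeIncl₂ : B →ₗ[ℝ] threeGr A B C 0 :=
  (LinearMap.inr ℝ A (B × C) ∘ₗ LinearMap.inl ℝ B C).codRestrict _ fun _ =>
    ⟨fun _ => rfl, fun h => absurd rfl h, fun _ => rfl⟩

/-- The inclusion of a summand. -/
def threeIncl₃ : C →ₗ[ℝ] threeGr A B C 1 :=
  (LinearMap.inr ℝ A (B × C) ∘ₗ LinearMap.inr ℝ B C).codRestrict _ fun _ =>
    ⟨fun _ => rfl, fun _ => rfl, fun h => absurd rfl h⟩

/-- The decomposition into homogeneous components. -/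
def threeDecompose : A × B × C →ₗ[ℝ] ⨁ i, threeGr A B C i :=
  (DirectSum.lof ℝ ℤ (fun i => threeGr A B C i) (-1) ∘ₗ threeIncl₁).coprod
    ((DirectSum.lof ℝ ℤ (fun i => threeGr A B C i) 0 ∘ₗ threeIncl₂).coprod
      (DirectSum.lof ℝ ℤ (fun i => threeGr A B C i) 1 ∘ₗ threeIncl₃))

instance threeDecomposition : DirectSum.Decomposition (threeGr A B C) :=
  DirectSum.Decomposition.ofLinearMap _ threeDecompose
    (by
      apply LinearMap.ext
      rintro ⟨a, b, c⟩
      simp only [threeDecompose, LinearMap.comp_apply, LinearMap.coprod_apply, map_add,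
        DirectSum.coeLinearMap_lof, LinearMap.id_apply]
      have h1 : ((threeIncl₁ a : threeGr A B C (-1)) : A × B × C) = (a, 0, 0) := rfl
      have h2 : ((threeIncl₂ b : threeGr A B C 0) : A × B × C) = (0, b, 0) := rfl
      have h3 : ((threeIncl₃ c : threeGr A B C 1) : A × B × C) = (0, 0, c) := rfl
      rw [h1, h2, h3]
      simp)
    (by
      apply DirectSum.linearMap_ext
      intro i
      apply LinearMap.ext
      rintro ⟨⟨a, b, c⟩, h1, h2, h3⟩
      simp only [threeDecompose, LinearMap.comp_apply, LinearMap.coprod_apply,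
        DirectSum.coeLinearMap_lof, LinearMap.id_apply]
      simp only at h1 h2 h3
      by_cases hi : i = -1
      · subst hi
        obtain rfl := h2 (by decide)
        obtain rfl := h3 (by decide)
        simp only [map_zero, add_zero]
        rfl
      by_cases hi' : i = 0
      · subst hi'
        obtain rfl := h1 (by decide)
        obtain rfl := h3 (by decide)
        simp only [map_zero, add_zero, zero_add]
        rfl
      by_cases hi'' : i = 1
      · subst hi''
        obtain rfl := h1 (by decide)
        obtain rfl := h2 (by decide)
        simp only [map_zero, zero_add]
        rfl
      obtain rfl := h1 hi
      obtain rfl := h2 hi'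
      obtain rfl := h3 hi''
      simp only [map_zero, add_zero]
      symm
      exact map_zero _)

/-- The shift of the complex `A ⟶ B ⟶ C` to the degrees `-1`, `0`, `1`; the differential of the
shifted complex is the negative of the original one. -/
def threeTerm (d₀ : A →ₗ[ℝ] B) (d₁ : B →ₗ[ℝ] C) (h : ∀ a, d₁ (d₀ a) = 0) :
    CochainCpx.{u} ℝ where
  carrier := A × B × C
  gr := threeGr A B C
  d := LinearMap.prod 0 (LinearMap.prod (-(d₀ ∘ₗ LinearMap.fst ℝ A (B × C)))
    (-(d₁ ∘ₗ LinearMap.fst ℝ B C ∘ₗ LinearMap.snd ℝ A (B × C))))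
  d_mem := by
    rintro i ⟨a, b, c⟩ ⟨h1, h2, h3⟩
    simp only at h1 h2 h3
    refine ⟨fun _ => rfl, fun hi => ?_, fun hi => ?_⟩
    · obtain rfl := h1 (by omega)
      simp
    · obtain rfl := h2 (by omega)
      simp
  d_d := by
    rintro ⟨a, b, c⟩
    simp [h]

/-- The grading of `A` concentrated in degree `0`. -/
def oneGr (A : Type u) [AddCommGroup A] [Module ℝ A] (i : ℤ) : Submodule ℝ A :=
  if i = 0 then ⊤ else ⊥

theorem mem_oneGr_zero (a : A) : a ∈ oneGr A 0 := by simp [oneGr]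

theorem eq_zero_of_mem_oneGr {i : ℤ} (hi : i ≠ 0) {a : A} (h : a ∈ oneGr A i) : a = 0 := by
  simpa [oneGr, hi] using h

instance oneDecomposition : DirectSum.Decomposition (oneGr A) :=
  DirectSum.Decomposition.ofLinearMap _
    (DirectSum.lof ℝ ℤ (fun i => oneGr A i) 0 ∘ₗ LinearMap.id.codRestrict _ mem_oneGr_zero)
    (by
      apply LinearMap.ext
      intro a
      simp only [LinearMap.comp_apply, DirectSum.coeLinearMap_lof]
      rfl)
    (by
      apply DirectSum.linearMap_ext
      intro i
      apply LinearMap.ext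
      rintro ⟨a, ha⟩
      simp only [LinearMap.comp_apply, DirectSum.coeLinearMap_lof, LinearMap.id_apply]
      by_cases hi : i = 0
      · subst hi
        rfl
      · obtain rfl := eq_zero_of_mem_oneGr hi ha
        have h : (⟨0, ha⟩ : oneGr A i) = 0 := rfl
        rw [h, map_zero, map_zero, map_zero])

/-- The cochain complex given by `A` in degree `0`. -/
def oneTerm (A : Type u) [AddCommGroup A] [Module ℝ A] : CochainCpx.{u} ℝ where
  carrier := A
  gr := oneGr A
  d := 0
  d_mem := fun _ _ _ => Submodule.zero_mem _
  d_d := fun _ => rfl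

end SmallComplexes

/-! The surface `B` and its boundary `N` -/

noncomputable section Surface

/-- The category of non-empty open subsets of `X` and their inclusions. -/
abbrev NEOpens (X : Type u) [TopologicalSpace X] : Type u :=
  {V : TopologicalSpace.Opens X // (V : Set X).Nonempty}

/-- The tangent space of a surface. -/
abbrev E2 : Type := EuclideanSpace ℝ (Fin 2)

/-- The tangent space of a curve. -/
abbrev E1 : Type := EuclideanSpace ℝ (Fin 1)

/-- A linear functional as an alternating `1`-form. -/
def oneForm {E : Type v} [NormedAddCommGroup E] [NormedSpace ℝ E] (l : E →L[ℝ] ℝ) :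
    E [⋀^Fin 1]→L[ℝ] ℝ :=
  ContinuousAlternatingMap.ofSubsingleton ℝ E ℝ (0 : Fin 1) l

theorem oneForm_add {E : Type v} [NormedAddCommGroup E] [NormedSpace ℝ E] (l m : E →L[ℝ] ℝ) :
    oneForm (l + m) = oneForm l + oneForm m := rfl

theorem oneForm_smul {E : Type v} [NormedAddCommGroup E] [NormedSpace ℝ E] (c : ℝ)
    (l : E →L[ℝ] ℝ) : oneForm (c • l) = c • oneForm l := rfl

/-- The differential of a real-valued function at a point, as a functional on the model space
`E` (which is by definition the tangent space). -/
def dAt {E : Type v} [NormedAddCommGroup E] [NormedSpace ℝ E] {H : Type v} [TopologicalSpace H]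
    (I : ModelWithCorners ℝ E H) {M : Type u} [TopologicalSpace M] [ChartedSpace H M]
    (f : M → ℝ) (x : M) : E →L[ℝ] ℝ :=
  mfderiv I 𝓘(ℝ, ℝ) f x

/-- The wedge product of two `1`-forms, `(a ∧ b)(v, w) = a v * b w - a w * b v`. -/
def wedge {E : Type v} [NormedAddCommGroup E] [NormedSpace ℝ E] (a b : E [⋀^Fin 1]→L[ℝ] ℝ) :
    E [⋀^Fin 2]→L[ℝ] ℝ :=
  ContinuousAlternatingMap.alternatizeUncurryFin
    (((ContinuousAlternatingMap.ofSubsingleton ℝ E ℝ (0 : Fin 1)).symm a).smulRight b)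

variable (B : Type u) [TopologicalSpace B] [T2Space B] [SigmaCompactSpace B]
  [ChartedSpace (EuclideanHalfSpace 2) B] [IsManifold (𝓡∂ 2) ∞ B]

variable {B} in
/-- The complex of compactly supported forms on the open subset `V` of `B`,
`Ω⁰_{∂,c}(V) ⟶ Ω¹_c(V) ⟶ Ω²_c(V)`, in degrees `-1`, `0`, `1` and with differential `-d`. -/
def bulkCpx (V : Set B) : CochainCpx.{u} ℝ :=
  threeTerm (A := compactFormsBdry (𝓡∂ 2) V) (B := compactForms (𝓡∂ 2) 1 V)
    (C := compactForms (𝓡∂ 2) 2 V)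
    (compactD (𝓡∂ 2) 0 V ∘ₗ Submodule.inclusion inf_le_left)
    (compactD (𝓡∂ 2) 1 V)
    (fun a => Subtype.ext (extD_extD a.2.1.1))

variable {B} in
/-- The pairing `σ(α, α') = (-1)^|α| ∫ α ∧ α'` of `α = a + b + c` and `α' = a' + b' + c'`, where
`a, a'` are `0`-forms (with `|a| = -1`), `b, b'` are `1`-forms (with `|b| = 0`) and `c, c'` are
`2`-forms (with `|c| = 1`). -/
def formPairing (a : B → E2 [⋀^Fin 0]→L[ℝ] ℝ) (b : B → E2 [⋀^Fin 1]→L[ℝ] ℝ)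
    (c : B → E2 [⋀^Fin 2]→L[ℝ] ℝ) (a' : B → E2 [⋀^Fin 0]→L[ℝ] ℝ)
    (b' : B → E2 [⋀^Fin 1]→L[ℝ] ℝ) (c' : B → E2 [⋀^Fin 2]→L[ℝ] ℝ) : ℝ :=
  - integral (𝓡∂ 2) (fun x : B => (a x ![]) • c' x)
  + integral (𝓡∂ 2) (fun x : B => wedge (b x) (b' x))
  - integral (𝓡∂ 2) (fun x : B => (a' x ![]) • c x)

variable {B} in
/-- The pairing `σ` on the complex `bulkCpx V`. -/
def bulkPairing (V : Set B) (p q : (bulkCpx V).carrier) : ℝ :=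
  formPairing p.1.1 p.2.1.1 p.2.2.1 q.1.1 q.2.1.1 q.2.2.1

theorem compactForms_mono {k : ℕ} {V V' : Set B} (h : V ⊆ V') :
    compactForms (𝓡∂ 2) k V ≤ compactForms (𝓡∂ 2) k V' := by
  rintro α ⟨hα, K, hK, hKV, h0⟩
  exact ⟨hα, K, hK, hKV.trans h, h0⟩

variable {B}

/-- Extension by zero. -/
def bulkExt {V V' : Set B} (h : V ⊆ V') : CochainCpx.Hom (bulkCpx V) (bulkCpx V') where
  toLin := LinearMap.prodMap
    (Submodule.inclusion (inf_le_inf_right _ (compactForms_mono B h)))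
    (LinearMap.prodMap (Submodule.inclusion (compactForms_mono B h))
      (Submodule.inclusion (compactForms_mono B h)))
  map_gr := by
    rintro i ⟨a, b, c⟩ ⟨h1, h2, h3⟩
    simp only at h1 h2 h3
    refine ⟨fun hi => ?_, fun hi => ?_, fun hi => ?_⟩
    · rw [h1 hi]; rfl
    · rw [h2 hi]; rfl
    · rw [h3 hi]; rfl
  map_d := fun _ => rfl

theorem bulkPairing_ext {V V' : Set B} (h : V ⊆ V') (p q : (bulkCpx V).carrier) :
    bulkPairing V' ((bulkExt h).toLin p) ((bulkExt h).toLin q) = bulkPairing V p q := by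
  have h0 (p : (bulkCpx V).carrier) : ((bulkExt h).toLin p).1.1 = p.1.1 := rfl
  have h1 (p : (bulkCpx V).carrier) : ((bulkExt h).toLin p).2.1.1 = p.2.1.1 := rfl
  have h2 (p : (bulkCpx V).carrier) : ((bulkExt h).toLin p).2.2.1 = p.2.2.1 := rfl
  unfold bulkPairing
  rw [h0, h0, h1, h1, h2, h2]

/-- The functor `V ↦ (Ω_{∂,c}(V)[1], σ)`, given that these are Poisson cochain complexes. -/
def bulkPoisson (hσ : ∀ V : NEOpens B, IsPoisson (bulkCpx (V.1 : Set B)) (bulkPairing (V.1 : Set B))) :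
    CategoryTheory.Functor (NEOpens B) PoCh.{u} where
  obj V := ⟨bulkCpx (V.1 : Set B), bulkPairing (V.1 : Set B), hσ V⟩
  map f := ⟨bulkExt (CategoryTheory.leOfHom f), bulkPairing_ext (CategoryTheory.leOfHom f)⟩
  map_id _ := PoCh.Hom.ext (CochainCpx.Hom.ext (LinearMap.ext fun _ => rfl))
  map_comp _ _ := PoCh.Hom.ext (CochainCpx.Hom.ext (LinearMap.ext fun _ => rfl))

variable {N : Type u} [TopologicalSpace N] [T2Space N] [SigmaCompactSpace N]
  [ChartedSpace E1 N] [IsManifold (𝓡 1) ∞ N]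

/-- The space `Ω⁰_c(W)` of compactly supported smooth functions on the open subset `W` of `N`,
extended by zero. -/
def bdryFunctions (W : Set N) : Submodule ℝ (N → ℝ) where
  carrier := {φ | ContMDiff (𝓡 1) 𝓘(ℝ, ℝ) ∞ φ ∧
    ∃ K : Set N, IsCompact K ∧ K ⊆ W ∧ ∀ x ∉ K, φ x = 0}
  zero_mem' := ⟨contMDiff_const, ∅, isCompact_empty, empty_subset _, fun _ _ => rfl⟩
  add_mem' := by
    rintro α β ⟨hα, K, hK, hKV, hαK⟩ ⟨hβ, L, hL, hLV, hβL⟩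
    refine ⟨hα.add hβ, K ∪ L, hK.union hL, union_subset hKV hLV, ?_⟩
    intro x hx
    rw [mem_union, not_or] at hx
    rw [Pi.add_apply, hαK x hx.1, hβL x hx.2, add_zero]
  smul_mem' := by
    rintro c α ⟨hα, K, hK, hKV, hαK⟩
    refine ⟨(contMDiff_const (c := c)).mul hα, K, hK, hKV, ?_⟩
    intro x hx
    rw [Pi.smul_apply, hαK x hx, smul_zero]

/-- The complex `Ω⁰_c(W)` concentrated in degree `0`. -/
def bdryCpx (W : Set N) : CochainCpx.{u} ℝ := oneTerm (bdryFunctions W)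

/-- The pairing `υ(φ, ψ) = - ∫_W φ dψ`. -/
def bdryPairing (W : Set N) (φ ψ : (bdryCpx W).carrier) : ℝ :=
  - integral (𝓡 1) (fun x : N => φ.1 x • oneForm (dAt (𝓡 1) ψ.1 x))

theorem bdryFunctions_mono {W W' : Set N} (h : W ⊆ W') :
    bdryFunctions W ≤ bdryFunctions W' := by
  rintro α ⟨hα, K, hK, hKV, h0⟩
  exact ⟨hα, K, hK, hKV.trans h, h0⟩

/-- Extension by zero. -/
def bdryExt {W W' : Set N} (h : W ⊆ W') : CochainCpx.Hom (bdryCpx W) (bdryCpx W') where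
  toLin := Submodule.inclusion (bdryFunctions_mono h)
  map_gr := by
    intro i φ hφ
    by_cases hi : i = 0
    · subst hi
      exact mem_oneGr_zero _
    · rw [eq_zero_of_mem_oneGr hi hφ]
      exact Submodule.zero_mem _
  map_d := fun _ => rfl

theorem bdryPairing_ext {W W' : Set N} (h : W ⊆ W') (φ ψ : (bdryCpx W).carrier) :
    bdryPairing W' ((bdryExt h).toLin φ) ((bdryExt h).toLin ψ) = bdryPairing W φ ψ := rfl

/-- The functor `W ↦ (Ω⁰_c(W), υ)`, given that these are Poisson cochain complexes. -/
def bdryPoisson (hυ : ∀ W : NEOpens N,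
    IsPoisson (bdryCpx (W.1 : Set N)) (bdryPairing (W.1 : Set N))) :
    CategoryTheory.Functor (NEOpens N) PoCh.{u} where
  obj W := ⟨bdryCpx (W.1 : Set N), bdryPairing (W.1 : Set N), hυ W⟩
  map f := ⟨bdryExt (CategoryTheory.leOfHom f), bdryPairing_ext (CategoryTheory.leOfHom f)⟩
  map_id _ := PoCh.Hom.ext (CochainCpx.Hom.ext (LinearMap.ext fun _ => rfl))
  map_comp _ _ := PoCh.Hom.ext (CochainCpx.Hom.ext (LinearMap.ext fun _ => rfl))

variable (B N) in
/-- A collar of the boundary of `B`: a diffeomorphism from `N × [0,1)` onto an open subset of `B`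
which maps `N × {0}` onto the boundary of `B`. In particular it identifies the manifold `N`
with the boundary of `B`. -/
structure Collar where
  toPartialEquiv : PartialEquiv (N × ℝ) B
  source_eq : toPartialEquiv.source = univ ×ˢ Ico (0 : ℝ) 1
  open_target : IsOpen toPartialEquiv.target
  contMDiffOn : ContMDiffOn ((𝓡 1).prod 𝓘(ℝ, ℝ)) (𝓡∂ 2) ∞ toPartialEquiv
    (univ ×ˢ Ico (0 : ℝ) 1)
  contMDiffOn_symm : ContMDiffOn (𝓡∂ 2) ((𝓡 1).prod 𝓘(ℝ, ℝ)) ∞ toPartialEquiv.symm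
    toPartialEquiv.target
  boundary_eq : toPartialEquiv '' (univ ×ˢ {0}) = (𝓡∂ 2).boundary B

/-- A compactly supported `1`-form `ω = f dr` on `[0,1)` with unit integral. -/
structure UnitForm where
  f : ℝ → ℝ
  contDiffOn : ContDiffOn ℝ ∞ f (Ico 0 1)
  compact_support : ∃ b < (1 : ℝ), ∀ t ∈ Ico (0 : ℝ) 1, b < t → f t = 0
  integral_eq : ∫ t in (0 : ℝ)..1, f t = 1

namespace Collar

variable (e : Collar B N)

/-- The derivative of the collar map at `(p, r)`. -/
def deriv (p : N) (r : ℝ) : E1 × ℝ →L[ℝ] E2 :=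
  mfderivWithin ((𝓡 1).prod 𝓘(ℝ, ℝ)) (𝓡∂ 2) e.toPartialEquiv (univ ×ˢ Ico (0 : ℝ) 1) (p, r)

/-- The collar is compatible with the orientations: `(∂_r, v)` is a positively oriented basis at
every point of the collar if `v` is a positively oriented tangent vector of `N`. -/
def OrientationCompatible : Prop :=
  ∀ (p : N), ∀ r ∈ Ico (0 : ℝ) 1,
    0 < (Matrix.of ![fun i => e.deriv p r (0, 1) i,
      fun i => e.deriv p r (EuclideanSpace.single 0 1, 0) i]).det

/-- The open subset `W × [0,1)` of `B`. -/
def tube (W : Set N) : Set B := e.toPartialEquiv '' (W ×ˢ Ico (0 : ℝ) 1)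

theorem isOpen_tube {W : Set N} (hW : IsOpen W) : IsOpen (e.tube W) := by
  have h : e.tube W = e.toPartialEquiv.target ∩
      e.toPartialEquiv.symm ⁻¹' (W ×ˢ (univ : Set ℝ)) := by
    have h1 : W ×ˢ Ico (0 : ℝ) 1 = e.toPartialEquiv.source ∩ W ×ˢ (univ : Set ℝ) := by
      rw [e.source_eq, prod_inter_prod, univ_inter, inter_univ]
    rw [tube, h1, PartialEquiv.image_source_inter_eq']
  rw [h]
  exact e.contMDiffOn_symm.continuousOn.isOpen_inter_preimage e.open_target
    (hW.prod isOpen_univ)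

/-- The functor `W ↦ W × [0,1)`. -/
def functor : CategoryTheory.Functor (NEOpens N) (NEOpens B) :=
  Monotone.functor (f := fun W : NEOpens N =>
    (⟨⟨e.tube W.1, e.isOpen_tube W.1.isOpen⟩,
      (W.2.prod ⟨0, by simp⟩).image _⟩ : NEOpens B))
    fun _ _ h => image_mono (prod_mono h le_rfl)

/-- The coordinate `r` on the collar. -/
def rad (x : B) : ℝ := (e.toPartialEquiv.symm x).2

/-- The projection of the collar to `N`. -/
def base (x : B) : N := (e.toPartialEquiv.symm x).1

open Classical in
/-- The `1`-form `κ(φ) = ω ∧ φ - (∫_r^1 ω) dφ` on the collar, extended by zero. -/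
def kappaForm (om : UnitForm) (φ : N → ℝ) (x : B) : E2 [⋀^Fin 1]→L[ℝ] ℝ :=
  if x ∈ e.toPartialEquiv.target then
    oneForm ((om.f (e.rad x) * φ (e.base x)) • dAt (𝓡∂ 2) e.rad x
      - (∫ t in (e.rad x)..1, om.f t) • dAt (𝓡∂ 2) (fun y => φ (e.base y)) x)
  else 0

theorem mdifferentiableAt_comp_base {W : Set N} {φ : N → ℝ} (hφ : φ ∈ bdryFunctions W) {x : B}
    (hx : x ∈ e.toPartialEquiv.target) :
    MDifferentiableAt (𝓡∂ 2) 𝓘(ℝ, ℝ) (fun y => φ (e.base y)) x := by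
  have h1 := (e.contMDiffOn_symm.contMDiffAt (e.open_target.mem_nhds hx)).fst
  exact ((hφ.1.contMDiffAt).comp x h1).mdifferentiableAt (by simp)

theorem kappaForm_add (om : UnitForm) {W : Set N} {φ ψ : N → ℝ} (hφ : φ ∈ bdryFunctions W)
    (hψ : ψ ∈ bdryFunctions W) :
    e.kappaForm om (φ + ψ) = e.kappaForm om φ + e.kappaForm om ψ := by
  funext x
  rw [Pi.add_apply]
  by_cases hx : x ∈ e.toPartialEquiv.target
  · have h : dAt (𝓡∂ 2) (fun y => (φ + ψ) (e.base y)) x =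
        dAt (𝓡∂ 2) (fun y => φ (e.base y)) x + dAt (𝓡∂ 2) (fun y => ψ (e.base y)) x :=
      ((e.mdifferentiableAt_comp_base hφ hx).hasMFDerivAt.add
        (e.mdifferentiableAt_comp_base hψ hx).hasMFDerivAt).mfderiv
    simp only [kappaForm, hx, if_true]
    rw [h, ← oneForm_add, Pi.add_apply, mul_add, add_smul, smul_add]
    congr 1
    abel
  · simp [kappaForm, hx]

theorem kappaForm_smul (om : UnitForm) {W : Set N} (c : ℝ) {φ : N → ℝ}
    (hφ : φ ∈ bdryFunctions W) : e.kappaForm om (c • φ) = c • e.kappaForm om φ := by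
  funext x
  rw [Pi.smul_apply]
  by_cases hx : x ∈ e.toPartialEquiv.target
  · have h : dAt (𝓡∂ 2) (fun y => (c • φ) (e.base y)) x =
        c • dAt (𝓡∂ 2) (fun y => φ (e.base y)) x :=
      ((e.mdifferentiableAt_comp_base hφ hx).hasMFDerivAt.const_smul c).mfderiv
    simp only [kappaForm, hx, if_true]
    rw [h, Pi.smul_apply, smul_eq_mul, ← oneForm_smul, smul_sub,
      smul_comm c (∫ t in (e.rad x)..1, om.f t), smul_smul c, mul_left_comm]
  · simp [kappaForm, hx]

end Collar

end Surface

/-! The quantum field theories and the natural transformation between them -/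

noncomputable section Theories

open CategoryTheory

/-- Einstein causality for a functor from non-empty open subsets to dg `*`-algebras: observables
with disjoint localization commute, in the graded sense. -/
def EinsteinCausality {X : Type u} [TopologicalSpace X] (F : NEOpens X ⥤ DGStarAlg.{v}) : Prop :=
  ∀ (V₁ V₂ V : NEOpens X) (f₁ : V₁ ⟶ V) (f₂ : V₂ ⟶ V), Disjoint (V₁.1 : Set X) (V₂.1 : Set X) →
    ∀ (i j : ℤ) (a : (F.obj V₁).carrier) (b : (F.obj V₂).carrier),
      a ∈ (F.obj V₁).gr i → b ∈ (F.obj V₂).gr j →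
      DGStarAlg.Hom.toAlgHom (F.map f₁) a * DGStarAlg.Hom.toAlgHom (F.map f₂) b =
        ((i * j).negOnePow : ℤ) •
          (DGStarAlg.Hom.toAlgHom (F.map f₂) b * DGStarAlg.Hom.toAlgHom (F.map f₁) a)

variable {B : Type u} [TopologicalSpace B] [T2Space B] [SigmaCompactSpace B]
  [ChartedSpace (EuclideanHalfSpace 2) B] [IsManifold (𝓡∂ 2) ∞ B]
  {N : Type u} [TopologicalSpace N] [T2Space N] [SigmaCompactSpace N]
  [ChartedSpace E1 N] [IsManifold (𝓡 1) ∞ N]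

/-- The bulk theory `𝔅 = CCR(Ω_{∂,c}[1], σ)` on `B`. -/
def bulkTheory (hσ : ∀ V : NEOpens B, IsPoisson (bulkCpx (V.1 : Set B)) (bulkPairing (V.1 : Set B))) :
    NEOpens B ⥤ DGStarAlg.{u} :=
  bulkPoisson hσ ⋙ PoCh.CCR

/-- The chiral free boson `ℭ = CCR(Ω⁰_c, υ)` on `N`. -/
def bosonTheory (hυ : ∀ W : NEOpens N,
      IsPoisson (bdryCpx (W.1 : Set N)) (bdryPairing (W.1 : Set N))) :
    NEOpens N ⥤ DGStarAlg.{u} :=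
  bdryPoisson hυ ⋙ PoCh.CCR

namespace Collar

variable (e : Collar B N) (om : UnitForm)

theorem kappaForm_zero : e.kappaForm om 0 = 0 := by
  simpa using e.kappaForm_smul om 0 (zero_mem (bdryFunctions (univ : Set N)))

/-- The cochain map `κ : Ω⁰_c(W) ⟶ Ω_{∂,c}(W × [0,1))[1]`, given that its values are compactly
supported in `W × [0,1)`, smooth and closed. -/
def kappa {W : Set N}
    (hmem : ∀ φ ∈ bdryFunctions W, e.kappaForm om φ ∈ compactForms (𝓡∂ 2) 1 (e.tube W))
    (hd : ∀ φ ∈ bdryFunctions W, extD (𝓡∂ 2) (e.kappaForm om φ) = 0) :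
    CochainCpx.Hom (bdryCpx W) (bulkCpx (e.tube W)) where
  toLin :=
    { toFun := fun φ => (0, ⟨e.kappaForm om φ.1, hmem φ.1 φ.2⟩, 0)
      map_add' := fun φ ψ => Prod.ext (add_zero _).symm
        (Prod.ext (Subtype.ext (e.kappaForm_add om φ.2 ψ.2)) (add_zero _).symm)
      map_smul' := fun c φ => Prod.ext (smul_zero _).symm
        (Prod.ext (Subtype.ext (e.kappaForm_smul om c φ.2)) (smul_zero _).symm) }
  map_gr := by
    intro i φ hφ
    refine ⟨fun _ => rfl, fun hi => ?_, fun _ => rfl⟩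
    rw [eq_zero_of_mem_oneGr hi hφ]
    exact Subtype.ext (e.kappaForm_zero om)
  map_d := by
    intro φ
    refine Prod.ext ?_ (Prod.ext ?_ ?_)
    · rfl
    · have h : -(compactD (𝓡∂ 2) 0 (e.tube W) 0) = 0 := by rw [map_zero, neg_zero]
      have h' : (⟨e.kappaForm om 0, hmem 0 (zero_mem _)⟩ :
          compactForms (𝓡∂ 2) 1 (e.tube W)) = 0 := Subtype.ext (e.kappaForm_zero om)
      exact h'.trans h.symm
    · apply Subtype.ext
      change (0 : B → E2 [⋀^Fin 2]→L[ℝ] ℝ) = -extD (𝓡∂ 2) (e.kappaForm om φ.1)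
      rw [hd φ.1 φ.2, neg_zero]

/-- The natural transformation `κ` from `(Ω⁰_c, υ)` to the restriction of `(Ω_{∂,c}[1], σ)` to the
collar, given that it is compatible with the pairings. -/
def kappaNat
    (hσ : ∀ V : NEOpens B, IsPoisson (bulkCpx (V.1 : Set B)) (bulkPairing (V.1 : Set B)))
    (hυ : ∀ W : NEOpens N, IsPoisson (bdryCpx (W.1 : Set N)) (bdryPairing (W.1 : Set N)))
    (hmem : ∀ W : NEOpens N, ∀ φ ∈ bdryFunctions (W.1 : Set N),
      e.kappaForm om φ ∈ compactForms (𝓡∂ 2) 1 (e.tube W.1))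
    (hd : ∀ W : NEOpens N, ∀ φ ∈ bdryFunctions (W.1 : Set N),
      extD (𝓡∂ 2) (e.kappaForm om φ) = 0)
    (hτ : ∀ (W : NEOpens N) (φ ψ : (bdryCpx (W.1 : Set N)).carrier),
      bulkPairing (e.tube W.1) ((e.kappa om (hmem W) (hd W)).toLin φ)
        ((e.kappa om (hmem W) (hd W)).toLin ψ) = bdryPairing (W.1 : Set N) φ ψ) :
    bdryPoisson hυ ⟶ e.functor ⋙ bulkPoisson hσ where
  app W := (⟨e.kappa om (hmem W) (hd W), hτ W⟩ : PoCh.Hom _ _)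
  naturality _ _ _ := PoCh.Hom.ext (CochainCpx.Hom.ext (LinearMap.ext fun _ => rfl))

/-- The natural transformation `CCR(κ)` from the chiral free boson to the restriction of the bulk
theory to the collar. -/
def ccrKappa
    (hσ : ∀ V : NEOpens B, IsPoisson (bulkCpx (V.1 : Set B)) (bulkPairing (V.1 : Set B)))
    (hυ : ∀ W : NEOpens N, IsPoisson (bdryCpx (W.1 : Set N)) (bdryPairing (W.1 : Set N)))
    (hmem : ∀ W : NEOpens N, ∀ φ ∈ bdryFunctions (W.1 : Set N),
      e.kappaForm om φ ∈ compactForms (𝓡∂ 2) 1 (e.tube W.1))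
    (hd : ∀ W : NEOpens N, ∀ φ ∈ bdryFunctions (W.1 : Set N),
      extD (𝓡∂ 2) (e.kappaForm om φ) = 0)
    (hτ : ∀ (W : NEOpens N) (φ ψ : (bdryCpx (W.1 : Set N)).carrier),
      bulkPairing (e.tube W.1) ((e.kappa om (hmem W) (hd W)).toLin φ)
        ((e.kappa om (hmem W) (hd W)).toLin ψ) = bdryPairing (W.1 : Set N) φ ψ) :
    bosonTheory hυ ⟶ e.functor ⋙ bulkTheory hσ :=
  Functor.whiskerRight (e.kappaNat om hσ hυ hmem hd hτ) PoCh.CCR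

end Collar

end Theories

/-!
The proof has three independent ingredients.

*The pairings.* That `σ` and `υ` are Poisson structures is integration by parts: Stokes' theorem
for compactly supported forms (`integral_extD_surface`, `integral_extD_curve`) applied to a
product. On the surface there is no boundary term because functions in degree `-1` vanish on the
boundary. The pairings vanish on forms with disjoint supports, and therefore the corresponding
generators commute in the graded sense, which extends to all products
(`PoCh.ccrMap_graded_commute`); this is Einstein causality.

*The map `κ`.* The form `κ(φ)` is the differential of `-(∫_r^1 ω) φ` (`Collar.kappaForm_eq`), so
it is closed; it is not a coboundary of the complex, since this function restricts to `-φ` on the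
boundary. In collar coordinates `κ(φ) ∧ κ(ψ)` is a product of `(∫_r^1 ω) ω` and `-(φ ψ' - ψ φ')
dx`, and since the integral of the first factor is `1/2`, Fubini's theorem and integration by
parts on the boundary identify the two pairings (`Collar.bulkPairing_kappa`). Integration along
the fibres of the collar, starting beyond the support, proves the Poincaré lemma for compactly
supported forms on the tube: `2`-forms are exact (`Collar.exists_extD_eq`), and closed `1`-forms
are uniquely of the form `da + κ(φ)` with `a` vanishing on the boundary
(`Collar.exists_extD_add_kappaForm_eq`, `Collar.eq_zero_of_extD_add_kappaForm`). By linear algebra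
over a field, `κ` is then the inclusion of a deformation retract
(`Collar.nonempty_retraction_kappa`).

*The CCR-functor* sends inclusions of deformation retracts to weak equivalences
(`PoCh.isWeakEquiv_of_retraction`). Let `i : P ⟶ Q` have the retraction `r` and the homotopy `h`.
The retraction need not preserve the pairings, but the cochain complex underlying a CCR-algebra
does not depend on the pairing: if `C_v` is the derivation with `C_v w = (τ₁ - τ₂)(v, w)`, the
operators `v · + (i/2) C_v` on the algebra of `τ₂` satisfy the relations of `τ₁`, and applying
them to `1` gives an isomorphism of complexes (`PoCh.exists_reordering_equiv`). So the pairing of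
`Q` may be taken to be the pullback along `r`. Then `h` and `1 - i r` take values in the kernel of
this pairing and extend to derivations `H` and `N` with `N = [d, H]`
(`PoCh.exists_homotopy_derivations`). The number operator `N` counts the generators in the kernel
of `r`: it is diagonalizable with eigenvalues in `ℕ`, and its kernel is the image of the
CCR-algebra of `P`. On a given element, a finite product of operators `1 - N/b` with `b ≥ 1` is
therefore the projection to this image (`PoCh.exists_iterate_eq_retract`), and each factor
preserves the cohomology class of a cocycle because `N` is homotopic to zero.
-/

/-! ### Graded derivations of CCR-algebras -/

namespace PoCh

noncomputable section

variable {P : PoCh.{u}}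

/-- Induction over words in homogeneous generators. -/
theorem ccr_induction {p : P.CCRAlg → Prop} (zero : p 0) (add : ∀ a b, p a → p b → p (a + b))
    (smul : ∀ (c : ℂ) a, p a → p (c • a)) (one : p 1)
    (mul : ∀ (i : ℤ) v b, v ∈ P.cpx.gr i → p b → p (P.gen v * b)) (a : P.CCRAlg) : p a :=
  CochainCpx.hom_induction P.ccrGr zero
    (fun _ _ ha => ccrGr_induction (p := fun _ a => p a) (fun _ => zero)
      (fun _ => add) (fun _ => smul) one (fun i _ v b hv _ hb => mul i v b hv hb) ha) add a

/-- Linear maps on a CCR-algebra agree if they agree at `1` and satisfy the same recursion over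
words. -/
theorem linearMap_ext_words {T : Type v} [AddCommGroup T] [Module ℂ T] (f g : P.CCRAlg →ₗ[ℂ] T)
    (one : f 1 = g 1)
    (mul : ∀ (i : ℤ) v b, v ∈ P.cpx.gr i → f b = g b → f (P.gen v * b) = g (P.gen v * b)) :
    f = g :=
  LinearMap.ext fun a => ccr_induction (p := fun a => f a = g a) (by simp)
    (fun a b ha hb => by rw [map_add, map_add, ha, hb])
    (fun c a ha => by rw [map_smul, map_smul, ha]) one mul a

theorem sgn_zero : sgn 0 = 1 := by simp [sgn]

theorem sgn_neg (i : ℤ) : sgn (-i) = sgn i := by simp [sgn]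

/-- A map on generators which is compatible with the commutation relations extends to a graded
derivation of degree `k`: it is the off-diagonal entry of the algebra map
`a ↦ !![(-1)^(k|a|) a, D a; 0, a]`. -/
theorem exists_gradedDerivation (k : ℤ) (D₀ : P.cpx.carrier →ₛₗ[Complex.ofRealHom] P.CCRAlg)
    (h : ∀ (i j : ℤ) v w, v ∈ P.cpx.gr i → w ∈ P.cpx.gr j →
      D₀ v * P.gen w + sgn (k * i) • (P.gen v * D₀ w) =
        sgn (i * j) • (D₀ w * P.gen v + sgn (k * j) • (P.gen w * D₀ v))) :
    ∃ D : P.CCRAlg →ₗ[ℂ] P.CCRAlg, D 1 = 0 ∧ ∀ (i : ℤ) v b, v ∈ P.cpx.gr i →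
      D (P.gen v * b) = D₀ v * b + sgn (k * i) • (P.gen v * D b) := by
  let s : ℤ → ℤˣ := fun i => (k * i).negOnePow
  let f : P.cpx.carrier →ₛₗ[Complex.ofRealHom] Matrix (Fin 2) (Fin 2) P.CCRAlg :=
    { toFun := fun v => !![P.gen (CochainCpx.scale P.cpx.gr s v), D₀ v; 0, P.gen v]
      map_add' := fun v w => by ext a b; fin_cases a <;> fin_cases b <;> simp
      map_smul' := fun r v => by ext a b; fin_cases a <;> fin_cases b <;> simp }
  have hf : ∀ {i : ℤ} {v : P.cpx.carrier}, v ∈ P.cpx.gr i →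
      f v = !![sgn (k * i) • P.gen v, D₀ v; 0, P.gen v] := by
    intro i v hv
    change !![_, _; _, _] = _
    rw [gen_scale _ hv]
  let F : P.CCRAlg →ₐ[ℂ] Matrix (Fin 2) (Fin 2) P.CCRAlg := ccrLift f (by
    intro i j v w hv hw
    have h1 := P.gen_comm hv hw
    have h2 := h i j v w hv hw
    have h5 : sgn (k * i) * (sgn (k * j) * (P.τ v w : ℂ)) = P.τ v w := by
      by_cases hij : i + j = 0
      · rw [← mul_assoc, ← sgn_add, ← mul_add, hij]; simp [sgn]
      · rw [P.isPoisson.degree_zero i j v w hv hw hij]; simp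
    rw [hf hv, hf hw]
    rw [Algebra.algebraMap_eq_smul_one] at h1 ⊢
    ext a b
    fin_cases a <;> fin_cases b
    · simp only [Fin.zero_eta, Matrix.mul_apply, Fin.sum_univ_two, Matrix.add_apply,
        Matrix.smul_apply, Matrix.one_apply_eq]
      simp only [Matrix.of_apply, Matrix.cons_val_zero, Matrix.cons_val_one, Matrix.cons_val',
        Matrix.cons_val_fin_one, mul_zero, add_zero, smul_mul_assoc, mul_smul_comm, h1]
      have : Complex.I * (P.τ v w : ℂ)
          = sgn (k * i) * (sgn (k * j) * (Complex.I * (P.τ v w : ℂ))) := by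
        linear_combination (-Complex.I) * h5
      conv_rhs => rw [this]
      module
    · simp only [Fin.zero_eta, Fin.mk_one, Matrix.mul_apply, Fin.sum_univ_two, Matrix.add_apply,
        Matrix.smul_apply, Matrix.one_apply_ne (zero_ne_one (α := Fin 2))]
      simp only [Matrix.of_apply, Matrix.cons_val_zero, Matrix.cons_val_one, Matrix.cons_val',
        Matrix.cons_val_fin_one, add_zero, smul_mul_assoc, smul_zero]
      rw [add_comm, h2, add_comm]
    · simp [Matrix.mul_apply, Fin.sum_univ_two]
    · simp only [Fin.mk_one, Matrix.mul_apply, Fin.sum_univ_two, Matrix.add_apply,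
        Matrix.smul_apply, Matrix.one_apply_eq]
      simp only [Matrix.of_apply, Matrix.cons_val_zero, Matrix.cons_val_one, Matrix.cons_val',
        Matrix.cons_val_fin_one, zero_mul, zero_add, h1])
  have hF : ∀ v, F (P.gen v) = f v := fun v => ccrLift_gen _ _ v
  let D : P.CCRAlg →ₗ[ℂ] P.CCRAlg :=
    { toFun := fun a => F a 0 1
      map_add' := fun a b => by simp
      map_smul' := fun c a => by simp }
  let G : P.CCRAlg →ₗ[ℂ] P.CCRAlg :=
    { toFun := fun a => F a 1 1
      map_add' := fun a b => by simp
      map_smul' := fun c a => by simp }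
  have hG : G = LinearMap.id := by
    refine linearMap_ext_words _ _ ?_ fun i v b hv hb => ?_
    · change F 1 1 1 = 1
      simp
    · change F (P.gen v * b) 1 1 = P.gen v * b
      have hb' : F b 1 1 = b := hb
      rw [map_mul, hF, hf hv, Matrix.mul_apply, Fin.sum_univ_two, hb']
      simp
  refine ⟨D, ?_, fun i v b hv => ?_⟩
  · change F 1 0 1 = 0
    simp
  · have hb : F b 1 1 = b := LinearMap.congr_fun hG b
    change F (P.gen v * b) 0 1 = _ + _ • (P.gen v * F b 0 1)
    rw [map_mul, hF, hf hv, Matrix.mul_apply, Fin.sum_univ_two, hb]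
    simp [add_comm]

/-- A family of maps on the homogeneous components of a real graded module, with values in a
complex vector space, extends to the whole module. -/
theorem exists_lift_homogeneous {V : Type u} [AddCommGroup V] [Module ℝ V]
    (gr : ℤ → Submodule ℝ V) [DirectSum.Decomposition gr] {T : Type v} [AddCommGroup T] [Module ℂ T]
    (f : ∀ i, gr i → T) (hadd : ∀ i a b, f i (a + b) = f i a + f i b)
    (hsmul : ∀ i (r : ℝ) a, f i (r • a) = (r : ℂ) • f i a) :
    ∃ g : V →ₛₗ[Complex.ofRealHom] T, ∀ i (v : V) (hv : v ∈ gr i), g v = f i ⟨v, hv⟩ := by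
  let F : ∀ i, gr i →ₗ[ℝ] T := fun i =>
    { toFun := f i, map_add' := hadd i, map_smul' := fun r a => hsmul i r a }
  let g : V →ₗ[ℝ] T := DirectSum.toModule ℝ ℤ T F ∘ₗ
    (DirectSum.decomposeLinearEquiv gr).toLinearMap
  refine ⟨{ toFun := g, map_add' := g.map_add, map_smul' := fun r v => g.map_smul r v },
    fun i v hv => ?_⟩
  change g v = _
  simp only [g, LinearMap.comp_apply, LinearEquiv.coe_coe,
    DirectSum.decomposeLinearEquiv_apply, DirectSum.decompose_of_mem gr hv]
  erw [DirectSum.toModule_lof]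
  rfl

end

end PoCh

/-! ### Contractions and change of the pairing -/

theorem IsPoisson.sub {V : CochainCpx.{u} ℝ} {τ τ' : V.carrier → V.carrier → ℝ}
    (h : IsPoisson V τ) (h' : IsPoisson V τ') : IsPoisson V (fun v w => τ v w - τ' v w) where
  add_left v v' w := by rw [h.add_left, h'.add_left]; ring
  smul_left c v w := by rw [h.smul_left, h'.smul_left]; ring
  add_right v w w' := by rw [h.add_right, h'.add_right]; ring
  smul_right c v w := by rw [h.smul_right, h'.smul_right]; ring
  degree_zero i j v w hv hw hij := by
    rw [h.degree_zero i j v w hv hw hij, h'.degree_zero i j v w hv hw hij, sub_zero]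
  cochain i v w hv := by linear_combination h.cochain i v w hv - h'.cochain i v w hv
  antisymm i j v w hv hw := by
    rw [h.antisymm i j v w hv hw, h'.antisymm i j v w hv hw]; ring

namespace PoCh

noncomputable section

/-- A family of graded derivations of the CCR-algebra of `P`, depending linearly on `v`, with the
scalar values `δ(v, w)` on the generators `w`. -/
def IsContraction (P : PoCh.{u}) (δ : P.cpx.carrier → P.cpx.carrier → ℝ)
    (C : P.cpx.carrier →ₛₗ[Complex.ofRealHom] (P.CCRAlg →ₗ[ℂ] P.CCRAlg)) : Prop :=
  ∀ (k : ℤ) v, v ∈ P.cpx.gr k → C v 1 = 0 ∧ ∀ (i : ℤ) w b, w ∈ P.cpx.gr i →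
    C v (P.gen w * b) = (δ v w : ℂ) • b + sgn (k * i) • (P.gen w * C v b)

/-- Signs that depend on the degree in the same way cancel against a pairing of degree zero. -/
theorem sgn_mul_smul_of_degree {P : PoCh.{u}} {δ : P.cpx.carrier → P.cpx.carrier → ℝ}
    (hδ : IsPoisson P.cpx δ) {i j : ℤ} {v w : P.cpx.carrier} (hv : v ∈ P.cpx.gr i)
    (hw : w ∈ P.cpx.gr j) (n : ℤ) : sgn (n * i) * sgn (n * j) * (δ v w : ℂ) = δ v w := by
  by_cases hij : i + j = 0
  · rw [← sgn_add, ← mul_add, hij]; simp [sgn]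
  · rw [hδ.degree_zero i j v w hv hw hij]; simp

/-- The map `w ↦ δ(v, w)` extends to a graded derivation whatever the pairing of `P` is: graded
derivations annihilate the scalars in the commutation relations, and scalars commute with the
generators. -/
theorem exists_contraction (P : PoCh.{u}) {δ : P.cpx.carrier → P.cpx.carrier → ℝ}
    (hδ : IsPoisson P.cpx δ) : ∃ C, IsContraction P δ C := by
  have hex : ∀ (k : ℤ) (v : P.cpx.gr k), ∃ D : P.CCRAlg →ₗ[ℂ] P.CCRAlg, D 1 = 0 ∧
      ∀ (i : ℤ) w b, w ∈ P.cpx.gr i →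
        D (P.gen w * b) = (δ v w : ℂ) • b + sgn (k * i) • (P.gen w * D b) := by
    rintro k ⟨v, hv⟩
    let D₀ : P.cpx.carrier →ₛₗ[Complex.ofRealHom] P.CCRAlg :=
      { toFun := fun w => (δ v w : ℂ) • 1
        map_add' := fun w w' => by rw [hδ.add_right, Complex.ofReal_add, add_smul]
        map_smul' := fun r w => by
          rw [hδ.smul_right, Complex.ofReal_mul, mul_smul]; rfl }
    obtain ⟨D, h1, h2⟩ := exists_gradedDerivation k D₀ (by
      intro i j w w' hw hw'
      have hD : ∀ w, D₀ w = (δ v w : ℂ) • (1 : P.CCRAlg) := fun w => rfl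
      rw [hD, hD]
      simp only [smul_mul_assoc, mul_smul_comm, one_mul, mul_one, smul_add, smul_smul]
      have e1 := sgn_mul_smul_of_degree hδ hv hw j
      have e2 := sgn_mul_smul_of_degree hδ hv hw' i
      have s1 := sgn_mul_self (k * i)
      rw [mul_comm j k, mul_comm j i] at e1
      rw [mul_comm i k] at e2
      rw [add_comm]
      congr 1
      · congr 1
        linear_combination (-sgn (k * i)) * e2 + (sgn (i * j) * (δ v w' : ℂ)) * s1
      · congr 1
        linear_combination (-e1))
    refine ⟨D, h1, fun i w b hw => ?_⟩
    rw [h2 i w b hw]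
    change ((δ v w : ℂ) • (1 : P.CCRAlg)) * b + _ = _
    rw [smul_mul_assoc, one_mul]
  choose D hD1 hD2 using hex
  obtain ⟨C, hC⟩ := exists_lift_homogeneous P.cpx.gr D
    (fun k v v' => by
      refine linearMap_ext_words _ _ ?_ fun i w b hw hb => ?_
      · simp [hD1]
      · rw [LinearMap.add_apply] at hb ⊢
        rw [hD2 _ _ _ _ _ hw, hD2 _ _ _ _ _ hw, hD2 _ _ _ _ _ hw, hb, Submodule.coe_add,
          hδ.add_left, Complex.ofReal_add, mul_add]
        module)
    (fun k r v => by
      refine linearMap_ext_words _ _ ?_ fun i w b hw hb => ?_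
      · simp [hD1]
      · rw [LinearMap.smul_apply] at hb ⊢
        rw [hD2 _ _ _ _ _ hw, hD2 _ _ _ _ _ hw, hb, Submodule.coe_smul,
          hδ.smul_left, Complex.ofReal_mul, mul_smul_comm]
        module)
  refine ⟨C, fun k v hv => ?_⟩
  rw [hC k v hv]
  exact ⟨hD1 k ⟨v, hv⟩, fun i w b hw => hD2 k ⟨v, hv⟩ i w b hw⟩

namespace IsContraction

variable {P : PoCh.{u}} {δ : P.cpx.carrier → P.cpx.carrier → ℝ}
  {C : P.cpx.carrier →ₛₗ[Complex.ofRealHom] (P.CCRAlg →ₗ[ℂ] P.CCRAlg)}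

theorem apply_mem (hC : IsContraction P δ C) (hδ : IsPoisson P.cpx δ) {k : ℤ}
    {v : P.cpx.carrier} (hv : v ∈ P.cpx.gr k) {i : ℤ} {a : P.CCRAlg} (ha : a ∈ P.ccrGr i) :
    C v a ∈ P.ccrGr (k + i) := by
  refine ccrGr_induction (p := fun i a => C v a ∈ P.ccrGr (k + i))
    (fun i => ?_) (fun i a b ha hb => ?_) (fun i c a ha => ?_) ?_
    (fun i j w b hw hb ih => ?_) ha
  · rw [map_zero]; exact zero_mem _
  · rw [map_add]; exact add_mem ha hb
  · rw [map_smul]; exact Submodule.smul_mem _ _ ha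
  · rw [(hC k v hv).1]; exact zero_mem _
  · rw [(hC k v hv).2 i w b hw]
    refine add_mem ?_ (Submodule.smul_mem _ _ ?_)
    · by_cases h : k + i = 0
      · rw [← add_assoc, h, zero_add]
        exact Submodule.smul_mem _ _ hb
      · rw [hδ.degree_zero k i v w hv hw h]
        simp
    · rw [show k + (i + j) = i + (k + j) by ring]
      exact SetLike.mul_mem_graded (gen_mem hw) ih

/-- Contractions commute in the graded sense. -/
theorem comm (hC : IsContraction P δ C) (hδ : IsPoisson P.cpx δ) {j k : ℤ}
    {v w : P.cpx.carrier} (hv : v ∈ P.cpx.gr j) (hw : w ∈ P.cpx.gr k) (a : P.CCRAlg) :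
    C v (C w a) = sgn (j * k) • C w (C v a) := by
  have h : C v ∘ₗ C w = sgn (j * k) • (C w ∘ₗ C v) := by
    refine linearMap_ext_words _ _ ?_ fun i x b hx hb => ?_
    · simp [(hC j v hv).1, (hC k w hw).1]
    · simp only [LinearMap.comp_apply, LinearMap.smul_apply] at hb ⊢
      rw [(hC j v hv).2 i x b hx, (hC k w hw).2 i x b hx, map_add, map_add, map_smul, map_smul,
        map_smul, map_smul, (hC j v hv).2 i x _ hx, (hC k w hw).2 i x _ hx, hb]
      have e1 := sgn_mul_smul_of_degree hδ hv hx k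
      have e2 := sgn_mul_smul_of_degree hδ hw hx j
      have s1 := sgn_mul_self (j * k)
      rw [mul_comm k j] at e1
      simp only [smul_add, smul_smul, mul_smul_comm]
      have c1 : sgn (j * k) * (sgn (j * i) * (δ w x : ℂ)) = δ w x := by
        rw [← mul_assoc]; exact e2
      have c2 : sgn (k * i) * (δ v x : ℂ) = sgn (j * k) * (δ v x : ℂ) := by
        linear_combination sgn (j * k) * e1 - sgn (k * i) * (δ v x : ℂ) * s1
      rw [c2, c1]
      module
  exact LinearMap.congr_fun h a

/-- The graded commutator of the differential with the contraction by `v` is the contraction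
by `d v`. -/
theorem ccrD_comm (hC : IsContraction P δ C) (hδ : IsPoisson P.cpx δ) {k : ℤ}
    {v : P.cpx.carrier} (hv : v ∈ P.cpx.gr k) (a : P.CCRAlg) :
    ccrD (C v a) = C (P.cpx.d v) a + sgn k • C v (ccrD a) := by
  have hdv := P.cpx.d_mem k v hv
  have h : ccrD ∘ₗ C v = C (P.cpx.d v) + sgn k • (C v ∘ₗ ccrD) := by
    refine linearMap_ext_words _ _ ?_ fun i x b hx hb => ?_
    · simp [(hC k v hv).1, (hC (k + 1) _ hdv).1, ccrD_one]
    · simp only [LinearMap.comp_apply, LinearMap.smul_apply, LinearMap.add_apply] at hb ⊢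
      have hdx := P.cpx.d_mem i x hx
      have e1 : (δ (P.cpx.d v) x : ℂ) + sgn k * (δ v (P.cpx.d x) : ℂ) = 0 := by
        have h := congrArg Complex.ofReal (hδ.cochain k v x hv)
        rw [Complex.ofReal_add, Complex.ofReal_mul, Complex.ofReal_intCast,
          Complex.ofReal_zero] at h
        exact h
      have e2 := sgn_mul_smul_of_degree hδ hv hx 1
      rw [one_mul, one_mul] at e2
      have s1 : sgn ((k + 1) * i) = sgn (k * i) * sgn i := by rw [← sgn_add]; ring_nf
      have s2 : sgn k * sgn (k * (i + 1)) = sgn (k * i) := by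
        rw [mul_add, mul_one, sgn_add, mul_comm, mul_assoc, sgn_mul_self, mul_one]
      rw [(hC k v hv).2 i x b hx, ccrD_mul (gen_mem hx), ccrD_gen, (hC (k + 1) _ hdv).2 i x b hx,
        map_add, map_add, map_smul, map_smul, map_smul, ccrD_mul (gen_mem hx), ccrD_gen,
        (hC k v hv).2 (i + 1) _ b hdx, (hC k v hv).2 i x _ hx, hb, s1]
      generalize sgn (k * (i + 1)) = z at *
      simp only [smul_add, smul_smul, mul_add, mul_smul_comm]
      rw [s2]
      have c1 : (δ (P.cpx.d v) x : ℂ) = - (sgn k * (δ v (P.cpx.d x) : ℂ)) := by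
        linear_combination e1
      rw [c1, ← mul_assoc (sgn k) (sgn i), e2]
      module
  exact LinearMap.congr_fun h a

end IsContraction

section ChangePairing

variable {V : CochainCpx.{u} ℝ} {τ₁ τ₂ : V.carrier → V.carrier → ℝ}
  {h₁ : IsPoisson V τ₁} {h₂ : IsPoisson V τ₂}

/-- A linear map between the CCR-algebras of two pairings on the same complex that intertwines the
product with `v` in the first algebra and the operator `v · + (i/2) C_v` on the second one. -/
def IsReordering (C : V.carrier →ₛₗ[Complex.ofRealHom]
      ((mk V τ₂ h₂).CCRAlg →ₗ[ℂ] (mk V τ₂ h₂).CCRAlg))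
    (Φ : (mk V τ₁ h₁).CCRAlg →ₗ[ℂ] (mk V τ₂ h₂).CCRAlg) : Prop :=
  Φ 1 = 1 ∧ ∀ v b, Φ ((mk V τ₁ h₁).gen v * b) =
    (mk V τ₂ h₂).gen v * Φ b + (Complex.I / 2) • C v (Φ b)

/-- The operators `v · + (i/2) C_v` on the CCR-algebra of `τ₂` satisfy the commutation relations
of `τ₁` if `C` is the contraction with `τ₁ - τ₂`. -/
theorem exists_reordering {C : V.carrier →ₛₗ[Complex.ofRealHom]
      ((mk V τ₂ h₂).CCRAlg →ₗ[ℂ] (mk V τ₂ h₂).CCRAlg)}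
    (hC : IsContraction (mk V τ₂ h₂) (fun v w => τ₁ v w - τ₂ v w) C) :
    ∃ Φ : (mk V τ₁ h₁).CCRAlg →ₗ[ℂ] (mk V τ₂ h₂).CCRAlg, IsReordering C Φ := by
  have hδ : IsPoisson (mk V τ₂ h₂).cpx (fun v w => τ₁ v w - τ₂ v w) := h₁.sub h₂
  let f : V.carrier →ₛₗ[Complex.ofRealHom] Module.End ℂ (mk V τ₂ h₂).CCRAlg :=
    { toFun := fun v => LinearMap.mulLeft ℂ ((mk V τ₂ h₂).gen v) + (Complex.I / 2) • C v
      map_add' := fun v w => by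
        ext b
        simp only [map_add, LinearMap.add_apply, LinearMap.smul_apply, LinearMap.mulLeft_apply,
          add_mul, smul_add]
        abel
      map_smul' := fun r v => by
        ext b
        simp only [map_smulₛₗ, LinearMap.add_apply, LinearMap.smul_apply,
          LinearMap.mulLeft_apply, smul_add, smul_mul_assoc]
        rw [smul_comm (Complex.I / 2)] }
  have hf : ∀ v b, f v b = (mk V τ₂ h₂).gen v * b + (Complex.I / 2) • C v b := fun v b => rfl
  let F : (mk V τ₁ h₁).CCRAlg →ₐ[ℂ] Module.End ℂ (mk V τ₂ h₂).CCRAlg :=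
    ccrLift (P := mk V τ₁ h₁) f (by
      intro i j v w hv hw
      refine LinearMap.ext fun b => ?_
      have h1 := congrArg (· * b) ((mk V τ₂ h₂).gen_comm (v := v) (w := w) hv hw)
      have h3 := hC.comm hδ hv hw b
      have h4 : ((τ₁ w v - τ₂ w v : ℝ) : ℂ) = - (sgn (i * j) * ((τ₁ v w - τ₂ v w : ℝ) : ℂ)) := by
        have h := congrArg Complex.ofReal (hδ.antisymm j i w v hw hv)
        rw [Complex.ofReal_neg, Complex.ofReal_mul, Complex.ofReal_intCast, mul_comm j i] at h
        exact h
      have s1 := sgn_mul_self (i * j)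
      simp only [add_mul, smul_mul_assoc, mul_assoc, Algebra.algebraMap_eq_smul_one,
        one_mul] at h1
      rw [Algebra.algebraMap_eq_smul_one]
      simp only [Module.End.mul_apply, LinearMap.add_apply, LinearMap.smul_apply,
        Module.End.one_apply, hf, map_add, map_smul, mul_add, mul_smul_comm]
      rw [(hC i v hv).2 j w _ hw, (hC j w hw).2 i v _ hv, h1, h3, mul_comm j i]
      have h4' : ((τ₁ w v : ℂ) - (τ₂ w v : ℂ)) = - (sgn (i * j) * ((τ₁ v w : ℂ) - τ₂ v w)) := by
        exact_mod_cast h4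
      have h6 : (τ₁ v w : ℂ) = τ₂ v w + ((τ₁ v w : ℂ) - τ₂ v w) := by ring
      simp only [Complex.ofReal_sub]
      rw [h4', show ((mk V τ₁ h₁).τ v w : ℂ) = (τ₁ v w : ℂ) from rfl,
        show ((mk V τ₂ h₂).τ v w : ℂ) = (τ₂ v w : ℂ) from rfl]
      match_scalars <;> first
        | ring1
        | linear_combination (Complex.I / 2 * (τ₁ v w - τ₂ v w)) * s1
        | linear_combination (Complex.I / 2) * s1
        | linear_combination (-(Complex.I / 2)) * s1)
  refine ⟨(LinearMap.applyₗ (1 : (mk V τ₂ h₂).CCRAlg)) ∘ₗ F.toLinearMap, ?_, fun v b => ?_⟩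
  · exact LinearMap.congr_fun (map_one F) 1
  · change F (_ * b) 1 = _ * F b 1 + _ • C v (F b 1)
    rw [map_mul, show F ((mk V τ₁ h₁).gen v) = f v from ccrLift_gen _ _ v]
    rfl

end ChangePairing

end

end PoCh

/-! ### Independence of the pairing -/

namespace PoCh

noncomputable section

section ChangePairing

variable {V : CochainCpx.{u} ℝ} {τ₁ τ₂ : V.carrier → V.carrier → ℝ}
  {h₁ : IsPoisson V τ₁} {h₂ : IsPoisson V τ₂}
  {C₂ : V.carrier →ₛₗ[Complex.ofRealHom] ((mk V τ₂ h₂).CCRAlg →ₗ[ℂ] (mk V τ₂ h₂).CCRAlg)}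
  {C₁ : V.carrier →ₛₗ[Complex.ofRealHom] ((mk V τ₁ h₁).CCRAlg →ₗ[ℂ] (mk V τ₁ h₁).CCRAlg)}
  {Φ : (mk V τ₁ h₁).CCRAlg →ₗ[ℂ] (mk V τ₂ h₂).CCRAlg}
  {Ψ : (mk V τ₂ h₂).CCRAlg →ₗ[ℂ] (mk V τ₁ h₁).CCRAlg}

namespace IsReordering

theorem apply_mem (hC : IsContraction (mk V τ₂ h₂) (fun v w => τ₁ v w - τ₂ v w) C₂)
    (hΦ : IsReordering C₂ Φ) {i : ℤ} {a : (mk V τ₁ h₁).CCRAlg}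
    (ha : a ∈ (mk V τ₁ h₁).ccrGr i) : Φ a ∈ (mk V τ₂ h₂).ccrGr i := by
  refine ccrGr_induction (p := fun i a => Φ a ∈ (mk V τ₂ h₂).ccrGr i)
    (fun i => ?_) (fun i a b ha hb => ?_) (fun i c a ha => ?_) ?_
    (fun i j w b hw hb ih => ?_) ha
  · rw [map_zero]; exact zero_mem _
  · rw [map_add]; exact add_mem ha hb
  · rw [map_smul]; exact Submodule.smul_mem _ _ ha
  · rw [hΦ.1]; exact SetLike.GradedOne.one_mem
  · rw [hΦ.2]
    exact add_mem (SetLike.mul_mem_graded (gen_mem (P := mk V τ₂ h₂) hw) ih)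
      (Submodule.smul_mem _ _ (hC.apply_mem (h₁.sub h₂) hw ih))

theorem map_ccrD (hC : IsContraction (mk V τ₂ h₂) (fun v w => τ₁ v w - τ₂ v w) C₂)
    (hΦ : IsReordering C₂ Φ) (a : (mk V τ₁ h₁).CCRAlg) : Φ (ccrD a) = ccrD (Φ a) := by
  have h : Φ ∘ₗ ccrD = ccrD ∘ₗ Φ := by
    refine linearMap_ext_words _ _ ?_ fun i v b hv hb => ?_
    · simp [ccrD_one, hΦ.1]
    · simp only [LinearMap.comp_apply] at hb ⊢
      rw [ccrD_mul (gen_mem hv), ccrD_gen, map_add, map_smul, hΦ.2, hΦ.2, hΦ.2, map_add, map_smul,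
        ccrD_mul (gen_mem (P := mk V τ₂ h₂) hv), ccrD_gen,
        hC.ccrD_comm (h₁.sub h₂) hv, hb]
      module
  exact LinearMap.congr_fun h a

/-- A reordering from the CCR-algebra of `τ₂` to that of `τ₁` intertwines the contractions with
`τ₁ - τ₂` on both algebras. -/
theorem map_contraction (hC₂ : IsContraction (mk V τ₂ h₂) (fun v w => τ₁ v w - τ₂ v w) C₂)
    (hC₁ : IsContraction (mk V τ₁ h₁) (fun v w => τ₂ v w - τ₁ v w) C₁)
    (hΨ : IsReordering C₁ Ψ) {k : ℤ} {v : V.carrier} (hv : v ∈ V.gr k)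
    (a : (mk V τ₂ h₂).CCRAlg) : Ψ (C₂ v a) = - C₁ v (Ψ a) := by
  have h : Ψ ∘ₗ C₂ v = - (C₁ v ∘ₗ Ψ) := by
    refine linearMap_ext_words _ _ ?_ fun i w b hw hb => ?_
    · simp [(hC₂ k v hv).1, (hC₁ k v hv).1, hΨ.1]
    · simp only [LinearMap.comp_apply, LinearMap.neg_apply] at hb ⊢
      rw [(hC₂ k v hv).2 i w b hw, map_add, map_smul, map_smul, hΨ.2, hΨ.2, hb, map_add, map_smul,
        (hC₁ k v hv).2 i w _ hw, hC₁.comm (h₂.sub h₁) hv hw, map_neg]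
      simp only [Complex.ofReal_sub, mul_neg]
      module
  exact LinearMap.congr_fun h a

theorem leftInverse (hC₂ : IsContraction (mk V τ₂ h₂) (fun v w => τ₁ v w - τ₂ v w) C₂)
    (hC₁ : IsContraction (mk V τ₁ h₁) (fun v w => τ₂ v w - τ₁ v w) C₁)
    (hΦ : IsReordering C₂ Φ) (hΨ : IsReordering C₁ Ψ) (a : (mk V τ₁ h₁).CCRAlg) :
    Ψ (Φ a) = a := by
  have h : Ψ ∘ₗ Φ = LinearMap.id := by
    refine linearMap_ext_words _ _ ?_ fun i v b hv hb => ?_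
    · simp [hΦ.1, hΨ.1]
    · simp only [LinearMap.comp_apply, LinearMap.id_apply] at hb ⊢
      rw [hΦ.2, map_add, map_smul, hΨ.2, map_contraction hC₂ hC₁ hΨ hv, hb]
      module
  exact LinearMap.congr_fun h a

end IsReordering

variable (h₁ h₂) in
/-- Changing the pairing does not change the cochain complex underlying the CCR-algebra, up to an
isomorphism. It is the identity on products of generators from a set on which the two pairings
agree. -/
theorem exists_reordering_equiv :
    ∃ (Φ : (mk V τ₁ h₁).CCRAlg →ₗ[ℂ] (mk V τ₂ h₂).CCRAlg)
      (Ψ : (mk V τ₂ h₂).CCRAlg →ₗ[ℂ] (mk V τ₁ h₁).CCRAlg),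
      (∀ a, Ψ (Φ a) = a) ∧ (∀ a, Φ (Ψ a) = a) ∧
      (∀ a, Φ (ccrD a) = ccrD (Φ a)) ∧ (∀ a, Ψ (ccrD a) = ccrD (Ψ a)) ∧
      (∀ i, ∀ a ∈ (mk V τ₁ h₁).ccrGr i, Φ a ∈ (mk V τ₂ h₂).ccrGr i) ∧
      (∀ i, ∀ a ∈ (mk V τ₂ h₂).ccrGr i, Ψ a ∈ (mk V τ₁ h₁).ccrGr i) ∧
      ∀ (P : PoCh.{u}) (f : PoCh.Hom P (mk V τ₁ h₁)) (g : PoCh.Hom P (mk V τ₂ h₂)),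
        f.toHom.toLin = g.toHom.toLin → ∀ a, Φ (ccrMap f a) = ccrMap g a := by
  obtain ⟨C₂, hC₂⟩ := exists_contraction (mk V τ₂ h₂) (h₁.sub h₂)
  obtain ⟨C₁, hC₁⟩ := exists_contraction (mk V τ₁ h₁) (h₂.sub h₁)
  obtain ⟨Φ, hΦ⟩ := exists_reordering (h₁ := h₁) hC₂
  obtain ⟨Ψ, hΨ⟩ := exists_reordering (h₁ := h₂) hC₁
  refine ⟨Φ, Ψ, hΦ.leftInverse hC₂ hC₁ hΨ, hΨ.leftInverse hC₁ hC₂ hΦ, hΦ.map_ccrD hC₂,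
    hΨ.map_ccrD hC₁, fun i a ha => hΦ.apply_mem hC₂ ha, fun i a ha => hΨ.apply_mem hC₁ ha,
    fun P f g hfg => ?_⟩
  have hτ : ∀ v w, τ₁ (g.toHom.toLin v) (g.toHom.toLin w) =
      τ₂ (g.toHom.toLin v) (g.toHom.toLin w) := by
    intro v w
    have h1 := f.map_τ v w
    rw [hfg] at h1
    exact h1.trans (g.map_τ v w).symm
  -- the contraction with a vanishing difference of pairings is zero
  have hvan : ∀ (k : ℤ) v, v ∈ P.cpx.gr k →
      C₂ (g.toHom.toLin v) ∘ₗ (ccrMap g).toLinearMap = 0 := by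
    intro k v hv
    have hv' := g.toHom.map_gr k v hv
    refine linearMap_ext_words _ _ ?_ fun i w b hw hb => ?_
    · simp [(hC₂ k _ hv').1]
    · simp only [LinearMap.comp_apply, AlgHom.toLinearMap_apply, LinearMap.zero_apply] at hb ⊢
      rw [map_mul, ccrMap_gen, (hC₂ k _ hv').2 i _ _ (g.toHom.map_gr i w hw), hb]
      simp [hτ]
  have h : Φ ∘ₗ (ccrMap f).toLinearMap = (ccrMap g).toLinearMap := by
    refine linearMap_ext_words _ _ ?_ fun i v b hv hb => ?_
    · simp [hΦ.1]
    · simp only [LinearMap.comp_apply, AlgHom.toLinearMap_apply] at hb ⊢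
      have h0 : C₂ (g.toHom.toLin v) (ccrMap g b) = 0 := LinearMap.congr_fun (hvan i v hv) b
      rw [map_mul (ccrMap f), map_mul (ccrMap g), ccrMap_gen, ccrMap_gen, hΦ.2, hb, hfg]
      erw [h0]
      rw [smul_zero, add_zero]
  exact fun a => LinearMap.congr_fun h a

end ChangePairing

end

end PoCh

/-! ### Deformation retracts and the CCR-functor -/

namespace CochainCpx

variable {k : Type} [CommRing k]

/-- A cochain map `i : P ⟶ Q` is the inclusion of a deformation retract: there are a cochain map
`r` and a homotopy `h` with `r i = 1`, `d h + h d = 1 - i r` and `r h = 0`. -/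
structure Retraction {P : CochainCpx.{u} k} {Q : CochainCpx.{v} k} (i : Hom P Q) where
  r : Hom Q P
  h : Q.carrier →ₗ[k] Q.carrier
  h_mem : ∀ (j : ℤ) (v : Q.carrier), v ∈ Q.gr j → h v ∈ Q.gr (j - 1)
  r_i : ∀ v, r.toLin (i.toLin v) = v
  r_h : ∀ v, r.toLin (h v) = 0
  homotopy : ∀ v, Q.d (h v) + h (Q.d v) = v - i.toLin (r.toLin v)

/-- A criterion for quasi-isomorphisms in terms of representing cocycles: injectivity and
surjectivity on cohomology. -/
theorem Hom.isQuasiIso_of_cocycles {P : CochainCpx.{u} k} {Q : CochainCpx.{v} k} {i : Hom P Q}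
    (hinj : ∀ (j : ℤ) (v : P.carrier) (y : Q.carrier), v ∈ P.gr j → P.d v = 0 →
      y ∈ Q.gr (j - 1) → Q.d y = i.toLin v → ∃ x ∈ P.gr (j - 1), P.d x = v)
    (hsurj : ∀ (j : ℤ) (w : Q.carrier), w ∈ Q.gr j → Q.d w = 0 →
      ∃ v ∈ P.gr j, P.d v = 0 ∧ ∃ y ∈ Q.gr (j - 1), Q.d y = i.toLin v - w) : i.IsQuasiIso := by
  intro j
  constructor
  · rw [injective_iff_map_eq_zero]
    intro x hx
    obtain ⟨⟨v, hv, hdv⟩, rfl⟩ := Submodule.Quotient.mk_surjective _ x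
    have h : (i.cocyclesMap j ⟨v, hv, hdv⟩) ∈ Q.coboundaries j := by
      rw [← Submodule.Quotient.mk_eq_zero]; exact hx
    obtain ⟨y, hy, hyv⟩ := h
    obtain ⟨x, hx, hxv⟩ := hinj j v y hv hdv hy hyv
    rw [Submodule.Quotient.mk_eq_zero]
    exact ⟨x, hx, hxv⟩
  · intro x
    obtain ⟨⟨w, hw, hdw⟩, rfl⟩ := Submodule.Quotient.mk_surjective _ x
    obtain ⟨v, hv, hdv, y, hy, hyw⟩ := hsurj j w hw hdw
    refine ⟨Submodule.Quotient.mk ⟨v, hv, hdv⟩, ?_⟩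
    refine (Submodule.Quotient.eq _).2 ?_
    exact ⟨y, hy, hyw⟩

theorem Retraction.isQuasiIso {P : CochainCpx.{u} k} {Q : CochainCpx.{v} k} {i : Hom P Q}
    (R : Retraction i) : i.IsQuasiIso := by
  refine Hom.isQuasiIso_of_cocycles (fun j v y hv _ hy h => ?_) (fun j w hw hdw => ?_)
  · refine ⟨R.r.toLin y, R.r.map_gr _ _ hy, ?_⟩
    rw [← R.r.map_d, h, R.r_i]
  · refine ⟨R.r.toLin w, R.r.map_gr _ _ hw, ?_, -R.h w, neg_mem (R.h_mem j w hw), ?_⟩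
    · rw [← R.r.map_d, hdw, map_zero]
    · have := R.homotopy w
      rw [hdw, map_zero, add_zero] at this
      rw [map_neg, this, neg_sub]

end CochainCpx

namespace IsPoisson

/-- The pullback of a Poisson structure along a cochain map. -/
theorem comap {P Q : CochainCpx.{u} ℝ} {τ : P.carrier → P.carrier → ℝ} (h : IsPoisson P τ)
    (r : CochainCpx.Hom Q P) : IsPoisson Q (fun v w => τ (r.toLin v) (r.toLin w)) where
  add_left v v' w := by rw [map_add, h.add_left]
  smul_left c v w := by rw [map_smul, h.smul_left]
  add_right v w w' := by rw [map_add, h.add_right]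
  smul_right c v w := by rw [map_smul, h.smul_right]
  degree_zero i j v w hv hw hij :=
    h.degree_zero i j _ _ (r.map_gr i v hv) (r.map_gr j w hw) hij
  cochain i v w hv := by rw [r.map_d, r.map_d]; exact h.cochain i _ _ (r.map_gr i v hv)
  antisymm i j v w hv hw := h.antisymm i j _ _ (r.map_gr i v hv) (r.map_gr j w hw)

theorem zero_left {V : CochainCpx.{u} ℝ} {τ : V.carrier → V.carrier → ℝ} (h : IsPoisson V τ)
    (w : V.carrier) : τ 0 w = 0 := by simpa using h.smul_left 0 0 w

end IsPoisson

namespace PoCh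

noncomputable section

section Retraction

variable {P : PoCh.{u}} {Q : CochainCpx.{u} ℝ} {i : CochainCpx.Hom P.cpx Q}
  (R : CochainCpx.Retraction i)

/-- The complex `Q` with the pairing pulled back along the retraction to `P`. -/
abbrev pull : PoCh.{u} := ⟨Q, _, P.isPoisson.comap R.r⟩

/-- The inclusion, as a morphism of Poisson complexes for the pulled back pairing. -/
def pullIncl : Hom P (pull R) where
  toHom := i
  map_τ v w := by
    change P.τ (R.r.toLin (i.toLin v)) (R.r.toLin (i.toLin w)) = _
    rw [R.r_i, R.r_i]

/-- The retraction, as a morphism of Poisson complexes for the pulled back pairing. -/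
def pullRetr : Hom (pull R) P where
  toHom := R.r
  map_τ _ _ := rfl

theorem ccrMap_pullRetr_pullIncl (a : P.CCRAlg) :
    ccrMap (pullRetr R) (ccrMap (pullIncl R) a) = a := by
  have h : (ccrMap (pullRetr R)).comp (ccrMap (pullIncl R)) = AlgHom.id ℂ P.CCRAlg := by
    refine ccr_hom_ext fun v => ?_
    rw [AlgHom.comp_apply, ccrMap_gen, ccrMap_gen, AlgHom.id_apply]
    congr 1
    exact R.r_i v
  exact DFunLike.congr_fun h a

/-- A generator in the kernel of the retraction commutes in the graded sense with every generator,
since the pulled back pairing vanishes on it. -/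
theorem pull_gen_comm {j k : ℤ} {v w : Q.carrier} (hv : v ∈ Q.gr j) (hw : w ∈ Q.gr k)
    (h : R.r.toLin v = 0) :
    (pull R).gen v * (pull R).gen w = sgn (j * k) • ((pull R).gen w * (pull R).gen v) := by
  have h1 := (pull R).gen_comm (v := v) (w := w) hv hw
  have h2 : (pull R).τ v w = 0 := by
    change P.τ (R.r.toLin v) (R.r.toLin w) = 0
    rw [h, P.isPoisson.zero_left]
  rw [h2] at h1
  simpa using h1

/-- The projection `1 - i r` onto the kernel of the retraction. -/
def kerProj : Q.carrier →ₗ[ℝ] Q.carrier := LinearMap.id - i.toLin ∘ₗ R.r.toLin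

theorem kerProj_apply (v : Q.carrier) : kerProj R v = v - i.toLin (R.r.toLin v) := rfl

theorem r_kerProj (v : Q.carrier) : R.r.toLin (kerProj R v) = 0 := by
  rw [kerProj_apply, map_sub, R.r_i, sub_self]

theorem kerProj_mem {j : ℤ} {v : Q.carrier} (hv : v ∈ Q.gr j) : kerProj R v ∈ Q.gr j :=
  sub_mem hv (i.map_gr _ _ (R.r.map_gr _ _ hv))

/-- The derivations `H` and `N` of the CCR-algebra that extend the homotopy `h` and the projection
`1 - i r`. They exist because `h` and `1 - i r` take values in the kernel of the retraction, where
the pulled back pairing vanishes. -/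
theorem exists_homotopy_derivations :
    ∃ H N : (pull R).CCRAlg →ₗ[ℂ] (pull R).CCRAlg,
      (∀ j, ∀ a ∈ (pull R).ccrGr j, H a ∈ (pull R).ccrGr (j - 1)) ∧
      (∀ a, ccrD (H a) + H (ccrD a) = N a) ∧ N 1 = 0 ∧
      ∀ v b, N ((pull R).gen v * b) = (pull R).gen (kerProj R v) * b + (pull R).gen v * N b := by
  obtain ⟨H, hH1, hH⟩ := exists_gradedDerivation (P := pull R) (-1)
    { toFun := fun v => (pull R).gen (R.h v)
      map_add' := fun v w => by rw [map_add, map_add]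
      map_smul' := fun c v => by rw [map_smul, map_smulₛₗ] } (by
    intro j k v w hv hw
    change (pull R).gen (R.h v) * (pull R).gen w +
      sgn (-1 * j) • ((pull R).gen v * (pull R).gen (R.h w)) =
      sgn (j * k) • ((pull R).gen (R.h w) * (pull R).gen v +
        sgn (-1 * k) • ((pull R).gen w * (pull R).gen (R.h v)))
    rw [pull_gen_comm R (R.h_mem j v hv) hw (R.r_h v),
      pull_gen_comm R (R.h_mem k w hw) hv (R.r_h w), neg_one_mul, neg_one_mul, sgn_neg, sgn_neg,
      show (j - 1) * k = j * k + -k by ring, show (k - 1) * j = j * k + -j by ring, sgn_add,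
      sgn_add, sgn_neg, sgn_neg]
    have s1 := sgn_mul_self (j * k)
    match_scalars
    · ring
    · linear_combination (-sgn j) * s1)
  obtain ⟨N, hN1, hN⟩ := exists_gradedDerivation (P := pull R) 0
    { toFun := fun v => (pull R).gen (kerProj R v)
      map_add' := fun v w => by rw [map_add, map_add]
      map_smul' := fun c v => by rw [map_smul, map_smulₛₗ] } (by
    intro j k v w hv hw
    change (pull R).gen (kerProj R v) * (pull R).gen w +
      sgn (0 * j) • ((pull R).gen v * (pull R).gen (kerProj R w)) =
      sgn (j * k) • ((pull R).gen (kerProj R w) * (pull R).gen v +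
        sgn (0 * k) • ((pull R).gen w * (pull R).gen (kerProj R v)))
    rw [pull_gen_comm R (kerProj_mem R hv) hw (r_kerProj R v),
      pull_gen_comm R (kerProj_mem R hw) hv (r_kerProj R w), zero_mul, zero_mul, sgn_zero,
      mul_comm k j]
    have s1 := sgn_mul_self (j * k)
    match_scalars
    · ring
    · linear_combination (-1 : ℂ) * s1)
  have hN' : ∀ v b, N ((pull R).gen v * b) =
      (pull R).gen (kerProj R v) * b + (pull R).gen v * N b := by
    intro v b
    refine CochainCpx.hom_induction Q.gr (p := fun v => N ((pull R).gen v * b) =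
      (pull R).gen (kerProj R v) * b + (pull R).gen v * N b) (by simp) (fun j v hv => ?_)
      (fun v w h h' => ?_) v
    · rw [hN j v b hv, zero_mul, sgn_zero, one_smul]
      rfl
    · rw [map_add, add_mul, map_add, h, h', map_add, map_add]
      simp only [add_mul]
      abel
  refine ⟨H, N, fun j a ha => ?_, fun a => ?_, hN1, hN'⟩
  · refine ccrGr_induction (p := fun j a => H a ∈ (pull R).ccrGr (j - 1))
      (fun i => ?_) (fun i a b ha hb => ?_) (fun i c a ha => ?_) ?_
      (fun i j w b hw hb ih => ?_) ha
    · rw [map_zero]; exact zero_mem _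
    · rw [map_add]; exact add_mem ha hb
    · rw [map_smul]; exact Submodule.smul_mem _ _ ha
    · rw [hH1]; exact zero_mem _
    · rw [hH i w b hw]
      refine add_mem ?_ (Submodule.smul_mem _ _ ?_)
      · rw [show i + j - 1 = (i - 1) + j by ring]
        exact SetLike.mul_mem_graded (gen_mem (P := pull R) (R.h_mem i w hw)) hb
      · rw [add_sub_assoc]
        exact SetLike.mul_mem_graded (gen_mem hw) ih
  · have h : ccrD ∘ₗ H + H ∘ₗ ccrD = N := by
      refine linearMap_ext_words _ _ ?_ fun j v b hv hb => ?_
      · simp [hH1, hN1, ccrD_one]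
      · simp only [LinearMap.comp_apply, LinearMap.add_apply] at hb ⊢
        have hh : (pull R).gen (kerProj R v) = (pull R).gen (Q.d (R.h v)) +
            (pull R).gen (R.h (Q.d v)) := by
          rw [← map_add, R.homotopy]; rfl
        have h1 : ∀ x, ({ toFun := fun v => (pull R).gen (R.h v)
                          map_add' := fun v w => by rw [map_add, map_add]
                          map_smul' := fun c v => by rw [map_smul, map_smulₛₗ] } :
            Q.carrier →ₛₗ[Complex.ofRealHom] (pull R).CCRAlg) x = (pull R).gen (R.h x) :=
          fun _ => rfl
        have hdv := (pull R).cpx.d_mem j v hv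
        rw [hH j v b hv, ccrD_mul (gen_mem hv), ccrD_gen, map_add, map_add, map_smul, map_smul,
          hH (j + 1) _ b hdv, hH j v _ hv, hN', h1, h1,
          ccrD_mul (gen_mem (P := pull R) (R.h_mem j v hv)), ccrD_gen, ccrD_mul (gen_mem hv),
          ccrD_gen, hh, add_mul, ← hb,
          show sgn (-1 * j) = sgn j by rw [neg_one_mul, sgn_neg],
          show sgn (j - 1) = - sgn j by rw [sub_eq_add_neg, sgn_add]; simp [sgn],
          show sgn (-1 * (j + 1)) = - sgn j by
            rw [neg_one_mul, sgn_neg, sgn_add]; simp [sgn], mul_add]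
        have s1 := sgn_mul_self j
        match_scalars <;> first | ring1 | linear_combination s1
    exact LinearMap.congr_fun h a

/-- On every element of the CCR-algebra, a finite product of operators `1 - N/b` agrees with the
projection to the image of the CCR-algebra of `P`, because the number operator `N` is
diagonalizable with eigenvalues in `ℕ` and that image is its kernel. -/
theorem exists_iterate_eq_retract {N : (pull R).CCRAlg →ₗ[ℂ] (pull R).CCRAlg} (hN1 : N 1 = 0)
    (hN : ∀ v b, N ((pull R).gen v * b) =
      (pull R).gen (kerProj R v) * b + (pull R).gen v * N b) (a : (pull R).CCRAlg) :
    ∃ m : ℕ, Nat.rec (motive := fun _ => (pull R).CCRAlg) a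
      (fun b x => x - ((b : ℂ) + 1)⁻¹ • N x) m =
        ccrMap (pullIncl R) (ccrMap (pullRetr R) a) := by
  let E : (pull R).CCRAlg →ₐ[ℂ] (pull R).CCRAlg :=
    (ccrMap (pullIncl R)).comp (ccrMap (pullRetr R))
  have hE : ∀ v, E ((pull R).gen v) = (pull R).gen (i.toLin (R.r.toLin v)) := by
    intro v
    change ccrMap (pullIncl R) (ccrMap (pullRetr R) _) = _
    rw [ccrMap_gen, ccrMap_gen]
    rfl
  -- the eigenspaces of `N`, with the value of the projection `E` on them
  let Z : ℕ → Submodule ℂ (pull R).CCRAlg := fun b =>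
    LinearMap.ker (N - (b : ℂ) • LinearMap.id) ⊓
      LinearMap.ker (E.toLinearMap - (if b = 0 then (1 : ℂ) else 0) • LinearMap.id)
  have hZ : ∀ b x, x ∈ Z b ↔ N x = (b : ℂ) • x ∧ E x = (if b = 0 then (1 : ℂ) else 0) • x := by
    intro b x
    simp only [Z, Submodule.mem_inf, LinearMap.mem_ker, LinearMap.sub_apply, LinearMap.smul_apply,
      LinearMap.id_apply, AlgHom.toLinearMap_apply, sub_eq_zero]
  have htop : ∀ x, x ∈ ⨆ b, Z b := by
    intro x
    refine ccr_induction (p := fun x => x ∈ ⨆ b, Z b) (zero_mem _) (fun _ _ => add_mem)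
      (fun c _ => Submodule.smul_mem _ c) ?_ (fun j v y hv hy => ?_) x
    · refine Submodule.mem_iSup_of_mem 0 ((hZ _ _).2 ⟨by simp [hN1], by simp⟩)
    · have hmul : ∀ y ∈ ⨆ b, Z b, (pull R).gen v * y ∈ ⨆ b, Z b := by
        intro y hy
        refine Submodule.iSup_induction Z (motive := fun y => (pull R).gen v * y ∈ ⨆ b, Z b) hy
          (fun b y hy => ?_) (by simp) (fun y z hy hz => ?_)
        · obtain ⟨h1, h2⟩ := (hZ _ _).1 hy
          have hv' : v = kerProj R v + i.toLin (R.r.toLin v) := by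
            rw [kerProj_apply]; abel
          have hkk : kerProj R (kerProj R v) = kerProj R v := by
            rw [kerProj_apply, r_kerProj, map_zero, sub_zero]
          have hki : kerProj R (i.toLin (R.r.toLin v)) = 0 := by
            rw [kerProj_apply, R.r_i, sub_self]
          -- one summand of the generator raises the eigenvalue, the other one preserves it
          rw [hv', map_add, add_mul]
          refine add_mem (Submodule.mem_iSup_of_mem (b + 1) ((hZ _ _).2 ⟨?_, ?_⟩))
            (Submodule.mem_iSup_of_mem b ((hZ _ _).2 ⟨?_, ?_⟩))
          · rw [hN, hkk, h1, mul_smul_comm]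
            push_cast
            module
          · rw [map_mul E, hE, r_kerProj, map_zero, map_zero, zero_mul]
            simp
          · rw [hN, hki, h1, map_zero, zero_mul, zero_add, mul_smul_comm]
          · rw [map_mul E, hE, h2, R.r_i, mul_smul_comm]
        · rw [mul_add]
          exact add_mem hy hz
      exact hmul y hy
  let T : ℕ → (pull R).CCRAlg →ₗ[ℂ] (pull R).CCRAlg := fun m =>
    Nat.rec (motive := fun _ => (pull R).CCRAlg →ₗ[ℂ] (pull R).CCRAlg) LinearMap.id
      (fun b t => t - ((b : ℂ) + 1)⁻¹ • (N ∘ₗ t)) m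
  have hT : ∀ m x, T m x = Nat.rec (motive := fun _ => (pull R).CCRAlg) x
      (fun b x => x - ((b : ℂ) + 1)⁻¹ • N x) m := by
    intro m x
    induction m with
    | zero => rfl
    | succ m ih =>
      change T m x - ((m : ℂ) + 1)⁻¹ • N (T m x) = _
      rw [ih]
  have hTE : ∃ m, ∀ m' ≥ m, T m' a = E a := by
    refine Submodule.iSup_induction Z (motive := fun a => ∃ m, ∀ m' ≥ m, T m' a = E a) (htop a)
      (fun b x hx => ?_) ⟨0, fun m' _ => by rw [map_zero, map_zero]⟩ ?_
    · obtain ⟨h1, h2⟩ := (hZ _ _).1 hx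
      have hs : ∀ m, T (m + 1) x = T m x - ((m : ℂ) + 1)⁻¹ • N (T m x) := fun m => rfl
      refine ⟨b, fun m' hm' => ?_⟩
      rw [h2]
      by_cases hb : b = 0
      · rw [if_pos hb, one_smul]
        clear hm'
        induction m' with
        | zero => rfl
        | succ m ih => rw [hs, ih, h1, hb]; simp
      · rw [if_neg hb, zero_smul]
        -- the factor `1 - N/b` kills the eigenspace for `b`
        have heig : ∀ m, N (T m x) = (b : ℂ) • T m x := by
          intro m
          induction m with
          | zero => exact h1
          | succ m ih => rw [hs, map_sub, map_smul, ih, map_smul, ih]; module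
        obtain ⟨c, rfl⟩ := Nat.exists_eq_succ_of_ne_zero hb
        induction m', hm' using Nat.le_induction with
        | base =>
          rw [Nat.succ_eq_add_one, hs, heig, smul_smul]
          push_cast
          rw [inv_mul_cancel₀ (Nat.cast_add_one_ne_zero c), one_smul, sub_self]
        | succ m _ ih => rw [hs, ih, map_zero, smul_zero, sub_zero]
    · rintro x y ⟨m, hm⟩ ⟨n, hn⟩
      refine ⟨max m n, fun m' hm' => ?_⟩
      rw [map_add, map_add, hm m' (le_of_max_le_left hm'), hn m' (le_of_max_le_right hm')]
  obtain ⟨m, hm⟩ := hTE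
  exact ⟨m, by rw [← hT]; exact hm m le_rfl⟩

end Retraction

/-- The CCR-functor sends the inclusion of a deformation retract (of complexes) to a weak
equivalence. The retraction need not preserve the pairings: the pairing of `Q` may be replaced by
the pulled back one without changing the underlying complex of the CCR-algebra. -/
theorem isWeakEquiv_of_retraction {P Q : PoCh.{u}} (f : P ⟶ Q)
    (R : CochainCpx.Retraction (PoCh.Hom.toHom f)) : DGStarAlg.IsWeakEquiv (CCR.map f) := by
  obtain ⟨V, τ, hτ⟩ := Q
  obtain ⟨Φ, Ψ, hΨΦ, hΦΨ, hΦd, hΨd, hΦm, hΨm, hΦf⟩ :=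
    exists_reordering_equiv hτ (P.isPoisson.comap R.r)
  have hf : ∀ a, Φ (ccrMap f a) = ccrMap (pullIncl R) a := hΦf P f (pullIncl R) rfl
  obtain ⟨H, N, hHm, hHN, hN1, hN⟩ := exists_homotopy_derivations R
  refine CochainCpx.Hom.isQuasiIso_of_cocycles ?_ ?_
  · intro j (v : P.CCRAlg) (y : (mk V τ hτ).CCRAlg) hv hdv hy (h : ccrD y = ccrMap f v)
    refine ⟨ccrMap (pullRetr R) (Φ y), ccrMap_mem _ (hΦm _ _ hy), ?_⟩
    change ccrD (ccrMap (pullRetr R) (Φ y)) = v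
    rw [← ccrMap_ccrD, ← hΦd, h, hf]
    exact ccrMap_pullRetr_pullIncl R v
  · intro j (w : (mk V τ hτ).CCRAlg) hw (hdw : ccrD w = 0)
    have hw' := hΦm j w hw
    have hdw' : ccrD (Φ w) = 0 := by rw [← hΦd, hdw, map_zero]
    obtain ⟨m, hm⟩ := exists_iterate_eq_retract R hN1 hN (Φ w)
    -- every operator `1 - N/b` preserves the cohomology class
    have key : ∀ m : ℕ, ∃ y ∈ (pull R).ccrGr (j - 1), ccrD y =
        Nat.rec (motive := fun _ => (pull R).CCRAlg) (Φ w)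
          (fun b x => x - ((b : ℂ) + 1)⁻¹ • N x) m - Φ w := by
      intro m
      induction m with
      | zero => exact ⟨0, zero_mem _, by simp⟩
      | succ m ih =>
        obtain ⟨y, hy, hyd⟩ := ih
        set x := Nat.rec (motive := fun _ => (pull R).CCRAlg) (Φ w)
          (fun b x => x - ((b : ℂ) + 1)⁻¹ • N x) m with hx
        have hxe : x = Φ w + ccrD y := by rw [hyd]; abel
        have hxj : x ∈ (pull R).ccrGr j := by
          rw [hxe]
          refine add_mem hw' ?_
          have := ccrD_mem hy
          rwa [sub_add_cancel] at this
        have hxd : ccrD x = 0 := by rw [hxe, map_add, hdw', ccrD_ccrD, add_zero]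
        refine ⟨y - ((m : ℂ) + 1)⁻¹ • H x,
          sub_mem hy (Submodule.smul_mem _ _ (hHm j x hxj)), ?_⟩
        have h1 := hHN x
        rw [hxd, map_zero, add_zero] at h1
        change _ = x - ((m : ℂ) + 1)⁻¹ • N x - Φ w
        rw [map_sub, map_smul, h1, hyd]
        abel
    obtain ⟨y, hy, hyd⟩ := key m
    rw [hm] at hyd
    refine ⟨ccrMap (pullRetr R) (Φ w), ccrMap_mem _ hw', ?_, Ψ y, hΨm _ _ hy, ?_⟩
    · change ccrD (ccrMap (pullRetr R) (Φ w)) = 0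
      rw [← ccrMap_ccrD, hdw', map_zero]
    · change ccrD (Ψ y) = ccrMap f _ - w
      rw [← hΨd, hyd, map_sub, hΨΦ, ← hf, hΨΦ]

end

end PoCh

/-! ### Graded commutation, and retractions of three term complexes -/

namespace PoCh

/-- Subalgebras generated by subcomplexes that are orthogonal for the pairing commute in the graded
sense. -/
theorem ccrMap_graded_commute {P₁ P₂ P : PoCh.{u}} (f₁ : Hom P₁ P) (f₂ : Hom P₂ P)
    (h : ∀ v w, P.τ (f₁.toHom.toLin v) (f₂.toHom.toLin w) = 0) {i j : ℤ} {a : P₁.CCRAlg}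
    {b : P₂.CCRAlg} (ha : a ∈ P₁.ccrGr i) (hb : b ∈ P₂.ccrGr j) :
    ccrMap f₁ a * ccrMap f₂ b = sgn (i * j) • (ccrMap f₂ b * ccrMap f₁ a) := by
  have hgen : ∀ (i : ℤ) v, v ∈ P₁.cpx.gr i → ∀ (j : ℤ) b, b ∈ P₂.ccrGr j →
      P.gen (f₁.toHom.toLin v) * ccrMap f₂ b =
        sgn (i * j) • (ccrMap f₂ b * P.gen (f₁.toHom.toLin v)) := by
    intro i v hv j b hb
    refine ccrGr_induction (p := fun j b => P.gen (f₁.toHom.toLin v) * ccrMap f₂ b =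
        sgn (i * j) • (ccrMap f₂ b * P.gen (f₁.toHom.toLin v)))
      (fun j => ?_) (fun j a b ha hb => ?_) (fun j c a ha => ?_) ?_
      (fun j k w b hw _ ih => ?_) hb
    · simp
    · rw [map_add, mul_add, ha, hb, add_mul, smul_add]
    · rw [map_smul, mul_smul_comm, ha, smul_mul_assoc, smul_comm]
    · rw [map_one, mul_zero, sgn_zero]; simp
    · have h1 := P.gen_comm (f₁.toHom.map_gr i v hv) (f₂.toHom.map_gr j w hw)
      rw [h, Complex.ofReal_zero, mul_zero, map_zero, add_zero] at h1
      rw [map_mul, ccrMap_gen, ← mul_assoc, h1, smul_mul_assoc, mul_assoc, ih, mul_smul_comm,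
        mul_assoc, mul_add, sgn_add, smul_smul]
  refine ccrGr_induction (p := fun i a => ccrMap f₁ a * ccrMap f₂ b =
      sgn (i * j) • (ccrMap f₂ b * ccrMap f₁ a))
    (fun j => ?_) (fun j a b ha hb => ?_) (fun j c a ha => ?_) ?_
    (fun k i v a hv _ ih => ?_) ha
  · simp
  · rw [map_add, mul_add, add_mul, ha, hb, smul_add]
  · rw [map_smul, mul_smul_comm, smul_mul_assoc, ha, smul_comm]
  · rw [map_one, zero_mul, sgn_zero]; simp
  · rw [map_mul, ccrMap_gen, mul_assoc, ih, mul_smul_comm, ← mul_assoc, hgen k v hv j b hb,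
      smul_mul_assoc, mul_assoc, add_mul, sgn_add, smul_smul, mul_comm (sgn (i * j))]

end PoCh

noncomputable section SmallRetractions

variable {A B C F : Type u} [AddCommGroup A] [Module ℝ A] [AddCommGroup B] [Module ℝ B]
  [AddCommGroup C] [Module ℝ C] [AddCommGroup F] [Module ℝ F]

/-- A map `k` from `F` to a three term complex is the inclusion of a deformation retract if the
complex is exact at both ends and its cocycles in the middle are the direct sum of the coboundaries
and the image of `k`. The retraction and the homotopy are built from a linear section `s` of the
second differential and the resulting decomposition of the middle term. -/
theorem nonempty_retraction_threeTerm (d₀ : A →ₗ[ℝ] B) (d₁ : B →ₗ[ℝ] C)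
    (hd : ∀ a, d₁ (d₀ a) = 0) (k : F →ₗ[ℝ] B) (hk : ∀ x, d₁ (k x) = 0)
    (hinj : ∀ a x, d₀ a + k x = 0 → a = 0 ∧ x = 0) (hsurj : ∀ c, ∃ b, d₁ b = c)
    (hker : ∀ b, d₁ b = 0 → ∃ a x, d₀ a + k x = b)
    (i : CochainCpx.Hom (oneTerm F) (threeTerm d₀ d₁ hd))
    (hi : ∀ x, i.toLin x = ((0, k x, 0) : A × B × C)) :
    Nonempty (CochainCpx.Retraction i) := by
  obtain ⟨s, hs⟩ := d₁.exists_rightInverse_of_surjective (LinearMap.range_eq_top.2 hsurj)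
  have hs : ∀ c, d₁ (s c) = c := fun c => LinearMap.congr_fun hs c
  let t : A × F →ₗ[ℝ] LinearMap.ker d₁ := (d₀.coprod k).codRestrict _ fun p => by
    simp [hd, hk]
  have ht : Function.Bijective t := by
    constructor
    · rw [injective_iff_map_eq_zero]
      rintro ⟨a, x⟩ h
      obtain ⟨rfl, rfl⟩ := hinj a x (congrArg Subtype.val h)
      rfl
    · rintro ⟨b, hb⟩
      obtain ⟨a, x, h⟩ := hker b hb
      exact ⟨(a, x), Subtype.ext h⟩
  let te := LinearEquiv.ofBijective t ht
  -- the projection of the middle term onto the cocycles along the image of `s`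
  let pr : B →ₗ[ℝ] LinearMap.ker d₁ := (LinearMap.id - s ∘ₗ d₁).codRestrict _ fun b => by
    simp [hs]
  let q : B →ₗ[ℝ] A × F := te.symm.toLinearMap ∘ₗ pr
  have hq : ∀ b, d₀ (q b).1 + k (q b).2 = b - s (d₁ b) := fun b =>
    congrArg Subtype.val (te.apply_symm_apply (pr b))
  have hqt : ∀ a x, q (d₀ a + k x) = (a, x) := by
    intro a x
    have h : pr (d₀ a + k x) = te (a, x) := Subtype.ext (by
      change d₀ a + k x - s (d₁ (d₀ a + k x)) = d₀ a + k x
      rw [map_add, hd, hk, add_zero, map_zero, sub_zero])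
    change te.symm (pr _) = _
    rw [h, te.symm_apply_apply]
  have hqs : ∀ c, q (s c) = 0 := by
    intro c
    have h : pr (s c) = 0 := Subtype.ext (by
      change s c - s (d₁ (s c)) = 0
      rw [hs, sub_self])
    change te.symm (pr _) = _
    rw [h, map_zero]
  have hqd : ∀ a, q (d₀ a) = (a, 0) := fun a => by simpa using hqt a 0
  let r : CochainCpx.Hom (threeTerm d₀ d₁ hd) (oneTerm F) :=
    { toLin := LinearMap.snd ℝ A F ∘ₗ q ∘ₗ LinearMap.fst ℝ B C ∘ₗ LinearMap.snd ℝ A (B × C)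
      map_gr := by
        rintro j ⟨a, b, c⟩ ⟨-, h2, -⟩
        by_cases hj : j = 0
        · subst hj
          exact mem_oneGr_zero _
        · obtain rfl : b = 0 := h2 hj
          change (q 0).2 ∈ _
          rw [map_zero]
          exact Submodule.zero_mem _
      map_d := by
        rintro ⟨a, b, c⟩
        change (q (-(d₀ a))).2 = 0
        rw [map_neg, hqd]
        exact neg_zero }
  let h : A × B × C →ₗ[ℝ] A × B × C :=
    LinearMap.prod (-(LinearMap.fst ℝ A F ∘ₗ q ∘ₗ LinearMap.fst ℝ B C ∘ₗ LinearMap.snd ℝ A (B × C)))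
      (LinearMap.prod (-(s ∘ₗ LinearMap.snd ℝ B C ∘ₗ LinearMap.snd ℝ A (B × C))) 0)
  have hh : ∀ a b c, h (a, b, c) = (-(q b).1, -(s c), 0) := fun _ _ _ => rfl
  refine ⟨⟨r, h, ?_, fun x => ?_, ?_, ?_⟩⟩
  · rintro j ⟨a, b, c⟩ ⟨h1, h2, h3⟩
    simp only at h1 h2 h3
    refine ⟨fun hj => ?_, fun hj => ?_, fun _ => rfl⟩
    · change -(q b).1 = 0
      rw [h2 (by omega), map_zero]
      exact neg_zero
    · change -(s c) = 0
      rw [h3 (by omega), map_zero, neg_zero]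
  · rw [hi]
    change (q (k x)).2 = x
    have := hqt 0 x
    rw [map_zero, zero_add] at this
    rw [this]
  · rintro ⟨a, b, c⟩
    change (q (-(s c))).2 = 0
    rw [map_neg, hqs]
    exact neg_zero
  · rintro ⟨a, b, c⟩
    rw [hi]
    change ((0, -(d₀ (-(q b).1)), -(d₁ (-(s c)))) : A × B × C) + h (0, -(d₀ a), -(d₁ b)) =
      (a, b, c) - (0, k (q b).2, 0)
    rw [hh]
    refine Prod.ext ?_ (Prod.ext ?_ ?_)
    · change 0 + -(q (-(d₀ a))).1 = a - 0
      rw [map_neg, hqd]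
      simp
    · change -(d₀ (-(q b).1)) + -(s (-(d₁ b))) = b - k (q b).2
      have := hq b
      rw [map_neg, map_neg, neg_neg, neg_neg, eq_sub_iff_add_eq, add_right_comm, this]
      abel
    · change -(d₁ (-(s c))) + 0 = c - 0
      rw [map_neg, hs]
      simp

end SmallRetractions

/-! ### Smooth forms and functions, and derivatives of charts -/

noncomputable section SmoothForms

open Filter

variable {E : Type v} [NormedAddCommGroup E] [NormedSpace ℝ E] {H : Type v} [TopologicalSpace H]
  {I : ModelWithCorners ℝ E H} {M : Type u} [TopologicalSpace M] [ChartedSpace H M]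

variable [IsManifold I ∞ M]

theorem contDiffOn_comp_extChartAt_symm {f : M → ℝ} (hf : ContMDiff I 𝓘(ℝ, ℝ) ∞ f) (x₀ : M) :
    ContDiffOn ℝ ∞ (f ∘ (extChartAt I x₀).symm) (extChartAt I x₀).target := by
  rw [← contMDiffOn_iff_contDiffOn]
  exact hf.comp_contMDiffOn (contMDiffOn_extChartAt_symm x₀)

theorem IsSmoothForm.smul {k : ℕ} {α : M → E [⋀^Fin k]→L[ℝ] ℝ} (hα : IsSmoothForm I α)
    {f : M → ℝ} (hf : ContMDiff I 𝓘(ℝ, ℝ) ∞ f) : IsSmoothForm I (fun x => f x • α x) :=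
  fun x₀ => (contDiffOn_comp_extChartAt_symm hf x₀).smul (hα x₀)

theorem compactForms_le_compactForms {k : ℕ} {V V' : Set M} (h : V ⊆ V') :
    compactForms I k V ≤ compactForms I k V' := by
  rintro α ⟨hα, K, hK, hKV, h0⟩
  exact ⟨hα, K, hK, hKV.trans h, h0⟩

theorem smul_mem_compactForms {k : ℕ} {V V' : Set M} {α : M → E [⋀^Fin k]→L[ℝ] ℝ}
    (hα : α ∈ compactForms I k V) {f : M → ℝ} (hf : ContMDiff I 𝓘(ℝ, ℝ) ∞ f)
    (hV : tsupport f ∩ V ⊆ V') : (fun x => f x • α x) ∈ compactForms I k V' := by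
  obtain ⟨K, hK, hKV, h0⟩ := hα.2
  refine ⟨hα.1.smul hf, tsupport f ∩ K, hK.inter_left (isClosed_tsupport f),
    (inter_subset_inter_right _ hKV).trans hV, fun x hx => ?_⟩
  change f x • α x = 0
  by_cases hxK : x ∈ K
  · have : f x = 0 := by
      by_contra h
      exact hx ⟨subset_tsupport f h, hxK⟩
    rw [this, zero_smul]
  · rw [h0 x hxK, smul_zero]

/-- A function as a differential form of degree zero. -/
def zeroForm (f : M → ℝ) (x : M) : E [⋀^Fin 0]→L[ℝ] ℝ :=
  ContinuousAlternatingMap.constOfIsEmpty ℝ E (Fin 0) (f x)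

theorem zeroForm_apply (f : M → ℝ) (x : M) (v : Fin 0 → E) : zeroForm (E := E) f x v = f x := rfl

theorem zeroForm_self (α : M → E [⋀^Fin 0]→L[ℝ] ℝ) : zeroForm (fun x => α x ![]) = α := by
  funext x
  ext v
  rw [zeroForm_apply]
  exact congrArg _ (Subsingleton.elim _ _)

theorem isSmoothForm_zeroForm {f : M → ℝ} (hf : ContMDiff I 𝓘(ℝ, ℝ) ∞ f) :
    IsSmoothForm I (zeroForm (E := E) f) := by
  intro x₀
  have h : chartRep I (zeroForm f) x₀ =
      fun y => (ContinuousAlternatingMap.constOfIsEmptyLIE ℝ E ℝ (Fin 0))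
        ((f ∘ (extChartAt I x₀).symm) y) := rfl
  rw [h]
  exact (ContinuousAlternatingMap.constOfIsEmptyLIE ℝ E ℝ (Fin 0)).contDiff.comp_contDiffOn
    (contDiffOn_comp_extChartAt_symm hf x₀)

theorem IsSmoothForm.contMDiff {α : M → E [⋀^Fin 0]→L[ℝ] ℝ} (hα : IsSmoothForm I α) :
    ContMDiff I 𝓘(ℝ, ℝ) ∞ (fun x => α x ![]) := by
  intro x
  have h1 : ContDiffOn ℝ ∞ (fun y => α ((extChartAt I x).symm y) ![]) (extChartAt I x).target := by
    have : (fun y => α ((extChartAt I x).symm y) ![]) =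
        fun y => (ContinuousAlternatingMap.constOfIsEmptyLIE ℝ E ℝ (Fin 0)).symm
          (chartRep I α x y) := by
      funext y
      change _ = (α _).compContinuousLinearMap _ 0
      exact congrArg _ (Subsingleton.elim _ _)
    rw [this]
    exact (ContinuousAlternatingMap.constOfIsEmptyLIE ℝ E ℝ (Fin 0)).symm.contDiff.comp_contDiffOn
      (hα x)
  have h2 : ContMDiffOn I 𝓘(ℝ, ℝ) ∞ ((fun y => α ((extChartAt I x).symm y) ![]) ∘ extChartAt I x)
      (chartAt H x).source := by
    refine (contMDiffOn_iff_contDiffOn.2 h1).comp contMDiffOn_extChartAt fun y hy => ?_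
    exact (extChartAt I x).map_source (by rwa [extChartAt_source])
  refine (h2.contMDiffAt ((chartAt H x).open_source.mem_nhds
    (mem_chart_source H x))).congr_of_eventuallyEq ?_
  filter_upwards [(chartAt H x).open_source.mem_nhds (mem_chart_source H x)] with y hy
  rw [Function.comp_apply, (extChartAt I x).left_inv (by rwa [extChartAt_source])]

/-- The exterior derivative of a function is its differential. -/
theorem extD_zeroForm {f : M → ℝ} {x : M} (hf : MDifferentiableAt I 𝓘(ℝ, ℝ) f x) :
    extD I (zeroForm f) x = oneForm (dAt I f x) := by
  have hr := extChartAt_target_subset_range x (mem_extChartAt_target (I := I) x)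
  change extDerivWithin (fun y => ContinuousAlternatingMap.constOfIsEmpty ℝ E (Fin 0)
    (f ((extChartAt I x).symm y))) (range I) (extChartAt I x x) = _
  rw [extDerivWithin_constOfIsEmpty _ (I.uniqueDiffOn _ hr), oneForm, dAt, hf.mfderiv]
  rfl

end SmoothForms

noncomputable section TopForms

variable {n : ℕ}

/-- The standard basis of Euclidean space, as a tuple of vectors. -/
abbrev stdBasis (n : ℕ) (i : Fin n) : EuclideanSpace ℝ (Fin n) := EuclideanSpace.single i 1

/-- Pulling back a form of top degree multiplies its coefficient by the determinant. -/
theorem comp_stdBasis (β : EuclideanSpace ℝ (Fin n) [⋀^Fin n]→L[ℝ] ℝ)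
    (A : EuclideanSpace ℝ (Fin n) →L[ℝ] EuclideanSpace ℝ (Fin n)) :
    β.compContinuousLinearMap A (stdBasis n) = A.det * β (stdBasis n) := by
  let e := (EuclideanSpace.basisFun (Fin n) ℝ).toBasis
  have he : ⇑e = stdBasis n := by
    funext i
    simp [e]
  have h1 := DFunLike.congr_fun (AlternatingMap.eq_smul_basis_det e β.toAlternatingMap)
    (A.toLinearMap ∘ e)
  rw [AlternatingMap.smul_apply, e.det_comp, e.det_self, mul_one, he] at h1
  rw [mul_comm]
  exact h1

variable {H : Type} [TopologicalSpace H]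
  {I : ModelWithCorners ℝ (EuclideanSpace ℝ (Fin n)) H} {M : Type u} [TopologicalSpace M]
  [ChartedSpace H M] [IsManifold I ∞ M]

/-- The derivative at `x` of the chart at `p`, as an endomorphism of the model space; the tangent
space at `x` is identified with the model space by the chart at `x`. -/
def chartDeriv (I : ModelWithCorners ℝ (EuclideanSpace ℝ (Fin n)) H) {M : Type u}
    [TopologicalSpace M] [ChartedSpace H M] (p x : M) :
    EuclideanSpace ℝ (Fin n) →L[ℝ] EuclideanSpace ℝ (Fin n) :=
  mfderiv I 𝓘(ℝ, EuclideanSpace ℝ (Fin n)) (extChartAt I p) x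

/-- The derivative of the inverse of a chart, as an endomorphism of the model space. -/
def chartSymmDeriv (I : ModelWithCorners ℝ (EuclideanSpace ℝ (Fin n)) H) {M : Type u}
    [TopologicalSpace M] [ChartedSpace H M] (p : M) (y : EuclideanSpace ℝ (Fin n)) :
    EuclideanSpace ℝ (Fin n) →L[ℝ] EuclideanSpace ℝ (Fin n) :=
  mfderivWithin 𝓘(ℝ, EuclideanSpace ℝ (Fin n)) I (extChartAt I p).symm (range I) y

theorem chartDeriv_det_pos (hM : IsOrientedAtlas I M) {p x : M}
    (hx : x ∈ (extChartAt I p).source) : 0 < (chartDeriv I p x).det := by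
  have : IsManifold I 1 M := IsManifold.of_le (m := 1) (n := ∞) (by simp)
  have hd := mdifferentiableAt_extChartAt (I := I) (x := p) (y := x)
    (by rwa [← extChartAt_source I])
  have h := hM _ (chart_mem_atlas H x) _ (chart_mem_atlas H p) (extChartAt I x x) (by
    simp only [PartialEquiv.trans_source, PartialEquiv.symm_source, mem_inter_iff, mem_preimage]
    refine ⟨mem_extChartAt_target x, ?_⟩
    change (extChartAt I x).symm (extChartAt I x x) ∈ (extChartAt I p).source
    rwa [extChartAt_to_inv])
  have h2 : chartDeriv I p x =
      fderivWithin ℝ ((chartAt H p).extend I ∘ ((chartAt H x).extend I).symm)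
      (range I) (extChartAt I x x) := by
    rw [chartDeriv, hd.mfderiv]
    rfl
  rwa [h2]

theorem chartSymmDeriv_comp_chartDeriv {p x : M} (hx : x ∈ (extChartAt I p).source) :
    (chartSymmDeriv I p (extChartAt I p x)).comp (chartDeriv I p x) =
      ContinuousLinearMap.id ℝ _ := by
  have : IsManifold I 1 M := IsManifold.of_le (m := 1) (n := ∞) (by simp)
  exact mfderivWithin_extChartAt_symm_comp_mfderiv_extChartAt' hx

theorem chartSymmDeriv_det_pos (hM : IsOrientedAtlas I M) {p : M} {y : EuclideanSpace ℝ (Fin n)}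
    (hy : y ∈ (extChartAt I p).target) : 0 < (chartSymmDeriv I p y).det := by
  have hx := (extChartAt I p).map_target hy
  have h := chartSymmDeriv_comp_chartDeriv (I := I) hx
  rw [(extChartAt I p).right_inv hy] at h
  have h1 := congrArg ContinuousLinearMap.det h
  rw [show ((chartSymmDeriv I p y).comp (chartDeriv I p ((extChartAt I p).symm y))).det =
    (chartSymmDeriv I p y).det * (chartDeriv I p ((extChartAt I p).symm y)).det from
      LinearMap.det_comp _ _,
    show (ContinuousLinearMap.id ℝ (EuclideanSpace ℝ (Fin n))).det = 1 from LinearMap.det_id] at h1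
  by_contra hneg
  nlinarith [chartDeriv_det_pos hM hx]

end TopForms

/-! ### Integration of top degree forms -/

noncomputable section ChangeOfVariables

open MeasureTheory

variable {n : ℕ} {H : Type} [TopologicalSpace H]
  {I : ModelWithCorners ℝ (EuclideanSpace ℝ (Fin n)) H} {M : Type u} [TopologicalSpace M]
  [ChartedSpace H M]

theorem measurableSet_extChartAt_target (p : M) : MeasurableSet (extChartAt I p).target := by
  rw [extChartAt_target]
  exact ((chartAt H p).open_target.preimage I.continuous_symm).measurableSet.inter
    I.isClosed_range.measurableSet

theorem integrableOn_chartRep [IsManifold I ∞ M] {p : M}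
    {α : M → EuclideanSpace ℝ (Fin n) [⋀^Fin n]→L[ℝ] ℝ}
    (hα : α ∈ compactForms I n (extChartAt I p).source) :
    IntegrableOn (fun y => chartRep I α p y (stdBasis n)) (extChartAt I p).target := by
  obtain ⟨K, hK, hKs, h0⟩ := hα.2
  have hc : ContinuousOn (fun y => chartRep I α p y (stdBasis n)) (extChartAt I p).target :=
    ((ContinuousAlternatingMap.apply ℝ (EuclideanSpace ℝ (Fin n)) ℝ
      (stdBasis n)).continuous).comp_continuousOn (hα.1 p).continuousOn
  have hKc : IsCompact (extChartAt I p '' K) :=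
    hK.image_of_continuousOn ((continuousOn_extChartAt p).mono hKs)
  have hKt : extChartAt I p '' K ⊆ (extChartAt I p).target := by
    rintro _ ⟨x, hx, rfl⟩
    exact (extChartAt I p).map_source (hKs hx)
  refine IntegrableOn.of_forall_sdiff_eq_zero ((hc.mono hKt).integrableOn_compact hKc)
    (measurableSet_extChartAt_target p) ?_
  rintro y ⟨hy, hyK⟩
  change chartRep I α p y (stdBasis n) = 0
  rw [chartRep_of_eq_zero (h0 _ fun h => hyK ⟨_, h, (extChartAt I p).right_inv hy⟩)]
  rfl

variable (I M) in
/-- The partition of unity in the definition of the integral: it is subordinate to the chart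
domains and indexed by their centres. -/
def chartPartition [T2Space M] [SigmaCompactSpace M] [IsManifold I ∞ M] :
    SmoothPartitionOfUnity M I M univ :=
  Classical.choose (SmoothPartitionOfUnity.exists_isSubordinate_chartAt_source I M)

variable [IsManifold I ∞ M]

section Partition

variable [T2Space M] [SigmaCompactSpace M]

theorem chartPartition_subordinate (p : M) :
    tsupport (chartPartition I M p) ⊆ (extChartAt I p).source := by
  rw [extChartAt_source]
  exact Classical.choose_spec (SmoothPartitionOfUnity.exists_isSubordinate_chartAt_source I M) p

theorem chartPartition_smul_mem {k : ℕ} {V : Set M}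
    {α : M → EuclideanSpace ℝ (Fin n) [⋀^Fin k]→L[ℝ] ℝ} (hα : α ∈ compactForms I k V) (p : M) :
    (fun x => chartPartition I M p x • α x) ∈ compactForms I k ((extChartAt I p).source ∩ V) :=
  smul_mem_compactForms hα (chartPartition I M p).contMDiff
    (inter_subset_inter_left _ (chartPartition_subordinate p))

/-- On a compact set, the partition of unity is a finite sum. -/
theorem finite_chartPartition {K : Set M} (hK : IsCompact K) :
    ∃ F : Finset M, (∀ x ∈ K, ∀ p ∉ F, chartPartition I M p x = 0) ∧
      ∀ x ∈ K, ∑ p ∈ F, chartPartition I M p x = 1 := by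
  have hfin := (chartPartition I M).locallyFinite.finite_nonempty_inter_compact hK
  have h0 : ∀ x ∈ K, ∀ p ∉ hfin.toFinset, chartPartition I M p x = 0 := by
    intro x hx p hp
    by_contra h
    exact hp (hfin.mem_toFinset.2 ⟨x, h, hx⟩)
  refine ⟨hfin.toFinset, h0, fun x hx => ?_⟩
  rw [← (chartPartition I M).sum_eq_one (mem_univ x)]
  refine (finsum_eq_sum_of_support_subset _ fun p hp => ?_).symm
  by_contra h
  exact hp (h0 x hx p h)

theorem integral_eq_sum {α : M → EuclideanSpace ℝ (Fin n) [⋀^Fin n]→L[ℝ] ℝ} {K : Set M}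
    (h0 : ∀ x ∉ K, α x = 0) {F : Finset M}
    (hF : ∀ x ∈ K, ∀ p ∉ F, chartPartition I M p x = 0) :
    integral I α = ∑ p ∈ F, chartIntegral I p (fun x => chartPartition I M p x • α x) := by
  change ∑ᶠ p : M, chartIntegral I p (fun x => chartPartition I M p x • α x) = _
  refine finsum_eq_sum_of_support_subset _ fun p hp => ?_
  by_contra h
  refine hp ?_
  have h1 : (fun x => chartPartition I M p x • α x) = 0 := by
    funext x
    by_cases hx : x ∈ K
    · rw [hF x hx p h, zero_smul]; rfl
    · rw [h0 x hx, smul_zero]; rfl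
  change chartIntegral I p (fun x => chartPartition I M p x • α x) = 0
  rw [h1, chartIntegral, chartRep_zero]
  simp

end Partition

/-- Change of variables between a chart of an oriented atlas and a positively oriented
parametrization. -/
theorem chartIntegral_eq_setIntegral (hM : IsOrientedAtlas I M) {p : M}
    {α : M → EuclideanSpace ℝ (Fin n) [⋀^Fin n]→L[ℝ] ℝ}
    (hα : α ∈ compactForms I n (extChartAt I p).source)
    {S : Set (EuclideanSpace ℝ (Fin n))} (hS : MeasurableSet S)
    {Ψ : EuclideanSpace ℝ (Fin n) → M}
    {Ψ' : EuclideanSpace ℝ (Fin n) → EuclideanSpace ℝ (Fin n) →L[ℝ] EuclideanSpace ℝ (Fin n)}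
    (hΨ : ∀ y ∈ S, HasMFDerivWithinAt 𝓘(ℝ, EuclideanSpace ℝ (Fin n)) I Ψ S y (Ψ' y))
    (hdet : ∀ y ∈ S, 0 < (Ψ' y).det) (hinj : InjOn Ψ S)
    (hsupp : ∀ x, α x ≠ 0 → x ∈ Ψ '' S) :
    IntegrableOn (fun y => (α (Ψ y)).compContinuousLinearMap (Ψ' y) (stdBasis n)) S ∧
    chartIntegral I p α =
      ∫ y in S, (α (Ψ y)).compContinuousLinearMap (Ψ' y) (stdBasis n) := by
  have : IsManifold I 1 M := IsManifold.of_le (m := 1) (n := ∞) (by simp)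
  -- the transition `T` from the parametrization to the chart is defined on `A`
  set A : Set (EuclideanSpace ℝ (Fin n)) := S ∩ Ψ ⁻¹' (extChartAt I p).source with hA
  set T : EuclideanSpace ℝ (Fin n) → EuclideanSpace ℝ (Fin n) := extChartAt I p ∘ Ψ with hT
  let T' : EuclideanSpace ℝ (Fin n) → EuclideanSpace ℝ (Fin n) →L[ℝ] EuclideanSpace ℝ (Fin n) :=
    fun y => (chartDeriv I p (Ψ y)).comp (Ψ' y)
  have hcont : ContinuousOn Ψ S := fun y hy => (hΨ y hy).continuousWithinAt
  have hAm : MeasurableSet A := by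
    obtain ⟨O, hO, hAO⟩ := continuousOn_iff'.1 hcont _ (isOpen_extChartAt_source (I := I) p)
    rw [hA, inter_comm, hAO]
    exact hO.measurableSet.inter hS
  have hTd : ∀ y ∈ A, HasFDerivWithinAt T (T' y) A y := by
    intro y hy
    have h1 : HasMFDerivAt I 𝓘(ℝ, EuclideanSpace ℝ (Fin n)) (extChartAt I p) (Ψ y)
        (chartDeriv I p (Ψ y)) :=
      (mdifferentiableAt_extChartAt (by rw [← extChartAt_source I]; exact hy.2)).hasMFDerivAt
    have h2 : HasMFDerivWithinAt 𝓘(ℝ, EuclideanSpace ℝ (Fin n)) 𝓘(ℝ, EuclideanSpace ℝ (Fin n))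
      T A y ((chartDeriv I p (Ψ y)).comp (Ψ' y)) :=
      h1.comp_hasMFDerivWithinAt y ((hΨ y hy.1).mono inter_subset_left)
    exact h2.hasFDerivWithinAt
  have hTinj : InjOn T A := fun y hy z hz h =>
    hinj hy.1 hz.1 ((extChartAt I p).injOn hy.2 hz.2 h)
  have hTt : T '' A ⊆ (extChartAt I p).target := by
    rintro _ ⟨y, hy, rfl⟩
    exact (extChartAt I p).map_source hy.2
  have hdetT : ∀ y ∈ A, 0 < (T' y).det := by
    intro y hy
    rw [show (T' y).det = (chartDeriv I p (Ψ y)).det * (Ψ' y).det from LinearMap.det_comp _ _]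
    exact mul_pos (chartDeriv_det_pos hM hy.2) (hdet y hy.1)
  set g : EuclideanSpace ℝ (Fin n) → ℝ := fun y => chartRep I α p y (stdBasis n) with hg
  set w : EuclideanSpace ℝ (Fin n) → ℝ :=
    fun y => (α (Ψ y)).compContinuousLinearMap (Ψ' y) (stdBasis n) with hw
  have hgw : ∀ y ∈ A, |(T' y).det| • g (T y) = w y := by
    intro y hy
    rw [abs_of_pos (hdetT y hy), smul_eq_mul, hg, hw]
    simp only
    rw [← comp_stdBasis, chartRep,
      show (extChartAt I p).symm (T y) = Ψ y from (extChartAt I p).left_inv hy.2]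
    have h1 := chartSymmDeriv_comp_chartDeriv (I := I) hy.2
    have h2 : (chartSymmDeriv I p (T y)).comp (T' y) = Ψ' y := by
      change (chartSymmDeriv I p (extChartAt I p (Ψ y))).comp
        ((chartDeriv I p (Ψ y)).comp (Ψ' y)) = Ψ' y
      rw [← ContinuousLinearMap.comp_assoc, h1, ContinuousLinearMap.id_comp]
    rw [← h2]
    rfl
  have hg0 : ∀ y ∈ (extChartAt I p).target \ T '' A, g y = 0 := by
    rintro y ⟨hy, hyA⟩
    have h1 : α ((extChartAt I p).symm y) = 0 := by
      by_contra h
      obtain ⟨z, hz, hzy⟩ := hsupp _ h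
      refine hyA ⟨z, ⟨hz, ?_⟩, ?_⟩
      · rw [mem_preimage, hzy]
        exact (extChartAt I p).map_target hy
      · rw [hT, Function.comp_apply, hzy, (extChartAt I p).right_inv hy]
    rw [hg]
    simp only
    rw [chartRep_of_eq_zero h1]
    rfl
  have hw0 : ∀ y ∈ S \ A, w y = 0 := by
    rintro y ⟨hy, hyA⟩
    have h1 : α (Ψ y) = 0 := by
      obtain ⟨K, -, hKs, h0⟩ := hα.2
      exact h0 _ fun h => hyA ⟨hy, hKs h⟩
    rw [hw]
    simp only
    rw [h1]
    rfl
  have hgi : IntegrableOn g (T '' A) := (integrableOn_chartRep hα).mono_set hTt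
  have hwi : IntegrableOn w A := by
    rw [integrableOn_image_iff_integrableOn_abs_det_fderiv_smul volume hAm hTd hTinj] at hgi
    exact hgi.congr_fun hgw hAm
  refine ⟨IntegrableOn.of_forall_sdiff_eq_zero hwi hS hw0, ?_⟩
  calc chartIntegral I p α = ∫ y in (extChartAt I p).target, g y := rfl
    _ = ∫ y in T '' A, g y := setIntegral_eq_of_subset_of_forall_sdiff_eq_zero
        (measurableSet_extChartAt_target p) hTt hg0
    _ = ∫ y in A, |(T' y).det| • g (T y) :=
        integral_image_eq_integral_abs_det_fderiv_smul volume hAm hTd hTinj g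
    _ = ∫ y in A, w y := setIntegral_congr_fun hAm hgw
    _ = ∫ y in S, w y := (setIntegral_eq_of_subset_of_forall_sdiff_eq_zero hS
        inter_subset_left hw0).symm

variable [T2Space M] [SigmaCompactSpace M]

/-- The integral of a compactly supported form of top degree is computed by any positively oriented
parametrization of a set that contains its support. -/
theorem integral_eq_setIntegral (hM : IsOrientedAtlas I M) {V : Set M}
    {α : M → EuclideanSpace ℝ (Fin n) [⋀^Fin n]→L[ℝ] ℝ} (hα : α ∈ compactForms I n V)
    {S : Set (EuclideanSpace ℝ (Fin n))} (hS : MeasurableSet S)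
    {Ψ : EuclideanSpace ℝ (Fin n) → M}
    {Ψ' : EuclideanSpace ℝ (Fin n) → EuclideanSpace ℝ (Fin n) →L[ℝ] EuclideanSpace ℝ (Fin n)}
    (hΨ : ∀ y ∈ S, HasMFDerivWithinAt 𝓘(ℝ, EuclideanSpace ℝ (Fin n)) I Ψ S y (Ψ' y))
    (hdet : ∀ y ∈ S, 0 < (Ψ' y).det) (hinj : InjOn Ψ S)
    (hsupp : ∀ x, α x ≠ 0 → x ∈ Ψ '' S) :
    integral I α = ∫ y in S, (α (Ψ y)).compContinuousLinearMap (Ψ' y) (stdBasis n) := by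
  obtain ⟨K, hK, -, h0⟩ := hα.2
  obtain ⟨F, hF0, hF1⟩ := finite_chartPartition (I := I) hK
  rw [integral_eq_sum h0 hF0]
  have hp : ∀ p, IntegrableOn (fun y => chartPartition I M p (Ψ y) •
        (α (Ψ y)).compContinuousLinearMap (Ψ' y) (stdBasis n)) S ∧
      chartIntegral I p (fun x => chartPartition I M p x • α x) =
        ∫ y in S, chartPartition I M p (Ψ y) •
          (α (Ψ y)).compContinuousLinearMap (Ψ' y) (stdBasis n) := fun p =>
    chartIntegral_eq_setIntegral hM (compactForms_le_compactForms inter_subset_left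
      (chartPartition_smul_mem hα p)) hS hΨ hdet hinj
      (fun x hx => hsupp x fun h => hx (by rw [h, smul_zero]))
  rw [Finset.sum_congr rfl fun p _ => (hp p).2, ← integral_finsetSum _ fun p _ => (hp p).1]
  refine setIntegral_congr_fun hS fun y _ => ?_
  simp only [smul_eq_mul]
  rw [← Finset.sum_mul]
  by_cases hy : Ψ y ∈ K
  · rw [hF1 _ hy, one_mul]
  · rw [h0 _ hy]
    exact mul_zero _

theorem integral_add {V : Set M} {α β : M → EuclideanSpace ℝ (Fin n) [⋀^Fin n]→L[ℝ] ℝ}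
    (hα : α ∈ compactForms I n V) (hβ : β ∈ compactForms I n V) :
    integral I (fun x => α x + β x) = integral I α + integral I β := by
  obtain ⟨K, hK, -, hK0⟩ := hα.2
  obtain ⟨L, hL, -, hL0⟩ := hβ.2
  obtain ⟨F, hF0, -⟩ := finite_chartPartition (I := I) (hK.union hL)
  have h1 : ∀ x ∉ K ∪ L, α x = 0 := fun x hx => hK0 x fun h => hx (Or.inl h)
  have h2 : ∀ x ∉ K ∪ L, β x = 0 := fun x hx => hL0 x fun h => hx (Or.inr h)
  rw [integral_eq_sum h1 hF0, integral_eq_sum h2 hF0,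
    integral_eq_sum (K := K ∪ L) (fun x hx => by rw [h1 x hx, h2 x hx, add_zero]) hF0,
    ← Finset.sum_add_distrib]
  refine Finset.sum_congr rfl fun p _ => ?_
  have hα' := integrableOn_chartRep (compactForms_le_compactForms inter_subset_left
    (chartPartition_smul_mem hα p))
  have hβ' := integrableOn_chartRep (compactForms_le_compactForms inter_subset_left
    (chartPartition_smul_mem hβ p))
  rw [chartIntegral, chartIntegral, chartIntegral, ← MeasureTheory.integral_add hα' hβ']
  refine integral_congr_ae (Filter.Eventually.of_forall fun y => ?_)
  simp only [chartRep, smul_add]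
  rfl

theorem integral_smul (c : ℝ) (α : M → EuclideanSpace ℝ (Fin n) [⋀^Fin n]→L[ℝ] ℝ) :
    integral I (fun x => c • α x) = c * integral I α := by
  change ∑ᶠ p : M, chartIntegral I p (fun x => chartPartition I M p x • c • α x) =
    c * ∑ᶠ p : M, chartIntegral I p (fun x => chartPartition I M p x • α x)
  rw [← smul_eq_mul, smul_finsum]
  refine finsum_congr fun p => ?_
  rw [smul_eq_mul, chartIntegral, chartIntegral, ← MeasureTheory.integral_const_mul]
  refine integral_congr_ae (Filter.Eventually.of_forall fun y => ?_)
  simp only [chartRep]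
  rw [smul_comm]
  rfl

theorem integral_zero : integral I (0 : M → EuclideanSpace ℝ (Fin n) [⋀^Fin n]→L[ℝ] ℝ) = 0 := by
  have h := integral_smul (I := I) 0 (0 : M → EuclideanSpace ℝ (Fin n) [⋀^Fin n]→L[ℝ] ℝ)
  have e : (fun x => (0 : ℝ) • (0 : M → EuclideanSpace ℝ (Fin n) [⋀^Fin n]→L[ℝ] ℝ) x) = 0 :=
    funext fun x => zero_smul ℝ _
  rwa [e, zero_mul] at h

theorem integral_neg (α : M → EuclideanSpace ℝ (Fin n) [⋀^Fin n]→L[ℝ] ℝ) :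
    integral I (fun x => -α x) = -integral I α := by
  have h := integral_smul (I := I) (-1) α
  have e : (fun x => (-1 : ℝ) • α x) = fun x => -α x := funext fun x => by ext v; simp
  rwa [e, neg_one_mul] at h

/-- The integral of a form that is supported in a chart domain is the integral in this chart. -/
theorem integral_eq_chartIntegral (hM : IsOrientedAtlas I M) {p : M}
    {α : M → EuclideanSpace ℝ (Fin n) [⋀^Fin n]→L[ℝ] ℝ}
    (hα : α ∈ compactForms I n (extChartAt I p).source) :
    integral I α = chartIntegral I p α := by
  have : IsManifold I 1 M := IsManifold.of_le (m := 1) (n := ∞) (by simp)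
  obtain ⟨K, hK, hKs, h0⟩ := hα.2
  refine integral_eq_setIntegral hM hα (measurableSet_extChartAt_target p)
    (Ψ' := chartSymmDeriv I p) (fun y hy => ?_) (fun y hy => chartSymmDeriv_det_pos hM hy)
    (extChartAt I p).symm.injOn (fun x hx => ?_)
  · exact ((mdifferentiableWithinAt_extChartAt_symm hy).hasMFDerivWithinAt).mono
      (extChartAt_target_subset_range p)
  · have hxs : x ∈ (extChartAt I p).source := by
      by_contra h
      exact hx (h0 x fun h' => h (hKs h'))
    exact ⟨extChartAt I p x, (extChartAt I p).map_source hxs, (extChartAt I p).left_inv hxs⟩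

end ChangeOfVariables

/-! ### Wedge products and the product rule -/

noncomputable section ProductRule

open Filter

variable {E : Type v} [NormedAddCommGroup E] [NormedSpace ℝ E]

theorem wedge_apply (a b : E [⋀^Fin 1]→L[ℝ] ℝ) (v : Fin 2 → E) :
    wedge a b v = a ![v 0] * b ![v 1] - a ![v 1] * b ![v 0] := by
  rw [wedge, ContinuousAlternatingMap.alternatizeUncurryFin_apply]
  have h0 : Fin.removeNth (0 : Fin 2) v = ![v 1] := by
    funext i; fin_cases i; rfl
  have h1 : Fin.removeNth (1 : Fin 2) v = ![v 0] := by
    funext i; fin_cases i; rfl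
  have h (w : E) : (fun _ : Fin 1 => w) = ![w] := by
    funext i; fin_cases i; rfl
  have hs (w : E) (u : Fin 1 → E) :
      (((ContinuousAlternatingMap.ofSubsingleton ℝ E ℝ (0 : Fin 1)).symm a).smulRight b) w u =
        a ![w] * b u := by
    rw [← h]
    rfl
  refine (Fin.sum_univ_two _).trans ?_
  rw [h0, h1, hs, hs]
  simp [sub_eq_add_neg]

theorem wedge_comm (a b : E [⋀^Fin 1]→L[ℝ] ℝ) : wedge a b = -wedge b a := by
  ext v
  rw [ContinuousAlternatingMap.neg_apply, wedge_apply, wedge_apply]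
  ring

theorem wedge_add_left (a a' b : E [⋀^Fin 1]→L[ℝ] ℝ) :
    wedge (a + a') b = wedge a b + wedge a' b := by
  ext v
  simp only [ContinuousAlternatingMap.add_apply, wedge_apply]
  ring

theorem wedge_smul_left (c : ℝ) (a b : E [⋀^Fin 1]→L[ℝ] ℝ) :
    wedge (c • a) b = c • wedge a b := by
  ext v
  simp only [ContinuousAlternatingMap.smul_apply, wedge_apply, smul_eq_mul]
  ring

theorem wedge_zero_left (b : E [⋀^Fin 1]→L[ℝ] ℝ) : wedge 0 b = 0 := by
  ext v
  simp [wedge_apply]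

theorem wedge_zero_right (a : E [⋀^Fin 1]→L[ℝ] ℝ) : wedge a 0 = 0 := by
  ext v
  simp [wedge_apply]

theorem wedge_compContinuousLinearMap {F : Type v} [NormedAddCommGroup F] [NormedSpace ℝ F]
    (a b : E [⋀^Fin 1]→L[ℝ] ℝ) (A : F →L[ℝ] E) :
    (wedge a b).compContinuousLinearMap A =
      wedge (a.compContinuousLinearMap A) (b.compContinuousLinearMap A) := by
  ext v
  have h (w : F) : A ∘ ![w] = ![A w] := by
    funext i; fin_cases i; rfl
  simp only [ContinuousAlternatingMap.compContinuousLinearMap_apply, wedge_apply, h]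
  rfl

variable {H : Type v} [TopologicalSpace H]
  {I : ModelWithCorners ℝ E H} {M : Type u} [TopologicalSpace M] [ChartedSpace H M]

theorem IsSmoothForm.wedge {α β : M → E [⋀^Fin 1]→L[ℝ] ℝ} (hα : IsSmoothForm I α)
    (hβ : IsSmoothForm I β) : IsSmoothForm I (fun x => wedge (α x) (β x)) := by
  intro x₀
  let L : (E →L[ℝ] ℝ) ≃ₗᵢ[ℝ] (E [⋀^Fin 1]→L[ℝ] ℝ) :=
    ContinuousAlternatingMap.ofSubsingletonLIE (0 : Fin 1)
  have h1 : ContDiffOn ℝ ∞ (fun y => L.symm (chartRep I α x₀ y)) (extChartAt I x₀).target :=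
    L.symm.contDiff.comp_contDiffOn (hα x₀)
  have h2 := (ContinuousAlternatingMap.alternatizeUncurryFinCLM ℝ E ℝ).contDiff.comp_contDiffOn
    (h1.smulRight (hβ x₀))
  refine h2.congr fun y _ => ?_
  exact wedge_compContinuousLinearMap _ _ _

theorem wedge_mem_compactForms {V : Set M} {α β : M → E [⋀^Fin 1]→L[ℝ] ℝ}
    (hα : α ∈ compactForms I 1 V) (hβ : IsSmoothForm I β) :
    (fun x => wedge (α x) (β x)) ∈ compactForms I 2 V := by
  obtain ⟨hs, K, hK, hKV, h0⟩ := hα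
  exact ⟨hs.wedge hβ, K, hK, hKV, fun x hx => by
    change wedge (α x) (β x) = 0
    rw [h0 x hx, wedge_zero_left]⟩

variable [IsManifold I ∞ M]

theorem chartRep_self {k : ℕ} (α : M → E [⋀^Fin k]→L[ℝ] ℝ) (x : M) :
    chartRep I α x (extChartAt I x x) = α x := by
  have : IsManifold I 1 M := IsManifold.of_le (m := 1) (n := ∞) (by simp)
  rw [chartRep, mfderivWithin_range_extChartAt_symm, extChartAt_to_inv]
  rfl

theorem fderivWithin_comp_extChartAt_symm {f : M → ℝ} {x : M}
    (hf : MDifferentiableAt I 𝓘(ℝ, ℝ) f x) :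
    fderivWithin ℝ (f ∘ (extChartAt I x).symm) (range I) (extChartAt I x x) = dAt I f x := by
  rw [dAt, hf.mfderiv]
  rfl

/-- The product rule for the exterior derivative. -/
theorem extD_fun_smul {f : M → ℝ} (hf : ContMDiff I 𝓘(ℝ, ℝ) ∞ f)
    {β : M → E [⋀^Fin 1]→L[ℝ] ℝ} (hβ : IsSmoothForm I β) (x : M) :
    extD I (fun y => f y • β y) x = wedge (oneForm (dAt I f x)) (β x) + f x • extD I β x := by
  have hx := mem_extChartAt_target (I := I) x
  have hr := extChartAt_target_subset_range x hx
  have hfd : DifferentiableWithinAt ℝ (f ∘ (extChartAt I x).symm) (range I) (extChartAt I x x) :=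
    (((contDiffOn_comp_extChartAt_symm hf x) _ hx).mono_of_mem_nhdsWithin
      (extChartAt_target_mem_nhdsWithin_of_mem hx)).differentiableWithinAt (by simp)
  have hβd : DifferentiableWithinAt ℝ (chartRep I β x) (range I) (extChartAt I x x) :=
    (hβ.contDiffWithinAt hx).differentiableWithinAt (by simp)
  have h : fderivWithin ℝ (chartRep I (fun y => f y • β y) x) (range I) (extChartAt I x x) =
      f x • fderivWithin ℝ (chartRep I β x) (range I) (extChartAt I x x) +
        (dAt I f x).smulRight (β x) := by
    have h1 := fderivWithin_fun_smul (I.uniqueDiffOn _ hr) hfd hβd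
    rw [fderivWithin_comp_extChartAt_symm (hf.mdifferentiableAt (by simp)), chartRep_self,
      Function.comp_apply, extChartAt_to_inv] at h1
    exact h1
  change ContinuousAlternatingMap.alternatizeUncurryFin _ = _
  rw [h, ContinuousAlternatingMap.alternatizeUncurryFin_add,
    ContinuousAlternatingMap.alternatizeUncurryFin_smul]
  exact add_comm _ _

end ProductRule

/-! ### The divergence theorem on the half plane, and forms in a chart -/

noncomputable section Stokes

open MeasureTheory Filter

section Plane

/-- The plane `ℝ × ℝ` as a Euclidean space. -/
def planeEquiv : (ℝ × ℝ) ≃L[ℝ] EuclideanSpace ℝ (Fin 2) :=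
  (ContinuousLinearEquiv.finTwoArrow ℝ ℝ).symm.trans (EuclideanSpace.equiv (Fin 2) ℝ).symm

theorem planeEquiv_apply_zero (z : ℝ × ℝ) : planeEquiv z 0 = z.1 := rfl

theorem planeEquiv_apply_one (z : ℝ × ℝ) : planeEquiv z 1 = z.2 := rfl

theorem planeEquiv_fst : planeEquiv (1, 0) = stdBasis 2 0 := by
  ext i
  fin_cases i <;> simp [planeEquiv_apply_zero, planeEquiv_apply_one]

theorem planeEquiv_snd : planeEquiv (0, 1) = stdBasis 2 1 := by
  ext i
  fin_cases i <;> simp [planeEquiv_apply_zero, planeEquiv_apply_one]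

theorem measurePreserving_planeEquiv : MeasurePreserving planeEquiv :=
  (PiLp.volume_preserving_toLp (Fin 2)).comp (volume_preserving_finTwoArrow ℝ).symm

theorem setIntegral_planeEquiv (g : EuclideanSpace ℝ (Fin 2) → ℝ)
    (s : Set (EuclideanSpace ℝ (Fin 2))) :
    ∫ z in planeEquiv ⁻¹' s, g (planeEquiv z) = ∫ y in s, g y :=
  measurePreserving_planeEquiv.setIntegral_preimage_emb
    planeEquiv.toHomeomorph.measurableEmbedding g s

/-- The divergence theorem on the half plane `{(r, x) | 0 ≤ r}` for a compactly supported vector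
field that is tangent to the boundary. -/
theorem setIntegral_halfPlane_divergence_eq_zero {f g : ℝ × ℝ → ℝ}
    {f' g' : ℝ × ℝ → ℝ × ℝ →L[ℝ] ℝ} {K : Set (ℝ × ℝ)} (hK : IsCompact K)
    (hf : ∀ z : ℝ × ℝ, 0 ≤ z.1 → HasFDerivWithinAt f (f' z) {z | 0 ≤ z.1} z)
    (hg : ∀ z : ℝ × ℝ, 0 ≤ z.1 → HasFDerivWithinAt g (g' z) {z | 0 ≤ z.1} z)
    (hc : ContinuousOn (fun z => f' z (1, 0) + g' z (0, 1)) {z | 0 ≤ z.1})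
    (hf0 : ∀ z ∉ K, f z = 0) (hg0 : ∀ z ∉ K, g z = 0)
    (hd0 : ∀ z ∉ K, 0 ≤ z.1 → f' z (1, 0) + g' z (0, 1) = 0) (hb : ∀ x, f (0, x) = 0) :
    ∫ z in {z : ℝ × ℝ | 0 ≤ z.1}, (f' z (1, 0) + g' z (0, 1)) = 0 := by
  obtain ⟨R, hR0, hR⟩ : ∃ R > 0, K ⊆ Metric.ball 0 R := by
    obtain ⟨R, hR⟩ := hK.isBounded.subset_ball 0
    exact ⟨max R 1, by positivity, hR.trans (Metric.ball_subset_ball (le_max_left _ _))⟩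
  have hbound : ∀ z ∈ K, |z.1| < R ∧ |z.2| < R := by
    intro z hz
    have := hR hz
    rw [mem_ball_zero_iff, Prod.norm_def, max_lt_iff] at this
    exact this
  have hsub : Icc ((0 : ℝ), -R) (R, R) ⊆ {z : ℝ × ℝ | 0 ≤ z.1} := fun z hz => hz.1.1
  have hnhds : ∀ z ∈ Ioo (0 : ℝ) R ×ˢ Ioo (-R) R, {z : ℝ × ℝ | 0 ≤ z.1} ∈ 𝓝 z := fun z hz =>
    mem_of_superset ((isOpen_lt continuous_const continuous_fst).mem_nhds hz.1.1)
      fun w (hw : 0 < w.1) => hw.le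
  have h := integral_divergence_prod_Icc_of_hasFDerivAt_of_le f g f' g' (0, -R) (R, R)
    ⟨hR0.le, by simp only; linarith⟩
    (fun z hz => ((hf z (hsub hz)).continuousWithinAt).mono hsub)
    (fun z hz => ((hg z (hsub hz)).continuousWithinAt).mono hsub)
    (fun z hz => (hf z hz.1.1.le).hasFDerivAt (hnhds z hz))
    (fun z hz => (hg z hz.1.1.le).hasFDerivAt (hnhds z hz))
    ((hc.mono hsub).integrableOn_compact isCompact_Icc)
  have e1 : ∀ x, g (x, R) = 0 := fun x => hg0 _ fun hz => by
    have := (hbound _ hz).2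
    rw [abs_of_pos hR0] at this
    exact lt_irrefl _ this
  have e2 : ∀ x, g (x, -R) = 0 := fun x => hg0 _ fun hz => by
    have := (hbound _ hz).2
    rw [abs_neg, abs_of_pos hR0] at this
    exact lt_irrefl _ this
  have e3 : ∀ y, f (R, y) = 0 := fun x => hf0 _ fun hz => by
    have := (hbound _ hz).1
    rw [abs_of_pos hR0] at this
    exact lt_irrefl _ this
  simp only [e1, e2, e3, hb, intervalIntegral.integral_zero, sub_zero, add_zero] at h
  refine Eq.trans ?_ h
  refine setIntegral_eq_of_subset_of_forall_sdiff_eq_zero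
    (measurableSet_le measurable_const measurable_fst) hsub fun z hz =>
    hd0 z (fun hzK => hz.2 ?_) hz.1
  obtain ⟨h1, h2⟩ := hbound z hzK
  rw [abs_lt] at h1 h2
  exact ⟨⟨hz.1, h2.1.le⟩, ⟨h1.2.le, h2.2.le⟩⟩

end Plane

variable {n : ℕ} {H : Type} [TopologicalSpace H]
  {I : ModelWithCorners ℝ (EuclideanSpace ℝ (Fin n)) H} {M : Type u} [TopologicalSpace M]
  [ChartedSpace H M] [IsManifold I ∞ M] [T2Space M]

/-- In a chart, a form with compact support in the chart domain is the restriction of a compactly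
supported smooth form on the model space. -/
theorem exists_chartRep_extension {k : ℕ} {p : M}
    {γ : M → EuclideanSpace ℝ (Fin n) [⋀^Fin k]→L[ℝ] ℝ}
    (hγ : γ ∈ compactForms I k (extChartAt I p).source) :
    ∃ (w : EuclideanSpace ℝ (Fin n) → EuclideanSpace ℝ (Fin n) [⋀^Fin k]→L[ℝ] ℝ)
      (K : Set (EuclideanSpace ℝ (Fin n))), IsCompact K ∧ K ⊆ (extChartAt I p).target ∧
      ContDiffOn ℝ ∞ w (range I) ∧
      (∀ y ∉ K, w y = 0) ∧ (∀ y ∉ K, extDerivWithin w (range I) y = 0) ∧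
      (∀ y ∈ (extChartAt I p).target, w y = chartRep I γ p y) ∧
      ∀ y ∈ (extChartAt I p).target, extDerivWithin w (range I) y = chartRep I (extD I γ) p y := by
  classical
  obtain ⟨K, hK, hKs, h0⟩ := hγ.2
  have hKc : IsCompact (extChartAt I p '' K) :=
    hK.image_of_continuousOn ((continuousOn_extChartAt p).mono hKs)
  have hKt : extChartAt I p '' K ⊆ (extChartAt I p).target := by
    rintro _ ⟨x, hx, rfl⟩
    exact (extChartAt I p).map_source (hKs hx)
  let w : EuclideanSpace ℝ (Fin n) → EuclideanSpace ℝ (Fin n) [⋀^Fin k]→L[ℝ] ℝ :=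
    fun y => if y ∈ (extChartAt I p).target then chartRep I γ p y else 0
  have hw1 : ∀ y ∈ (extChartAt I p).target, w y = chartRep I γ p y := fun y hy => if_pos hy
  have hw0 : ∀ y ∉ extChartAt I p '' K, w y = 0 := by
    intro y hy
    by_cases hyt : y ∈ (extChartAt I p).target
    · rw [hw1 y hyt, chartRep_of_eq_zero (h0 _ fun h => hy ⟨_, h, (extChartAt I p).right_inv hyt⟩)]
    · exact if_neg hyt
  have hev : ∀ y ∈ (extChartAt I p).target, w =ᶠ[𝓝[range I] y] chartRep I γ p := fun y hy => by
    filter_upwards [extChartAt_target_mem_nhdsWithin_of_mem hy] with z hz using hw1 z hz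
  have hev0 : ∀ y ∉ extChartAt I p '' K, w =ᶠ[𝓝 y] fun _ => 0 := fun y hy => by
    filter_upwards [hKc.isClosed.isOpen_compl.mem_nhds hy] with z hz using hw0 z hz
  refine ⟨w, _, hKc, hKt, fun y hy => ?_, hw0, fun y hy => ?_, hw1, fun y hy => ?_⟩
  · by_cases hyK : y ∈ extChartAt I p '' K
    · exact (hγ.1.contDiffWithinAt (hKt hyK)).congr_of_eventuallyEq (hev y (hKt hyK))
        (hw1 y (hKt hyK))
    · exact (contDiffWithinAt_const (c := (0 : EuclideanSpace ℝ (Fin n) [⋀^Fin k]→L[ℝ] ℝ))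
        ).congr_of_eventuallyEq ((hev0 y hyK).filter_mono nhdsWithin_le_nhds) (hw0 y hyK)
  · rw [(hev0 y hy).extDerivWithin_eq_nhds, extDerivWithin, fderivWithin_fun_const]
    exact map_zero (ContinuousAlternatingMap.alternatizeUncurryFinCLM ℝ _ ℝ)
  · rw [(hev y hy).extDerivWithin_eq_of_mem (extChartAt_target_subset_range p hy),
      chartRep_extD hγ.1 hy]

/-- The integral over a chart is an integral over the whole range of the model. -/
theorem chartIntegral_eq_setIntegral_range {p : M}
    {α : M → EuclideanSpace ℝ (Fin n) [⋀^Fin n]→L[ℝ] ℝ}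
    {w : EuclideanSpace ℝ (Fin n) → EuclideanSpace ℝ (Fin n) [⋀^Fin n]→L[ℝ] ℝ}
    {K : Set (EuclideanSpace ℝ (Fin n))} (hK : K ⊆ (extChartAt I p).target)
    (hw0 : ∀ y ∉ K, w y = 0) (hw : ∀ y ∈ (extChartAt I p).target, w y = chartRep I α p y) :
    chartIntegral I p α = ∫ y in range I, w y (stdBasis n) := by
  have h1 : chartIntegral I p α = ∫ y in (extChartAt I p).target, w y (stdBasis n) :=
    setIntegral_congr_fun (measurableSet_extChartAt_target p) fun y hy =>
      (congrArg (fun a => a (stdBasis n)) (hw y hy)).symm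
  rw [h1]
  refine (setIntegral_eq_of_subset_of_forall_sdiff_eq_zero I.isClosed_range.measurableSet
    (extChartAt_target_subset_range p) fun y hy => ?_).symm
  rw [hw0 y fun h => hy.2 (hK h)]
  rfl

theorem extDerivWithin_apply_stdBasis_one
    {w : EuclideanSpace ℝ (Fin 1) → EuclideanSpace ℝ (Fin 1) [⋀^Fin 0]→L[ℝ] ℝ}
    {s : Set (EuclideanSpace ℝ (Fin 1))} {y : EuclideanSpace ℝ (Fin 1)}
    (hw : DifferentiableWithinAt ℝ w s y) (hs : UniqueDiffWithinAt ℝ s y) :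
    extDerivWithin w s y (stdBasis 1) =
      fderivWithin ℝ (fun z => w z ![]) s y (stdBasis 1 0) := by
  rw [extDerivWithin_apply hw hs]
  simp only [Nat.reduceAdd, Finset.univ_unique, Fin.default_eq_zero, Finset.sum_singleton,
    Fin.val_zero, pow_zero, one_smul]
  have : Fin.removeNth (0 : Fin 1) (stdBasis 1) = ![] := Subsingleton.elim _ _
  rw [this]

theorem extDerivWithin_apply_two {F : Type*} [NormedAddCommGroup F] [NormedSpace ℝ F]
    {w : F → F [⋀^Fin 1]→L[ℝ] ℝ} {s : Set F} {y : F} (hw : DifferentiableWithinAt ℝ w s y)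
    (hs : UniqueDiffWithinAt ℝ s y) (v : Fin 2 → F) :
    extDerivWithin w s y v = fderivWithin ℝ (fun z => w z ![v 1]) s y (v 0) -
      fderivWithin ℝ (fun z => w z ![v 0]) s y (v 1) := by
  rw [extDerivWithin_apply hw hs]
  have h0 : Fin.removeNth (0 : Fin 2) v = ![v 1] := by
    funext i; fin_cases i; rfl
  have h1 : Fin.removeNth (1 : Fin 2) v = ![v 0] := by
    funext i; fin_cases i; rfl
  refine (Fin.sum_univ_two _).trans ?_
  rw [h0, h1]
  simp [sub_eq_add_neg]

end Stokes

/-! ### Stokes' theorem -/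

noncomputable section StokesTheorem

open MeasureTheory Filter

theorem ContDiffOn.alternating_apply {E F : Type*} [NormedAddCommGroup E] [NormedSpace ℝ E]
    [NormedAddCommGroup F] [NormedSpace ℝ F] {k : ℕ} {w : F → E [⋀^Fin k]→L[ℝ] ℝ} {s : Set F}
    (hw : ContDiffOn ℝ ∞ w s) (v : Fin k → E) : ContDiffOn ℝ ∞ (fun y => w y v) s :=
  (ContinuousAlternatingMap.apply ℝ E ℝ v).contDiff.comp_contDiffOn hw

/-- Stokes' theorem in a chart of a curve. -/
theorem chartIntegral_extD_curve {N : Type u} [TopologicalSpace N] [T2Space N]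
    [ChartedSpace E1 N] [IsManifold (𝓡 1) ∞ N] {p : N} {γ : N → E1 [⋀^Fin 0]→L[ℝ] ℝ}
    (hγ : γ ∈ compactForms (𝓡 1) 0 (extChartAt (𝓡 1) p).source) :
    chartIntegral (𝓡 1) p (extD (𝓡 1) γ) = 0 := by
  obtain ⟨w, K, hK, hKt, hw, hw0, hwd0, -, hwd⟩ := exists_chartRep_extension hγ
  have hr : range (𝓡 1) = univ := by simp
  rw [chartIntegral_eq_setIntegral_range hKt hwd0 hwd]
  rw [hr] at hw hwd0 ⊢
  set f : E1 → ℝ := fun y => w y ![] with hf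
  have hfc : ContDiff ℝ ∞ f := contDiffOn_univ.1 (hw.alternating_apply _)
  have hfs : HasCompactSupport f := HasCompactSupport.intro hK fun y hy => by
    rw [hf]
    simp only
    rw [hw0 y hy]
    rfl
  have hder : ∀ y, extDerivWithin w univ y (stdBasis 1) = fderiv ℝ f y (stdBasis 1 0) := by
    intro y
    rw [extDerivWithin_apply_stdBasis_one ((hw y (mem_univ y)).differentiableWithinAt (by simp))
      uniqueDiffWithinAt_univ, fderivWithin_univ]
  have hfd : Continuous (fun y => fderiv ℝ f y (stdBasis 1 0)) :=
    (hfc.continuous_fderiv (by simp)).clm_apply continuous_const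
  have hfi : Integrable (fun y => fderiv ℝ f y (stdBasis 1 0)) :=
    hfd.integrable_of_hasCompactSupport ((hfs.fderiv_apply (𝕜 := ℝ) (stdBasis 1 0)))
  have h := integral_mul_fderiv_eq_neg_fderiv_mul_of_integrable (μ := (volume : Measure E1))
    (f := fun _ => (1 : ℝ)) (g := f) (v := stdBasis 1 0) (by simp) (by simpa using hfi)
    (by simpa using hfc.continuous.integrable_of_hasCompactSupport hfs) (by simp)
    (fun x _ => hfc.differentiable (by simp) x)
  simp only [hder, setIntegral_univ]
  simpa using h

theorem range_halfPlane_preimage :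
    planeEquiv ⁻¹' (range (𝓡∂ 2)) = {z : ℝ × ℝ | 0 ≤ z.1} := by
  rw [range_modelWithCornersEuclideanHalfSpace]
  rfl

/-- Stokes' theorem in a chart of a surface: the flux through the boundary is a coefficient of the
form, which vanishes there. -/
theorem chartIntegral_extD_surface {B : Type u} [TopologicalSpace B] [T2Space B]
    [ChartedSpace (EuclideanHalfSpace 2) B] [IsManifold (𝓡∂ 2) ∞ B] {p : B}
    {γ : B → E2 [⋀^Fin 1]→L[ℝ] ℝ}
    (hγ : γ ∈ compactForms (𝓡∂ 2) 1 (extChartAt (𝓡∂ 2) p).source)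
    (hb : ∀ x ∈ (𝓡∂ 2).boundary B, γ x = 0) :
    chartIntegral (𝓡∂ 2) p (extD (𝓡∂ 2) γ) = 0 := by
  obtain ⟨w, K, hK, hKt, hw, hw0, hwd0, hwγ, hwd⟩ := exists_chartRep_extension hγ
  rw [chartIntegral_eq_setIntegral_range hKt hwd0 hwd, ← setIntegral_planeEquiv,
    range_halfPlane_preimage]
  have hrz : ∀ z : ℝ × ℝ, 0 ≤ z.1 → planeEquiv z ∈ range (𝓡∂ 2) := fun z hz => by
    rw [range_modelWithCornersEuclideanHalfSpace]
    exact hz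
  have hmaps : MapsTo planeEquiv {z : ℝ × ℝ | 0 ≤ z.1} (range (𝓡∂ 2)) := hrz
  -- the coefficients of the form and their derivatives
  let D : E2 → E2 → E2 →L[ℝ] ℝ := fun v y => fderivWithin ℝ (fun y => w y ![v]) (range (𝓡∂ 2)) y
  have hD : ∀ v y, y ∈ range (𝓡∂ 2) →
      HasFDerivWithinAt (fun y => w y ![v]) (D v y) (range (𝓡∂ 2)) y := fun v y hy =>
    (((hw.alternating_apply ![v]) y hy).differentiableWithinAt (by simp)).hasFDerivWithinAt
  have hL : ∀ v z, 0 ≤ z.1 → HasFDerivWithinAt (fun z : ℝ × ℝ => w (planeEquiv z) ![v])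
      ((D v (planeEquiv z)).comp (planeEquiv : (ℝ × ℝ) →L[ℝ] E2)) {z | 0 ≤ z.1} z :=
    fun v z hz => (hD v _ (hrz z hz)).comp z planeEquiv.hasFDerivWithinAt hmaps
  have hwd' : ∀ z : ℝ × ℝ, 0 ≤ z.1 →
      extDerivWithin w (range (𝓡∂ 2)) (planeEquiv z) (stdBasis 2) =
      ((D (stdBasis 2 1) (planeEquiv z)).comp (planeEquiv : (ℝ × ℝ) →L[ℝ] E2)) (1, 0) +
      (-((D (stdBasis 2 0) (planeEquiv z)).comp (planeEquiv : (ℝ × ℝ) →L[ℝ] E2))) (0, 1) := by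
    intro z hz
    rw [extDerivWithin_apply_two ((hw _ (hrz z hz)).differentiableWithinAt (by simp))
      ((𝓡∂ 2).uniqueDiffOn _ (hrz z hz)), sub_eq_add_neg, ← planeEquiv_fst, ← planeEquiv_snd]
    rfl
  have hmeas : MeasurableSet {z : ℝ × ℝ | 0 ≤ z.1} :=
    measurableSet_le measurable_const measurable_fst
  rw [setIntegral_congr_fun hmeas hwd']
  have hcD : ∀ v : E2, ∀ a : ℝ × ℝ, ContinuousOn (fun z : ℝ × ℝ =>
      ((D v (planeEquiv z)).comp (planeEquiv : (ℝ × ℝ) →L[ℝ] E2)) a) {z | 0 ≤ z.1} := by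
    intro v a
    have h1 : ContinuousOn (D v) (range (𝓡∂ 2)) :=
      (hw.alternating_apply ![v]).continuousOn_fderivWithin (𝓡∂ 2).uniqueDiffOn (by simp)
    exact (h1.comp planeEquiv.continuous.continuousOn hmaps).clm_apply continuousOn_const
  have hw0' : ∀ v : E2, ∀ z ∉ planeEquiv ⁻¹' K, w (planeEquiv z) ![v] = 0 := by
    intro v z hz
    rw [hw0 _ hz]
    rfl
  refine setIntegral_halfPlane_divergence_eq_zero
    (planeEquiv.toHomeomorph.isCompact_preimage.2 hK) (hL (stdBasis 2 1))
    (fun z hz => (hL (stdBasis 2 0) z hz).neg)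
    ((hcD _ _).add (hcD _ _).neg) (hw0' _)
    (fun z hz => neg_eq_zero.2 (hw0' _ z hz)) (fun z hz hz0 => ?_) (fun x => ?_)
  · rw [← hwd' z hz0, hwd0 (planeEquiv z) hz]
    rfl
  · by_cases hx : planeEquiv (0, x) ∈ (extChartAt (𝓡∂ 2) p).target
    · rw [hwγ _ hx, chartRep_of_eq_zero]
      · rfl
      · apply hb
        have hs := (extChartAt (𝓡∂ 2) p).map_target hx
        rw [extChartAt_source] at hs
        refine (ModelWithCorners.isBoundaryPoint_iff_not_isInteriorPoint _).2 fun hint => ?_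
        have h1 := interior_mono (extChartAt_target_subset_range p)
          ((ModelWithCorners.isInteriorPoint_iff_of_mem_atlas (n := ∞) (by simp)
            (chart_mem_atlas _ p) hs).1 hint)
        rw [interior_range_modelWithCornersEuclideanHalfSpace] at h1
        change 0 < (extChartAt (𝓡∂ 2) p ((extChartAt (𝓡∂ 2) p).symm (planeEquiv (0, x)))) 0 at h1
        rw [(extChartAt (𝓡∂ 2) p).right_inv hx] at h1
        exact lt_irrefl _ h1
    · rw [hw0 _ fun h => hx (hKt h)]
      rfl

variable {n : ℕ} {H : Type} [TopologicalSpace H]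
  {I : ModelWithCorners ℝ (EuclideanSpace ℝ (Fin n)) H} {M : Type u} [TopologicalSpace M]
  [ChartedSpace H M] [IsManifold I ∞ M] [T2Space M] [SigmaCompactSpace M]

variable (I) in
/-- The integral as a linear functional on compactly supported forms. -/
def integralLin (V : Set M) : compactForms I n V →ₗ[ℝ] ℝ where
  toFun α := integral I α.1
  map_add' α β := integral_add α.2 β.2
  map_smul' c α := integral_smul c α.1

/-- A compactly supported form is a finite sum of forms with support in chart domains. -/
theorem exists_sum_chartPartition {k : ℕ} {V : Set M} (α : compactForms I k V) :
    ∃ F : Finset M, α = ∑ p ∈ F, ⟨fun x => chartPartition I M p x • α.1 x,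
      compactForms_le_compactForms inter_subset_right (chartPartition_smul_mem α.2 p)⟩ := by
  obtain ⟨K, hK, -, h0⟩ := α.2.2
  obtain ⟨F, hF0, hF1⟩ := finite_chartPartition (I := I) hK
  refine ⟨F, Subtype.ext (funext fun x => ?_)⟩
  rw [AddSubmonoidClass.coe_finsetSum, Finset.sum_apply]
  simp only
  rw [← Finset.sum_smul]
  by_cases hx : x ∈ K
  · rw [hF1 x hx, one_smul]
  · rw [h0 x hx, smul_zero]

/-- The integral of a compactly supported exact form vanishes if the integrals over charts of the
derivatives of its localizations vanish. -/
theorem integral_extD_eq_zero_of_chart {k : ℕ}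
    {I : ModelWithCorners ℝ (EuclideanSpace ℝ (Fin (k + 1))) H} {M : Type u} [TopologicalSpace M]
    [ChartedSpace H M] [IsManifold I ∞ M] [T2Space M] [SigmaCompactSpace M]
    (hM : IsOrientedAtlas I M) {V : Set M}
    {γ : M → EuclideanSpace ℝ (Fin (k + 1)) [⋀^Fin k]→L[ℝ] ℝ} (hγ : γ ∈ compactForms I k V)
    (h : ∀ p, chartIntegral I p (extD I fun x => chartPartition I M p x • γ x) = 0) :
    integral I (extD I γ) = 0 := by
  obtain ⟨F, hF⟩ := exists_sum_chartPartition ⟨γ, hγ⟩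
  have h1 : integral I (extD I γ) = integralLin I V (compactD I k V ⟨γ, hγ⟩) := rfl
  rw [h1, hF, map_sum, map_sum]
  refine Finset.sum_eq_zero fun p _ => ?_
  refine Eq.trans (integral_eq_chartIntegral hM (p := p) ?_) (h p)
  have h2 := compactForms_le_compactForms inter_subset_left (chartPartition_smul_mem hγ p)
  exact (compactD I k _ ⟨_, h2⟩).2

/-- Stokes' theorem on a curve (without boundary). -/
theorem integral_extD_curve {N : Type u} [TopologicalSpace N] [T2Space N] [SigmaCompactSpace N]
    [ChartedSpace E1 N] [IsManifold (𝓡 1) ∞ N] (hN : IsOrientedAtlas (𝓡 1) N) {V : Set N}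
    {γ : N → E1 [⋀^Fin 0]→L[ℝ] ℝ} (hγ : γ ∈ compactForms (𝓡 1) 0 V) :
    integral (𝓡 1) (extD (𝓡 1) γ) = 0 :=
  integral_extD_eq_zero_of_chart hN hγ fun p => chartIntegral_extD_curve
    (compactForms_le_compactForms inter_subset_left (chartPartition_smul_mem hγ p))

/-- Stokes' theorem on a surface for `1`-forms that vanish at the boundary. -/
theorem integral_extD_surface {B : Type u} [TopologicalSpace B] [T2Space B] [SigmaCompactSpace B]
    [ChartedSpace (EuclideanHalfSpace 2) B] [IsManifold (𝓡∂ 2) ∞ B]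
    (hB : IsOrientedAtlas (𝓡∂ 2) B) {V : Set B}
    {γ : B → E2 [⋀^Fin 1]→L[ℝ] ℝ} (hγ : γ ∈ compactForms (𝓡∂ 2) 1 V)
    (hb : ∀ x ∈ (𝓡∂ 2).boundary B, γ x = 0) :
    integral (𝓡∂ 2) (extD (𝓡∂ 2) γ) = 0 :=
  integral_extD_eq_zero_of_chart hB hγ fun p => chartIntegral_extD_surface
    (compactForms_le_compactForms inter_subset_left (chartPartition_smul_mem hγ p))
    fun x hx => by rw [hb x hx, smul_zero]

end StokesTheorem

/-! ### The Poisson structures and Einstein causality -/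

noncomputable section Pairings

variable {B : Type u} [TopologicalSpace B] [T2Space B] [SigmaCompactSpace B]
  [ChartedSpace (EuclideanHalfSpace 2) B] [IsManifold (𝓡∂ 2) ∞ B]
  {N : Type u} [TopologicalSpace N] [T2Space N] [SigmaCompactSpace N]
  [ChartedSpace E1 N] [IsManifold (𝓡 1) ∞ N]

theorem smul_topForm_mem {V : Set B} {a : B → E2 [⋀^Fin 0]→L[ℝ] ℝ}
    (ha : a ∈ compactForms (𝓡∂ 2) 0 V) {k : ℕ} {c : B → E2 [⋀^Fin k]→L[ℝ] ℝ}
    (hc : c ∈ compactForms (𝓡∂ 2) k V) :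
    (fun x => a x ![] • c x) ∈ compactForms (𝓡∂ 2) k V :=
  smul_mem_compactForms hc ha.1.contMDiff inter_subset_right

/-- The pairing `∫ a c` of functions that vanish at the boundary and `2`-forms. -/
def smulPairing (V : Set B) :
    compactFormsBdry (𝓡∂ 2) V →ₗ[ℝ] compactForms (𝓡∂ 2) 2 V →ₗ[ℝ] ℝ :=
  LinearMap.mk₂ ℝ (fun a c => integral (𝓡∂ 2) fun x : B => a.1 x ![] • c.1 x)
    (fun a a' c => by
      rw [← integral_add (smul_topForm_mem a.2.1 c.2) (smul_topForm_mem a'.2.1 c.2)]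
      congr 1
      funext x
      exact add_smul (a.1 x ![]) (a'.1 x ![]) (c.1 x))
    (fun r a c => by
      rw [smul_eq_mul, ← integral_smul]
      congr 1
      funext x
      exact mul_smul r (a.1 x ![]) (c.1 x))
    (fun a c c' => by
      rw [← integral_add (smul_topForm_mem a.2.1 c.2) (smul_topForm_mem a.2.1 c'.2)]
      congr 1
      funext x
      exact smul_add (a.1 x ![]) (c.1 x) (c'.1 x))
    (fun r a c => by
      rw [smul_eq_mul, ← integral_smul]
      congr 1
      funext x
      exact smul_comm (a.1 x ![]) r (c.1 x))

theorem integral_wedge_comm (b b' : B → E2 [⋀^Fin 1]→L[ℝ] ℝ) :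
    integral (𝓡∂ 2) (fun x : B => wedge (b x) (b' x)) =
      -integral (𝓡∂ 2) (fun x : B => wedge (b' x) (b x)) := by
  rw [← integral_neg]
  congr 1
  funext x
  exact wedge_comm _ _

theorem integral_wedge_add {V : Set B} (b b₂ b' : compactForms (𝓡∂ 2) 1 V) :
    integral (𝓡∂ 2) (fun x : B => wedge ((b + b₂).1 x) (b'.1 x)) =
      integral (𝓡∂ 2) (fun x : B => wedge (b.1 x) (b'.1 x)) +
        integral (𝓡∂ 2) (fun x : B => wedge (b₂.1 x) (b'.1 x)) := by
  rw [← integral_add (wedge_mem_compactForms b.2 b'.2.1) (wedge_mem_compactForms b₂.2 b'.2.1)]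
  congr 1
  funext x
  exact wedge_add_left (b.1 x) (b₂.1 x) (b'.1 x)

theorem integral_wedge_smul {V : Set B} (r : ℝ) (b b' : compactForms (𝓡∂ 2) 1 V) :
    integral (𝓡∂ 2) (fun x : B => wedge ((r • b).1 x) (b'.1 x)) =
      r * integral (𝓡∂ 2) (fun x : B => wedge (b.1 x) (b'.1 x)) := by
  rw [← integral_smul]
  congr 1
  funext x
  exact wedge_smul_left r (b.1 x) (b'.1 x)

/-- The pairing `∫ b ∧ b'` of `1`-forms. -/
def wedgePairing (V : Set B) :
    compactForms (𝓡∂ 2) 1 V →ₗ[ℝ] compactForms (𝓡∂ 2) 1 V →ₗ[ℝ] ℝ :=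
  LinearMap.mk₂ ℝ (fun b b' => integral (𝓡∂ 2) fun x : B => wedge (b.1 x) (b'.1 x))
    integral_wedge_add integral_wedge_smul
    (fun b b' b₂ => by
      rw [integral_wedge_comm, integral_wedge_add, integral_wedge_comm b'.1,
        integral_wedge_comm b₂.1]
      ring)
    (fun r b b' => by
      rw [integral_wedge_comm, integral_wedge_smul, integral_wedge_comm b'.1, smul_eq_mul]
      ring)

theorem wedgePairing_comm {V : Set B} (b b' : compactForms (𝓡∂ 2) 1 V) :
    wedgePairing V b b' = -wedgePairing V b' b := integral_wedge_comm b.1 b'.1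

/-- Integration by parts for the product of a function that vanishes at the boundary and a
`1`-form. -/
theorem integral_wedge_extD_add (hB : IsOrientedAtlas (𝓡∂ 2) B) {V : Set B}
    {a : B → E2 [⋀^Fin 0]→L[ℝ] ℝ} (ha : a ∈ compactFormsBdry (𝓡∂ 2) V)
    {b : B → E2 [⋀^Fin 1]→L[ℝ] ℝ} (hb : b ∈ compactForms (𝓡∂ 2) 1 V) :
    integral (𝓡∂ 2) (fun x : B => wedge (extD (𝓡∂ 2) a x) (b x)) +
      integral (𝓡∂ 2) (fun x : B => a x ![] • extD (𝓡∂ 2) b x) = 0 := by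
  have hda : extD (𝓡∂ 2) a ∈ compactForms (𝓡∂ 2) 1 V := (compactD (𝓡∂ 2) 0 V ⟨a, ha.1⟩).2
  have hdb : extD (𝓡∂ 2) b ∈ compactForms (𝓡∂ 2) 2 V := (compactD (𝓡∂ 2) 1 V ⟨b, hb⟩).2
  rw [← integral_add (wedge_mem_compactForms hda hb.1) (smul_topForm_mem ha.1 hdb)]
  refine Eq.trans ?_ (integral_extD_surface hB (smul_topForm_mem ha.1 hb) fun x hx => ?_)
  · congr 1
    funext x
    have hf := ha.1.1.contMDiff
    rw [extD_fun_smul hf hb.1, ← extD_zeroForm (hf.mdifferentiableAt (by simp)), zeroForm_self]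
  · rw [ha.2 x hx]
    exact zero_smul ℝ (b x)

theorem bulkPairing_eq (V : Set B) (a : compactFormsBdry (𝓡∂ 2) V) (b : compactForms (𝓡∂ 2) 1 V)
    (c : compactForms (𝓡∂ 2) 2 V) (a' : compactFormsBdry (𝓡∂ 2) V) (b' : compactForms (𝓡∂ 2) 1 V)
    (c' : compactForms (𝓡∂ 2) 2 V) :
    bulkPairing V (a, b, c) (a', b', c') =
      -smulPairing V a c' + wedgePairing V b b' - smulPairing V a' c := rfl

set_option maxHeartbeats 1000000 in
/-- The pairing `σ` is a cochain map by integration by parts and graded antisymmetric because the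
wedge product of `1`-forms is antisymmetric. -/
theorem isPoisson_bulkPairing (hB : IsOrientedAtlas (𝓡∂ 2) B) (V : Set B) :
    IsPoisson (bulkCpx V) (bulkPairing V) where
  add_left := by
    rintro ⟨a, b, c⟩ ⟨a₂, b₂, c₂⟩ ⟨a', b', c'⟩
    refine (bulkPairing_eq V (a + a₂) (b + b₂) (c + c₂) a' b' c').trans ?_
    rw [bulkPairing_eq, bulkPairing_eq, map_add, map_add, map_add, LinearMap.add_apply,
      LinearMap.add_apply]
    ring
  smul_left := by
    rintro r ⟨a, b, c⟩ ⟨a', b', c'⟩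
    refine (bulkPairing_eq V (r • a) (r • b) (r • c) a' b' c').trans ?_
    rw [bulkPairing_eq, map_smul, map_smul, map_smul, LinearMap.smul_apply, LinearMap.smul_apply]
    simp only [smul_eq_mul]
    ring
  add_right := by
    rintro ⟨a, b, c⟩ ⟨a₂, b₂, c₂⟩ ⟨a', b', c'⟩
    refine (bulkPairing_eq V a b c (a₂ + a') (b₂ + b') (c₂ + c')).trans ?_
    rw [bulkPairing_eq, bulkPairing_eq, map_add, map_add, map_add, LinearMap.add_apply]
    ring
  smul_right := by
    rintro r ⟨a, b, c⟩ ⟨a', b', c'⟩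
    refine (bulkPairing_eq V a b c (r • a') (r • b') (r • c')).trans ?_
    rw [bulkPairing_eq, map_smul, map_smul, map_smul, LinearMap.smul_apply]
    simp only [smul_eq_mul]
    ring
  degree_zero := by
    rintro i j ⟨a, b, c⟩ ⟨a', b', c'⟩ ⟨h1, h2, h3⟩ ⟨k1, k2, k3⟩ hij
    simp only at h1 h2 h3 k1 k2 k3
    rw [bulkPairing_eq]
    have e1 : smulPairing V a c' = 0 := by
      by_cases hi : i = -1
      · rw [k3 (by omega), map_zero]
      · rw [h1 hi, map_zero, LinearMap.zero_apply]
    have e2 : wedgePairing V b b' = 0 := by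
      by_cases hi : i = 0
      · rw [k2 (by omega), map_zero]
      · rw [h2 hi, map_zero, LinearMap.zero_apply]
    have e3 : smulPairing V a' c = 0 := by
      by_cases hi : i = 1
      · rw [k1 (by omega), map_zero, LinearMap.zero_apply]
      · rw [h3 hi, map_zero]
    rw [e1, e2, e3]
    ring
  cochain := by
    rintro i ⟨a, b, c⟩ ⟨a', b', c'⟩ ⟨h1, h2, h3⟩
    simp only at h1 h2 h3
    let D₀ := compactD (𝓡∂ 2) 0 V
    let D₁ := compactD (𝓡∂ 2) 1 V
    have h := bulkPairing_eq V 0 (-D₀ ⟨a.1, a.2.1⟩) (-D₁ b) a' b' c'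
    have h' := bulkPairing_eq V a b c 0 (-D₀ ⟨a'.1, a'.2.1⟩) (-D₁ b')
    have e1 : wedgePairing V (D₀ ⟨a.1, a.2.1⟩) b' + smulPairing V a (D₁ b') = 0 :=
      integral_wedge_extD_add hB a.2 b'.2
    have e2 : wedgePairing V (D₀ ⟨a'.1, a'.2.1⟩) b + smulPairing V a' (D₁ b) = 0 :=
      integral_wedge_extD_add hB a'.2 b.2
    rw [map_zero, map_neg, map_neg, LinearMap.neg_apply, LinearMap.zero_apply] at h
    rw [map_zero, map_neg, map_neg, LinearMap.zero_apply] at h'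
    change bulkPairing V ((0 : compactFormsBdry (𝓡∂ 2) V), -D₀ ⟨a.1, a.2.1⟩, -D₁ b) (a', b', c') +
      (i.negOnePow : ℤ) * bulkPairing V (a, b, c)
        ((0 : compactFormsBdry (𝓡∂ 2) V), -D₀ ⟨a'.1, a'.2.1⟩, -D₁ b') = 0
    rw [h, h', wedgePairing_comm b]
    by_cases hb : b = 0
    · rw [hb, map_zero, map_zero, map_zero]
      by_cases hi : i = -1
      · subst hi
        simp only [Int.negOnePow_neg, Int.negOnePow_one, Units.val_neg, Units.val_one,
          Int.cast_neg, Int.cast_one]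
        linarith
      · have ha := h1 hi
        subst ha
        rw [map_zero, LinearMap.zero_apply] at e1 ⊢
        rw [add_zero] at e1
        rw [e1]
        ring
    · have hi : i = 0 := by
        by_contra hi
        exact hb (h2 hi)
      subst hi
      have ha := h1 (by decide)
      subst ha
      rw [map_zero, LinearMap.zero_apply] at e1 ⊢
      simp only [Int.negOnePow_zero, Units.val_one, Int.cast_one]
      linarith
  antisymm := by
    rintro i j ⟨a, b, c⟩ ⟨a', b', c'⟩ ⟨h1, h2, h3⟩ ⟨k1, k2, k3⟩
    simp only at h1 h2 h3 k1 k2 k3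
    rw [bulkPairing_eq, bulkPairing_eq, wedgePairing_comm b' b]
    by_cases hi : i = 0
    · subst hi
      rw [h1 (by decide), h3 (by decide)]
      simp
    · rw [h2 hi]
      by_cases hj : j = 0
      · subst hj
        rw [k1 (by decide), k3 (by decide)]
        simp
      rw [k2 hj]
      by_cases hij : i * j = -1
      · rw [hij]
        simp only [Int.negOnePow_neg, Int.negOnePow_one, Units.val_neg, Units.val_one,
          Int.cast_neg, Int.cast_one, map_zero]
        ring
      · have e1 : smulPairing V a c' = 0 := by
          by_cases hi : i = -1
          · rw [k3 (by rintro rfl; exact hij (by rw [hi]; rfl)), map_zero]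
          · rw [h1 hi, map_zero, LinearMap.zero_apply]
        have e2 : smulPairing V a' c = 0 := by
          by_cases hi : i = 1
          · rw [k1 (by rintro rfl; exact hij (by rw [hi]; rfl)), map_zero, LinearMap.zero_apply]
          · rw [h3 hi, map_zero]
        rw [e1, e2]
        simp

theorem dAt_mul {f g : N → ℝ} (hf : ContMDiff (𝓡 1) 𝓘(ℝ, ℝ) ∞ f)
    (hg : ContMDiff (𝓡 1) 𝓘(ℝ, ℝ) ∞ g) (x : N) :
    dAt (𝓡 1) (fun y => f y * g y) x = f x • dAt (𝓡 1) g x + g x • dAt (𝓡 1) f x :=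
  ((hf.mdifferentiableAt (by simp)).hasMFDerivAt.mul
    (hg.mdifferentiableAt (by simp)).hasMFDerivAt).mfderiv

theorem smul_oneForm_dAt_mem {W : Set N} {φ ψ : N → ℝ} (hφ : ContMDiff (𝓡 1) 𝓘(ℝ, ℝ) ∞ φ)
    (hψ : ψ ∈ bdryFunctions W) :
    (fun x => φ x • oneForm (dAt (𝓡 1) ψ x)) ∈ compactForms (𝓡 1) 1 W := by
  have h1 : zeroForm ψ ∈ compactForms (𝓡 1) 0 W := by
    obtain ⟨K, hK, hKW, h0⟩ := hψ.2
    refine ⟨isSmoothForm_zeroForm hψ.1, K, hK, hKW, fun x hx => ?_⟩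
    ext v
    rw [zeroForm_apply, h0 x hx]
    rfl
  have h2 := smul_mem_compactForms (compactD (𝓡 1) 0 W ⟨_, h1⟩).2 hφ inter_subset_right
  convert h2 using 3 with x
  exact (extD_zeroForm (hψ.1.mdifferentiableAt (by simp))).symm

/-- Integration by parts: `∫ φ dψ + ∫ ψ dφ = ∫ d(φ ψ) = 0`. -/
theorem bdryPairing_comm (hN : IsOrientedAtlas (𝓡 1) N) {W : Set N} (φ ψ : (bdryCpx W).carrier) :
    bdryPairing W φ ψ = -bdryPairing W ψ φ := by
  obtain ⟨K, hK, hKW, h0⟩ := φ.2.2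
  have hφ := φ.2.1
  have hψ := ψ.2.1
  have h1 : zeroForm (fun x => φ.1 x * ψ.1 x) ∈ compactForms (𝓡 1) 0 W := by
    refine ⟨isSmoothForm_zeroForm (hφ.mul hψ), K, hK, hKW, fun x hx => ?_⟩
    ext v
    rw [zeroForm_apply, h0 x hx, zero_mul]
    rfl
  have h := integral_extD_curve hN h1
  have e : extD (𝓡 1) (zeroForm (fun x => φ.1 x * ψ.1 x)) = fun x =>
      φ.1 x • oneForm (dAt (𝓡 1) ψ.1 x) + ψ.1 x • oneForm (dAt (𝓡 1) φ.1 x) := by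
    funext x
    rw [extD_zeroForm (f := fun x => φ.1 x * ψ.1 x) ((hφ.mul hψ).mdifferentiableAt (by simp)),
      dAt_mul hφ hψ]
    rfl
  rw [e, integral_add (smul_oneForm_dAt_mem φ.2.1 ψ.2) (smul_oneForm_dAt_mem ψ.2.1 φ.2)] at h
  unfold bdryPairing
  linarith

theorem bdryPairing_add_left {W : Set N} (φ φ' ψ : (bdryCpx W).carrier) :
    bdryPairing W (φ + φ') ψ = bdryPairing W φ ψ + bdryPairing W φ' ψ := by
  have h := integral_add (smul_oneForm_dAt_mem φ.2.1 ψ.2) (smul_oneForm_dAt_mem φ'.2.1 ψ.2)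
  unfold bdryPairing
  rw [← neg_add, ← h]
  congr 2
  funext x
  exact add_smul (φ.1 x) (φ'.1 x) _

theorem bdryPairing_smul_left {W : Set N} (c : ℝ) (φ ψ : (bdryCpx W).carrier) :
    bdryPairing W (c • φ) ψ = c * bdryPairing W φ ψ := by
  have h := integral_smul (I := 𝓡 1) c (fun x => φ.1 x • oneForm (dAt (𝓡 1) ψ.1 x))
  unfold bdryPairing
  rw [mul_neg, ← h]
  congr 2
  funext x
  exact mul_smul c (φ.1 x) _

theorem isPoisson_bdryPairing (hN : IsOrientedAtlas (𝓡 1) N) (W : Set N) :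
    IsPoisson (bdryCpx W) (bdryPairing W) where
  add_left := bdryPairing_add_left
  smul_left := bdryPairing_smul_left
  add_right φ ψ ψ' := by
    rw [bdryPairing_comm hN, bdryPairing_add_left, bdryPairing_comm hN φ, bdryPairing_comm hN φ]
    ring
  smul_right c φ ψ := by
    rw [bdryPairing_comm hN, bdryPairing_smul_left, bdryPairing_comm hN φ]
    ring
  degree_zero i j φ ψ hφ hψ hij := by
    have h0 : ∀ χ, bdryPairing W 0 χ = 0 := fun χ => by
      have := bdryPairing_smul_left 0 0 χ
      rwa [zero_smul, zero_mul] at this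
    by_cases hi : i = 0
    · rw [bdryPairing_comm hN, eq_zero_of_mem_oneGr (i := j) (by omega) hψ]
      exact neg_eq_zero.2 (h0 φ)
    · rw [eq_zero_of_mem_oneGr hi hφ]
      exact h0 ψ
  cochain i φ ψ _ := by
    have h0 : ∀ χ, bdryPairing W 0 χ = 0 := fun χ => by
      have := bdryPairing_smul_left 0 0 χ
      rwa [zero_smul, zero_mul] at this
    change bdryPairing W 0 ψ + _ * bdryPairing W φ 0 = 0
    rw [bdryPairing_comm hN φ, h0, h0, neg_zero, mul_zero, add_zero]
  antisymm i j φ ψ hφ hψ := by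
    have h0 : ∀ χ, bdryPairing W 0 χ = 0 := fun χ => by
      have := bdryPairing_smul_left 0 0 χ
      rwa [zero_smul, zero_mul] at this
    by_cases hi : i = 0
    · subst hi
      rw [bdryPairing_comm hN]
      simp
    · have : φ = 0 := eq_zero_of_mem_oneGr hi hφ
      rw [this, bdryPairing_comm hN ψ, h0]
      simp

theorem bulkPairing_eq_zero_of_disjoint {V V₁ V₂ : Set B} (h₁ : V₁ ⊆ V) (h₂ : V₂ ⊆ V)
    (h : Disjoint V₁ V₂) (p : (bulkCpx V₁).carrier) (q : (bulkCpx V₂).carrier) :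
    bulkPairing V ((bulkExt h₁).toLin p) ((bulkExt h₂).toLin q) = 0 := by
  have key : ∀ {k l : ℕ} {α : B → E2 [⋀^Fin k]→L[ℝ] ℝ} {β : B → E2 [⋀^Fin l]→L[ℝ] ℝ},
      α ∈ compactForms (𝓡∂ 2) k V₁ → β ∈ compactForms (𝓡∂ 2) l V₂ → ∀ x, α x = 0 ∨ β x = 0 := by
    rintro k l α β ⟨-, K, -, hK, hα⟩ ⟨-, L, -, hL, hβ⟩ x
    by_cases hx : x ∈ K
    · exact Or.inr (hβ x fun hx' => disjoint_left.1 h (hK hx) (hL hx'))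
    · exact Or.inl (hα x hx)
  obtain ⟨a, b, c⟩ := p
  obtain ⟨a', b', c'⟩ := q
  have e1 : (fun x : B => a.1 x ![] • c'.1 x) = 0 := funext fun x => by
    rcases key a.2.1 c'.2 x with h | h
    · rw [h]; exact zero_smul ℝ (c'.1 x)
    · rw [h, smul_zero]; rfl
  have e2 : (fun x : B => wedge (b.1 x) (b'.1 x)) = 0 := funext fun x => by
    rcases key b.2 b'.2 x with h | h
    · rw [h, wedge_zero_left]; rfl
    · rw [h, wedge_zero_right]; rfl
  have e3 : (fun x : B => a'.1 x ![] • c.1 x) = 0 := funext fun x => by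
    rcases key c.2 a'.2.1 x with h | h
    · rw [h, smul_zero]; rfl
    · rw [h]; exact zero_smul ℝ (c.1 x)
  change -integral (𝓡∂ 2) (fun x : B => a.1 x ![] • c'.1 x) +
    integral (𝓡∂ 2) (fun x : B => wedge (b.1 x) (b'.1 x)) -
    integral (𝓡∂ 2) (fun x : B => a'.1 x ![] • c.1 x) = 0
  rw [e1, e2, e3, integral_zero]
  ring

theorem bdryPairing_eq_zero_of_disjoint {W W₁ W₂ : Set N} (h₁ : W₁ ⊆ W) (h₂ : W₂ ⊆ W)
    (h : Disjoint W₁ W₂) (φ : (bdryCpx W₁).carrier) (ψ : (bdryCpx W₂).carrier) :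
    bdryPairing W ((bdryExt h₁).toLin φ) ((bdryExt h₂).toLin ψ) = 0 := by
  obtain ⟨-, K, -, hK, hφ⟩ := φ.2
  obtain ⟨-, L, hLc, hL, hψ⟩ := ψ.2
  have e : (fun x : N => φ.1 x • oneForm (dAt (𝓡 1) ψ.1 x)) = 0 := funext fun x => by
    by_cases hx : x ∈ K
    · have hxL : x ∉ L := fun hx' => disjoint_left.1 h (hK hx) (hL hx')
      have hev : ψ.1 =ᶠ[𝓝 x] fun _ => 0 := by
        filter_upwards [hLc.isClosed.isOpen_compl.mem_nhds hxL] with y hy using hψ y hy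
      have : dAt (𝓡 1) ψ.1 x = 0 := hev.mfderiv_eq.trans mfderiv_const
      rw [this]
      exact smul_zero _
    · rw [hφ x hx]
      exact zero_smul ℝ (oneForm (dAt (𝓡 1) ψ.1 x))
  change -integral (𝓡 1) (fun x : N => φ.1 x • oneForm (dAt (𝓡 1) ψ.1 x)) = 0
  rw [e, integral_zero, neg_zero]

open CategoryTheory

theorem einsteinCausality_bulkTheory (hσ : ∀ V : NEOpens B,
      IsPoisson (bulkCpx (V.1 : Set B)) (bulkPairing (V.1 : Set B))) :
    EinsteinCausality (bulkTheory hσ) := by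
  intro V₁ V₂ V f₁ f₂ h i j a b ha hb
  refine Eq.trans (PoCh.ccrMap_graded_commute ((bulkPoisson hσ).map f₁) ((bulkPoisson hσ).map f₂)
    (fun v w => bulkPairing_eq_zero_of_disjoint (leOfHom f₁) (leOfHom f₂) h v w) ha hb)
    (PoCh.zsmul_sgn _ _).symm

theorem einsteinCausality_bosonTheory (hυ : ∀ W : NEOpens N,
      IsPoisson (bdryCpx (W.1 : Set N)) (bdryPairing (W.1 : Set N))) :
    EinsteinCausality (bosonTheory hυ) := by
  intro V₁ V₂ V f₁ f₂ h i j a b ha hb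
  refine Eq.trans (PoCh.ccrMap_graded_commute ((bdryPoisson hυ).map f₁) ((bdryPoisson hυ).map f₂)
    (fun v w => bdryPairing_eq_zero_of_disjoint (leOfHom f₁) (leOfHom f₂) h v w) ha hb)
    (PoCh.zsmul_sgn _ _).symm

theorem einsteinCausality_collar (e : Collar B N) {F : NEOpens B ⥤ DGStarAlg.{v}}
    (hF : EinsteinCausality F) : EinsteinCausality (e.functor ⋙ F) := by
  intro W₁ W₂ W f₁ f₂ h i j a b ha hb
  refine hF (e.functor.obj W₁) (e.functor.obj W₂) (e.functor.obj W) (e.functor.map f₁)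
    (e.functor.map f₂) ?_ i j a b ha hb
  have hs : ∀ U : NEOpens N, (U.1 : Set N) ×ˢ Ico (0 : ℝ) 1 ⊆ e.toPartialEquiv.source := fun U => by
    rw [e.source_eq]
    exact prod_mono (subset_univ _) le_rfl
  refine disjoint_iff_inter_eq_empty.2 (((e.toPartialEquiv.injOn.mono
    (union_subset (hs W₁) (hs W₂))).image_inter subset_union_left subset_union_right).symm.trans ?_)
  rw [prod_inter_prod, h.inter_eq, empty_prod, image_empty]

end Pairings

/-! ### Parametric integrals on a strip -/

noncomputable section ParametricIntegral

open MeasureTheory Filter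

variable {O : Set ℝ} {u : ℝ × ℝ → ℝ} {b : ℝ}

theorem uniqueDiffOn_strip (hO : IsOpen O) : UniqueDiffOn ℝ (Ico (0 : ℝ) 1 ×ˢ O) :=
  (uniqueDiffOn_Ico 0 1).prod hO.uniqueDiffOn

theorem uIcc_subset_unitIco {r s : ℝ} (hr : r ∈ Ico (0 : ℝ) 1) (hs : s ∈ Ico (0 : ℝ) 1) :
    uIcc r s ⊆ Ico 0 1 := ordConnected_Ico.uIcc_subset hr hs

/-- The derivative of a primitive in the first variable of a function of two variables. -/
theorem hasFDerivWithinAt_primitive (hO : IsOpen O)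
    (hu : ContDiffOn ℝ ∞ u (Ico (0 : ℝ) 1 ×ˢ O)) (hb : b ∈ Ico (0 : ℝ) 1) {z : ℝ × ℝ}
    (hz : z ∈ Ico (0 : ℝ) 1 ×ˢ O) :
    HasFDerivWithinAt (fun w : ℝ × ℝ => ∫ s in b..w.1, u (s, w.2))
      (u z • ContinuousLinearMap.fst ℝ ℝ ℝ +
        (∫ s in b..z.1, fderivWithin ℝ u (Ico (0 : ℝ) 1 ×ˢ O) (s, z.2) (0, 1)) •
          ContinuousLinearMap.snd ℝ ℝ ℝ) (Ico (0 : ℝ) 1 ×ˢ O) z := by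
  obtain ⟨r, x⟩ := z
  obtain ⟨hr, hx⟩ := hz
  simp only at hr hx ⊢
  set S := Ico (0 : ℝ) 1 ×ˢ O with hS
  set v : ℝ × ℝ → ℝ := fun z => fderivWithin ℝ u S z (0, 1) with hv
  have hvc : ContinuousOn v S :=
    (hu.continuousOn_fderivWithin (uniqueDiffOn_strip hO) (by simp)).clm_apply continuousOn_const
  have hline : ∀ {f : ℝ × ℝ → ℝ}, ContinuousOn f S → ∀ t ∈ O, ∀ {p q : ℝ}, p ∈ Ico (0 : ℝ) 1 →
      q ∈ Ico (0 : ℝ) 1 → ContinuousOn (fun s => f (s, t)) (uIcc p q) := by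
    intro f hf t ht p q hp hq
    exact hf.comp (Continuous.prodMk_left t).continuousOn
      fun s hs => ⟨uIcc_subset_unitIco hp hq hs, ht⟩
  have hint : ∀ {f : ℝ × ℝ → ℝ}, ContinuousOn f S → ∀ t ∈ O, ∀ {p q : ℝ}, p ∈ Ico (0 : ℝ) 1 →
      q ∈ Ico (0 : ℝ) 1 → IntervalIntegrable (fun s => f (s, t)) volume p q :=
    fun hf t ht _ _ hp hq => (hline hf t ht hp hq).intervalIntegrable
  -- the derivative in the direction of the parameter
  have h1 : HasDerivAt (fun t => ∫ s in b..r, u (s, t)) (∫ s in b..r, v (s, x)) x := by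
    obtain ⟨δ, hδ, hδO⟩ := Metric.nhds_basis_closedBall.mem_iff.1 (hO.mem_nhds hx)
    have hcomp : IsCompact (uIcc b r ×ˢ Metric.closedBall x δ) :=
      isCompact_uIcc.prod (isCompact_closedBall x δ)
    have hsub : uIcc b r ×ˢ Metric.closedBall x δ ⊆ S :=
      prod_mono (uIcc_subset_unitIco hb hr) hδO
    obtain ⟨C, hC⟩ := hcomp.exists_bound_of_continuousOn (hvc.mono hsub)
    refine (intervalIntegral.hasDerivAt_integral_of_dominated_loc_of_deriv_le
      (F := fun t s => u (s, t)) (F' := fun t s => v (s, t)) (bound := fun _ => C)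
      (Metric.closedBall_mem_nhds x hδ) ?_ (hint hu.continuousOn x hx hb hr)
      (hint hvc x hx hb hr).aestronglyMeasurable_restrict_uIoc ?_ (by simp) ?_).2
    · filter_upwards [hO.mem_nhds hx] with t ht
      exact (hint hu.continuousOn t ht hb hr).aestronglyMeasurable_restrict_uIoc
    · exact Eventually.of_forall fun s hs t ht => hC (s, t) ⟨uIoc_subset_uIcc hs, ht⟩
    · refine Eventually.of_forall fun s hs t ht => ?_
      have hst : (s, t) ∈ S := hsub ⟨uIoc_subset_uIcc hs, ht⟩
      have hd := ((hu _ hst).differentiableWithinAt (by simp)).hasFDerivWithinAt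
      have hc : HasDerivWithinAt (fun t : ℝ => (s, t)) ((0 : ℝ), (1 : ℝ)) O t :=
        ((hasDerivAt_const t s).prodMk (hasDerivAt_id t)).hasDerivWithinAt
      exact (hd.comp_hasDerivWithinAt t hc fun t' ht' => ⟨hst.1, ht'⟩).hasDerivAt
        (hO.mem_nhds hst.2)
  have h2 : HasFDerivWithinAt (fun w : ℝ × ℝ => ∫ s in b..r, u (s, w.2))
      ((∫ s in b..r, v (s, x)) • ContinuousLinearMap.snd ℝ ℝ ℝ) S (r, x) := by
    have := (h1.hasFDerivAt (x := ((r, x) : ℝ × ℝ).2)).comp ((r, x) : ℝ × ℝ)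
      (hasFDerivAt_snd (𝕜 := ℝ) (p := ((r, x) : ℝ × ℝ)))
    refine (this.congr_fderiv ?_).hasFDerivWithinAt
    ext <;> simp
  -- the derivative in the direction of the integration variable
  have h3 : HasFDerivWithinAt (fun w : ℝ × ℝ => ∫ s in r..w.1, u (s, w.2))
      (u (r, x) • ContinuousLinearMap.fst ℝ ℝ ℝ) S (r, x) := by
    rw [hasFDerivWithinAt_iff_isLittleO, Asymptotics.isLittleO_iff]
    intro ε hε
    obtain ⟨δ, hδ, hδu⟩ := Metric.continuousWithinAt_iff.1
      (hu.continuousOn (r, x) ⟨hr, hx⟩) ε hε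
    filter_upwards [self_mem_nhdsWithin, nhdsWithin_le_nhds (Metric.ball_mem_nhds (r, x) hδ)]
      with w hwS hw
    have hconst : (u (r, x) • ContinuousLinearMap.fst ℝ ℝ ℝ) (w - (r, x)) =
        ∫ _ in r..w.1, u (r, x) := by
      simp [mul_comm]
    simp only [intervalIntegral.integral_same, sub_zero]
    rw [hconst, ← intervalIntegral.integral_sub (hint hu.continuousOn w.2 hwS.2 hr hwS.1)
      (by simp)]
    refine (intervalIntegral.norm_integral_le_of_norm_le_const (C := ε) fun s hs => ?_).trans ?_
    · have hs' := uIoc_subset_uIcc hs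
      refine (hδu (x := (s, w.2)) ⟨uIcc_subset_unitIco hr hwS.1 hs', hwS.2⟩ ?_).le
      rw [Metric.mem_ball, Prod.dist_eq, max_lt_iff] at hw
      rw [Prod.dist_eq, max_lt_iff]
      refine ⟨lt_of_le_of_lt ?_ hw.1, hw.2⟩
      rw [Real.dist_eq, Real.dist_eq]
      exact abs_sub_left_of_mem_uIcc hs'
    · exact mul_le_mul_of_nonneg_left (norm_fst_le (w - (r, x))) hε.le
  rw [add_comm]
  refine (h2.add h3).congr (fun w hw => ?_) ?_
  · exact (intervalIntegral.integral_add_adjacent_intervals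
      (hint hu.continuousOn w.2 hw.2 hb hr) (hint hu.continuousOn w.2 hw.2 hr hw.1)).symm
  · simp

theorem contDiffOn_fderivWithin_strip_apply (hO : IsOpen O)
    (hu : ContDiffOn ℝ ∞ u (Ico (0 : ℝ) 1 ×ˢ O)) (a : ℝ × ℝ) :
    ContDiffOn ℝ ∞ (fun z => fderivWithin ℝ u (Ico (0 : ℝ) 1 ×ˢ O) z a) (Ico (0 : ℝ) 1 ×ˢ O) :=
  (hu.fderivWithin (uniqueDiffOn_strip hO) (by simp)).clm_apply contDiffOn_const

/-- Smoothness follows by induction, because the partial derivative of the primitive in the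
direction of the parameter is itself a primitive. -/
theorem contDiffOn_primitive (hO : IsOpen O) (hu : ContDiffOn ℝ ∞ u (Ico (0 : ℝ) 1 ×ˢ O))
    (hb : b ∈ Ico (0 : ℝ) 1) :
    ContDiffOn ℝ ∞ (fun w : ℝ × ℝ => ∫ s in b..w.1, u (s, w.2)) (Ico (0 : ℝ) 1 ×ˢ O) := by
  rw [contDiffOn_infty]
  intro n
  induction n generalizing u with
  | zero =>
    exact contDiffOn_zero.2 fun z hz => (hasFDerivWithinAt_primitive hO hu hb hz).continuousWithinAt
  | succ n ih =>
    rw [Nat.cast_add, Nat.cast_one]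
    refine (contDiffOn_succ_iff_hasFDerivWithinAt_of_uniqueDiffOn (uniqueDiffOn_strip hO)).2
      ⟨by simp, _, ?_, fun z hz => hasFDerivWithinAt_primitive hO hu hb hz⟩
    exact ((hu.of_le (by exact_mod_cast le_top)).smul contDiffOn_const).add
      ((ih (contDiffOn_fderivWithin_strip_apply hO hu (0, 1))).smul contDiffOn_const)

end ParametricIntegral

/-! ### Collar coordinates -/

noncomputable section CollarCharts

open Filter

theorem ContDiffWithinAt.alternating_apply_apply {E F : Type*} [NormedAddCommGroup E]
    [NormedSpace ℝ E] [NormedAddCommGroup F] [NormedSpace ℝ F] {k : ℕ} {n : WithTop ℕ∞}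
    {w : F → E [⋀^Fin k]→L[ℝ] ℝ} {v : F → Fin k → E} {s : Set F} {z : F}
    (hw : ContDiffWithinAt ℝ n w s z) (hv : ContDiffWithinAt ℝ n v s z) :
    ContDiffWithinAt ℝ n (fun y => w y (v y)) s z := by
  let f : (E [⋀^Fin k]→L[ℝ] ℝ) →L[ℝ] ContinuousMultilinearMap ℝ (fun _ : Fin k => E) ℝ :=
    ContinuousAlternatingMap.toContinuousMultilinearMapCLM ℝ
  have h : ContDiffAt ℝ n (fun p : (E [⋀^Fin k]→L[ℝ] ℝ) × (Fin k → E) => f p.1 p.2) (w z, v z) :=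
    (f.cpolynomialAt_uncurry_of_multilinear (x := (w z, v z))).contDiffAt
  exact h.comp_contDiffWithinAt z (hw.prodMk hv)

/-- The line as a Euclidean space. -/
def lineEquiv : ℝ ≃L[ℝ] E1 :=
  (ContinuousLinearEquiv.funUnique (Fin 1) ℝ ℝ).symm.trans (EuclideanSpace.equiv (Fin 1) ℝ).symm

theorem lineEquiv_apply (t : ℝ) (i : Fin 1) : lineEquiv t i = t := rfl

theorem lineEquiv_one : lineEquiv 1 = stdBasis 1 0 := by
  ext i
  fin_cases i
  simp [lineEquiv_apply]

variable {B : Type u} [TopologicalSpace B] [T2Space B] [SigmaCompactSpace B]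
  [ChartedSpace (EuclideanHalfSpace 2) B] [IsManifold (𝓡∂ 2) ∞ B]
  {N : Type u} [TopologicalSpace N] [T2Space N] [SigmaCompactSpace N]
  [ChartedSpace E1 N] [IsManifold (𝓡 1) ∞ N]

/-- The image of the chart at `p` of the curve `N`, as a subset of the line. -/
def lineDomain (p : N) : Set ℝ := lineEquiv ⁻¹' (extChartAt (𝓡 1) p).target

theorem isOpen_lineDomain (p : N) : IsOpen (lineDomain p) :=
  (isOpen_extChartAt_target p).preimage lineEquiv.continuous

/-- The domain of the coordinates `(r, x)` on the collar. -/
abbrev strip (p : N) : Set (ℝ × ℝ) := Ico (0 : ℝ) 1 ×ˢ lineDomain p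

theorem uniqueMDiffOn_strip (p : N) : UniqueMDiffOn 𝓘(ℝ, ℝ × ℝ) (strip p) :=
  (uniqueDiffOn_strip (isOpen_lineDomain p)).uniqueMDiffOn

theorem mem_closure_interior_strip {p : N} {z : ℝ × ℝ} (hz : z ∈ strip p) :
    z ∈ closure (interior (strip p)) := by
  rw [interior_prod_eq, closure_prod_eq, interior_Ico, (isOpen_lineDomain p).interior_eq,
    closure_Ioo zero_ne_one]
  exact ⟨Ico_subset_Icc_self hz.1, subset_closure hz.2⟩

namespace Collar

variable (e : Collar B N)

theorem mem_source (n : N) {r : ℝ} (hr : r ∈ Ico (0 : ℝ) 1) : (n, r) ∈ e.toPartialEquiv.source := by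
  rw [e.source_eq]
  exact ⟨mem_univ _, hr⟩

theorem base_apply (n : N) {r : ℝ} (hr : r ∈ Ico (0 : ℝ) 1) :
    e.base (e.toPartialEquiv (n, r)) = n := by
  rw [base, e.toPartialEquiv.left_inv (e.mem_source n hr)]

theorem rad_apply (n : N) {r : ℝ} (hr : r ∈ Ico (0 : ℝ) 1) :
    e.rad (e.toPartialEquiv (n, r)) = r := by
  rw [rad, e.toPartialEquiv.left_inv (e.mem_source n hr)]

theorem rad_mem {x : B} (hx : x ∈ e.toPartialEquiv.target) : e.rad x ∈ Ico (0 : ℝ) 1 := by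
  have := e.toPartialEquiv.map_target hx
  rw [e.source_eq] at this
  exact this.2

theorem apply_base_rad {x : B} (hx : x ∈ e.toPartialEquiv.target) :
    e.toPartialEquiv (e.base x, e.rad x) = x :=
  e.toPartialEquiv.right_inv hx

theorem contMDiffOn_base : ContMDiffOn (𝓡∂ 2) (𝓡 1) ∞ e.base e.toPartialEquiv.target :=
  fun x hx => (e.contMDiffOn_symm x hx).fst

theorem contMDiffOn_rad : ContMDiffOn (𝓡∂ 2) 𝓘(ℝ, ℝ) ∞ e.rad e.toPartialEquiv.target :=
  fun x hx => (e.contMDiffOn_symm x hx).snd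

/-- The coordinates `(r, x)` on the part of the collar over a chart domain of the curve `N`. -/
def chart (p : N) : PartialEquiv (ℝ × ℝ) B where
  toFun z := e.toPartialEquiv ((extChartAt (𝓡 1) p).symm (lineEquiv z.2), z.1)
  invFun x := (e.rad x, lineEquiv.symm (extChartAt (𝓡 1) p (e.base x)))
  source := strip p
  target := e.toPartialEquiv.target ∩ e.base ⁻¹' (extChartAt (𝓡 1) p).source
  map_source' := by
    rintro z ⟨hr, hx⟩
    refine ⟨e.toPartialEquiv.map_source (e.mem_source _ hr), ?_⟩
    rw [mem_preimage, e.base_apply _ hr]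
    exact (extChartAt (𝓡 1) p).map_target hx
  map_target' := by
    rintro x ⟨hx, hxp⟩
    refine ⟨e.rad_mem hx, ?_⟩
    rw [lineDomain, mem_preimage, ContinuousLinearEquiv.apply_symm_apply]
    exact (extChartAt (𝓡 1) p).map_source hxp
  left_inv' := by
    rintro z ⟨hr, hx⟩
    rw [e.base_apply _ hr, e.rad_apply _ hr, (extChartAt (𝓡 1) p).right_inv hx,
      ContinuousLinearEquiv.symm_apply_apply]
  right_inv' := by
    rintro x ⟨hx, hxp⟩
    simp only
    rw [ContinuousLinearEquiv.apply_symm_apply, (extChartAt (𝓡 1) p).left_inv hxp,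
      e.apply_base_rad hx]

theorem rad_chart {p : N} {z : ℝ × ℝ} (hz : z ∈ strip p) : e.rad (e.chart p z) = z.1 :=
  e.rad_apply _ hz.1

theorem base_chart {p : N} {z : ℝ × ℝ} (hz : z ∈ strip p) :
    e.base (e.chart p z) = (extChartAt (𝓡 1) p).symm (lineEquiv z.2) :=
  e.base_apply _ hz.1

theorem isOpen_chart_target (p : N) : IsOpen (e.chart p).target :=
  e.contMDiffOn_base.continuousOn.isOpen_inter_preimage e.open_target (isOpen_extChartAt_source p)

theorem mem_chart_target {x : B} (hx : x ∈ e.toPartialEquiv.target) :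
    x ∈ (e.chart (e.base x)).target :=
  ⟨hx, mem_extChartAt_source _⟩

theorem contMDiffOn_strip (p : N) : ContMDiffOn 𝓘(ℝ, ℝ × ℝ) ((𝓡 1).prod 𝓘(ℝ, ℝ)) ∞
    (fun z : ℝ × ℝ => ((extChartAt (𝓡 1) p).symm (lineEquiv z.2), z.1)) (strip p) := by
  have h1 : ContMDiffOn 𝓘(ℝ, ℝ × ℝ) 𝓘(ℝ, E1) ∞ (fun z : ℝ × ℝ => lineEquiv z.2) (strip p) :=
    (lineEquiv.contDiff.comp contDiff_snd).contMDiff.contMDiffOn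
  exact ((contMDiffOn_extChartAt_symm p).comp h1 fun z hz => hz.2).prodMk
    contDiff_fst.contMDiff.contMDiffOn

theorem contMDiffOn_chart (p : N) : ContMDiffOn 𝓘(ℝ, ℝ × ℝ) (𝓡∂ 2) ∞ (e.chart p) (strip p) :=
  e.contMDiffOn.comp (contMDiffOn_strip p) fun _ hz => ⟨mem_univ _, hz.1⟩

theorem contMDiffOn_chart_symm (p : N) :
    ContMDiffOn (𝓡∂ 2) 𝓘(ℝ, ℝ × ℝ) ∞ (e.chart p).symm (e.chart p).target := by
  have h1 : ContMDiffOn (𝓡∂ 2) 𝓘(ℝ, ℝ) ∞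
      (fun x => lineEquiv.symm (extChartAt (𝓡 1) p (e.base x))) (e.chart p).target := by
    refine lineEquiv.symm.contDiff.contMDiff.comp_contMDiffOn ((contMDiffOn_extChartAt).comp
      (e.contMDiffOn_base.mono inter_subset_left) fun x hx => ?_)
    rw [← extChartAt_source (𝓡 1)]
    exact hx.2
  exact (e.contMDiffOn_rad.mono inter_subset_left).prodMk_space h1

/-- The derivative of the collar coordinates. -/
def chartD (p : N) (z : ℝ × ℝ) : ℝ × ℝ →L[ℝ] E2 :=
  mfderivWithin 𝓘(ℝ, ℝ × ℝ) (𝓡∂ 2) (e.chart p) (strip p) z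

theorem hasMFDerivWithinAt_chart {p : N} {z : ℝ × ℝ} (hz : z ∈ strip p) :
    HasMFDerivWithinAt 𝓘(ℝ, ℝ × ℝ) (𝓡∂ 2) (e.chart p) (strip p) z (e.chartD p z) :=
  (((e.contMDiffOn_chart p) z hz).mdifferentiableWithinAt (by simp)).hasMFDerivWithinAt

/-- The derivative of the inverse of the collar coordinates. -/
def chartSymmD (p : N) (x : B) : E2 →L[ℝ] ℝ × ℝ :=
  mfderiv (𝓡∂ 2) 𝓘(ℝ, ℝ × ℝ) (e.chart p).symm x

theorem hasMFDerivAt_chart_symm {p : N} {x : B} (hx : x ∈ (e.chart p).target) :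
    HasMFDerivAt (𝓡∂ 2) 𝓘(ℝ, ℝ × ℝ) (e.chart p).symm x (e.chartSymmD p x) :=
  (((e.contMDiffOn_chart_symm p).contMDiffAt
    ((e.isOpen_chart_target p).mem_nhds hx)).mdifferentiableAt (by simp)).hasMFDerivAt

theorem chartD_comp_chartSymmD {p : N} {x : B} (hx : x ∈ (e.chart p).target) :
    (e.chartD p ((e.chart p).symm x)).comp (e.chartSymmD p x) = ContinuousLinearMap.id ℝ E2 := by
  have hnhds := (e.isOpen_chart_target p).mem_nhds hx
  have h1 : HasMFDerivWithinAt (𝓡∂ 2) (𝓡∂ 2) (e.chart p ∘ (e.chart p).symm) (e.chart p).target x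
      ((e.chartD p ((e.chart p).symm x)).comp (e.chartSymmD p x)) :=
    (e.hasMFDerivWithinAt_chart ((e.chart p).map_target hx)).comp x
      (e.hasMFDerivAt_chart_symm hx).hasMFDerivWithinAt fun y hy => (e.chart p).map_target hy
  have h2 := h1.hasMFDerivAt hnhds
  have h3 : HasMFDerivAt (𝓡∂ 2) (𝓡∂ 2) (e.chart p ∘ (e.chart p).symm) x
      (ContinuousLinearMap.id ℝ E2) := by
    refine (hasMFDerivAt_id x).congr_of_eventuallyEq ?_
    filter_upwards [hnhds] with y hy using (e.chart p).right_inv hy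
  exact hasMFDerivAt_unique h2 h3

/-- The pullback of a form along the collar coordinates. -/
def pull {k : ℕ} (p : N) (α : B → E2 [⋀^Fin k]→L[ℝ] ℝ) (z : ℝ × ℝ) : (ℝ × ℝ) [⋀^Fin k]→L[ℝ] ℝ :=
  (α (e.chart p z)).compContinuousLinearMap (e.chartD p z)

theorem eq_zero_of_pull_eq_zero {k : ℕ} {p : N} {α : B → E2 [⋀^Fin k]→L[ℝ] ℝ} {z : ℝ × ℝ}
    (hz : z ∈ strip p) (h : e.pull p α z = 0) : α (e.chart p z) = 0 := by
  have h1 := e.chartD_comp_chartSymmD ((e.chart p).map_source hz)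
  rw [(e.chart p).left_inv hz] at h1
  have h2 : α (e.chart p z) =
      (e.pull p α z).compContinuousLinearMap (e.chartSymmD p (e.chart p z)) := by
    ext v
    change _ = α (e.chart p z) (((e.chartD p z).comp (e.chartSymmD p (e.chart p z))) ∘ v)
    rw [h1]
    rfl
  rw [h2, h]
  rfl

/-- Near a point of the strip, the pullback of a form factors through a chart of the surface. -/
theorem pull_eventuallyEq {k : ℕ} {p : N} (α : B → E2 [⋀^Fin k]→L[ℝ] ℝ) {z : ℝ × ℝ}
    (hz : z ∈ strip p) :
    let T := extChartAt (𝓡∂ 2) (e.chart p z) ∘ e.chart p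
    ContDiffWithinAt ℝ ∞ T (strip p) z ∧
    e.pull p α =ᶠ[𝓝[strip p] z] fun y =>
      (chartRep (𝓡∂ 2) α (e.chart p z) (T y)).compContinuousLinearMap
        (fderivWithin ℝ T (strip p) y) := by
  have : IsManifold (𝓡∂ 2) 1 B := IsManifold.of_le (m := 1) (n := ∞) (by simp)
  intro T
  set x := e.chart p z with hx
  refine ⟨?_, ?_⟩
  · rw [← contMDiffWithinAt_iff_contDiffWithinAt]
    exact (contMDiffAt_extChartAt (n := ∞) (x := x)).comp_contMDiffWithinAt z
      (e.contMDiffOn_chart p z hz)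
  · have hev : ∀ᶠ y in 𝓝[strip p] z, e.chart p y ∈ (extChartAt (𝓡∂ 2) x).source :=
      ((e.contMDiffOn_chart p).continuousOn z hz).eventually
        ((isOpen_extChartAt_source x).mem_nhds (mem_extChartAt_source x))
    filter_upwards [hev, self_mem_nhdsWithin] with y hy hyS
    have h1 : HasMFDerivWithinAt 𝓘(ℝ, ℝ × ℝ) 𝓘(ℝ, E2) T (strip p) y
        ((chartDeriv (𝓡∂ 2) x (e.chart p y)).comp (e.chartD p y)) :=
      (mdifferentiableAt_extChartAt (by rwa [← extChartAt_source (𝓡∂ 2)])).hasMFDerivAt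
        |>.comp_hasMFDerivWithinAt y (e.hasMFDerivWithinAt_chart hyS)
    have h1' : HasFDerivWithinAt T ((chartDeriv (𝓡∂ 2) x (e.chart p y)).comp (e.chartD p y))
        (strip p) y := h1.hasFDerivWithinAt
    have h2 := h1'.fderivWithin (uniqueDiffOn_strip (isOpen_lineDomain p) y hyS)
    have h3 := chartSymmDeriv_comp_chartDeriv (I := 𝓡∂ 2) hy
    have h4 : (chartSymmDeriv (𝓡∂ 2) x (T y)).comp (fderivWithin ℝ T (strip p) y) =
        e.chartD p y := by
      rw [h2]
      change (chartSymmDeriv (𝓡∂ 2) x (extChartAt (𝓡∂ 2) x (e.chart p y))).comp _ = _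
      rw [← ContinuousLinearMap.comp_assoc, h3, ContinuousLinearMap.id_comp]
    rw [chartRep, show (extChartAt (𝓡∂ 2) x).symm (T y) = e.chart p y from
      (extChartAt (𝓡∂ 2) x).left_inv hy, pull, ← h4]
    rfl

theorem mapsTo_extChartAt_range (p : N) (x : B) :
    MapsTo (extChartAt (𝓡∂ 2) x ∘ e.chart p) (strip p) (range (𝓡∂ 2)) :=
  fun _ _ => mem_range_self _

/-- The coefficients of the pullback of a smooth form are smooth. -/
theorem contDiffOn_pull_apply {k : ℕ} (p : N) {α : B → E2 [⋀^Fin k]→L[ℝ] ℝ}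
    (hα : IsSmoothForm (𝓡∂ 2) α) (v : Fin k → ℝ × ℝ) :
    ContDiffOn ℝ ∞ (fun z => e.pull p α z v) (strip p) := by
  intro z hz
  obtain ⟨hT, hev⟩ := e.pull_eventuallyEq α hz
  set T := extChartAt (𝓡∂ 2) (e.chart p z) ∘ e.chart p with hTdef
  have hTd : ContDiffWithinAt ℝ ∞ (fderivWithin ℝ T (strip p)) (strip p) z :=
    hT.fderivWithin_right (m := ∞) (uniqueDiffOn_strip (isOpen_lineDomain p)) (by simp) hz
  have h1 : ContDiffWithinAt ℝ ∞ (fun y => chartRep (𝓡∂ 2) α (e.chart p z) (T y)) (strip p) z :=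
    ContDiffWithinAt.comp (g := chartRep (𝓡∂ 2) α (e.chart p z)) (f := T) z
      (hα.contDiffWithinAt (mem_extChartAt_target (e.chart p z))) hT (e.mapsTo_extChartAt_range p _)
  have h2 : ContDiffWithinAt ℝ ∞ (fun y => fun i => fderivWithin ℝ T (strip p) y (v i))
      (strip p) z :=
    contDiffWithinAt_pi.2 fun i => hTd.clm_apply contDiffWithinAt_const
  refine (h1.alternating_apply_apply h2).congr_of_eventuallyEq_of_mem ?_ hz
  filter_upwards [hev] with y hy
  rw [hy]
  rfl

/-- The pullback along the collar coordinates commutes with the exterior derivative. -/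
theorem pull_extD {k : ℕ} {p : N} {α : B → E2 [⋀^Fin k]→L[ℝ] ℝ} (hα : IsSmoothForm (𝓡∂ 2) α)
    {z : ℝ × ℝ} (hz : z ∈ strip p) :
    e.pull p (extD (𝓡∂ 2) α) z = extDerivWithin (e.pull p α) (strip p) z := by
  obtain ⟨hT, hev⟩ := e.pull_eventuallyEq α hz
  obtain ⟨-, hev'⟩ := e.pull_eventuallyEq (extD (𝓡∂ 2) α) hz
  have hx := mem_extChartAt_target (I := 𝓡∂ 2) (e.chart p z)
  have hd : DifferentiableWithinAt ℝ (chartRep (𝓡∂ 2) α (e.chart p z)) (range (𝓡∂ 2))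
      ((extChartAt (𝓡∂ 2) (e.chart p z) ∘ e.chart p) z) :=
    (hα.contDiffWithinAt hx).differentiableWithinAt (by simp)
  have hm := e.mapsTo_extChartAt_range p (e.chart p z)
  have hD : chartRep (𝓡∂ 2) (extD (𝓡∂ 2) α) (e.chart p z)
      ((extChartAt (𝓡∂ 2) (e.chart p z) ∘ e.chart p) z) = extDerivWithin
        (chartRep (𝓡∂ 2) α (e.chart p z)) (range (𝓡∂ 2))
        ((extChartAt (𝓡∂ 2) (e.chart p z) ∘ e.chart p) z) := chartRep_extD hα hx
  rw [hev.extDerivWithin_eq_of_mem hz, hev'.self_of_nhdsWithin hz]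
  beta_reduce
  rw [hD]
  generalize extChartAt (𝓡∂ 2) (e.chart p z) ∘ e.chart p = T at *
  generalize chartRep (𝓡∂ 2) α (e.chart p z) = w at *
  exact (extDerivWithin_pullback hd hT minSmoothness_two_le
    (uniqueDiffOn_strip (isOpen_lineDomain p)) (mem_closure_interior_strip hz) hz hm).symm

theorem pull_oneForm_dAt {p : N} {f : B → ℝ} {z : ℝ × ℝ} (hz : z ∈ strip p)
    (hf : MDifferentiableAt (𝓡∂ 2) 𝓘(ℝ, ℝ) f (e.chart p z)) {α : B → E2 [⋀^Fin 1]→L[ℝ] ℝ}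
    (hα : α (e.chart p z) = oneForm (dAt (𝓡∂ 2) f (e.chart p z))) (v : Fin 1 → ℝ × ℝ) :
    e.pull p α z v = fderivWithin ℝ (f ∘ e.chart p) (strip p) z (v 0) := by
  have h1 : HasMFDerivWithinAt 𝓘(ℝ, ℝ × ℝ) 𝓘(ℝ, ℝ) (f ∘ e.chart p) (strip p) z
      ((dAt (𝓡∂ 2) f (e.chart p z)).comp (e.chartD p z)) :=
    hf.hasMFDerivAt.comp_hasMFDerivWithinAt z (e.hasMFDerivWithinAt_chart hz)
  have h1' : HasFDerivWithinAt (f ∘ e.chart p)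
      ((dAt (𝓡∂ 2) f (e.chart p z)).comp (e.chartD p z)) (strip p) z := h1.hasFDerivWithinAt
  rw [h1'.fderivWithin (uniqueDiffOn_strip (isOpen_lineDomain p) z hz), pull, hα]
  rfl

/-- The collar coordinates are the collar composed with a chart of the curve. -/
theorem chartD_apply {p : N} {z : ℝ × ℝ} (hz : z ∈ strip p) (v : ℝ × ℝ) :
    e.chartD p z v = e.deriv ((extChartAt (𝓡 1) p).symm (lineEquiv z.2)) z.1
      (chartSymmDeriv (𝓡 1) p (lineEquiv z.2) (lineEquiv v.2), v.1) := by
  have : IsManifold (𝓡 1) 1 N := IsManifold.of_le (m := 1) (n := ∞) (by simp)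
  let L₂ : ℝ × ℝ →L[ℝ] E1 := (lineEquiv : ℝ →L[ℝ] E1).comp (ContinuousLinearMap.snd ℝ ℝ ℝ)
  have h1 : HasMFDerivWithinAt 𝓘(ℝ, ℝ × ℝ) 𝓘(ℝ, E1) (fun z : ℝ × ℝ => lineEquiv z.2) (strip p) z
      L₂ := L₂.hasFDerivWithinAt.hasMFDerivWithinAt
  have h2 : HasMFDerivWithinAt 𝓘(ℝ, E1) (𝓡 1) (extChartAt (𝓡 1) p).symm (range (𝓡 1))
      (lineEquiv z.2) (chartSymmDeriv (𝓡 1) p (lineEquiv z.2)) :=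
    (mdifferentiableWithinAt_extChartAt_symm hz.2).hasMFDerivWithinAt
  have h3 : HasMFDerivWithinAt 𝓘(ℝ, ℝ × ℝ) (𝓡 1)
      (fun z : ℝ × ℝ => (extChartAt (𝓡 1) p).symm (lineEquiv z.2)) (strip p) z
      ((chartSymmDeriv (𝓡 1) p (lineEquiv z.2)).comp L₂) :=
    h2.comp z h1 fun _ _ => by simp
  have h4 : HasMFDerivWithinAt 𝓘(ℝ, ℝ × ℝ) 𝓘(ℝ, ℝ) (fun z : ℝ × ℝ => z.1) (strip p) z
      (ContinuousLinearMap.fst ℝ ℝ ℝ) :=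
    (ContinuousLinearMap.fst ℝ ℝ ℝ).hasFDerivWithinAt.hasMFDerivWithinAt
  have h5 := h3.prodMk h4
  have h6 : HasMFDerivWithinAt ((𝓡 1).prod 𝓘(ℝ, ℝ)) (𝓡∂ 2) e.toPartialEquiv
      (univ ×ˢ Ico (0 : ℝ) 1) ((extChartAt (𝓡 1) p).symm (lineEquiv z.2), z.1)
      (e.deriv ((extChartAt (𝓡 1) p).symm (lineEquiv z.2)) z.1) :=
    ((e.contMDiffOn _ ⟨mem_univ _, hz.1⟩).mdifferentiableWithinAt (by simp)).hasMFDerivWithinAt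
  have hmaps : MapsTo (fun z : ℝ × ℝ => ((extChartAt (𝓡 1) p).symm (lineEquiv z.2), z.1)) (strip p)
      (univ ×ˢ Ico (0 : ℝ) 1) := fun w hw => ⟨mem_univ _, hw.1⟩
  have h7 := h6.comp z h5 hmaps
  have h8 := (uniqueMDiffOn_strip p z hz).eq (e.hasMFDerivWithinAt_chart hz) h7
  exact DFunLike.congr_fun h8 v

theorem det_eq_det_of_apply (A : E2 →L[ℝ] E2) :
    A.det = (Matrix.of ![fun i => A (stdBasis 2 0) i, fun i => A (stdBasis 2 1) i]).det := by
  have h := LinearMap.det_toMatrix (EuclideanSpace.basisFun (Fin 2) ℝ).toBasis A.toLinearMap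
  change _ = A.det at h
  rw [← h, Matrix.det_fin_two, Matrix.det_fin_two]
  simp [LinearMap.toMatrix_apply]
  ring

/-- The collar coordinates are positively oriented. -/
theorem chartD_det_pos (hN : IsOrientedAtlas (𝓡 1) N) (he : e.OrientationCompatible) {p : N}
    {z : ℝ × ℝ} (hz : z ∈ strip p) :
    0 < ((e.chartD p z).comp (planeEquiv.symm : E2 →L[ℝ] ℝ × ℝ)).det := by
  set n := (extChartAt (𝓡 1) p).symm (lineEquiv z.2) with hn
  set A := chartSymmDeriv (𝓡 1) p (lineEquiv z.2) with hA
  have hpos : 0 < A.det := chartSymmDeriv_det_pos hN hz.2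
  -- on a line, an endomorphism is multiplication by its determinant
  have hA1 : A (stdBasis 1 0) = A.det • stdBasis 1 0 := by
    have h := LinearMap.det_toMatrix (EuclideanSpace.basisFun (Fin 1) ℝ).toBasis A.toLinearMap
    change _ = A.det at h
    rw [Matrix.det_unique] at h
    ext i
    fin_cases i
    rw [← h]
    simp [LinearMap.toMatrix_apply]
  have e0 : (e.chartD p z).comp (planeEquiv.symm : E2 →L[ℝ] ℝ × ℝ) (stdBasis 2 0) =
      e.deriv n z.1 (0, 1) := by
    rw [← planeEquiv_fst]
    change e.chartD p z (planeEquiv.symm (planeEquiv (1, 0))) = _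
    rw [ContinuousLinearEquiv.symm_apply_apply, e.chartD_apply hz]
    simp only
    rw [map_zero, ← hA, map_zero]
  have e1 : (e.chartD p z).comp (planeEquiv.symm : E2 →L[ℝ] ℝ × ℝ) (stdBasis 2 1) =
      A.det • e.deriv n z.1 (stdBasis 1 0, 0) := by
    rw [← planeEquiv_snd]
    change e.chartD p z (planeEquiv.symm (planeEquiv (0, 1))) = _
    rw [ContinuousLinearEquiv.symm_apply_apply, e.chartD_apply hz, ← map_smul]
    simp only
    rw [lineEquiv_one, ← hA, hA1, Prod.smul_mk, smul_zero]
  rw [det_eq_det_of_apply, e0, e1]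
  have h := he n z.1 hz.1
  rw [Matrix.det_fin_two] at h ⊢
  simp only [Matrix.of_apply, Matrix.cons_val_zero, Matrix.cons_val_one, PiLp.smul_apply,
    smul_eq_mul] at h ⊢
  have := mul_pos hpos h
  linarith

end Collar

end CollarCharts

/-! ### The form `κ(φ)` as an exact form -/

noncomputable section KappaExact

open Filter MeasureTheory

namespace UnitForm

variable (om : UnitForm)

/-- The primitive `∫_r^1 ω` of `-ω` that vanishes near `1`. -/
def tail (r : ℝ) : ℝ := ∫ t in r..1, om.f t

/-- The support of `ω` stays away from `1`, so that the integral `∫_r^1 ω` can be replaced by one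
over a compact interval on which `ω` is smooth. -/
theorem exists_bound : ∃ b ∈ Ico (0 : ℝ) 1, (∀ t ∈ Ioo b 1, om.f t = 0) ∧
    ∀ r ∈ Ico (0 : ℝ) 1, om.tail r = -∫ t in b..r, om.f t := by
  obtain ⟨b₀, hb₀, h0⟩ := om.compact_support
  set b := max b₀ 0 with hb
  have hb1 : b < 1 := max_lt hb₀ one_pos
  have hbI : b ∈ Ico (0 : ℝ) 1 := ⟨le_max_right _ _, hb1⟩
  have hz : ∀ t ∈ Ioo b 1, om.f t = 0 := fun t ht =>
    h0 t ⟨hbI.1.trans ht.1.le, ht.2⟩ ((le_max_left _ _).trans_lt ht.1)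
  refine ⟨b, hbI, hz, fun r hr => ?_⟩
  have hae : ∀ᵐ t ∂(volume.restrict (uIoc b 1)), om.f t = 0 := by
    rw [uIoc_of_le hb1.le, ← restrict_Ioo_eq_restrict_Ioc]
    exact (ae_restrict_iff' measurableSet_Ioo).2 (Eventually.of_forall hz)
  have h1 : IntervalIntegrable om.f volume b 1 := by
    refine (intervalIntegrable_const (c := (0 : ℝ))).congr_ae ?_
    filter_upwards [hae] with t ht using ht.symm
  have h2 : IntervalIntegrable om.f volume r b :=
    (om.contDiffOn.continuousOn.mono (uIcc_subset_unitIco hr hbI)).intervalIntegrable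
  have h3 : ∫ t in b..1, om.f t = 0 := by
    rw [intervalIntegral.integral_zero_ae]
    rw [ae_restrict_iff' measurableSet_uIoc] at hae
    exact hae
  rw [tail, ← intervalIntegral.integral_add_adjacent_intervals h2 h1, h3, add_zero,
    intervalIntegral.integral_symm]

theorem tail_zero : om.tail 0 = 1 := om.integral_eq

theorem contDiffOn_comp_fst : ContDiffOn ℝ ∞ (fun z : ℝ × ℝ => om.f z.1) (Ico (0 : ℝ) 1 ×ˢ univ) :=
  om.contDiffOn.comp contDiff_fst.contDiffOn fun _ hz => hz.1

theorem contDiffOn_tail : ContDiffOn ℝ ∞ om.tail (Ico 0 1) := by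
  obtain ⟨b, hb, -, h⟩ := om.exists_bound
  have h1 := contDiffOn_primitive isOpen_univ om.contDiffOn_comp_fst hb
  have h2 : ContDiffOn ℝ ∞ (fun r : ℝ => (r, (0 : ℝ))) (Ico 0 1) :=
    (contDiff_id.prodMk contDiff_const).contDiffOn
  refine (h1.comp h2 fun r hr => ⟨hr, mem_univ _⟩).neg.congr fun r hr => ?_
  rw [h r hr]
  rfl

theorem hasDerivWithinAt_tail {r : ℝ} (hr : r ∈ Ico (0 : ℝ) 1) :
    HasDerivWithinAt om.tail (-om.f r) (Ico 0 1) r := by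
  obtain ⟨b, hb, -, h⟩ := om.exists_bound
  have h1 := hasFDerivWithinAt_primitive isOpen_univ om.contDiffOn_comp_fst hb
    (z := (r, 0)) ⟨hr, mem_univ _⟩
  have h2 : HasDerivWithinAt (fun r : ℝ => (r, (0 : ℝ))) ((1 : ℝ), (0 : ℝ)) (Ico 0 1) r :=
    ((hasDerivAt_id r).prodMk (hasDerivAt_const r (0 : ℝ))).hasDerivWithinAt
  have hmaps : MapsTo (fun r : ℝ => (r, (0 : ℝ))) (Ico 0 1) (Ico (0 : ℝ) 1 ×ˢ univ) :=
    fun r hr => ⟨hr, mem_univ _⟩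
  have h3 := (h1.comp_hasDerivWithinAt r h2 hmaps).neg
  exact (h3.congr_deriv (by simp)).congr (fun r hr => h r hr) (h r hr)

/-- The integrand is the derivative of `-(∫_r^1 ω)² / 2`. -/
theorem integral_mul_tail : ∫ r in Ico (0 : ℝ) 1, om.f r * om.tail r = 1 / 2 := by
  obtain ⟨b, hb, hz, h⟩ := om.exists_bound
  have hcont : ContinuousOn (fun r => om.f r * om.tail r) (Icc 0 b) :=
    (om.contDiffOn.continuousOn.mul om.contDiffOn_tail.continuousOn).mono
      (Icc_subset_Ico_right hb.2)
  have h1 : ∫ r in Ico (0 : ℝ) 1, om.f r * om.tail r = ∫ r in (0 : ℝ)..b, om.f r * om.tail r := by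
    rw [intervalIntegral.integral_of_le hb.1, ← integral_Icc_eq_integral_Ioc]
    refine setIntegral_eq_of_subset_of_forall_sdiff_eq_zero measurableSet_Ico
      (Icc_subset_Ico_right hb.2) fun r hr => ?_
    have : b < r := by
      by_contra hh
      exact hr.2 ⟨hr.1.1, not_lt.1 hh⟩
    rw [hz r ⟨this, hr.1.2⟩, zero_mul]
  have htb : om.tail b = 0 := by rw [h b hb, intervalIntegral.integral_same, neg_zero]
  have h2 := intervalIntegral.integral_eq_sub_of_hasDerivAt_of_le hb.1
    (f := fun r => -(1 / 2) * om.tail r ^ 2) (f' := fun r => om.f r * om.tail r)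
    ((continuousOn_const.mul (om.contDiffOn_tail.continuousOn.pow 2)).mono
      (Icc_subset_Ico_right hb.2)) (fun r hr => by
        have := (om.hasDerivWithinAt_tail ⟨hr.1.le, hr.2.trans hb.2⟩).hasDerivAt
          (Ico_mem_nhds hr.1 (hr.2.trans hb.2))
        refine ((this.pow 2).const_mul (-(1 / 2))).congr_deriv ?_
        simp
        ring) (by
          rw [← uIcc_of_le hb.1] at hcont
          exact hcont.intervalIntegrable)
  rw [h1, h2, htb, om.tail_zero]
  norm_num

end UnitForm

/-- A function that is smooth on an open set and vanishes outside a compact subset of it is smooth.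
-/
theorem contMDiff_of_isCompact {E : Type v} [NormedAddCommGroup E] [NormedSpace ℝ E] {H : Type v}
    [TopologicalSpace H] {I : ModelWithCorners ℝ E H} {M : Type u} [TopologicalSpace M] [T2Space M]
    [ChartedSpace H M] {f : M → ℝ} {U K : Set M} (hU : IsOpen U) (hf : ContMDiffOn I 𝓘(ℝ, ℝ) ∞ f U)
    (hK : IsCompact K) (hKU : K ⊆ U) (h0 : ∀ x ∉ K, f x = 0) : ContMDiff I 𝓘(ℝ, ℝ) ∞ f := by
  have hs : tsupport f ⊆ K := closure_minimal (fun x hx => by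
    by_contra h
    exact hx (h0 x h)) hK.isClosed
  exact contMDiff_of_tsupport fun x hx => hf.contMDiffAt (hU.mem_nhds (hKU (hs hx)))

variable {B : Type u} [TopologicalSpace B] [T2Space B] [SigmaCompactSpace B]
  [ChartedSpace (EuclideanHalfSpace 2) B] [IsManifold (𝓡∂ 2) ∞ B]
  {N : Type u} [TopologicalSpace N] [T2Space N] [SigmaCompactSpace N]
  [ChartedSpace E1 N] [IsManifold (𝓡 1) ∞ N]

namespace Collar

variable (e : Collar B N) (om : UnitForm)

theorem tube_subset_target (W : Set N) : e.tube W ⊆ e.toPartialEquiv.target := by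
  rintro _ ⟨⟨n, r⟩, ⟨-, hr⟩, rfl⟩
  exact e.toPartialEquiv.map_source (e.mem_source n hr)

theorem mem_tube {W : Set N} {x : B} (hx : x ∈ e.toPartialEquiv.target) :
    x ∈ e.tube W ↔ e.base x ∈ W := by
  constructor
  · rintro ⟨⟨n, r⟩, ⟨hn, hr⟩, rfl⟩
    rwa [e.base_apply n hr]
  · intro h
    exact ⟨(e.base x, e.rad x), ⟨h, e.rad_mem hx⟩, e.apply_base_rad hx⟩

theorem tube_mono {W W' : Set N} (h : W ⊆ W') : e.tube W ⊆ e.tube W' :=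
  image_mono (prod_mono h le_rfl)

theorem tube_source (p : N) : e.tube (extChartAt (𝓡 1) p).source = (e.chart p).target := by
  ext x
  constructor
  · intro hx
    have ht := e.tube_subset_target _ hx
    exact ⟨ht, (e.mem_tube ht).1 hx⟩
  · rintro ⟨ht, hx⟩
    exact (e.mem_tube ht).2 hx

/-- The points over `K` with coordinate `r ≤ b`. -/
def tubeIcc (K : Set N) (b : ℝ) : Set B := e.toPartialEquiv '' (K ×ˢ Icc 0 b)

theorem isCompact_tubeIcc {K : Set N} (hK : IsCompact K) {b : ℝ} (hb : b < 1) :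
    IsCompact (e.tubeIcc K b) :=
  (hK.prod isCompact_Icc).image_of_continuousOn (e.contMDiffOn.continuousOn.mono
    (prod_mono (subset_univ _) (Icc_subset_Ico_right hb)))

theorem tubeIcc_subset {K W : Set N} (hKW : K ⊆ W) {b : ℝ} (hb : b < 1) :
    e.tubeIcc K b ⊆ e.tube W :=
  image_mono (prod_mono hKW (Icc_subset_Ico_right hb))

theorem mem_tubeIcc {K : Set N} {b : ℝ} {x : B} (hx : x ∈ e.toPartialEquiv.target)
    (h1 : e.base x ∈ K) (h2 : e.rad x ≤ b) : x ∈ e.tubeIcc K b :=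
  ⟨(e.base x, e.rad x), ⟨h1, (e.rad_mem hx).1, h2⟩, e.apply_base_rad hx⟩

open Classical in
/-- The function `(∫_r^1 ω) φ` on the collar, extended by zero. -/
def cutoff (φ : N → ℝ) (x : B) : ℝ :=
  if x ∈ e.toPartialEquiv.target then om.tail (e.rad x) * φ (e.base x) else 0

theorem cutoff_of_mem (φ : N → ℝ) {x : B} (hx : x ∈ e.toPartialEquiv.target) :
    e.cutoff om φ x = om.tail (e.rad x) * φ (e.base x) := if_pos hx

theorem cutoff_support {W : Set N} {φ : N → ℝ} (hφ : φ ∈ bdryFunctions W) :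
    ∃ K : Set B, IsCompact K ∧ K ⊆ e.tube W ∧ ∀ x ∉ K, e.cutoff om φ x = 0 := by
  obtain ⟨L, hL, hLW, h0⟩ := hφ.2
  obtain ⟨b, hb, hz, h⟩ := om.exists_bound
  refine ⟨e.tubeIcc L b, e.isCompact_tubeIcc hL hb.2, e.tubeIcc_subset hLW hb.2, fun x hx => ?_⟩
  by_cases ht : x ∈ e.toPartialEquiv.target
  · rw [e.cutoff_of_mem om φ ht]
    by_cases hb' : e.base x ∈ L
    · have hr : b < e.rad x := by
        by_contra hh
        exact hx (e.mem_tubeIcc ht hb' (not_lt.1 hh))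
      have h1 : ∫ t in b..e.rad x, om.f t = 0 := by
        refine intervalIntegral.integral_zero_ae (Eventually.of_forall fun t ht' => ?_)
        rw [uIoc_of_le hr.le] at ht'
        exact hz t ⟨ht'.1, ht'.2.trans_lt (e.rad_mem ht).2⟩
      rw [h _ (e.rad_mem ht), h1, neg_zero, zero_mul]
    · rw [h0 _ hb', mul_zero]
  · exact if_neg ht

theorem contMDiff_cutoff {W : Set N} {φ : N → ℝ} (hφ : φ ∈ bdryFunctions W) :
    ContMDiff (𝓡∂ 2) 𝓘(ℝ, ℝ) ∞ (e.cutoff om φ) := by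
  obtain ⟨K, hK, hKW, h0⟩ := e.cutoff_support om hφ
  refine contMDiff_of_isCompact e.open_target ?_ hK (hKW.trans (e.tube_subset_target W)) h0
  have h1 : ContMDiffOn (𝓡∂ 2) 𝓘(ℝ, ℝ) ∞ (fun x => om.tail (e.rad x)) e.toPartialEquiv.target :=
    om.contDiffOn_tail.contMDiffOn.comp e.contMDiffOn_rad fun x hx => e.rad_mem hx
  have h2 : ContMDiffOn (𝓡∂ 2) 𝓘(ℝ, ℝ) ∞ (fun x => φ (e.base x)) e.toPartialEquiv.target :=
    hφ.1.comp_contMDiffOn e.contMDiffOn_base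
  exact (h1.mul h2).congr fun x hx => e.cutoff_of_mem om φ hx

theorem zeroForm_cutoff_mem {W : Set N} {φ : N → ℝ} (hφ : φ ∈ bdryFunctions W) :
    zeroForm (e.cutoff om φ) ∈ compactForms (𝓡∂ 2) 0 (e.tube W) := by
  obtain ⟨K, hK, hKW, h0⟩ := e.cutoff_support om hφ
  refine ⟨isSmoothForm_zeroForm (e.contMDiff_cutoff om hφ), K, hK, hKW, fun x hx => ?_⟩
  ext v
  rw [zeroForm_apply, h0 x hx]
  rfl

/-- The form `κ(φ)` is the differential of `-(∫_r^1 ω) φ`, a function which in general does not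
vanish on the boundary. -/
theorem kappaForm_eq {W : Set N} {φ : N → ℝ} (hφ : φ ∈ bdryFunctions W) :
    e.kappaForm om φ = -extD (𝓡∂ 2) (zeroForm (e.cutoff om φ)) := by
  funext x
  rw [Pi.neg_apply]
  by_cases hx : x ∈ e.toPartialEquiv.target
  · have hnhds := e.open_target.mem_nhds hx
    have h1 : HasMFDerivAt (𝓡∂ 2) 𝓘(ℝ, ℝ) e.rad x (dAt (𝓡∂ 2) e.rad x) :=
      ((e.contMDiffOn_rad.contMDiffAt hnhds).mdifferentiableAt (by simp)).hasMFDerivAt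
    have h2 : HasMFDerivWithinAt 𝓘(ℝ, ℝ) 𝓘(ℝ, ℝ) om.tail (Ico 0 1) (e.rad x)
        (ContinuousLinearMap.toSpanSingleton ℝ (-om.f (e.rad x))) :=
      (om.hasDerivWithinAt_tail (e.rad_mem hx)).hasFDerivWithinAt.hasMFDerivWithinAt
    have h3 := (h2.comp x h1.hasMFDerivWithinAt (s := e.toPartialEquiv.target)
      fun y hy => e.rad_mem hy).hasMFDerivAt hnhds
    have h4 : HasMFDerivAt (𝓡∂ 2) 𝓘(ℝ, ℝ) (fun y => φ (e.base y)) x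
        (dAt (𝓡∂ 2) (fun y => φ (e.base y)) x) :=
      (e.mdifferentiableAt_comp_base hφ hx).hasMFDerivAt
    have h5 := h3.mul h4
    have h6 : HasMFDerivAt (𝓡∂ 2) 𝓘(ℝ, ℝ) (e.cutoff om φ) x _ := h5.congr_of_eventuallyEq (by
      filter_upwards [hnhds] with y hy using e.cutoff_of_mem om φ hy)
    rw [extD_zeroForm ((e.contMDiff_cutoff om hφ).mdifferentiableAt (by simp)), kappaForm,
      if_pos hx,
      show dAt (𝓡∂ 2) (e.cutoff om φ) x = _ from h6.mfderiv]
    ext v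
    change om.f (e.rad x) * φ (e.base x) * dAt (𝓡∂ 2) e.rad x (v 0) -
      om.tail (e.rad x) * dAt (𝓡∂ 2) (fun y => φ (e.base y)) x (v 0) =
      -(om.tail (e.rad x) * dAt (𝓡∂ 2) (fun y => φ (e.base y)) x (v 0) +
        φ (e.base x) * (dAt (𝓡∂ 2) e.rad x (v 0) * -om.f (e.rad x)))
    ring
  · obtain ⟨K, hK, hKW, h0⟩ := (e.zeroForm_cutoff_mem om hφ).2
    rw [kappaForm, if_neg hx, extD_eq_zero hK.isClosed h0
      fun h => hx (e.tube_subset_target W (hKW h)), neg_zero]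

theorem kappaForm_mem {W : Set N} {φ : N → ℝ} (hφ : φ ∈ bdryFunctions W) :
    e.kappaForm om φ ∈ compactForms (𝓡∂ 2) 1 (e.tube W) := by
  rw [e.kappaForm_eq om hφ]
  exact neg_mem (compactD (𝓡∂ 2) 0 (e.tube W) ⟨_, e.zeroForm_cutoff_mem om hφ⟩).2

theorem extD_kappaForm {W : Set N} {φ : N → ℝ} (hφ : φ ∈ bdryFunctions W) :
    extD (𝓡∂ 2) (e.kappaForm om φ) = 0 := by
  have h : e.kappaForm om φ = (-1 : ℝ) • extD (𝓡∂ 2) (zeroForm (e.cutoff om φ)) := by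
    rw [e.kappaForm_eq om hφ]
    funext x
    ext v
    simp
  rw [h, extD_smul, extD_extD (isSmoothForm_zeroForm (e.contMDiff_cutoff om hφ)), smul_zero]

end Collar

end KappaExact

/-! ### Compatibility of `κ` with the pairings -/

noncomputable section KappaPairing

open Filter MeasureTheory

theorem measurePreserving_lineEquiv : MeasurePreserving lineEquiv :=
  (PiLp.volume_preserving_toLp (Fin 1)).comp (volume_preserving_funUnique (Fin 1) ℝ).symm

theorem setIntegral_lineEquiv (g : E1 → ℝ) (s : Set E1) :
    ∫ t in lineEquiv ⁻¹' s, g (lineEquiv t) = ∫ y in s, g y :=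
  measurePreserving_lineEquiv.setIntegral_preimage_emb
    lineEquiv.toHomeomorph.measurableEmbedding g s

variable {B : Type u} [TopologicalSpace B] [T2Space B] [SigmaCompactSpace B]
  [ChartedSpace (EuclideanHalfSpace 2) B] [IsManifold (𝓡∂ 2) ∞ B]
  {N : Type u} [TopologicalSpace N] [T2Space N] [SigmaCompactSpace N]
  [ChartedSpace E1 N] [IsManifold (𝓡 1) ∞ N]

/-- The coordinate expression of a function on a curve. -/
def lineRep (p : N) (φ : N → ℝ) (t : ℝ) : ℝ := φ ((extChartAt (𝓡 1) p).symm (lineEquiv t))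

theorem hasDerivAt_lineRep {p : N} {φ : N → ℝ} (hφ : ContMDiff (𝓡 1) 𝓘(ℝ, ℝ) ∞ φ) {t : ℝ}
    (ht : t ∈ lineDomain p) :
    HasDerivAt (lineRep p φ) (dAt (𝓡 1) φ ((extChartAt (𝓡 1) p).symm (lineEquiv t))
      (chartSymmDeriv (𝓡 1) p (lineEquiv t) (stdBasis 1 0))) t := by
  have : IsManifold (𝓡 1) 1 N := IsManifold.of_le (m := 1) (n := ∞) (by simp)
  have h2 : HasMFDerivWithinAt 𝓘(ℝ, E1) (𝓡 1) (extChartAt (𝓡 1) p).symm (range (𝓡 1))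
      (lineEquiv t) (chartSymmDeriv (𝓡 1) p (lineEquiv t)) :=
    (mdifferentiableWithinAt_extChartAt_symm ht).hasMFDerivWithinAt
  have h3 : HasMFDerivWithinAt 𝓘(ℝ, E1) 𝓘(ℝ, ℝ) (φ ∘ (extChartAt (𝓡 1) p).symm) (range (𝓡 1))
      (lineEquiv t) ((dAt (𝓡 1) φ ((extChartAt (𝓡 1) p).symm (lineEquiv t))).comp
        (chartSymmDeriv (𝓡 1) p (lineEquiv t))) :=
    (hφ.mdifferentiableAt (by simp)).hasMFDerivAt.comp_hasMFDerivWithinAt _ h2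
  have h4 : HasFDerivAt (φ ∘ (extChartAt (𝓡 1) p).symm)
      ((dAt (𝓡 1) φ ((extChartAt (𝓡 1) p).symm (lineEquiv t))).comp
        (chartSymmDeriv (𝓡 1) p (lineEquiv t))) (lineEquiv t) :=
    h3.hasFDerivWithinAt.hasFDerivAt (by simp)
  have h5 : HasDerivAt (fun t => lineEquiv t) (lineEquiv 1) t :=
    (lineEquiv : ℝ →L[ℝ] E1).hasDerivAt
  have h6 := h4.comp_hasDerivAt t h5
  rw [lineEquiv_one] at h6
  exact h6

theorem smul_oneForm_dAt_mem_left {W : Set N} {φ ψ : N → ℝ} (hφ : φ ∈ bdryFunctions W)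
    (hψ : ContMDiff (𝓡 1) 𝓘(ℝ, ℝ) ∞ ψ) :
    (fun x => φ x • oneForm (dAt (𝓡 1) ψ x)) ∈ compactForms (𝓡 1) 1 W := by
  obtain ⟨K, hK, hKW, h0⟩ := hφ.2
  refine ⟨?_, K, hK, hKW, fun x hx => ?_⟩
  · convert (isSmoothForm_zeroForm hψ).extD.smul hφ.1 using 3 with x
    exact (extD_zeroForm (hψ.mdifferentiableAt (by simp))).symm
  · beta_reduce
    rw [h0 x hx, zero_smul]

/-- The integral of `φ dψ` in a chart. -/
theorem integral_smul_dAt (hN : IsOrientedAtlas (𝓡 1) N) {p : N} {φ ψ : N → ℝ}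
    (hφψ : (fun x => φ x • oneForm (dAt (𝓡 1) ψ x)) ∈
      compactForms (𝓡 1) 1 (extChartAt (𝓡 1) p).source)
    (hψ : ContMDiff (𝓡 1) 𝓘(ℝ, ℝ) ∞ ψ) :
    IntegrableOn (fun t => lineRep p φ t * _root_.deriv (lineRep p ψ) t) (lineDomain p) ∧
    _root_.integral (𝓡 1) (fun x => φ x • oneForm (dAt (𝓡 1) ψ x)) =
      ∫ t in lineDomain p, lineRep p φ t * _root_.deriv (lineRep p ψ) t := by
  have h1 : ∀ t ∈ lineDomain p,
      chartRep (𝓡 1) (fun x => φ x • oneForm (dAt (𝓡 1) ψ x)) p (lineEquiv t) (stdBasis 1) =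
        lineRep p φ t * _root_.deriv (lineRep p ψ) t := fun t ht => by
    rw [(hasDerivAt_lineRep hψ ht).deriv]
    rfl
  have hm : MeasurableSet (lineDomain p) := (isOpen_lineDomain p).measurableSet
  constructor
  · have h2 := integrableOn_chartRep hφψ
    rw [← measurePreserving_lineEquiv.integrableOn_comp_preimage
      lineEquiv.toHomeomorph.measurableEmbedding] at h2
    exact h2.congr_fun h1 hm
  · rw [integral_eq_chartIntegral hN hφψ, ← setIntegral_congr_fun hm h1]
    exact (setIntegral_lineEquiv (fun y => chartRep (𝓡 1)
      (fun x => φ x • oneForm (dAt (𝓡 1) ψ x)) p y (stdBasis 1)) _).symm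

/-- A compactly supported function is a finite sum of functions with support in chart domains. -/
theorem exists_sum_bdryFunctions {W : Set N} (φ : bdryFunctions W) :
    ∃ (F : Finset N) (f : N → bdryFunctions W), φ = ∑ p ∈ F, f p ∧
      ∀ p, (f p).1 ∈ bdryFunctions ((extChartAt (𝓡 1) p).source ∩ W) := by
  obtain ⟨K, hK, hKW, h0⟩ := φ.2.2
  obtain ⟨F, hF0, hF1⟩ := finite_chartPartition (I := 𝓡 1) hK
  have hmem : ∀ p, (fun x => chartPartition (𝓡 1) N p x * φ.1 x) ∈
      bdryFunctions ((extChartAt (𝓡 1) p).source ∩ W) := by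
    refine fun p => ⟨(chartPartition (𝓡 1) N p).contMDiff.mul φ.2.1,
      tsupport (chartPartition (𝓡 1) N p) ∩ K, hK.inter_left (isClosed_tsupport _),
      inter_subset_inter (chartPartition_subordinate p) hKW, fun x hx => ?_⟩
    beta_reduce
    by_cases hxK : x ∈ K
    · rw [image_eq_zero_of_notMem_tsupport fun h => hx ⟨h, hxK⟩, zero_mul]
    · rw [h0 x hxK, mul_zero]
  refine ⟨F, fun p => ⟨_, bdryFunctions_mono inter_subset_right (hmem p)⟩,
    Subtype.ext (funext fun x => ?_), hmem⟩
  rw [AddSubmonoidClass.coe_finsetSum, Finset.sum_apply]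
  simp only
  rw [← Finset.sum_mul]
  by_cases hx : x ∈ K
  · rw [hF1 x hx, one_mul]
  · rw [h0 x hx, mul_zero]

namespace Collar

variable (e : Collar B N) (om : UnitForm)

/-- The integral of a form over a surface in the collar coordinates. -/
theorem integral_eq_strip (hB : IsOrientedAtlas (𝓡∂ 2) B) (hN : IsOrientedAtlas (𝓡 1) N)
    (he : e.OrientationCompatible) {p : N} {α : B → E2 [⋀^Fin 2]→L[ℝ] ℝ}
    (hα : α ∈ compactForms (𝓡∂ 2) 2 (e.chart p).target) :
    _root_.integral (𝓡∂ 2) α = ∫ z in strip p, e.pull p α z ![(1, 0), (0, 1)] := by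
  set S : Set E2 := planeEquiv.symm ⁻¹' strip p with hS
  have hpre : planeEquiv ⁻¹' S = strip p := by
    ext z
    rw [hS, mem_preimage, mem_preimage, ContinuousLinearEquiv.symm_apply_apply]
  have hSm : MeasurableSet S :=
    (measurableSet_Ico.prod (isOpen_lineDomain p).measurableSet).preimage
      planeEquiv.symm.continuous.measurable
  have h := integral_eq_setIntegral hB hα hSm (Ψ := e.chart p ∘ planeEquiv.symm)
    (Ψ' := fun y => (e.chartD p (planeEquiv.symm y)).comp (planeEquiv.symm : E2 →L[ℝ] ℝ × ℝ))
    (fun y hy => ?_) (fun y hy => e.chartD_det_pos hN he hy) (fun y hy y' hy' h => ?_)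
    (fun x hx => ?_)
  · rw [h, ← setIntegral_planeEquiv, hpre]
    refine setIntegral_congr_fun (measurableSet_Ico.prod (isOpen_lineDomain p).measurableSet)
      fun z _ => ?_
    simp only [Function.comp_apply, ContinuousLinearEquiv.symm_apply_apply]
    change α (e.chart p z) _ = α (e.chart p z) _
    congr 1
    funext i
    fin_cases i
    · change e.chartD p z (planeEquiv.symm (stdBasis 2 0)) = e.chartD p z (1, 0)
      rw [← planeEquiv_fst, ContinuousLinearEquiv.symm_apply_apply]
    · change e.chartD p z (planeEquiv.symm (stdBasis 2 1)) = e.chartD p z (0, 1)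
      rw [← planeEquiv_snd, ContinuousLinearEquiv.symm_apply_apply]
  · have h1 : HasMFDerivWithinAt 𝓘(ℝ, E2) 𝓘(ℝ, ℝ × ℝ) planeEquiv.symm S y
        (planeEquiv.symm : E2 →L[ℝ] ℝ × ℝ) :=
      (planeEquiv.symm : E2 →L[ℝ] ℝ × ℝ).hasFDerivWithinAt.hasMFDerivWithinAt
    exact (e.hasMFDerivWithinAt_chart hy).comp y h1 fun _ hz => hz
  · exact planeEquiv.symm.injective ((e.chart p).injOn hy hy' h)
  · obtain ⟨K, -, hKs, h0⟩ := hα.2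
    have hxt : x ∈ (e.chart p).target := by
      by_contra h
      exact hx (h0 x fun h' => h (hKs h'))
    refine ⟨planeEquiv ((e.chart p).symm x), ?_, ?_⟩
    · rw [hS, mem_preimage, ContinuousLinearEquiv.symm_apply_apply]
      exact (e.chart p).map_target hxt
    · rw [Function.comp_apply, ContinuousLinearEquiv.symm_apply_apply]
      exact (e.chart p).right_inv hxt

/-- In collar coordinates, `κ(φ) = φ ω - (∫_r^1 ω) φ' dx`. -/
theorem pull_kappaForm {p : N} {W : Set N} {φ : N → ℝ} (hφ : φ ∈ bdryFunctions W) {z : ℝ × ℝ}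
    (hz : z ∈ strip p) (v : Fin 1 → ℝ × ℝ) :
    e.pull p (e.kappaForm om φ) z v = om.f z.1 * lineRep p φ z.2 * (v 0).1 -
      om.tail z.1 * _root_.deriv (lineRep p φ) z.2 * (v 0).2 := by
  have hG := (e.contMDiff_cutoff om hφ).mdifferentiableAt (x := e.chart p z) (by simp)
  have h1 := e.pull_oneForm_dAt hz hG (extD_zeroForm hG) v
  have h2 : e.pull p (e.kappaForm om φ) z v =
      -e.pull p (extD (𝓡∂ 2) (zeroForm (e.cutoff om φ))) z v := by
    rw [e.kappaForm_eq om hφ]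
    rfl
  have h3 : HasFDerivWithinAt (fun z : ℝ × ℝ => om.tail z.1)
      ((-om.f z.1) • ContinuousLinearMap.fst ℝ ℝ ℝ) (strip p) z :=
    (om.hasDerivWithinAt_tail hz.1).comp_hasFDerivWithinAt z hasFDerivWithinAt_fst
      fun w hw => hw.1
  have h4 : HasFDerivWithinAt (fun z : ℝ × ℝ => lineRep p φ z.2)
      (_root_.deriv (lineRep p φ) z.2 • ContinuousLinearMap.snd ℝ ℝ ℝ) (strip p) z :=
    (hasDerivAt_lineRep hφ.1 hz.2).differentiableAt.hasDerivAt.comp_hasFDerivWithinAt z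
      hasFDerivWithinAt_snd
  have h5 : HasFDerivWithinAt (e.cutoff om φ ∘ e.chart p) (om.tail z.1 •
      (_root_.deriv (lineRep p φ) z.2 • ContinuousLinearMap.snd ℝ ℝ ℝ) +
      lineRep p φ z.2 • ((-om.f z.1) • ContinuousLinearMap.fst ℝ ℝ ℝ)) (strip p) z := by
    have h6 : ∀ w ∈ strip p, (e.cutoff om φ ∘ e.chart p) w = om.tail w.1 * lineRep p φ w.2 := by
      intro w hw
      rw [Function.comp_apply, e.cutoff_of_mem om φ ((e.chart p).map_source hw).1, e.rad_chart hw,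
        e.base_chart hw]
      rfl
    exact (h3.mul h4).congr h6 (h6 z hz)
  rw [h2, h1, h5.fderivWithin (uniqueDiffOn_strip (isOpen_lineDomain p) z hz)]
  simp
  ring

/-- Fubini's theorem in collar coordinates; the factor `1/2` is the integral of `(∫_r^1 ω) ω`
over the fibres. -/
theorem integral_wedge_kappaForm (hB : IsOrientedAtlas (𝓡∂ 2) B) (hN : IsOrientedAtlas (𝓡 1) N)
    (he : e.OrientationCompatible) {p : N} {W : Set N} {φ ψ : N → ℝ}
    (hφ : φ ∈ bdryFunctions (extChartAt (𝓡 1) p).source) (hψ : ψ ∈ bdryFunctions W) :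
    _root_.integral (𝓡∂ 2) (fun x => wedge (e.kappaForm om φ x) (e.kappaForm om ψ x)) =
      -(1 / 2) * ∫ t in lineDomain p,
        (lineRep p φ t * _root_.deriv (lineRep p ψ) t -
          lineRep p ψ t * _root_.deriv (lineRep p φ) t) := by
  have hm := wedge_mem_compactForms (e.kappaForm_mem om hφ) (e.kappaForm_mem om hψ).1
  rw [e.tube_source] at hm
  have h1 : ∀ z ∈ strip p,
      e.pull p (fun x => wedge (e.kappaForm om φ x) (e.kappaForm om ψ x)) z ![(1, 0), (0, 1)] =
        (om.f z.1 * om.tail z.1) * -(lineRep p φ z.2 * _root_.deriv (lineRep p ψ) z.2 -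
          lineRep p ψ z.2 * _root_.deriv (lineRep p φ) z.2) := by
    intro z hz
    have h2 : e.pull p (fun x => wedge (e.kappaForm om φ x) (e.kappaForm om ψ x)) z =
        wedge (e.pull p (e.kappaForm om φ) z) (e.pull p (e.kappaForm om ψ) z) :=
      wedge_compContinuousLinearMap _ _ _
    rw [h2, wedge_apply, e.pull_kappaForm om hφ hz, e.pull_kappaForm om hφ hz,
      e.pull_kappaForm om hψ hz, e.pull_kappaForm om hψ hz]
    simp
    ring
  rw [e.integral_eq_strip hB hN he hm,
    setIntegral_congr_fun (measurableSet_Ico.prod (isOpen_lineDomain p).measurableSet) h1,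
    Measure.volume_eq_prod,
    setIntegral_prod_mul (fun r => om.f r * om.tail r) (fun t => -(lineRep p φ t *
      _root_.deriv (lineRep p ψ) t - lineRep p ψ t * _root_.deriv (lineRep p φ) t)),
    om.integral_mul_tail,
    MeasureTheory.integral_neg]
  ring

/-- The map `κ` is compatible with the pairings: a partition of unity reduces this to `φ` supported
in a chart, where both sides are integrals over the line, equal by integration by parts. -/
theorem bulkPairing_kappa (hB : IsOrientedAtlas (𝓡∂ 2) B) (hN : IsOrientedAtlas (𝓡 1) N)
    (he : e.OrientationCompatible) {W : Set N}
    (hmem : ∀ φ ∈ bdryFunctions W, e.kappaForm om φ ∈ compactForms (𝓡∂ 2) 1 (e.tube W))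
    (hd : ∀ φ ∈ bdryFunctions W, extD (𝓡∂ 2) (e.kappaForm om φ) = 0)
    (φ ψ : (bdryCpx W).carrier) :
    bulkPairing (e.tube W) ((e.kappa om hmem hd).toLin φ) ((e.kappa om hmem hd).toLin ψ) =
      bdryPairing W φ ψ := by
  have hσ := isPoisson_bulkPairing hB (e.tube W)
  obtain ⟨F, f, hf, hfs⟩ : ∃ (F : Finset N) (f : N → (bdryCpx W).carrier), φ = ∑ p ∈ F, f p ∧
      ∀ p, (f p).1 ∈ bdryFunctions ((extChartAt (𝓡 1) p).source ∩ W) := exists_sum_bdryFunctions φ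
  rw [hf]
  refine Finset.sum_induction f (fun χ : (bdryCpx W).carrier =>
    bulkPairing (e.tube W) ((e.kappa om hmem hd).toLin χ) ((e.kappa om hmem hd).toLin ψ) =
      bdryPairing W χ ψ) (fun χ χ' h h' => ?_) ?_ fun p _ => ?_
  · rw [map_add, hσ.add_left, bdryPairing_add_left, h, h']
  · have h0 := bdryPairing_smul_left 0 0 ψ
    have h0' := hσ.smul_left 0 0 ((e.kappa om hmem hd).toLin ψ)
    rw [zero_smul, zero_mul] at h0 h0'
    rw [map_zero, h0, h0']
  · have h1 := bdryFunctions_mono inter_subset_left (hfs p)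
    have h2 : bulkPairing (e.tube W) ((e.kappa om hmem hd).toLin (f p))
        ((e.kappa om hmem hd).toLin ψ) =
        _root_.integral (𝓡∂ 2)
          (fun x => wedge (e.kappaForm om (f p).1 x) (e.kappaForm om ψ.1 x)) := by
      refine (bulkPairing_eq _ _ _ _ _ _ _).trans ?_
      have h3 : ∀ a, smulPairing (e.tube W) a 0 = 0 := fun a => map_zero _
      rw [h3, neg_zero, zero_add]
      exact sub_zero _
    obtain ⟨i1, e1⟩ := integral_smul_dAt hN (smul_oneForm_dAt_mem_left h1 ψ.2.1) ψ.2.1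
    obtain ⟨i2, e2⟩ := integral_smul_dAt hN (smul_oneForm_dAt_mem ψ.2.1 h1) h1.1
    -- integration by parts absorbs the factor `1/2`
    have h5 := bdryPairing_comm hN (f p) ψ
    rw [h2, e.integral_wedge_kappaForm om hB hN he h1 ψ.2, integral_sub i1 i2, ← e1, ← e2]
    have h6 : bdryPairing W (f p) ψ =
      -_root_.integral (𝓡 1) (fun x => (f p).1 x • oneForm (dAt (𝓡 1) ψ.1 x)) := rfl
    have h7 : bdryPairing W ψ (f p) =
      -_root_.integral (𝓡 1) (fun x => ψ.1 x • oneForm (dAt (𝓡 1) (f p).1 x)) := rfl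
    linarith

end Collar

end KappaPairing

/-! ### Integration along the fibres of the collar -/

noncomputable section FibreIntegration

open Filter MeasureTheory

variable {B : Type u} [TopologicalSpace B] [T2Space B] [SigmaCompactSpace B]
  [ChartedSpace (EuclideanHalfSpace 2) B] [IsManifold (𝓡∂ 2) ∞ B]
  {N : Type u} [TopologicalSpace N] [T2Space N] [SigmaCompactSpace N]
  [ChartedSpace E1 N] [IsManifold (𝓡 1) ∞ N]

namespace Collar

variable (e : Collar B N)

/-- A compact subset of the collar stays away from the end `r = 1`. -/
theorem exists_rad_lt {K : Set B} (hK : IsCompact K) (hKt : K ⊆ e.toPartialEquiv.target) :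
    ∃ b ∈ Ico (0 : ℝ) 1, ∀ x ∈ K, e.rad x < b := by
  obtain rfl | hne := K.eq_empty_or_nonempty
  · exact ⟨0, by simp, by simp⟩
  obtain ⟨x, hx, hmax⟩ := hK.exists_isMaxOn hne (e.contMDiffOn_rad.continuousOn.mono hKt)
  have h := e.rad_mem (hKt hx)
  exact ⟨(e.rad x + 1) / 2, ⟨by linarith [h.1], by linarith [h.2]⟩, fun y hy => by
    have : e.rad y ≤ e.rad x := hmax hy
    linarith [h.2]⟩

theorem isCompact_base_image {K : Set B} (hK : IsCompact K) {W : Set N} (hKW : K ⊆ e.tube W) :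
    IsCompact (e.base '' K) ∧ e.base '' K ⊆ W := by
  have ht := hKW.trans (e.tube_subset_target W)
  refine ⟨hK.image_of_continuousOn (e.contMDiffOn_base.continuousOn.mono ht), ?_⟩
  rintro _ ⟨x, hx, rfl⟩
  exact (e.mem_tube (ht hx)).1 (hKW hx)

theorem subset_tubeIcc {K : Set B} (hKt : K ⊆ e.toPartialEquiv.target) {b : ℝ}
    (hb : ∀ x ∈ K, e.rad x < b) : K ⊆ e.tubeIcc (e.base '' K) b :=
  fun x hx => e.mem_tubeIcc (hKt hx) ⟨x, hx, rfl⟩ (hb x hx).le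

theorem contDiffOn_comp_chart {f : B → ℝ} (hf : ContMDiff (𝓡∂ 2) 𝓘(ℝ, ℝ) ∞ f) (p : N) :
    ContDiffOn ℝ ∞ (f ∘ e.chart p) (strip p) :=
  contMDiffOn_iff_contDiffOn.1 (hf.comp_contMDiffOn (e.contMDiffOn_chart p))

open Classical in
/-- The integral of a function along the fibres of the collar, from the coordinate `b`; extended by
zero. -/
def fibrePrimitive (b : ℝ) (P : B → ℝ) (x : B) : ℝ :=
  if x ∈ e.toPartialEquiv.target then ∫ s in b..e.rad x, P (e.toPartialEquiv (e.base x, s)) else 0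

theorem fibrePrimitive_chart (b : ℝ) (P : B → ℝ) {p : N} {z : ℝ × ℝ} (hz : z ∈ strip p) :
    e.fibrePrimitive b P (e.chart p z) = ∫ s in b..z.1, (P ∘ e.chart p) (s, z.2) := by
  rw [fibrePrimitive, if_pos ((e.chart p).map_source hz).1, e.rad_chart hz, e.base_chart hz]
  rfl

section

variable {W : Set N} {K : Set B} {P : B → ℝ} {b : ℝ}

/-- The primitive starts beyond the support of `P`, so it vanishes near the end `r = 1` and over the
complement of the projection of the support. -/
theorem fibrePrimitive_eq_zero (hb : b ∈ Ico (0 : ℝ) 1)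
    (hbK : ∀ x ∈ K, e.rad x < b) (hP0 : ∀ x ∉ K, P x = 0) {x : B}
    (hx : x ∉ e.tubeIcc (e.base '' K) b) : e.fibrePrimitive b P x = 0 := by
  by_cases ht : x ∈ e.toPartialEquiv.target
  · have hr := e.rad_mem ht
    rw [fibrePrimitive, if_pos ht]
    refine intervalIntegral.integral_zero_ae (Eventually.of_forall fun s hs => hP0 _ fun hsK => ?_)
    have hs' := uIcc_subset_unitIco hb hr (uIoc_subset_uIcc hs)
    have h1 := hbK _ hsK
    rw [e.rad_apply _ hs'] at h1
    have h2 : e.base x ∈ e.base '' K := ⟨_, hsK, e.base_apply _ hs'⟩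
    have h3 : b < e.rad x := by
      by_contra h
      exact hx (e.mem_tubeIcc ht h2 (not_lt.1 h))
    rw [uIoc_of_le h3.le] at hs
    exact lt_irrefl _ (h1.trans hs.1)
  · exact if_neg ht

theorem eqOn_fibrePrimitive_chart (p : N) :
    EqOn (e.fibrePrimitive b P ∘ e.chart p)
      (fun z => ∫ s in b..z.1, (P ∘ e.chart p) (s, z.2)) (strip p) :=
  fun _ hz => e.fibrePrimitive_chart b P hz

theorem contMDiff_fibrePrimitive (hK : IsCompact K) (hKW : K ⊆ e.tube W)
    (hb : b ∈ Ico (0 : ℝ) 1) (hbK : ∀ x ∈ K, e.rad x < b) (hP0 : ∀ x ∉ K, P x = 0)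
    (hP : ContMDiff (𝓡∂ 2) 𝓘(ℝ, ℝ) ∞ P) :
    ContMDiff (𝓡∂ 2) 𝓘(ℝ, ℝ) ∞ (e.fibrePrimitive b P) := by
  obtain ⟨hL, hLW⟩ := e.isCompact_base_image hK hKW
  refine contMDiff_of_isCompact e.open_target (fun x hx => ?_) (e.isCompact_tubeIcc hL hb.2)
    ((e.tubeIcc_subset hLW hb.2).trans (e.tube_subset_target W))
    fun x hx => e.fibrePrimitive_eq_zero hb hbK hP0 hx
  set p := e.base x
  have h1 := (contDiffOn_primitive (isOpen_lineDomain p) (e.contDiffOn_comp_chart hP p)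
    hb).contMDiffOn
  have h2 := h1.comp (e.contMDiffOn_chart_symm p) fun y hy => (e.chart p).map_target hy
  refine ((h2.congr fun y hy => ?_).contMDiffAt
    ((e.isOpen_chart_target p).mem_nhds (e.mem_chart_target hx))).contMDiffWithinAt
  have := e.fibrePrimitive_chart b P ((e.chart p).map_target hy)
  rw [(e.chart p).right_inv hy] at this
  exact this

theorem fderivWithin_fibrePrimitive (hb : b ∈ Ico (0 : ℝ) 1)
    (hP : ContMDiff (𝓡∂ 2) 𝓘(ℝ, ℝ) ∞ P) {p : N} {z : ℝ × ℝ} (hz : z ∈ strip p) :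
    fderivWithin ℝ (e.fibrePrimitive b P ∘ e.chart p) (strip p) z =
      P (e.chart p z) • ContinuousLinearMap.fst ℝ ℝ ℝ +
        (∫ s in b..z.1, fderivWithin ℝ (P ∘ e.chart p) (strip p) (s, z.2) (0, 1)) •
          ContinuousLinearMap.snd ℝ ℝ ℝ := by
  have h := hasFDerivWithinAt_primitive (isOpen_lineDomain p) (e.contDiffOn_comp_chart hP p) hb hz
  exact (h.congr (e.eqOn_fibrePrimitive_chart p)
    (e.fibrePrimitive_chart b P hz)).fderivWithin (uniqueDiffOn_strip (isOpen_lineDomain p) z hz)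

end

theorem hasDerivWithinAt_line {f : ℝ × ℝ → ℝ} {p : N} (hf : ContDiffOn ℝ ∞ f (strip p)) {r t : ℝ}
    (hr : r ∈ Ico (0 : ℝ) 1) (ht : t ∈ lineDomain p) :
    HasDerivWithinAt (fun s => f (s, t)) (fderivWithin ℝ f (strip p) (r, t) (1, 0))
      (Ico 0 1) r := by
  have h1 := ((hf (r, t) ⟨hr, ht⟩).differentiableWithinAt (by simp)).hasFDerivWithinAt
  have h2 : HasDerivWithinAt (fun s : ℝ => (s, t)) ((1 : ℝ), (0 : ℝ)) (Ico 0 1) r :=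
    ((hasDerivAt_id r).prodMk (hasDerivAt_const r t)).hasDerivWithinAt
  have hm : MapsTo (fun s : ℝ => (s, t)) (Ico 0 1) (strip p) := fun s hs => ⟨hs, ht⟩
  exact h1.comp_hasDerivWithinAt r h2 hm

/-- The fundamental theorem of calculus along the fibres. -/
theorem integral_fderivWithin_line {f : ℝ × ℝ → ℝ} {p : N} (hf : ContDiffOn ℝ ∞ f (strip p))
    {b r t : ℝ} (hb : b ∈ Ico (0 : ℝ) 1) (hr : r ∈ Ico (0 : ℝ) 1) (ht : t ∈ lineDomain p) :
    ∫ s in b..r, fderivWithin ℝ f (strip p) (s, t) (1, 0) = f (r, t) - f (b, t) := by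
  have hsub := uIcc_subset_unitIco hb hr
  have hd : ∀ s ∈ uIcc b r, HasDerivWithinAt (fun s => f (s, t))
      (fderivWithin ℝ f (strip p) (s, t) (1, 0)) (Ico 0 1) s := fun s hs =>
    hasDerivWithinAt_line hf (hsub hs) ht
  refine intervalIntegral.integral_eq_sub_of_hasDeriv_right (f := fun s => f (s, t))
    (fun s hs => ((hd s hs).continuousWithinAt).mono hsub) (fun s hs => ?_) ?_
  · have hs' : s ∈ uIcc b r := Ioo_subset_Icc_self hs
    refine (hd s hs').mono_of_mem_nhdsWithin ?_
    exact mem_of_superset (Ioo_mem_nhdsGT (hsub hs').2) fun y hy =>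
      ⟨(hsub hs').1.trans hy.1.le, hy.2⟩
  · refine ContinuousOn.intervalIntegrable ?_
    have hc := (contDiffOn_fderivWithin_strip_apply (isOpen_lineDomain p) hf (1, 0)).continuousOn
    exact hc.comp (Continuous.prodMk_left t).continuousOn fun s hs => ⟨hsub hs, ht⟩

theorem differentiableWithinAt_pull {k : ℕ} {p : N} {α : B → E2 [⋀^Fin k]→L[ℝ] ℝ}
    (hα : IsSmoothForm (𝓡∂ 2) α) {z : ℝ × ℝ} (hz : z ∈ strip p) :
    DifferentiableWithinAt ℝ (e.pull p α) (strip p) z := by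
  obtain ⟨hT, hev⟩ := e.pull_eventuallyEq α hz
  have hd : DifferentiableWithinAt ℝ (chartRep (𝓡∂ 2) α (e.chart p z)) (range (𝓡∂ 2))
      ((extChartAt (𝓡∂ 2) (e.chart p z) ∘ e.chart p) z) :=
    (hα.contDiffWithinAt (mem_extChartAt_target _)).differentiableWithinAt (by simp)
  have hTd := hT.fderivWithin_right (m := ∞) (uniqueDiffOn_strip (isOpen_lineDomain p)) (by simp) hz
  exact ((hd.comp z (hT.differentiableWithinAt (by simp))
    (e.mapsTo_extChartAt_range p _)).continuousAlternatingMapCompContinuousLinearMap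
    (hTd.differentiableWithinAt (by simp))).congr_of_eventuallyEq hev (hev.self_of_nhdsWithin hz)

/-- A function with compact support in the tube whose differential vanishes is zero. -/
theorem eq_zero_of_extD_eq_zero {W : Set N} {f : B → ℝ} (hf : ContMDiff (𝓡∂ 2) 𝓘(ℝ, ℝ) ∞ f)
    {K : Set B} (hK : IsCompact K) (hKW : K ⊆ e.tube W) (h0 : ∀ x ∉ K, f x = 0)
    (hd : extD (𝓡∂ 2) (zeroForm f) = 0) : f = 0 := by
  have hKt := hKW.trans (e.tube_subset_target W)
  obtain ⟨b, hb, hbK⟩ := e.exists_rad_lt hK hKt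
  funext x
  by_cases hx : x ∈ K
  · have hc := e.mem_chart_target (hKt hx)
    set p := e.base x
    have hz := (e.chart p).map_target hc
    set z := (e.chart p).symm x
    have hfd : ∀ w ∈ strip p, fderivWithin ℝ (f ∘ e.chart p) (strip p) w = 0 := by
      intro w hw
      have hfw := hf.mdifferentiableAt (x := e.chart p w) (by simp)
      refine ContinuousLinearMap.ext fun v => ?_
      rw [← e.pull_oneForm_dAt hw hfw (extD_zeroForm hfw) (fun _ => v), hd]
      rfl
    have h1 := integral_fderivWithin_line (e.contDiffOn_comp_chart hf p) hb hz.1 hz.2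
    have h2 : ∫ s in b..z.1, fderivWithin ℝ (f ∘ e.chart p) (strip p) (s, z.2) (1, 0) = 0 := by
      refine intervalIntegral.integral_zero_ae (Eventually.of_forall fun s hs => ?_)
      rw [hfd (s, z.2) ⟨uIcc_subset_unitIco hb hz.1 (uIoc_subset_uIcc hs), hz.2⟩]
      rfl
    have h3 : (f ∘ e.chart p) (b, z.2) = 0 := h0 _ fun h => by
      have := hbK _ h
      rw [e.rad_chart (z := (b, z.2)) ⟨hb, hz.2⟩] at this
      exact lt_irrefl _ this
    rw [h2, h3, sub_zero] at h1
    have h4 : e.chart p z = x := (e.chart p).right_inv hc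
    rw [← h4]
    exact h1.symm
  · exact h0 x hx

end Collar

end FibreIntegration

/-! ### The Poincaré lemma for functions and `1`-forms -/

noncomputable section PoincareLemma

open Filter MeasureTheory

variable {B : Type u} [TopologicalSpace B] [T2Space B] [SigmaCompactSpace B]
  [ChartedSpace (EuclideanHalfSpace 2) B] [IsManifold (𝓡∂ 2) ∞ B]
  {N : Type u} [TopologicalSpace N] [T2Space N] [SigmaCompactSpace N]
  [ChartedSpace E1 N] [IsManifold (𝓡 1) ∞ N]

theorem zeroForm_mem_compactForms {V : Set B} {f : B → ℝ} (hf : ContMDiff (𝓡∂ 2) 𝓘(ℝ, ℝ) ∞ f)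
    {K : Set B} (hK : IsCompact K) (hKV : K ⊆ V) (h0 : ∀ x ∉ K, f x = 0) :
    zeroForm f ∈ compactForms (𝓡∂ 2) 0 V := by
  refine ⟨isSmoothForm_zeroForm hf, K, hK, hKV, fun x hx => ?_⟩
  ext v
  rw [zeroForm_apply, h0 x hx]
  rfl

theorem extD_zeroForm_add {f g : B → ℝ} (hf : ContMDiff (𝓡∂ 2) 𝓘(ℝ, ℝ) ∞ f)
    (hg : ContMDiff (𝓡∂ 2) 𝓘(ℝ, ℝ) ∞ g) :
    extD (𝓡∂ 2) (zeroForm (fun x => f x + g x)) =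
      extD (𝓡∂ 2) (zeroForm f) + extD (𝓡∂ 2) (zeroForm g) := by
  rw [← extD_add (isSmoothForm_zeroForm hf) (isSmoothForm_zeroForm hg)]
  congr 1

/-- A smooth function near a compact set agrees near this set with a smooth function on the whole
surface. -/
theorem exists_contMDiff_eventuallyEq {f : B → ℝ} {U K : Set B} (hU : IsOpen U)
    (hf : ContMDiffOn (𝓡∂ 2) 𝓘(ℝ, ℝ) ∞ f U) (hK : IsCompact K) (hKU : K ⊆ U) :
    ∃ g : B → ℝ, ContMDiff (𝓡∂ 2) 𝓘(ℝ, ℝ) ∞ g ∧ ∀ x ∈ K, g =ᶠ[𝓝 x] f := by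
  have : LocallyCompactSpace (EuclideanHalfSpace 2) := (𝓡∂ 2).locallyCompactSpace
  have : LocallyCompactSpace B := ChartedSpace.locallyCompactSpace (EuclideanHalfSpace 2) B
  obtain ⟨L, hL, hKL, hLU⟩ := exists_compact_between hK hU hKU
  obtain ⟨ζ, hζ1, hζ0, -⟩ := exists_contMDiffMap_one_nhds_of_subset_interior (𝓡∂ 2)
    (n := (⊤ : ℕ∞)) hK.isClosed hKL
  refine ⟨fun x => ζ x * f x, contMDiff_of_isCompact hU (ζ.contMDiff.contMDiffOn.mul hf) hL hLU
    fun x hx => by rw [hζ0 x hx, zero_mul], fun x hx => ?_⟩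
  filter_upwards [(hζ1.filter_mono (nhds_le_nhdsSet hx))] with y hy
  rw [hy, one_mul]

/-- A `2`-form on the plane is determined by its coefficient. -/
theorem alternating_two_ext {a b : (ℝ × ℝ) [⋀^Fin 2]→L[ℝ] ℝ}
    (h : a ![(1, 0), (0, 1)] = b ![(1, 0), (0, 1)]) : a = b := by
  have h' : a ![(0, 1), (1, 0)] = b ![(0, 1), (1, 0)] := by
    have key : ∀ c : (ℝ × ℝ) [⋀^Fin 2]→L[ℝ] ℝ, c ![(0, 1), (1, 0)] = -c ![(1, 0), (0, 1)] := by
      intro c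
      have h1 := c.map_swap ![(1, 0), (0, 1)] (i := 0) (j := 1) (by decide)
      refine Eq.trans ?_ h1
      change c _ = c _
      congr 1
      funext i
      fin_cases i <;> rfl
    rw [key, key, h]
  refine ContinuousAlternatingMap.toAlternatingMap_injective
    ((Module.Basis.finTwoProd ℝ).ext_alternating fun v hv => ?_)
  have h01 : v 0 ≠ v 1 := fun h => absurd (hv h) (by decide)
  have hcases : v = ![0, 1] ∨ v = ![1, 0] := by
    have h0 : v 0 = 0 ∨ v 0 = 1 := by omega
    have h1 : v 1 = 0 ∨ v 1 = 1 := by omega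
    rcases h0 with h0 | h0 <;> rcases h1 with h1 | h1
    · exact absurd (h0.trans h1.symm) h01
    · exact Or.inl (funext fun i => by fin_cases i <;> assumption)
    · exact Or.inr (funext fun i => by fin_cases i <;> assumption)
    · exact absurd (h0.trans h1.symm) h01
  rcases hcases with rfl | rfl
  · have : (fun i => Module.Basis.finTwoProd ℝ ((![0, 1] : Fin 2 → Fin 2) i)) =
        ![(1, 0), (0, 1)] := by
      funext i
      fin_cases i <;> simp
    rw [this]
    exact h
  · have : (fun i => Module.Basis.finTwoProd ℝ ((![1, 0] : Fin 2 → Fin 2) i)) =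
        ![(0, 1), (1, 0)] := by
      funext i
      fin_cases i <;> simp
    rw [this]
    exact h'

theorem alternating_one_apply (c : (ℝ × ℝ) [⋀^Fin 1]→L[ℝ] ℝ) (v : Fin 1 → ℝ × ℝ) :
    c v = (v 0).1 * c ![(1, 0)] + (v 0).2 * c ![(0, 1)] := by
  let L : ℝ × ℝ →L[ℝ] ℝ := (ContinuousAlternatingMap.ofSubsingleton ℝ (ℝ × ℝ) ℝ (0 : Fin 1)).symm c
  have hL : ∀ w : Fin 1 → ℝ × ℝ, c w = L (w 0) := fun w => by
    conv_lhs =>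
      rw [← (ContinuousAlternatingMap.ofSubsingleton ℝ (ℝ × ℝ) ℝ (0 : Fin 1)).apply_symm_apply c]
    rfl
  rw [hL, hL, hL, ← smul_eq_mul, ← smul_eq_mul, ← map_smul, ← map_smul, ← map_add]
  congr 1
  simp

namespace Collar

variable (e : Collar B N) (om : UnitForm)

theorem boundary_mem (n : N) : e.toPartialEquiv (n, 0) ∈ (𝓡∂ 2).boundary B := by
  rw [← e.boundary_eq]
  exact ⟨(n, 0), ⟨mem_univ _, rfl⟩, rfl⟩

theorem zero_mem_Ico : (0 : ℝ) ∈ Ico (0 : ℝ) 1 := ⟨le_rfl, one_pos⟩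

/-- On the boundary, `(∫_r^1 ω) φ` is `φ`, since `∫ ω = 1`. -/
theorem cutoff_zero (φ : N → ℝ) (n : N) : e.cutoff om φ (e.toPartialEquiv (n, 0)) = φ n := by
  rw [e.cutoff_of_mem om φ (e.toPartialEquiv.map_source (e.mem_source n zero_mem_Ico)),
    e.rad_apply n zero_mem_Ico, e.base_apply n zero_mem_Ico, om.tail_zero, one_mul]

/-- The map `(a, φ) ↦ da + κ(φ)` is injective: a compactly supported function on the tube with
vanishing differential is zero, hence `a = (∫_r^1 ω) φ`, and `φ` is its boundary value. -/
theorem eq_zero_of_extD_add_kappaForm {W : Set N} {a : B → E2 [⋀^Fin 0]→L[ℝ] ℝ}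
    (ha : a ∈ compactFormsBdry (𝓡∂ 2) (e.tube W)) {φ : N → ℝ} (hφ : φ ∈ bdryFunctions W)
    (h : extD (𝓡∂ 2) a + e.kappaForm om φ = 0) : a = 0 ∧ φ = 0 := by
  have hf := ha.1.1.contMDiff
  have hg := e.contMDiff_cutoff om hφ
  obtain ⟨K, hK, hKW, hK0⟩ := ha.1.2
  obtain ⟨L, hL, hLW, hL0⟩ := e.cutoff_support om hφ
  have hfg : ContMDiff (𝓡∂ 2) 𝓘(ℝ, ℝ) ∞ fun x => a x ![] - e.cutoff om φ x := hf.sub hg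
  have hd : extD (𝓡∂ 2) (zeroForm fun x => a x ![] - e.cutoff om φ x) = 0 := by
    have h1 := extD_zeroForm_add hfg hg
    simp only [sub_add_cancel] at h1
    rw [zeroForm_self] at h1
    rw [h1, e.kappaForm_eq om hφ, add_neg_cancel_right] at h
    exact h
  have h1 := e.eq_zero_of_extD_eq_zero hfg (hK.union hL)
    (union_subset hKW hLW) (fun x hx => by
      rw [mem_union, not_or] at hx
      rw [hK0 x hx.1, hL0 x hx.2]
      exact sub_zero _) hd
  have h2 : ∀ x, a x ![] = e.cutoff om φ x := fun x => sub_eq_zero.1 (congrFun h1 x)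
  have h3 : φ = 0 := by
    funext n
    rw [← e.cutoff_zero om φ n, ← h2, ha.2 _ (e.boundary_mem n)]
    rfl
  refine ⟨?_, h3⟩
  rw [← zeroForm_self a]
  funext x
  ext v
  rw [zeroForm_apply, h2, h3]
  by_cases hx : x ∈ e.toPartialEquiv.target
  · rw [e.cutoff_of_mem om _ hx, Pi.zero_apply, mul_zero]
    rfl
  · exact if_neg hx

/-- A closed `1`-form with compact support in the tube is the differential of its primitive along
the fibres, which in general does not vanish on the boundary. -/
theorem exists_extD_eq_of_closed {W : Set N} {b : B → E2 [⋀^Fin 1]→L[ℝ] ℝ}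
    (hb : b ∈ compactForms (𝓡∂ 2) 1 (e.tube W)) (hd : extD (𝓡∂ 2) b = 0) :
    ∃ F : B → ℝ, ContMDiff (𝓡∂ 2) 𝓘(ℝ, ℝ) ∞ F ∧ (∃ K : Set N, IsCompact K ∧ K ⊆ W ∧
      ∃ r < (1 : ℝ), ∀ x ∉ e.tubeIcc K r, F x = 0) ∧ extD (𝓡∂ 2) (zeroForm F) = b := by
  obtain ⟨K, hK, hKW, h0⟩ := hb.2
  have hKt := hKW.trans (e.tube_subset_target W)
  obtain ⟨r₀, hr₀, hrK⟩ := e.exists_rad_lt hK hKt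
  obtain ⟨hL, hLW⟩ := e.isCompact_base_image hK hKW
  -- the coefficient of the form in the direction of the fibres
  set P : B → ℝ := fun x => b x ![e.deriv (e.base x) (e.rad x) (0, 1)] with hPdef
  have hPchart : ∀ p, ∀ z ∈ strip p, (P ∘ e.chart p) z = e.pull p b z ![(1, 0)] := by
    intro p z hz
    change b (e.chart p z) _ = b (e.chart p z) _
    congr 1
    funext i
    fin_cases i
    change e.deriv (e.base (e.chart p z)) (e.rad (e.chart p z)) (0, 1) = e.chartD p z (1, 0)
    rw [e.chartD_apply hz, e.rad_chart hz, e.base_chart hz]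
    simp only
    rw [map_zero, map_zero]
  have hP0 : ∀ x ∉ K, P x = 0 := fun x hx => by
    rw [hPdef]
    simp only
    rw [h0 x hx]
    rfl
  have hP : ContMDiff (𝓡∂ 2) 𝓘(ℝ, ℝ) ∞ P := by
    refine contMDiff_of_isCompact e.open_target (fun x hx => ?_) hK hKt hP0
    have h1 := (e.contDiffOn_pull_apply (e.base x) hb.1 ![(1, 0)]).contMDiffOn.comp
      (e.contMDiffOn_chart_symm (e.base x)) fun y hy => (e.chart _).map_target hy
    refine ((h1.congr fun y hy => ?_).contMDiffAt ((e.isOpen_chart_target _).mem_nhds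
      (e.mem_chart_target hx))).contMDiffWithinAt
    have h2 := hPchart _ _ ((e.chart (e.base x)).map_target hy)
    rw [Function.comp_apply, (e.chart (e.base x)).right_inv hy] at h2
    exact h2
  have hF := e.contMDiff_fibrePrimitive hK hKW hr₀ hrK hP0 hP
  refine ⟨e.fibrePrimitive r₀ P, hF, ⟨_, hL, hLW, r₀, hr₀.2,
    fun x hx => e.fibrePrimitive_eq_zero hr₀ hrK hP0 hx⟩, ?_⟩
  funext x
  by_cases hx : x ∈ e.toPartialEquiv.target
  · have hc := e.mem_chart_target hx
    set p := e.base x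
    have hz := (e.chart p).map_target hc
    set z := (e.chart p).symm x
    have hzx : e.chart p z = x := (e.chart p).right_inv hc
    -- the coefficient of the form in the direction of the curve
    set Q : ℝ × ℝ → ℝ := fun w => e.pull p b w ![(0, 1)] with hQdef
    have hQ : ContDiffOn ℝ ∞ Q (strip p) := e.contDiffOn_pull_apply p hb.1 _
    have hclosed : ∀ w ∈ strip p, fderivWithin ℝ (P ∘ e.chart p) (strip p) w (0, 1) =
        fderivWithin ℝ Q (strip p) w (1, 0) := by
      intro w hw
      have h1 := congrArg (fun c => c ![(1, 0), (0, 1)]) (e.pull_extD hb.1 hw)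
      rw [extDerivWithin_apply_two (e.differentiableWithinAt_pull hb.1 hw)
        (uniqueDiffOn_strip (isOpen_lineDomain p) w hw), hd] at h1
      have h2 : fderivWithin ℝ (P ∘ e.chart p) (strip p) w =
          fderivWithin ℝ (fun z => e.pull p b z ![(1, 0)]) (strip p) w :=
        fderivWithin_congr (hPchart p) (hPchart p w hw)
      rw [h2]
      exact (sub_eq_zero.1 h1.symm).symm
    have hint : ∫ s in r₀..z.1, fderivWithin ℝ (P ∘ e.chart p) (strip p) (s, z.2) (0, 1) = Q z := by
      have h1 := integral_fderivWithin_line hQ hr₀ hz.1 hz.2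
      have h2 : Q (r₀, z.2) = 0 := by
        have h3 : b (e.chart p (r₀, z.2)) = 0 := h0 _ fun h => by
          have := hrK _ h
          rw [e.rad_chart (z := (r₀, z.2)) ⟨hr₀, hz.2⟩] at this
          exact lt_irrefl _ this
        rw [hQdef]
        simp only
        rw [pull, h3]
        rfl
      rw [h2, sub_zero] at h1
      rw [show Q z = Q (z.1, z.2) from rfl, ← h1]
      refine intervalIntegral.integral_congr fun s hs => ?_
      exact hclosed (s, z.2) ⟨uIcc_subset_unitIco hr₀ hz.1 hs, hz.2⟩
    rw [← sub_eq_zero, ← hzx]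
    refine e.eq_zero_of_pull_eq_zero (p := p)
      (α := fun x => extD (𝓡∂ 2) (zeroForm (e.fibrePrimitive r₀ P)) x - b x) hz ?_
    ext v
    have hFz := hF.mdifferentiableAt (x := e.chart p z) (by simp)
    have h1 := e.pull_oneForm_dAt hz hFz (extD_zeroForm hFz) v
    rw [e.fderivWithin_fibrePrimitive hr₀ hP hz, hint] at h1
    have h2 : e.pull p b z v = (v 0).1 * P (e.chart p z) + (v 0).2 * Q z := by
      have h3 := hPchart p z hz
      rw [Function.comp_apply] at h3
      rw [h3, alternating_one_apply]
    change e.pull p (extD (𝓡∂ 2) (zeroForm (e.fibrePrimitive r₀ P))) z v - e.pull p b z v = 0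
    rw [h1, h2]
    simp
    ring
  · have hx' : x ∉ K := fun h => hx (hKt h)
    have hx'' : x ∉ e.tubeIcc (e.base '' K) r₀ := fun h =>
      hx (e.tube_subset_target W (e.tubeIcc_subset hLW hr₀.2 h))
    rw [h0 x hx', extD_eq_zero (e.isCompact_tubeIcc hL hr₀.2).isClosed (fun y hy => ?_) hx'']
    ext v
    rw [zeroForm_apply, e.fibrePrimitive_eq_zero hr₀ hrK hP0 hy]
    rfl

/-- Closed `1`-forms are of the form `da + κ(φ)`: with a primitive `F` of the form and `φ` minus its
boundary value, the function `a = F + (∫_r^1 ω) φ` vanishes on the boundary. -/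
theorem exists_extD_add_kappaForm_eq {W : Set N} {b : B → E2 [⋀^Fin 1]→L[ℝ] ℝ}
    (hb : b ∈ compactForms (𝓡∂ 2) 1 (e.tube W)) (hd : extD (𝓡∂ 2) b = 0) :
    ∃ a ∈ compactFormsBdry (𝓡∂ 2) (e.tube W), ∃ φ ∈ bdryFunctions W,
      extD (𝓡∂ 2) a + e.kappaForm om φ = b := by
  obtain ⟨F, hF, ⟨K, hK, hKW, r, hr, hF0⟩, hFb⟩ := e.exists_extD_eq_of_closed hb hd
  set φ : N → ℝ := fun n => -F (e.toPartialEquiv (n, 0)) with hφdef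
  have hφ : φ ∈ bdryFunctions W := by
    refine ⟨?_, K, hK, hKW, fun n hn => ?_⟩
    · have h1 : ContMDiffOn (𝓡 1) ((𝓡 1).prod 𝓘(ℝ, ℝ)) ∞ (fun n : N => (n, (0 : ℝ))) univ :=
        (contMDiff_id.prodMk contMDiff_const).contMDiffOn
      have h2 := (hF.comp_contMDiffOn e.contMDiffOn).comp h1 fun n _ => ⟨mem_univ _, zero_mem_Ico⟩
      exact (contMDiffOn_univ.1 h2).neg
    · rw [hφdef]
      simp only
      have h4 : e.toPartialEquiv (n, 0) ∉ e.tubeIcc K r := by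
        rintro ⟨⟨m, s⟩, ⟨hm, hs⟩, he⟩
        have h3 := congrArg e.base he
        rw [e.base_apply n zero_mem_Ico, e.base_apply m ⟨hs.1, hs.2.trans_lt hr⟩] at h3
        exact hn (h3 ▸ hm)
      rw [hF0 _ h4, neg_zero]
  have hG := e.contMDiff_cutoff om hφ
  obtain ⟨L, hL, hLW, hL0⟩ := e.cutoff_support om hφ
  refine ⟨zeroForm fun x => F x + e.cutoff om φ x, ⟨?_, ?_⟩, φ, hφ, ?_⟩
  · refine zeroForm_mem_compactForms (hF.add hG) ((e.isCompact_tubeIcc hK hr).union hL)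
      (union_subset (e.tubeIcc_subset hKW hr) hLW) fun x hx => ?_
    rw [mem_union, not_or] at hx
    rw [hF0 x hx.1, hL0 x hx.2, add_zero]
  · intro x hx
    rw [← e.boundary_eq] at hx
    obtain ⟨⟨n, s⟩, ⟨-, rfl⟩, rfl⟩ := hx
    ext v
    rw [zeroForm_apply, e.cutoff_zero, hφdef]
    exact add_neg_cancel _
  · rw [extD_zeroForm_add hF hG, e.kappaForm_eq om hφ, hFb]
    exact add_neg_cancel_right _ _

end Collar

end PoincareLemma

/-! ### The Poincaré lemma for `2`-forms, and the retraction of `κ` -/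

noncomputable section TopDegree

open Filter MeasureTheory

variable {B : Type u} [TopologicalSpace B] [T2Space B] [SigmaCompactSpace B]
  [ChartedSpace (EuclideanHalfSpace 2) B] [IsManifold (𝓡∂ 2) ∞ B]
  {N : Type u} [TopologicalSpace N] [T2Space N] [SigmaCompactSpace N]
  [ChartedSpace E1 N] [IsManifold (𝓡 1) ∞ N]

namespace Collar

variable (e : Collar B N) (om : UnitForm)

/-- A `2`-form `h dr ∧ dx` with compact support in the domain of collar coordinates is the
differential of `F dx`, where `F` is the primitive of `h` along the fibres. -/
theorem exists_extD_eq_of_chart {W : Set N} {p : N} {c : B → E2 [⋀^Fin 2]→L[ℝ] ℝ}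
    (hc : c ∈ compactForms (𝓡∂ 2) 2 (e.tube ((extChartAt (𝓡 1) p).source ∩ W))) :
    ∃ b ∈ compactForms (𝓡∂ 2) 1 (e.tube W), extD (𝓡∂ 2) b = c := by
  classical
  obtain ⟨K, hK, hKW, h0⟩ := hc.2
  have hKt := hKW.trans (e.tube_subset_target _)
  have hKp : K ⊆ (e.chart p).target := by
    rw [← e.tube_source]
    exact hKW.trans (e.tube_mono inter_subset_left)
  obtain ⟨r₀, hr₀, hrK⟩ := e.exists_rad_lt hK hKt
  obtain ⟨hL, hLW⟩ := e.isCompact_base_image hK hKW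
  set L := e.tubeIcc (e.base '' K) r₀ with hLdef
  have hLc : IsCompact L := e.isCompact_tubeIcc hL hr₀.2
  have hLW' : L ⊆ e.tube W := e.tubeIcc_subset (hLW.trans inter_subset_right) hr₀.2
  have hLp : L ⊆ (e.chart p).target := by
    rw [← e.tube_source]
    exact e.tubeIcc_subset (hLW.trans inter_subset_left) hr₀.2
  have hKL : K ⊆ L := e.subset_tubeIcc hKt hrK
  -- the coefficient `h` as a function on the surface
  set P : B → ℝ := fun x => if x ∈ (e.chart p).target then
    e.pull p c ((e.chart p).symm x) ![(1, 0), (0, 1)] else 0 with hPdef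
  have hPchart : ∀ z ∈ strip p, P (e.chart p z) = e.pull p c z ![(1, 0), (0, 1)] := fun z hz => by
    rw [hPdef]
    simp only
    rw [if_pos ((e.chart p).map_source hz), (e.chart p).left_inv hz]
  have hP0 : ∀ x ∉ K, P x = 0 := fun x hx => by
    by_cases hxp : x ∈ (e.chart p).target
    · rw [← (e.chart p).right_inv hxp, hPchart _ ((e.chart p).map_target hxp), pull,
        (e.chart p).right_inv hxp, h0 x hx]
      rfl
    · exact if_neg hxp
  have hP : ContMDiff (𝓡∂ 2) 𝓘(ℝ, ℝ) ∞ P := by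
    refine contMDiff_of_isCompact (e.isOpen_chart_target p) ?_ hK hKp hP0
    exact ((e.contDiffOn_pull_apply p hc.1 _).contMDiffOn.comp (e.contMDiffOn_chart_symm p)
      fun y hy => (e.chart p).map_target hy).congr fun y hy => if_pos hy
  have hF := e.contMDiff_fibrePrimitive hK hKW hr₀ hrK hP0 hP
  have hF0 : ∀ x ∉ L, e.fibrePrimitive r₀ P x = 0 := fun x hx =>
    e.fibrePrimitive_eq_zero hr₀ hrK hP0 hx
  -- a function on the surface that agrees with the coordinate `x` near the support
  obtain ⟨ξ, hξ, hξL⟩ := exists_contMDiff_eventuallyEq (f := fun x => ((e.chart p).symm x).2)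
    (e.isOpen_chart_target p) (contDiff_snd.contMDiff.comp_contMDiffOn (e.contMDiffOn_chart_symm p))
    hLc hLp
  have hβ := (isSmoothForm_zeroForm (E := E2) hξ).extD
  have hb : (fun x => e.fibrePrimitive r₀ P x • extD (𝓡∂ 2) (zeroForm ξ) x) ∈
      compactForms (𝓡∂ 2) 1 (e.tube W) :=
    ⟨hβ.smul hF, L, hLc, hLW', fun x hx => by beta_reduce; rw [hF0 x hx, zero_smul]⟩
  refine ⟨_, hb, ?_⟩
  funext x
  by_cases hx : x ∈ L
  · have hz := (e.chart p).map_target (hLp hx)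
    set z := (e.chart p).symm x
    have hzx : e.chart p z = x := (e.chart p).right_inv (hLp hx)
    have hz' : e.chart p z ∈ L := hzx ▸ hx
    rw [← sub_eq_zero, ← hzx]
    refine e.eq_zero_of_pull_eq_zero (p := p) (α := fun x => extD (𝓡∂ 2)
      (fun x => e.fibrePrimitive r₀ P x • extD (𝓡∂ 2) (zeroForm ξ) x) x - c x) hz ?_
    refine alternating_two_ext ?_
    set γ : B → E2 [⋀^Fin 1]→L[ℝ] ℝ := fun x => oneForm (dAt (𝓡∂ 2) (e.fibrePrimitive r₀ P) x)
      with hγ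
    have h1 : extD (𝓡∂ 2) (fun x => e.fibrePrimitive r₀ P x • extD (𝓡∂ 2) (zeroForm ξ) x)
        (e.chart p z) = wedge (γ (e.chart p z)) (extD (𝓡∂ 2) (zeroForm ξ) (e.chart p z)) := by
      rw [extD_fun_smul hF hβ, extD_extD (isSmoothForm_zeroForm hξ), Pi.zero_apply, smul_zero,
        add_zero]
    have h2 : e.pull p (fun x => extD (𝓡∂ 2)
        (fun x => e.fibrePrimitive r₀ P x • extD (𝓡∂ 2) (zeroForm ξ) x) x - c x) z =
        wedge (e.pull p γ z) (e.pull p (extD (𝓡∂ 2) (zeroForm ξ)) z) - e.pull p c z := by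
      rw [pull, h1, pull, pull, ← wedge_compContinuousLinearMap]
      rfl
    have hFz := hF.mdifferentiableAt (x := e.chart p z) (by simp)
    have hξz := hξ.mdifferentiableAt (x := e.chart p z) (by simp)
    have h3 : fderivWithin ℝ (ξ ∘ e.chart p) (strip p) z = ContinuousLinearMap.snd ℝ ℝ ℝ := by
      have hev : ξ ∘ e.chart p =ᶠ[𝓝[strip p] z] fun w => w.2 := by
        filter_upwards [((e.contMDiffOn_chart p).continuousOn z hz).eventually (hξL _ hz'),
          self_mem_nhdsWithin] with w hw hws
        rw [Function.comp_apply, hw, (e.chart p).left_inv hws]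
      rw [hev.fderivWithin_eq_of_mem hz]
      exact hasFDerivWithinAt_snd.fderivWithin (uniqueDiffOn_strip (isOpen_lineDomain p) z hz)
    rw [h2]
    change wedge (e.pull p γ z) (e.pull p (extD (𝓡∂ 2) (zeroForm ξ)) z) _ - e.pull p c z _ = 0
    rw [wedge_apply, e.pull_oneForm_dAt (α := γ) hz hFz rfl, e.pull_oneForm_dAt (α := γ) hz hFz rfl,
      e.pull_oneForm_dAt hz hξz (extD_zeroForm hξz), e.pull_oneForm_dAt hz hξz (extD_zeroForm hξz),
      h3, e.fderivWithin_fibrePrimitive hr₀ hP hz, hPchart z hz]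
    simp
  · rw [h0 x fun h => hx (hKL h)]
    exact extD_eq_zero hLc.isClosed (fun y hy => by rw [hF0 y hy, zero_smul]) hx

/-- All `2`-forms with compact support in the tube are exact. A partition of unity reduces this to
forms supported in collar coordinates. -/
theorem exists_extD_eq {W : Set N} {c : B → E2 [⋀^Fin 2]→L[ℝ] ℝ}
    (hc : c ∈ compactForms (𝓡∂ 2) 2 (e.tube W)) :
    ∃ b ∈ compactForms (𝓡∂ 2) 1 (e.tube W), extD (𝓡∂ 2) b = c := by
  obtain ⟨K, hK, hKW, h0⟩ := hc.2
  have hKt := hKW.trans (e.tube_subset_target _)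
  obtain ⟨ρ, hρ⟩ := SmoothPartitionOfUnity.exists_isSubordinate (𝓡∂ 2) hK.isClosed
    (fun p : N => (e.chart p).target) e.isOpen_chart_target
    fun x hx => mem_iUnion.2 ⟨_, e.mem_chart_target (hKt hx)⟩
  have hmem : ∀ p, (fun x => ρ p x • c x) ∈
      compactForms (𝓡∂ 2) 2 (e.tube ((extChartAt (𝓡 1) p).source ∩ W)) := fun p => by
    refine smul_mem_compactForms hc (ρ p).contMDiff fun x hx => ?_
    have hxt := e.tube_subset_target W hx.2
    exact (e.mem_tube hxt).2 ⟨(hρ p hx.1).2, (e.mem_tube hxt).1 hx.2⟩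
  choose β hβ hβd using fun p => e.exists_extD_eq_of_chart (hmem p)
  have hfin := ρ.locallyFinite.finite_nonempty_inter_compact hK
  refine ⟨(∑ p ∈ hfin.toFinset, (⟨β p, hβ p⟩ : compactForms (𝓡∂ 2) 1 (e.tube W)) : _).1,
    Subtype.coe_prop _, ?_⟩
  have h1 : (compactD (𝓡∂ 2) 1 (e.tube W) (∑ p ∈ hfin.toFinset, ⟨β p, hβ p⟩)).1 = c := by
    rw [map_sum, AddSubmonoidClass.coe_finsetSum]
    funext x
    rw [Finset.sum_apply]
    have h2 : ∀ p, (compactD (𝓡∂ 2) 1 (e.tube W) ⟨β p, hβ p⟩).1 x = ρ p x • c x := fun p =>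
      congrFun (hβd p) x
    rw [Finset.sum_congr rfl fun p _ => h2 p, ← Finset.sum_smul]
    by_cases hx : x ∈ K
    · rw [← finsum_eq_sum_of_support_subset (fun p => ρ p x) fun p hp =>
        hfin.mem_toFinset.2 ⟨x, hp, hx⟩, ρ.sum_eq_one hx, one_smul]
    · rw [h0 x hx, smul_zero]
  exact h1

/-- The cochain map `κ` is the inclusion of a deformation retract. -/
theorem nonempty_retraction_kappa {W : Set N}
    (hmem : ∀ φ ∈ bdryFunctions W, e.kappaForm om φ ∈ compactForms (𝓡∂ 2) 1 (e.tube W))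
    (hd : ∀ φ ∈ bdryFunctions W, extD (𝓡∂ 2) (e.kappaForm om φ) = 0) :
    Nonempty (CochainCpx.Retraction (e.kappa om hmem hd)) := by
  let k : bdryFunctions W →ₗ[ℝ] compactForms (𝓡∂ 2) 1 (e.tube W) :=
    { toFun := fun φ => ⟨e.kappaForm om φ.1, hmem φ.1 φ.2⟩
      map_add' := fun φ ψ => Subtype.ext (e.kappaForm_add om φ.2 ψ.2)
      map_smul' := fun c φ => Subtype.ext (e.kappaForm_smul om c φ.2) }
  refine nonempty_retraction_threeTerm
    (compactD (𝓡∂ 2) 0 (e.tube W) ∘ₗ Submodule.inclusion inf_le_left)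
    (compactD (𝓡∂ 2) 1 (e.tube W)) (fun a => Subtype.ext (extD_extD a.2.1.1)) k
    (fun φ => Subtype.ext (hd φ.1 φ.2)) (fun a φ h => ?_) (fun c => ?_) (fun b hb => ?_) _
    (fun _ => rfl)
  · obtain ⟨h1, h2⟩ := e.eq_zero_of_extD_add_kappaForm om a.2 φ.2 (congrArg Subtype.val h)
    exact ⟨Subtype.ext h1, Subtype.ext h2⟩
  · obtain ⟨b, hb, h⟩ := e.exists_extD_eq c.2
    exact ⟨⟨b, hb⟩, Subtype.ext h⟩
  · obtain ⟨a, ha, φ, hφ, h⟩ := e.exists_extD_add_kappaForm_eq om b.2 (congrArg Subtype.val hb)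
    exact ⟨⟨a, ha⟩, ⟨φ, hφ⟩, Subtype.ext h⟩

end Collar

end TopDegree

theorem mainTheorem2 {B N : Type u}
    [TopologicalSpace B] [T2Space B] [SigmaCompactSpace B]
    [ChartedSpace (EuclideanHalfSpace 2) B] [IsManifold (𝓡∂ 2) ∞ B]
    [TopologicalSpace N] [T2Space N] [SigmaCompactSpace N]
    [ChartedSpace (EuclideanSpace ℝ (Fin 1)) N] [IsManifold (𝓡 1) ∞ N]
    (hB : IsOrientedAtlas (𝓡∂ 2) B) (hN : IsOrientedAtlas (𝓡 1) N)
    (e : Collar B N) (he : e.OrientationCompatible) (om : UnitForm) :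
    ∃ (hσ : ∀ V : NEOpens B, IsPoisson (bulkCpx (V.1 : Set B)) (bulkPairing (V.1 : Set B)))
      (hυ : ∀ W : NEOpens N, IsPoisson (bdryCpx (W.1 : Set N)) (bdryPairing (W.1 : Set N)))
      (hmem : ∀ W : NEOpens N, ∀ φ ∈ bdryFunctions (W.1 : Set N),
        e.kappaForm om φ ∈ compactForms (𝓡∂ 2) 1 (e.tube W.1))
      (hd : ∀ W : NEOpens N, ∀ φ ∈ bdryFunctions (W.1 : Set N),
        extD (𝓡∂ 2) (e.kappaForm om φ) = 0)
      (hτ : ∀ (W : NEOpens N) (φ ψ : (bdryCpx (W.1 : Set N)).carrier),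
        bulkPairing (e.tube W.1) ((e.kappa om (hmem W) (hd W)).toLin φ)
          ((e.kappa om (hmem W) (hd W)).toLin ψ) = bdryPairing (W.1 : Set N) φ ψ),
      EinsteinCausality (bulkTheory hσ) ∧
      EinsteinCausality (e.functor.comp (bulkTheory hσ)) ∧
      EinsteinCausality (bosonTheory hυ) ∧
      (∀ W : NEOpens N, (e.kappa om (hmem W) (hd W)).IsQuasiIso) ∧
      (∀ W : NEOpens N,
        DGStarAlg.IsWeakEquiv ((e.ccrKappa om hσ hυ hmem hd hτ).app W)) := by
  have hσ : ∀ V : NEOpens B, IsPoisson (bulkCpx (V.1 : Set B)) (bulkPairing (V.1 : Set B)) :=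
    fun V => isPoisson_bulkPairing hB V.1
  have hυ : ∀ W : NEOpens N, IsPoisson (bdryCpx (W.1 : Set N)) (bdryPairing (W.1 : Set N)) :=
    fun W => isPoisson_bdryPairing hN W.1
  have hmem : ∀ W : NEOpens N, ∀ φ ∈ bdryFunctions (W.1 : Set N),
      e.kappaForm om φ ∈ compactForms (𝓡∂ 2) 1 (e.tube W.1) := fun _ _ hφ => e.kappaForm_mem om hφ
  have hd : ∀ W : NEOpens N, ∀ φ ∈ bdryFunctions (W.1 : Set N),
      extD (𝓡∂ 2) (e.kappaForm om φ) = 0 := fun _ _ hφ => e.extD_kappaForm om hφ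
  have hτ : ∀ (W : NEOpens N) (φ ψ : (bdryCpx (W.1 : Set N)).carrier),
      bulkPairing (e.tube W.1) ((e.kappa om (hmem W) (hd W)).toLin φ)
        ((e.kappa om (hmem W) (hd W)).toLin ψ) = bdryPairing (W.1 : Set N) φ ψ :=
    fun W φ ψ => e.bulkPairing_kappa om hB hN he (hmem W) (hd W) φ ψ
  refine ⟨hσ, hυ, hmem, hd, hτ, einsteinCausality_bulkTheory hσ,
    einsteinCausality_collar e (einsteinCausality_bulkTheory hσ), einsteinCausality_bosonTheory hυ,
    fun W => ?_, fun W => ?_⟩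
  · obtain ⟨R⟩ := e.nonempty_retraction_kappa om (hmem W) (hd W)
    exact R.isQuasiIso
  · obtain ⟨R⟩ := e.nonempty_retraction_kappa om (hmem W) (hd W)
    exact PoCh.isWeakEquiv_of_retraction
      (P := (bdryPoisson hυ).obj W) (Q := (bulkPoisson hσ).obj (e.functor.obj W))
      ((e.kappaNat om hσ hυ hmem hd hτ).app W) R
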